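/- All objects are smooth. Let $g$ be a Riemannian metric on the oriented two-sphere $S^2$, with area form $\mu$, Gaussian curvature $K$ and curvature form $\sigma_g:=K\mu$, and let $\sigma$ be a symplectic form on $S^2$ (so that $(S^2,g,\sigma)$ is a symplectic magnetic system); put $[\sigma]:=\int_{S^2}\sigma$ and $c:=\frac{[\sigma]}{4\pi}$. On $TS^2\xrightarrow{\ \pi\ }S^2$ let $E(x,v)=\frac12 g_x(v,v)$, let $\lambda_{(x,v)}(\xi)=g_x(v,d\pi\,\xi)$ be the Liouville form, let $\omega_\sigma:=d\lambda-\pi^*\sigma$, and let $\tau_{(x,v)}(\xi)=g_x\big(\jmath_x v,\frac{\nabla \hat v}{dt}\big)$ for any path $(\hat x,\hat v)$ with velocity $\xi$ at $(x,v)$, where $\nabla$ is the Levi-Civita connection and $\jmath$ the rotation by $\pi/2$. For $m>0$ let $\Sigma_m:=\{E=\frac{m^2}{2}\}\subset TS^2$. A contact form $\alpha$ on a lens space is called dynamically convex if every contractible periodic orbit $(\gamma,T)$ of its Reeb flow (with $T>0$ any period, not necessarily the minimal one) has lower Conley–Zehnder index $\mu^l_{\mathrm{CZ}}(\gamma)\ge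 3$. Here one chooses a cylinder connecting a constant loop with $\gamma$ and a $d\alpha$-symplectic trivialisation of $\ker\alpha$ over the cylinder which is constant along the constant loop; the linearised Reeb flow along $\gamma$ becomes a path $\Psi:[0,T]\to \mathrm{Sp}(1)$ of symplectic $2\times2$ matrices with $\Psi(0)=\mathrm{Id}$, and $\mu^l_{\mathrm{CZ}}(\gamma):=\mu^l(\Psi)$. Let $I(\Psi)$ be the interval of the total rotations, divided by $2\pi$, of $t\mapsto\Psi(t)u$ for $u\in\mathbb R^2\setminus\{0\}$; for all sufficiently small $\varepsilon>0$, $\mu^l(\Psi)=2k$ if $I(\Psi)-\varepsilon$ contains the integer $k$, and $\mu^l(\Psi)=2k+1$ if $I(\Psi)-\varepsilon\subset(k,k+1)$. (The result does not depend on the choices.) Theorem. (i) For every $m>0$, $\Sigma_m$ is diffeomorphic to the lens space $L(2,1)=S^3/\{\pm1\}$. (ii) There exists a 1-form $\beta$ on $S^2$ such that $d\beta=\sigma-c\,\sigma_g$. (iii) For every 1-form $\beta$ on $S^2$ with $d\beta=\sigma-c\,\sigma_g$ there is $m_0>0$ such that, for all $0<m<m_0$, the 1-form $$\Big(\lambda+c\,\frac{\tau}{2E}-\pi^*\beta\Big)\Big|_{\Sigma_m}$$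 is a primitive of $\omega_\sigma|_{\Sigma_m}$, is a contact form, and is dynamically convex. (Under the dilation $(x,v)\mapsto(x,mv)$ from the unit sphere bundle $SS^2=\Sigma_1$ to $\Sigma_m$, this form pulls back to $\lambda^g_{m,\beta}:=m\lambda+c\,\tau-\pi^*\beta$.) -/

import Mathlib

open scoped Matrix ContDiff Topology

noncomputable section

namespace MagneticSphere

/-! ### Generalities: 1-forms, contact forms and Reeb flows on submanifolds of a vector space

A submanifold of a normed space `E` is given by its underlying set `S` together with its tangent
spaces `TS z`, for `z ∈ S`.  A differential form on `S` is given by a form on `E` that is smooth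
near `S`; only its values on tangent vectors of `S` at points of `S` are ever used.  Since `d`
commutes with the restriction to `S`, the exterior derivative may be computed in `E`. -/

section Contact

variable {E : Type*} [NormedAddCommGroup E] [NormedSpace ℝ E]

/-- The exterior derivative `(dα)_z(ξ, ζ)` of a 1-form. -/
def dOne (α : E → E →L[ℝ] ℝ) (z ξ ζ : E) : ℝ :=
  extDeriv (fun y => ContinuousAlternatingMap.ofSubsingleton ℝ E ℝ (0 : Fin 1) (α y)) z ![ξ, ζ]

/-- `α` restricts to a primitive on `S` of the 2-form `Ω`. -/
def IsPrimitiveOn (S : Set E) (TS : E → Submodule ℝ E) (α : E → E →L[ℝ] ℝ)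
    (Ω : E → E → E → ℝ) : Prop :=
  ∀ z ∈ S, ∀ ξ ∈ TS z, ∀ ζ ∈ TS z, dOne α z ξ ζ = Ω z ξ ζ

/-- `α` restricts to a contact form on the three-dimensional submanifold `S`: it is smooth and
`α ∧ dα` does not vanish on any basis of any tangent space of `S`. -/
def IsContactForm (S : Set E) (TS : E → Submodule ℝ E) (α : E → E →L[ℝ] ℝ) : Prop :=
  (∃ U : Set E, IsOpen U ∧ S ⊆ U ∧ ContDiffOn ℝ ∞ α U) ∧
  ∀ z ∈ S, ∀ ξ : Fin 3 → E, (∀ i, ξ i ∈ TS z) → LinearIndependent ℝ ξ →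
    α z (ξ 0) * dOne α z (ξ 1) (ξ 2) + α z (ξ 1) * dOne α z (ξ 2) (ξ 0)
      + α z (ξ 2) * dOne α z (ξ 0) (ξ 1) ≠ 0

/-- `r` is the value at `z` of the Reeb vector field of `α` on `S`. -/
def IsReebVector (TS : E → Submodule ℝ E) (α : E → E →L[ℝ] ℝ) (z r : E) : Prop :=
  r ∈ TS z ∧ α z r = 1 ∧ ∀ ζ ∈ TS z, dOne α z r ζ = 0

/-- `γ` is an integral curve on `S` of the Reeb vector field. -/
def IsReebTrajectory (S : Set E) (TS : E → Submodule ℝ E) (α : E → E →L[ℝ] ℝ) (γ : ℝ → E) :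
    Prop :=
  ∀ t, γ t ∈ S ∧ ∃ r, IsReebVector TS α (γ t) r ∧ HasDerivAt γ r t

/-- `Φ t z` is the flow of the Reeb vector field on `S` (its values outside `S` are irrelevant). -/
def IsReebFlow (S : Set E) (TS : E → Submodule ℝ E) (α : E → E →L[ℝ] ℝ) (Φ : ℝ → E → E) :
    Prop :=
  ∀ z ∈ S, Φ 0 z = z ∧ IsReebTrajectory S TS α (fun t => Φ t z)

/-- `(γ, T)` is a periodic orbit of the Reeb flow; `T` need not be the minimal period. -/
def IsPeriodicReebOrbit (S : Set E) (TS : E → Submodule ℝ E) (α : E → E →L[ℝ] ℝ) (γ : ℝ → E)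
    (T : ℝ) : Prop :=
  0 < T ∧ IsReebTrajectory S TS α γ ∧ ∀ t, γ (t + T) = γ t

/-- `i : [0,1] × ℝ/Tℤ → S` is a cylinder connecting a constant loop with the loop `γ`. -/
def IsCappingCylinder (S : Set E) (γ : ℝ → E) (T : ℝ) (i : ℝ → ℝ → E) : Prop :=
  ContinuousOn (fun p : ℝ × ℝ => i p.1 p.2) (Set.Icc 0 1 ×ˢ Set.univ) ∧
  (∀ s ∈ Set.Icc (0 : ℝ) 1, ∀ t, i s t ∈ S ∧ i s (t + T) = i s t) ∧
  (∀ t, i 0 t = i 0 0) ∧ ∀ t, i 1 t = γ t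

/-- The `T`-periodic loop `γ` is contractible in `S`. -/
def IsContractibleLoop (S : Set E) (γ : ℝ → E) (T : ℝ) : Prop :=
  ∃ i, IsCappingCylinder S γ T i

/-- `(e, f)` is a symplectic frame, over the cylinder `i`, of the bundle `(ker α, dα)`, and it is
constant along the constant loop `i 0`.  It is the same thing as a symplectic trivialisation over
the cylinder that extends the constant one, with `e ↦ (1, 0)` and `f ↦ (0, 1)`. -/
def IsSymplecticFrame (TS : E → Submodule ℝ E) (α : E → E →L[ℝ] ℝ) (T : ℝ)
    (i e f : ℝ → ℝ → E) : Prop :=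
  ContinuousOn (fun p : ℝ × ℝ => e p.1 p.2) (Set.Icc 0 1 ×ˢ Set.univ) ∧
  ContinuousOn (fun p : ℝ × ℝ => f p.1 p.2) (Set.Icc 0 1 ×ˢ Set.univ) ∧
  (∀ s ∈ Set.Icc (0 : ℝ) 1, ∀ t,
    e s t ∈ TS (i s t) ∧ f s t ∈ TS (i s t) ∧
    α (i s t) (e s t) = 0 ∧ α (i s t) (f s t) = 0 ∧
    dOne α (i s t) (e s t) (f s t) = 1 ∧
    e s (t + T) = e s t ∧ f s (t + T) = f s t) ∧
  ∀ t, e 0 t = e 0 0 ∧ f 0 t = f 0 0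

/-- `Ψ` is, on `[0,T]`, the linearised Reeb flow along `γ` on `ker α`, written in the frame
`(e, f)` along `γ`: the differential of the time-`t` flow map on `S` at `γ 0` sends
`a₀ e(0) + a₁ f(0)` to `(Ψ(t)a)₀ e(t) + (Ψ(t)a)₁ f(t)`. -/
def IsLinearisedFlow (S : Set E) (TS : E → Submodule ℝ E) (α : E → E →L[ℝ] ℝ) (γ : ℝ → E)
    (T : ℝ) (e f : ℝ → E) (Ψ : ℝ → Matrix (Fin 2) (Fin 2) ℝ) : Prop :=
  ∃ (Φ : ℝ → E → E) (D : ℝ → E →L[ℝ] E), IsReebFlow S TS α Φ ∧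
    ∀ t ∈ Set.Icc 0 T, HasFDerivWithinAt (Φ t) (D t) S (γ 0) ∧
      ∀ a : Fin 2 → ℝ,
        D t (a 0 • e 0 + a 1 • f 0) = (Ψ t *ᵥ a) 0 • e t + (Ψ t *ᵥ a) 1 • f t

end Contact

/-! ### The Maslov index and dynamical convexity -/

/-- The interval `I(Ψ)` of the winding numbers `(θ(T) - θ(0)) / 2π`, where `θ` is a continuous
angle of `Ψ(t)u`, over all `u ≠ 0` in the plane. -/
def rotationInterval (Ψ : ℝ → Matrix (Fin 2) (Fin 2) ℝ) (T : ℝ) : Set ℝ :=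
  {r | ∃ u : Fin 2 → ℝ, u ≠ 0 ∧ ∃ θ ρ : ℝ → ℝ, ContinuousOn θ (Set.Icc 0 T) ∧
    (∀ t ∈ Set.Icc 0 T,
      0 < ρ t ∧ Ψ t *ᵥ u = ![ρ t * Real.cos (θ t), ρ t * Real.sin (θ t)]) ∧
    r = (θ T - θ 0) / (2 * Real.pi)}

/-- The recipe which attaches an integer to an interval: `2k` if it contains the integer `k`, and
`2k + 1` if it is contained in the open interval `(k, k + 1)`. -/
def IsIntervalIndex (I : Set ℝ) (n : ℤ) : Prop :=
  ∃ k : ℤ, (n = 2 * k ∧ (k : ℝ) ∈ I) ∨ (n = 2 * k + 1 ∧ I ⊆ Set.Ioo (k : ℝ) (k + 1))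

/-- `n` is the lower semicontinuous Maslov index `μˡ(Ψ)`: the index of the interval `I(Ψ)` after
shifting it to the left by an arbitrarily small amount. -/
def IsLowerMaslovIndex (Ψ : ℝ → Matrix (Fin 2) (Fin 2) ℝ) (T : ℝ) (n : ℤ) : Prop :=
  ∀ᶠ ε in 𝓝[>] (0 : ℝ), IsIntervalIndex ((fun r => r - ε) '' rotationInterval Ψ T) n

section Contact

variable {E : Type*} [NormedAddCommGroup E] [NormedSpace ℝ E]

/-- `n` is the (lower) Conley-Zehnder index of the contractible periodic Reeb orbit `(γ, T)`. -/
def IsConleyZehnderIndex (S : Set E) (TS : E → Submodule ℝ E) (α : E → E →L[ℝ] ℝ) (γ : ℝ → E)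
    (T : ℝ) (n : ℤ) : Prop :=
  ∃ (i e f : ℝ → ℝ → E) (Ψ : ℝ → Matrix (Fin 2) (Fin 2) ℝ),
    IsCappingCylinder S γ T i ∧ IsSymplecticFrame TS α T i e f ∧
    IsLinearisedFlow S TS α γ T (e 1) (f 1) Ψ ∧ IsLowerMaslovIndex Ψ T n

/-- Dynamical convexity of the contact form `α` on `S`: every contractible periodic Reeb orbit has
a Conley-Zehnder index, and this index is at least `3` (for all choices of the cylinder and of
the trivialisation). -/
def IsDynamicallyConvex (S : Set E) (TS : E → Submodule ℝ E) (α : E → E →L[ℝ] ℝ) : Prop :=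
  ∀ (γ : ℝ → E) (T : ℝ), IsPeriodicReebOrbit S TS α γ T → IsContractibleLoop S γ T →
    (∃ n, IsConleyZehnderIndex S TS α γ T n) ∧
    ∀ n, IsConleyZehnderIndex S TS α γ T n → 3 ≤ n

/-- `S` is an embedded submanifold of `E` diffeomorphic to the lens space `L(p,q)`, the quotient
of `S³ ⊂ ℂ²` by `[k]·(z₁, z₂) = (exp(2πik/p) z₁, exp(2πikq/p) z₂)`: there is a smooth immersion of
`S³` in `E` with image `S` whose fibres are exactly the orbits of this action. -/
def IsDiffeomorphicToLensSpace (p q : ℕ) (S : Set E) : Prop :=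
  ∃ P : ℂ × ℂ → E, ContDiff ℝ ∞ P ∧
    P '' {w | ‖w.1‖ ^ 2 + ‖w.2‖ ^ 2 = 1} = S ∧
    (∀ w w' : ℂ × ℂ, ‖w.1‖ ^ 2 + ‖w.2‖ ^ 2 = 1 → ‖w'.1‖ ^ 2 + ‖w'.2‖ ^ 2 = 1 →
      (P w = P w' ↔ ∃ k : ℤ,
        w' = (Complex.exp (2 * Real.pi * Complex.I * k / p) * w.1,
          Complex.exp (2 * Real.pi * Complex.I * k * q / p) * w.2))) ∧
    ∀ w h : ℂ × ℂ, ‖w.1‖ ^ 2 + ‖w.2‖ ^ 2 = 1 → inner ℝ w.1 h.1 + inner ℝ w.2 h.2 = 0 →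
      fderiv ℝ P w h = 0 → h = 0

end Contact

/-! ### Riemannian geometry of the two-sphere

`S²` is the unit sphere `x ⬝ᵥ x = 1` of `ℝ³`, with `T_x S² = {u | x ⬝ᵥ u = 0}`, oriented by its
outward normal, and `T S² ⊂ ℝ³ × ℝ³` is the set of pairs `(x, v)` with `x ∈ S²`, `v ∈ T_x S²`.
Tensors on `S²` are given by smooth tensors on `ℝ³`; every smooth tensor on `S²` is the restriction
of such a one, and all the notions below depend on the restriction to `S²` only. -/

abbrev R3 : Type := Fin 3 → ℝ

/-- A smooth Riemannian metric on `S²`: a smooth field of symmetric bilinear forms on `ℝ³`, positive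
definite on the tangent planes of `S²`. -/
structure SphereMetric where
  form : R3 → R3 →L[ℝ] R3 →L[ℝ] ℝ
  smooth : ContDiff ℝ ∞ form
  symm : ∀ x u w, form x u w = form x w u
  pos : ∀ x u, x ⬝ᵥ x = 1 → x ⬝ᵥ u = 0 → u ≠ 0 → 0 < form x u u

/-- A symplectic form on `S²`: a smooth 2-form, non-degenerate on the tangent planes of `S²`
(2-forms on a surface are closed). -/
structure SphereSymplecticForm where
  form : R3 → R3 [⋀^Fin 2]→L[ℝ] ℝ
  smooth : ContDiff ℝ ∞ form
  nondegenerate : ∀ x u, x ⬝ᵥ x = 1 → x ⬝ᵥ u = 0 → u ≠ 0 →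
    ∃ w, x ⬝ᵥ w = 0 ∧ form x ![u, w] ≠ 0

/-- `[σ] = ∫_{S²} σ`, in spherical coordinates. -/
def SphereSymplecticForm.integral (σ : SphereSymplecticForm) : ℝ :=
  ∫ θ in (0 : ℝ)..Real.pi, ∫ φ in (0 : ℝ)..(2 * Real.pi),
    σ.form
      ![Real.sin θ * Real.cos φ, Real.sin θ * Real.sin φ, Real.cos θ]
      ![![Real.cos θ * Real.cos φ, Real.cos θ * Real.sin φ, -Real.sin θ],
        ![-(Real.sin θ * Real.sin φ), Real.sin θ * Real.cos φ, 0]]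

namespace SphereMetric

variable (g : SphereMetric)

/-- The covector `g_x(v, ·)` as a vector of coordinates. -/
def flat (x v : R3) : R3 := fun i => g.form x v (Pi.single i 1)

/-- The density of the Riemannian area of `g` with respect to the Euclidean area of `S²`, namely
the square root of the determinant of `g_x` on `T_x S²`, which for a unit vector `x` is
`xᵀ adj(G) x` with `G` the matrix of `g_x`. -/
def areaDensity (x : R3) : ℝ :=
  √(x ⬝ᵥ ((Matrix.of fun i j : Fin 3 =>
    g.form x (Pi.single i 1) (Pi.single j 1)).adjugate *ᵥ x))

/-- The positive Riemannian area form `μ`. -/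
def areaForm (x u w : R3) : ℝ := g.areaDensity x * (x ⬝ᵥ (u ⨯₃ w))

/-- The rotation `ȷ_x` by `π/2` of `T_x S²` with respect to `g` and the orientation. -/
def rot (x v : R3) : R3 := (g.areaDensity x)⁻¹ • (x ⨯₃ g.flat x v)

/-- The tangent vector `w ∈ T_x S²` with `g_x(w, y) = L ⬝ᵥ y` for all `y ∈ T_x S²`. -/
def sharp (x L : R3) : R3 :=
  -((g.areaDensity x ^ 2)⁻¹ • (x ⨯₃ g.flat x (x ⨯₃ L)))

/-- The Levi-Civita covariant derivative `∇v/dt` of a field `v` of tangent vectors of `S²` along a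
curve `x` on `S²`, at a time when the point, the vector and their velocities in `ℝ³` are
`x, v, x', v'`.  It is the tangent vector whose product with `y ∈ T_x S²` is
`g(v', y) + (∂_{x'} g(v, y) + ∂_v g(x', y) - ∂_y g(x', v)) / 2`. -/
def covDeriv (x v x' v' : R3) : R3 :=
  g.sharp x fun i =>
    g.form x v' (Pi.single i 1) +
      (fderiv ℝ g.form x x' v (Pi.single i 1) + fderiv ℝ g.form x v x' (Pi.single i 1)
        - fderiv ℝ g.form x (Pi.single i 1) x' v) / 2

theorem covDeriv_add (x v a a' b b' : R3) :
    g.covDeriv x v (a + b) (a' + b') = g.covDeriv x v a a' + g.covDeriv x v b b' := by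
  have h : ∀ L L' : R3, g.sharp x (L + L') = g.sharp x L + g.sharp x L' := by
    intro L L'
    have hf : ∀ w w' : R3, g.flat x (w + w') = g.flat x w + g.flat x w' := by
      intro w w'; ext i; simp [flat]
    simp only [sharp, map_add, hf, smul_add, neg_add]
  rw [covDeriv, covDeriv, covDeriv, ← h]
  congr 1
  ext i
  simp only [map_add, add_apply, Pi.add_apply]
  ring

theorem covDeriv_smul (x v : R3) (c : ℝ) (a a' : R3) :
    g.covDeriv x v (c • a) (c • a') = c • g.covDeriv x v a a' := by
  have h : ∀ L : R3, g.sharp x (c • L) = c • g.sharp x L := by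
    intro L
    have hf : ∀ w : R3, g.flat x (c • w) = c • g.flat x w := by
      intro w; ext i; simp [flat]
    simp only [sharp, map_smul, hf, smul_neg]
    rw [smul_comm]
  rw [covDeriv, covDeriv, ← h]
  congr 1
  ext i
  simp only [map_smul, smul_apply, Pi.smul_apply, smul_eq_mul]
  ring

/-- The covariant derivative `∇_A B` of vector fields tangent to `S²`. -/
def nabla (A B : R3 → R3) (x : R3) : R3 := g.covDeriv x (B x) (A x) (fderiv ℝ B x (A x))

/-- The curvature `R(A, B)C = ∇_A ∇_B C - ∇_B ∇_A C - ∇_{[A, B]} C` of vector fields tangent to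
`S²`. -/
def curvature (A B C : R3 → R3) (x : R3) : R3 :=
  g.nabla A (g.nabla B C) x - g.nabla B (g.nabla A C) x
    - g.nabla (VectorField.lieBracket ℝ A B) C x

/-- A vector field tangent to `S²` with value `a` at the points `x` of `S²` with `a ∈ T_x S²`. -/
def extend (a : R3) (y : R3) : R3 := a - (y ⬝ᵥ a) • y

/-- The Gaussian curvature at `x ∈ S²`, computed from a basis `a, b` of `T_x S²`. -/
def gaussCurvature (x a b : R3) : ℝ :=
  g.form x (g.curvature (extend a) (extend b) (extend b) x) a /
    (g.form x a a * g.form x b b - g.form x a b ^ 2)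

/-- The curvature form `σ_g = K μ`. (If `a, b` are linearly dependent, then `μ` vanishes.) -/
def curvatureForm (x a b : R3) : ℝ := g.gaussCurvature x a b * g.areaForm x a b

/-! ### The tangent bundle, its energy levels and the magnetic symplectic form -/

/-- The kinetic energy. -/
def energy (z : R3 × R3) : ℝ := g.form z.1 z.2 z.2 / 2

/-- The functions of which `Σ_m ⊂ ℝ³ × ℝ³` is a regular level. -/
def levelMap (z : R3 × R3) : ℝ × ℝ × ℝ := (z.1 ⬝ᵥ z.1, z.1 ⬝ᵥ z.2, g.energy z)

/-- The energy level `Σ_m = {(x, v) ∈ T S² | E(x, v) = m²/2}`. -/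
def energyLevel (m : ℝ) : Set (R3 × R3) := {z | g.levelMap z = (1, 0, m ^ 2 / 2)}

/-- The tangent space of `Σ_m` at `z ∈ Σ_m`. -/
def levelTangent (z : R3 × R3) : Submodule ℝ (R3 × R3) :=
  LinearMap.ker (fderiv ℝ g.levelMap z : R3 × R3 →ₗ[ℝ] ℝ × ℝ × ℝ)

/-- The Liouville form `λ_{(x,v)}(ξ) = g_x(v, dπ ξ)`. -/
def liouvilleForm (z : R3 × R3) : R3 × R3 →L[ℝ] ℝ :=
  (g.form z.1 z.2).comp (ContinuousLinearMap.fst ℝ R3 R3)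

/-- The angular component of the Levi-Civita connection, `τ_{(x,v)}(ξ) = g_x(ȷ_x v, ∇v̂/dt)` for a
path `(x̂, v̂)` in `T S²` with velocity `ξ`. -/
def angularForm (z : R3 × R3) : R3 × R3 →L[ℝ] ℝ :=
  LinearMap.toContinuousLinearMap
    { toFun := fun ξ => g.form z.1 (g.rot z.1 z.2) (g.covDeriv z.1 z.2 ξ.1 ξ.2)
      map_add' := fun ξ ζ => by simp [covDeriv_add]
      map_smul' := fun c ξ => by simp [covDeriv_smul] }

/-- The twisted symplectic form `ω_σ = dλ - π^*σ`. -/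
def twistedForm (σ : SphereSymplecticForm) (z ξ ζ : R3 × R3) : ℝ :=
  dOne g.liouvilleForm z ξ ζ - σ.form z.1 ![ξ.1, ζ.1]

/-- `β` is a smooth 1-form on `S²` with `dβ = σ - ([σ] / 4π) σ_g`. -/
def IsCurvaturePrimitive (σ : SphereSymplecticForm) (β : R3 → R3 →L[ℝ] ℝ) : Prop :=
  ContDiff ℝ ∞ β ∧ ∀ x u w, x ⬝ᵥ x = 1 → x ⬝ᵥ u = 0 → x ⬝ᵥ w = 0 →
    dOne β x u w = σ.form x ![u, w] - σ.integral / (4 * Real.pi) * g.curvatureForm x u w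

/-- The 1-form `λ + ([σ] / 4π) τ / (2E) - π^*β` on the complement of the zero section of `T S²`.
Its pull-back from `Σ_m` to the unit sphere bundle under `(x, v) ↦ (x, m v)` is
`m λ + ([σ] / 4π) τ - π^*β`. -/
def contactPrimitive (σ : SphereSymplecticForm) (β : R3 → R3 →L[ℝ] ℝ) (z : R3 × R3) :
    R3 × R3 →L[ℝ] ℝ :=
  g.liouvilleForm z + (σ.integral / (4 * Real.pi) / (2 * g.energy z)) • g.angularForm z
    - (β z.1).comp (ContinuousLinearMap.fst ℝ R3 R3)

end SphereMetric

end MagneticSphere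

end

/-!
# Dynamical convexity of the low energy levels of a symplectic magnetic system on the two-sphere

Let `j` be the rotation by `π/2` and `c = [σ] / 4π`, which is not zero as `σ` is an area form up to
sign. The form `τ / 2E` is the connection form of the circle bundle of directions, with
`d(τ / 2E) = -π^*σ_g` (`dOne_connectionForm`). It is computed in local frames, where it is the sum
of the connection form of the frame, whose differential is the curvature, and of the differential
of an angle.

*The primitive.* Stokes' theorem for the connection form on the unit field `∂_θ` of the punctured
sphere is the Gauss-Bonnet theorem (`integral_curvatureForm`), so `σ - c σ_g` has vanishing integral.
Such a form is exact (`isExactDensity_of_sphereIntegral_eq_zero`): averages over rotations change it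
by explicit exact forms, and reduce it to a zonal form supported away from the poles, which is
integrated by hand. With `dβ = σ - c σ_g`, the form `α = λ + c τ/2E - π^*β` is a primitive of
`ω_σ = dλ - π^*σ`.

*The contact form.* On `Σ_m` there is a coframe `p, q, r` with `dπ ξ = p v + q jv` and `r = τ/2E`
(`radialForm`, `transverseForm`, `connectionForm`). With `σ = f μ` it gives
`dα = m² (r ∧ q - f p ∧ q)`, so that `α ∧ dα` is a multiple of `h = m² + c f - β(v)`, and the Reeb
vector has `p = 1 / h`, `q = 0`, `r = f / h`. As `c f > 0` and `v = O(m)`, the function `h` is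
positive for small `m`.

*The linearised flow.* Let `w = q + i sgn(c) p` be the complex coordinate on `ker α`. As
`f / h = 1 / c + O(m)`, the symmetries of the Levi-Civita connection show that the linearised flow
satisfies `w' = (i / |c|) w + O(m) |w|` (`hasDerivAt_coframe`, `hasDerivAt_fibreCoord`). So `w`
rotates by nearly `T / |c|` along an orbit of period `T`. The frames of the definition of the index
extend over a disc, and the total angle in such a frame differs from that of `w` by less than `π`
(`exists_log_frame`, `rotationInterval_of_orbit`).

*The periods.* For bounded periods the orbit stays over a small disc of the sphere and its velocity
rotates with speed `f / h`. So a closed orbit closes after about a whole number of turns, each of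
which takes the time `2π |c|`. The space `Σ_m` is a copy of the orthonormal frames of `ℝ³`, doubly
covered by the three-sphere, and a contractible loop lifts to a closed loop there. With spinors this
says that its total angle is a multiple of `4π` (`exists_angle_eq_four_pi_mul`), and the angle is
not zero. Hence `T` is at least `4π |c|`, up to a factor near `1` (`exists_period_ge`), the
rotation of the linearised flow is more than `5/4` turns, and the index is at least `3`.

*The lens space.* The same description by spinors, `(w₁, w₂) ↦ (w₁² - w₂², i(w₁² + w₂²), -2 w₁ w₂)`,
whose real and imaginary parts span the frame, parametrises `Σ_m` by the three-sphere, and two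
spinors have the same image if and only if they agree up to sign.
-/

open scoped Matrix ContDiff Topology

noncomputable section

set_option maxSynthPendingDepth 3

namespace MagneticSphere

/-! ### The exterior derivative of 1-forms -/

section ExteriorDerivative

variable {E F : Type*} [NormedAddCommGroup E] [NormedSpace ℝ E]
  [NormedAddCommGroup F] [NormedSpace ℝ F]

theorem differentiableAt_ofSubsingleton {α : E → E →L[ℝ] ℝ} {z : E} (h : DifferentiableAt ℝ α z) :
    DifferentiableAt ℝ
      (fun y => ContinuousAlternatingMap.ofSubsingleton ℝ E ℝ (0 : Fin 1) (α y)) z :=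
  ((ContinuousAlternatingMap.ofSubsingletonLIE (𝕜 := ℝ) (E := E) (F := ℝ)
    (0 : Fin 1)).differentiable _).comp z h

theorem dOne_apply {α : E → E →L[ℝ] ℝ} {z : E} (h : DifferentiableAt ℝ α z) (ξ ζ : E) :
    dOne α z ξ ζ = fderiv ℝ α z ξ ζ - fderiv ℝ α z ζ ξ := by
  have e : ∀ u, fderiv ℝ (fun y => α y u) z = (fderiv ℝ α z).flip u := by
    intro u
    ext w
    have := (h.hasFDerivAt.clm_apply (hasFDerivAt_const u z)).fderiv
    rw [this]; simp
  rw [dOne, extDeriv_apply (differentiableAt_ofSubsingleton h), Fin.sum_univ_two]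
  simp [ContinuousAlternatingMap.ofSubsingleton_apply_apply, Fin.removeNth, e, sub_eq_add_neg]

theorem dOne_pullback {α : F → F →L[ℝ] ℝ} {f : E → F} {z : E} (hα : DifferentiableAt ℝ α (f z))
    (hf : ContDiffAt ℝ 2 f z) (ξ ζ : E) :
    dOne (fun y => (α (f y)).comp (fderiv ℝ f y)) z ξ ζ
      = dOne α (f z) (fderiv ℝ f z ξ) (fderiv ℝ f z ζ) := by
  have := extDeriv_pullback (differentiableAt_ofSubsingleton hα) hf
    (by rw [minSmoothness_of_isRCLikeNormedField])
  have h2 := congrArg (fun A => A ![ξ, ζ]) this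
  simp only [ContinuousAlternatingMap.compContinuousLinearMap_apply] at h2
  have e : ⇑(fderiv ℝ f z) ∘ ![ξ, ζ] = ![fderiv ℝ f z ξ, fderiv ℝ f z ζ] := by
    funext i
    fin_cases i <;> rfl
  rw [e] at h2
  exact h2

theorem dOne_congr {α α' : E → E →L[ℝ] ℝ} {z : E} (h : α =ᶠ[𝓝 z] α') (ξ ζ : E) :
    dOne α z ξ ζ = dOne α' z ξ ζ := by
  rw [dOne, dOne, Filter.EventuallyEq.extDeriv_eq]
  filter_upwards [h] with y hy
  rw [hy]

theorem dOne_self (α : E → E →L[ℝ] ℝ) (z ξ : E) : dOne α z ξ ξ = 0 :=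
  ContinuousAlternatingMap.map_eq_zero_of_eq _ _ (i := 0) (j := 1) rfl (by decide)

theorem dOne_smul_right (α : E → E →L[ℝ] ℝ) (z ξ ζ : E) (c : ℝ) :
    dOne α z ξ (c • ζ) = c * dOne α z ξ ζ := by
  have h := ContinuousAlternatingMap.map_update_smul (extDeriv (fun y =>
    ContinuousAlternatingMap.ofSubsingleton ℝ E ℝ (0 : Fin 1) (α y)) z) ![ξ, 0] 1 c ζ
  have e : ∀ w, Function.update ![ξ, 0] 1 w = ![ξ, w] := by
    intro w; funext i; fin_cases i <;> simp
  simp only [e, smul_eq_mul] at h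
  exact h

theorem dOne_swap (α : E → E →L[ℝ] ℝ) (z ξ ζ : E) : dOne α z ξ ζ = - dOne α z ζ ξ := by
  have h := (extDeriv (fun y => ContinuousAlternatingMap.ofSubsingleton ℝ E ℝ (0 : Fin 1)
    (α y)) z).toAlternatingMap.map_swap ![ζ, ξ] (i := 0) (j := 1) (by decide)
  have e : ![ζ, ξ] ∘ Equiv.swap (0 : Fin 2) 1 = ![ξ, ζ] := by
    funext i; fin_cases i <;> simp
  rw [e] at h
  exact h

theorem dOne_smul_left (α : E → E →L[ℝ] ℝ) (z ξ ζ : E) (c : ℝ) :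
    dOne α z (c • ξ) ζ = c * dOne α z ξ ζ := by
  rw [dOne_swap, dOne_smul_right, dOne_swap α z ξ]; ring

theorem dOne_add {α α' : E → E →L[ℝ] ℝ} {z : E} (h : DifferentiableAt ℝ α z)
    (h' : DifferentiableAt ℝ α' z) (ξ ζ : E) :
    dOne (fun y => α y + α' y) z ξ ζ = dOne α z ξ ζ + dOne α' z ξ ζ := by
  rw [dOne_apply (h.fun_add h'), dOne_apply h, dOne_apply h', fderiv_fun_add h h']
  simp only [add_apply]; ring

theorem dOne_sub {α α' : E → E →L[ℝ] ℝ} {z : E} (h : DifferentiableAt ℝ α z)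
    (h' : DifferentiableAt ℝ α' z) (ξ ζ : E) :
    dOne (fun y => α y - α' y) z ξ ζ = dOne α z ξ ζ - dOne α' z ξ ζ := by
  rw [dOne_apply (h.fun_sub h'), dOne_apply h, dOne_apply h', fderiv_fun_sub h h']
  simp only [sub_apply]; ring

theorem dOne_const_smul {α : E → E →L[ℝ] ℝ} {z : E} (h : DifferentiableAt ℝ α z) (c : ℝ)
    (ξ ζ : E) : dOne (fun y => c • α y) z ξ ζ = c * dOne α z ξ ζ := by
  rw [dOne_apply (h.fun_const_smul c), dOne_apply h, fderiv_fun_const_smul h]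
  simp only [smul_apply, smul_eq_mul]; ring

theorem dOne_smul {α : E → E →L[ℝ] ℝ} {f : E → ℝ} {z : E} (hf : DifferentiableAt ℝ f z)
    (h : DifferentiableAt ℝ α z) (ξ ζ : E) :
    dOne (fun y => f y • α y) z ξ ζ
      = f z * dOne α z ξ ζ + fderiv ℝ f z ξ * α z ζ - fderiv ℝ f z ζ * α z ξ := by
  rw [dOne_apply (hf.fun_smul h), dOne_apply h, fderiv_fun_smul hf h]
  simp only [add_apply, smul_apply, smul_eq_mul, ContinuousLinearMap.smulRight_apply]; ring

theorem dOne_fderiv {f : E → ℝ} {z : E} (h : ContDiffAt ℝ 2 f z) (ξ ζ : E) :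
    dOne (fun y => fderiv ℝ f y) z ξ ζ = 0 := by
  have h1 : DifferentiableAt ℝ (fun y => fderiv ℝ f y) z :=
    (h.fderiv_right (m := 1) (by norm_num)).differentiableAt (by norm_num)
  rw [dOne_apply h1, (h.isSymmSndFDerivAt (by simp)).eq, sub_self]

theorem dOne_comp_fst {β : E → E →L[ℝ] ℝ} {z : E × F} (h : DifferentiableAt ℝ β z.1)
    (ξ ζ : E × F) :
    dOne (fun y : E × F => (β y.1).comp (ContinuousLinearMap.fst ℝ E F)) z ξ ζ
      = dOne β z.1 ξ.1 ζ.1 := by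
  have := dOne_pullback (f := (Prod.fst : E × F → E)) (z := z) h contDiffAt_fst ξ ζ
  simpa [fderiv_fst] using this

/-- If two 1-forms agree on the vectors tangent to the image of a retraction, then so do their
exterior derivatives. -/
theorem dOne_eq_of_retraction {α α' : E → E →L[ℝ] ℝ} {z : E} {ρ : E → E}
    (hα : DifferentiableAt ℝ α z) (hα' : DifferentiableAt ℝ α' z) (hρ : ContDiffAt ℝ 2 ρ z)
    (hz : ρ z = z)
    (h : ∀ᶠ y in 𝓝 z, ∀ u, α (ρ y) (fderiv ℝ ρ y u) = α' (ρ y) (fderiv ℝ ρ y u))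
    {ξ ζ : E} (hξ : fderiv ℝ ρ z ξ = ξ) (hζ : fderiv ℝ ρ z ζ = ζ) :
    dOne α z ξ ζ = dOne α' z ξ ζ := by
  have h1 := dOne_pullback (f := ρ) (z := z) (by rwa [hz]) hρ ξ ζ (α := α)
  have h2 := dOne_pullback (f := ρ) (z := z) (by rwa [hz]) hρ ξ ζ (α := α')
  rw [hz, hξ, hζ] at h1 h2
  rw [← h1, ← h2]
  apply dOne_congr
  filter_upwards [h] with y hy
  ext u
  exact hy u

end ExteriorDerivative

/-! ### Calculus of the dot and cross products -/

section Products

variable {E : Type*} [NormedAddCommGroup E] [NormedSpace ℝ E]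

theorem dot_eq (u w : R3) : u ⬝ᵥ w = u 0 * w 0 + u 1 * w 1 + u 2 * w 2 := by
  simp [dotProduct, Fin.sum_univ_three]

theorem cross_zero (u w : R3) : (u ⨯₃ w) 0 = u 1 * w 2 - u 2 * w 1 := by simp [cross_apply]
theorem cross_one (u w : R3) : (u ⨯₃ w) 1 = u 2 * w 0 - u 0 * w 2 := by simp [cross_apply]
theorem cross_two (u w : R3) : (u ⨯₃ w) 2 = u 0 * w 1 - u 1 * w 0 := by simp [cross_apply]

@[fun_prop]
theorem contDiffAt_dot {n : WithTop ℕ∞} {f h : E → R3} {z : E} (hf : ContDiffAt ℝ n f z)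
    (hh : ContDiffAt ℝ n h z) : ContDiffAt ℝ n (fun y => f y ⬝ᵥ h y) z := by
  simp only [dot_eq]
  rw [contDiffAt_pi] at hf hh
  exact (((hf 0).mul (hh 0)).add ((hf 1).mul (hh 1))).add ((hf 2).mul (hh 2))

@[fun_prop]
theorem contDiffAt_cross {n : WithTop ℕ∞} {f h : E → R3} {z : E} (hf : ContDiffAt ℝ n f z)
    (hh : ContDiffAt ℝ n h z) : ContDiffAt ℝ n (fun y => f y ⨯₃ h y) z := by
  rw [contDiffAt_pi] at hf hh ⊢
  intro i
  fin_cases i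
  · simpa only [Fin.zero_eta, cross_zero] using
      ((hf 1).mul (hh 2)).sub ((hf 2).mul (hh 1))
  · simpa only [Fin.mk_one, cross_one] using
      ((hf 2).mul (hh 0)).sub ((hf 0).mul (hh 2))
  · simpa only [Fin.reduceFinMk, cross_two] using
      ((hf 0).mul (hh 1)).sub ((hf 1).mul (hh 0))

@[fun_prop]
theorem contDiff_dot {n : WithTop ℕ∞} {f h : E → R3} (hf : ContDiff ℝ n f)
    (hh : ContDiff ℝ n h) : ContDiff ℝ n (fun y => f y ⬝ᵥ h y) :=
  contDiff_iff_contDiffAt.2 fun _ => contDiffAt_dot hf.contDiffAt hh.contDiffAt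

@[fun_prop]
theorem contDiff_cross {n : WithTop ℕ∞} {f h : E → R3} (hf : ContDiff ℝ n f)
    (hh : ContDiff ℝ n h) : ContDiff ℝ n (fun y => f y ⨯₃ h y) :=
  contDiff_iff_contDiffAt.2 fun _ => contDiffAt_cross hf.contDiffAt hh.contDiffAt

theorem hasDerivAt_dot {f h : ℝ → R3} {f' h' : R3} {t : ℝ} (hf : HasDerivAt f f' t)
    (hh : HasDerivAt h h' t) :
    HasDerivAt (fun s => f s ⬝ᵥ h s) (f' ⬝ᵥ h t + f t ⬝ᵥ h') t := by
  rw [hasDerivAt_pi] at hf hh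
  simp only [dot_eq]
  exact ((((hf 0).fun_mul (hh 0)).fun_add ((hf 1).fun_mul (hh 1))).fun_add
    ((hf 2).fun_mul (hh 2))).congr_deriv (by ring)

/-- The triple product `det (x, u, w)`. -/
theorem triple_eq (x u w : R3) : x ⬝ᵥ (u ⨯₃ w) =
    x 0 * (u 1 * w 2 - u 2 * w 1) + x 1 * (u 2 * w 0 - u 0 * w 2)
      + x 2 * (u 0 * w 1 - u 1 * w 0) := by
  rw [dot_eq, cross_zero, cross_one, cross_two]

end Products

/-! ### Linear algebra of the metric in a tangent plane -/

section CrossProduct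

theorem cross_self_left (x u : R3) : x ⬝ᵥ (x ⨯₃ u) = 0 := dot_self_cross x u

theorem cross_eq_triple_smul {x u w : R3} (hx : x ⬝ᵥ x = 1) (hu : x ⬝ᵥ u = 0) (hw : x ⬝ᵥ w = 0) :
    u ⨯₃ w = (x ⬝ᵥ (u ⨯₃ w)) • x := by
  rw [triple_eq]
  rw [dot_eq] at hx hu hw
  ext i
  fin_cases i
  · simp only [Fin.zero_eta, cross_zero, Pi.smul_apply, smul_eq_mul]
    linear_combination (-(u 1 * w 2 - u 2 * w 1)) * hx + (x 1 * w 2 - x 2 * w 1) * hu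
      + (x 2 * u 1 - x 1 * u 2) * hw
  · simp only [Fin.mk_one, cross_one, Pi.smul_apply, smul_eq_mul]
    linear_combination (-(u 2 * w 0 - u 0 * w 2)) * hx + (x 2 * w 0 - x 0 * w 2) * hu
      + (x 0 * u 2 - x 2 * u 0) * hw
  · simp only [Fin.reduceFinMk, cross_two, Pi.smul_apply, smul_eq_mul]
    linear_combination (-(u 0 * w 1 - u 1 * w 0)) * hx + (x 0 * w 1 - x 1 * w 0) * hu
      + (x 1 * u 0 - x 0 * u 1) * hw

theorem cross_cross_eq (x u : R3) : x ⨯₃ (x ⨯₃ u) = (x ⬝ᵥ u) • x - (x ⬝ᵥ x) • u := by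
  rw [dot_eq, dot_eq]
  ext i
  fin_cases i
  · simp only [Fin.zero_eta, cross_zero, cross_one, cross_two, Pi.smul_apply, Pi.sub_apply,
      smul_eq_mul]; ring
  · simp only [Fin.mk_one, cross_zero, cross_one, cross_two, Pi.smul_apply, Pi.sub_apply,
      smul_eq_mul]; ring
  · simp only [Fin.reduceFinMk, cross_zero, cross_one, cross_two, Pi.smul_apply, Pi.sub_apply,
      smul_eq_mul]; ring

theorem dot_self_pos {u : R3} (hu : u ≠ 0) : 0 < u ⬝ᵥ u := by
  have h0 : u ⬝ᵥ u ≠ 0 := fun h => hu (dotProduct_self_eq_zero.1 h)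
  have : 0 ≤ u ⬝ᵥ u := by rw [dot_eq]; nlinarith [sq_nonneg (u 0), sq_nonneg (u 1), sq_nonneg (u 2)]
  exact lt_of_le_of_ne this h0.symm

theorem triple_swap (x u w : R3) : x ⬝ᵥ (u ⨯₃ w) = - (x ⬝ᵥ (w ⨯₃ u)) := by
  rw [triple_eq, triple_eq]; ring

theorem triple_cross_self {x u : R3} (hx : x ⬝ᵥ x = 1) (hu : x ⬝ᵥ u = 0) :
    x ⬝ᵥ (u ⨯₃ (x ⨯₃ u)) = u ⬝ᵥ u := by
  rw [triple_eq]
  rw [dot_eq] at *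
  simp only [cross_zero, cross_one, cross_two]
  linear_combination (u 0 ^ 2 + u 1 ^ 2 + u 2 ^ 2) * hx
    - (x 0 * u 0 + x 1 * u 1 + x 2 * u 2) * hu

theorem exists_tangent (x : R3) : ∃ u : R3, x ⬝ᵥ u = 0 ∧ u ≠ 0 := by
  by_cases h : x 0 = 0 ∧ x 1 = 0
  · refine ⟨![1, 0, 0], by rw [dot_eq]; simp [h.1], fun h0 => ?_⟩
    simpa using congrFun h0 0
  · refine ⟨![-x 1, x 0, 0], by rw [dot_eq]; simp; ring, fun h0 => h ⟨?_, ?_⟩⟩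
    · simpa using congrFun h0 1
    · simpa using congrFun h0 0

end CrossProduct

namespace SphereMetric

variable (g : SphereMetric)

/-- The coefficients of the metric in the standard basis. -/
def coeff (x : R3) (i j : Fin 3) : ℝ := g.form x (Pi.single i 1) (Pi.single j 1)

theorem coeff_symm (x : R3) (i j : Fin 3) : g.coeff x i j = g.coeff x j i := g.symm _ _ _

theorem sum_single (u : R3) : u = u 0 • Pi.single 0 1 + u 1 • Pi.single 1 1
    + u 2 • (Pi.single 2 1 : R3) := by
  ext i; fin_cases i <;> simp

theorem flat_apply (x v : R3) (i : Fin 3) :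
    g.flat x v i = v 0 * g.coeff x 0 i + v 1 * g.coeff x 1 i + v 2 * g.coeff x 2 i := by
  conv_lhs => rw [flat, sum_single v]
  simp [coeff]

theorem apply_eq_dot {x : R3} (L : R3 →L[ℝ] ℝ) (y : R3) (hx : x = fun i => L (Pi.single i 1)) :
    L y = x ⬝ᵥ y := by
  conv_lhs => rw [sum_single y]
  simp [dot_eq, hx]; ring

theorem form_eq_dot (x v w : R3) : g.form x v w = g.flat x v ⬝ᵥ w :=
  apply_eq_dot (g.form x v) w rfl

theorem form_eq (x v w : R3) : g.form x v w =
    (v 0 * g.coeff x 0 0 + v 1 * g.coeff x 0 1 + v 2 * g.coeff x 0 2) * w 0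
    + (v 0 * g.coeff x 0 1 + v 1 * g.coeff x 1 1 + v 2 * g.coeff x 1 2) * w 1
    + (v 0 * g.coeff x 0 2 + v 1 * g.coeff x 1 2 + v 2 * g.coeff x 2 2) * w 2 := by
  rw [form_eq_dot, dot_eq, flat_apply, flat_apply, flat_apply, g.coeff_symm x 1 0,
    g.coeff_symm x 2 0, g.coeff_symm x 2 1]

/-- The square of the area density. -/
def areaSq (x : R3) : ℝ :=
  x ⬝ᵥ ((Matrix.of fun i j : Fin 3 =>
    g.form x (Pi.single i 1) (Pi.single j 1)).adjugate *ᵥ x)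

theorem areaSq_eq (x : R3) : g.areaSq x =
    x 0 ^ 2 * (g.coeff x 1 1 * g.coeff x 2 2 - g.coeff x 1 2 ^ 2)
    + x 1 ^ 2 * (g.coeff x 0 0 * g.coeff x 2 2 - g.coeff x 0 2 ^ 2)
    + x 2 ^ 2 * (g.coeff x 0 0 * g.coeff x 1 1 - g.coeff x 0 1 ^ 2)
    + 2 * x 0 * x 1 * (g.coeff x 0 2 * g.coeff x 1 2 - g.coeff x 0 1 * g.coeff x 2 2)
    + 2 * x 0 * x 2 * (g.coeff x 0 1 * g.coeff x 1 2 - g.coeff x 0 2 * g.coeff x 1 1)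
    + 2 * x 1 * x 2 * (g.coeff x 0 1 * g.coeff x 0 2 - g.coeff x 0 0 * g.coeff x 1 2) := by
  have h : (Matrix.of fun i j : Fin 3 => g.form x (Pi.single i 1) (Pi.single j 1)) =
      !![g.coeff x 0 0, g.coeff x 0 1, g.coeff x 0 2; g.coeff x 0 1, g.coeff x 1 1, g.coeff x 1 2;
        g.coeff x 0 2, g.coeff x 1 2, g.coeff x 2 2] := by
    ext i j
    fin_cases i <;> fin_cases j <;> simp [coeff, g.symm x (Pi.single 1 1) (Pi.single 0 1),
      g.symm x (Pi.single 2 1) (Pi.single 0 1), g.symm x (Pi.single 2 1) (Pi.single 1 1)]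
  rw [areaSq, h, Matrix.adjugate_fin_three_of]
  rw [dot_eq]
  simp only [Matrix.mulVec, dot_eq]
  simp
  ring

/-- The Gram determinant of two tangent vectors. -/
theorem gram_eq {x u w : R3} (hx : x ⬝ᵥ x = 1) (hu : x ⬝ᵥ u = 0) (hw : x ⬝ᵥ w = 0) :
    g.form x u u * g.form x w w - g.form x u w ^ 2 = g.areaSq x * (x ⬝ᵥ (u ⨯₃ w)) ^ 2 := by
  have h := cross_eq_triple_smul hx hu hw
  set D := x ⬝ᵥ (u ⨯₃ w)
  have h0 : u 1 * w 2 - u 2 * w 1 = D * x 0 := by simpa [cross_zero] using congrFun h 0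
  have h1 : u 2 * w 0 - u 0 * w 2 = D * x 1 := by simpa [cross_one] using congrFun h 1
  have h2 : u 0 * w 1 - u 1 * w 0 = D * x 2 := by simpa [cross_two] using congrFun h 2
  rw [areaSq_eq]
  trans (u 1 * w 2 - u 2 * w 1) ^ 2 * (g.coeff x 1 1 * g.coeff x 2 2 - g.coeff x 1 2 ^ 2)
    + (u 2 * w 0 - u 0 * w 2) ^ 2 * (g.coeff x 0 0 * g.coeff x 2 2 - g.coeff x 0 2 ^ 2)
    + (u 0 * w 1 - u 1 * w 0) ^ 2 * (g.coeff x 0 0 * g.coeff x 1 1 - g.coeff x 0 1 ^ 2)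
    + 2 * (u 1 * w 2 - u 2 * w 1) * (u 2 * w 0 - u 0 * w 2) *
      (g.coeff x 0 2 * g.coeff x 1 2 - g.coeff x 0 1 * g.coeff x 2 2)
    + 2 * (u 1 * w 2 - u 2 * w 1) * (u 0 * w 1 - u 1 * w 0) *
      (g.coeff x 0 1 * g.coeff x 1 2 - g.coeff x 0 2 * g.coeff x 1 1)
    + 2 * (u 2 * w 0 - u 0 * w 2) * (u 0 * w 1 - u 1 * w 0) *
      (g.coeff x 0 1 * g.coeff x 0 2 - g.coeff x 0 0 * g.coeff x 1 2)
  · rw [form_eq, form_eq, form_eq]; ring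
  · rw [h0, h1, h2]; ring

theorem areaSq_pos {x : R3} (hx : x ⬝ᵥ x = 1) : 0 < g.areaSq x := by
  obtain ⟨u, hu, hu0⟩ := exists_tangent x
  have hw := cross_self_left x u
  set w := x ⨯₃ u with hwd
  have hD : x ⬝ᵥ (u ⨯₃ w) = u ⬝ᵥ u := triple_cross_self hx hu
  have hDpos := dot_self_pos hu0
  have ha := g.pos x u hx hu hu0
  set t := g.form x u u • w - g.form x u w • u with ht
  have htx : x ⬝ᵥ t = 0 := by simp [ht, dotProduct_sub, dotProduct_smul, hw, hu]
  have ht0 : t ≠ 0 := by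
    intro h
    have h2 : x ⬝ᵥ (u ⨯₃ t) = g.form x u u * (u ⬝ᵥ u) := by
      rw [ht, map_sub, map_smul, map_smul, cross_self, dotProduct_sub, dotProduct_smul, hD]; simp
    rw [h] at h2
    simp only [map_zero, dotProduct_zero] at h2
    exact (mul_pos ha hDpos).ne h2
  have hp := g.pos x t hx htx ht0
  have e : g.form x t t = g.form x u u * (g.form x u u * g.form x w w - g.form x u w ^ 2) := by
    simp only [ht, map_sub, map_smul, sub_apply, smul_apply, smul_eq_mul, g.symm x w u]; ring
  rw [e, g.gram_eq hx hu hw] at hp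
  by_contra hc
  have : g.form x u u * (g.areaSq x * (x ⬝ᵥ (u ⨯₃ w)) ^ 2) ≤ 0 :=
    mul_nonpos_of_nonneg_of_nonpos ha.le (mul_nonpos_of_nonpos_of_nonneg (not_lt.1 hc) (sq_nonneg _))
  linarith

theorem areaDensity_pos {x : R3} (hx : x ⬝ᵥ x = 1) : 0 < g.areaDensity x :=
  Real.sqrt_pos.2 (g.areaSq_pos hx)

theorem areaDensity_sq {x : R3} (hx : 0 < g.areaSq x) : g.areaDensity x ^ 2 = g.areaSq x :=
  Real.sq_sqrt hx.le

theorem sharp_tangent (x L : R3) : x ⬝ᵥ g.sharp x L = 0 := by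
  simp [sharp, dotProduct_neg, dotProduct_smul]

theorem rot_tangent (x v : R3) : x ⬝ᵥ g.rot x v = 0 := by
  simp [rot, dotProduct_smul]

theorem covDeriv_tangent (x v a a' : R3) : x ⬝ᵥ g.covDeriv x v a a' = 0 := g.sharp_tangent _ _

/-- The defining property of `sharp`; it holds at all points where the area density is positive. -/
theorem form_sharp {x y : R3} (hx : 0 < g.areaSq x) (hy : x ⬝ᵥ y = 0) (L : R3) :
    g.form x (g.sharp x L) y = L ⬝ᵥ y := by
  have key : g.form x (x ⨯₃ g.flat x (x ⨯₃ L)) y = - g.areaSq x * (L ⬝ᵥ y) := by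
    have e : ∀ i, g.flat x (x ⨯₃ L) i = g.flat x (x ⨯₃ L) i := fun _ => rfl
    rw [areaSq_eq, form_eq, dot_eq]
    rw [dot_eq] at hy
    simp only [cross_zero, cross_one, cross_two, flat_apply, g.coeff_symm x 1 0,
      g.coeff_symm x 2 0, g.coeff_symm x 2 1]
    linear_combination (
      L 0 * (x 0 * (g.coeff x 1 1 * g.coeff x 2 2 - g.coeff x 1 2 ^ 2)
        + x 1 * (g.coeff x 0 2 * g.coeff x 1 2 - g.coeff x 0 1 * g.coeff x 2 2)
        + x 2 * (g.coeff x 0 1 * g.coeff x 1 2 - g.coeff x 0 2 * g.coeff x 1 1))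
      + L 1 * (x 0 * (g.coeff x 0 2 * g.coeff x 1 2 - g.coeff x 0 1 * g.coeff x 2 2)
        + x 1 * (g.coeff x 0 0 * g.coeff x 2 2 - g.coeff x 0 2 ^ 2)
        + x 2 * (g.coeff x 0 1 * g.coeff x 0 2 - g.coeff x 0 0 * g.coeff x 1 2))
      + L 2 * (x 0 * (g.coeff x 0 1 * g.coeff x 1 2 - g.coeff x 0 2 * g.coeff x 1 1)
        + x 1 * (g.coeff x 0 1 * g.coeff x 0 2 - g.coeff x 0 0 * g.coeff x 1 2)
        + x 2 * (g.coeff x 0 0 * g.coeff x 1 1 - g.coeff x 0 1 ^ 2))) * hy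
  rw [sharp, map_neg, map_smul, neg_apply, smul_apply, key, smul_eq_mul, g.areaDensity_sq hx]
  field_simp

theorem eq_zero_of_form {x t : R3} (hx : x ⬝ᵥ x = 1) (ht : x ⬝ᵥ t = 0)
    (h : g.form x t t = 0) : t = 0 := by
  by_contra h0
  exact (g.pos x t hx ht h0).ne' h

theorem sharp_flat {x v : R3} (hx : x ⬝ᵥ x = 1) (hv : x ⬝ᵥ v = 0) :
    g.sharp x (g.flat x v) = v := by
  have h1 := g.sharp_tangent x (g.flat x v)
  rw [← sub_eq_zero]
  have ht : x ⬝ᵥ (g.sharp x (g.flat x v) - v) = 0 := by simp [dotProduct_sub, h1, hv]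
  refine g.eq_zero_of_form hx ht ?_
  have e := map_sub (g.form x) (g.sharp x (g.flat x v)) v
  rw [e, sub_apply, g.form_sharp (g.areaSq_pos hx) ht, ← form_eq_dot, sub_self]

theorem form_rot {x v w : R3} (hx : x ⬝ᵥ x = 1) (hv : x ⬝ᵥ v = 0) (hw : x ⬝ᵥ w = 0) :
    g.form x (g.rot x v) w = g.areaDensity x * (x ⬝ᵥ (v ⨯₃ w)) := by
  have h := cross_eq_triple_smul hx hv hw
  set D := x ⬝ᵥ (v ⨯₃ w)
  have h0 : v 1 * w 2 - v 2 * w 1 = D * x 0 := by simpa [cross_zero] using congrFun h 0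
  have h1 : v 2 * w 0 - v 0 * w 2 = D * x 1 := by simpa [cross_one] using congrFun h 1
  have h2 : v 0 * w 1 - v 1 * w 0 = D * x 2 := by simpa [cross_two] using congrFun h 2
  have key : g.form x (x ⨯₃ g.flat x v) w = g.areaSq x * D := by
    rw [areaSq_eq, form_eq]
    simp only [cross_zero, cross_one, cross_two, flat_apply, g.coeff_symm x 1 0,
      g.coeff_symm x 2 0, g.coeff_symm x 2 1]
    linear_combination
      (x 0 * (g.coeff x 1 1 * g.coeff x 2 2 - g.coeff x 1 2 ^ 2)
        + x 1 * (g.coeff x 0 2 * g.coeff x 1 2 - g.coeff x 0 1 * g.coeff x 2 2)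
        + x 2 * (g.coeff x 0 1 * g.coeff x 1 2 - g.coeff x 0 2 * g.coeff x 1 1)) * h0
      + (x 0 * (g.coeff x 0 2 * g.coeff x 1 2 - g.coeff x 0 1 * g.coeff x 2 2)
        + x 1 * (g.coeff x 0 0 * g.coeff x 2 2 - g.coeff x 0 2 ^ 2)
        + x 2 * (g.coeff x 0 1 * g.coeff x 0 2 - g.coeff x 0 0 * g.coeff x 1 2)) * h1
      + (x 0 * (g.coeff x 0 1 * g.coeff x 1 2 - g.coeff x 0 2 * g.coeff x 1 1)
        + x 1 * (g.coeff x 0 1 * g.coeff x 0 2 - g.coeff x 0 0 * g.coeff x 1 2)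
        + x 2 * (g.coeff x 0 0 * g.coeff x 1 1 - g.coeff x 0 1 ^ 2)) * h2
  have hp := g.areaDensity_pos hx
  rw [rot, map_smul, smul_apply, key, smul_eq_mul, ← g.areaDensity_sq (g.areaSq_pos hx)]
  field_simp

theorem form_rot_self {x v : R3} (hx : x ⬝ᵥ x = 1) (hv : x ⬝ᵥ v = 0) :
    g.form x (g.rot x v) v = 0 := by
  rw [g.form_rot hx hv hv, cross_self]; simp

theorem form_rot_swap {x v w : R3} (hx : x ⬝ᵥ x = 1) (hv : x ⬝ᵥ v = 0) (hw : x ⬝ᵥ w = 0) :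
    g.form x (g.rot x v) w = - g.form x (g.rot x w) v := by
  rw [g.form_rot hx hv hw, g.form_rot hx hw hv, triple_swap]; ring

theorem rot_smul (x v : R3) (c : ℝ) : g.rot x (c • v) = c • g.rot x v := by
  have : g.flat x (c • v) = c • g.flat x v := by ext i; simp [flat]
  rw [rot, rot, this, map_smul, smul_comm]

theorem rot_add (x v w : R3) : g.rot x (v + w) = g.rot x v + g.rot x w := by
  have : g.flat x (v + w) = g.flat x v + g.flat x w := by ext i; simp [flat]
  rw [rot, rot, rot, this, map_add, smul_add]

theorem rot_rot {x v : R3} (hx : x ⬝ᵥ x = 1) (hv : x ⬝ᵥ v = 0) :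
    g.rot x (g.rot x v) = -v := by
  have h := g.sharp_flat hx hv
  have e : g.flat x (g.rot x v) = (g.areaDensity x)⁻¹ • g.flat x (x ⨯₃ g.flat x v) := by
    ext i; simp [flat, rot]
  conv_rhs => rw [← h]
  rw [rot, e, map_smul, smul_smul, sharp, neg_neg]
  congr 1
  rw [sq, mul_inv]

theorem form_rot_rot {x v w : R3} (hx : x ⬝ᵥ x = 1) (hv : x ⬝ᵥ v = 0) (hw : x ⬝ᵥ w = 0) :
    g.form x (g.rot x v) (g.rot x w) = g.form x v w := by
  rw [g.form_rot_swap hx hv (g.rot_tangent x w), g.rot_rot hx hw, map_neg, neg_apply, neg_neg,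
    g.symm]

/-- The expansion of a tangent vector in the orthogonal frame `(v, ȷ v)`. -/
theorem frame_expand {x v w : R3} (hx : x ⬝ᵥ x = 1) (hv : x ⬝ᵥ v = 0) (hw : x ⬝ᵥ w = 0) :
    g.form x v v • w = g.form x v w • v + g.form x (g.rot x v) w • g.rot x v := by
  have hp := g.areaDensity_pos hx
  have h := cross_eq_triple_smul hx hv hw
  have h2 : g.form x (g.rot x v) w • g.rot x v = (g.flat x v) ⨯₃ (w ⨯₃ v) := by
    rw [g.form_rot hx hv hw, rot, smul_smul, ← cross_anticomm v w, h, map_neg, map_smul,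
      ← cross_anticomm x (g.flat x v)]
    rw [smul_neg, neg_neg]
    congr 1
    field_simp
    rw [← h]
  rw [h2, form_eq_dot, form_eq_dot, dot_eq, dot_eq]
  ext i
  fin_cases i
  · simp only [Fin.zero_eta, cross_zero, cross_one, cross_two, Pi.smul_apply, Pi.add_apply,
      smul_eq_mul]; ring
  · simp only [Fin.mk_one, cross_zero, cross_one, cross_two, Pi.smul_apply, Pi.add_apply,
      smul_eq_mul]; ring
  · simp only [Fin.reduceFinMk, cross_zero, cross_one, cross_two, Pi.smul_apply, Pi.add_apply,
      smul_eq_mul]; ring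

/-- Two tangent vectors with the same products with `v` and `ȷ v` are equal. -/
theorem eq_of_form_eq {x v w w' : R3} (hx : x ⬝ᵥ x = 1) (hv : x ⬝ᵥ v = 0) (hv0 : v ≠ 0)
    (hw : x ⬝ᵥ w = 0) (hw' : x ⬝ᵥ w' = 0) (h1 : g.form x v w = g.form x v w')
    (h2 : g.form x (g.rot x v) w = g.form x (g.rot x v) w') : w = w' := by
  have e := g.frame_expand hx hv hw
  rw [h1, h2, ← g.frame_expand hx hv hw'] at e
  exact smul_right_injective _ (g.pos x v hx hv hv0).ne' e

end SphereMetric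

/-! ### Smoothness of the metric objects, and differentiation along curves -/

namespace SphereMetric

variable (g : SphereMetric)

section Smoothness

variable {E : Type*} [NormedAddCommGroup E] [NormedSpace ℝ E] {x v w a b : E → R3} {z : E}

theorem contDiffAt_form (hx : ContDiffAt ℝ ∞ x z) (hv : ContDiffAt ℝ ∞ v z)
    (hw : ContDiffAt ℝ ∞ w z) : ContDiffAt ℝ ∞ (fun y => g.form (x y) (v y) (w y)) z :=
  ((g.smooth.contDiffAt.comp z hx).clm_apply hv).clm_apply hw

theorem contDiffAt_fderiv_form (hx : ContDiffAt ℝ ∞ x z) (ha : ContDiffAt ℝ ∞ a z)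
    (hv : ContDiffAt ℝ ∞ v z) (hw : ContDiffAt ℝ ∞ w z) :
    ContDiffAt ℝ ∞ (fun y => fderiv ℝ g.form (x y) (a y) (v y) (w y)) z := by
  have h : ContDiff ℝ ∞ (fderiv ℝ g.form) := g.smooth.fderiv_right (by simp)
  exact (((h.contDiffAt.comp z hx).clm_apply ha).clm_apply hv).clm_apply hw

theorem contDiffAt_flat (hx : ContDiffAt ℝ ∞ x z) (hv : ContDiffAt ℝ ∞ v z) :
    ContDiffAt ℝ ∞ (fun y => g.flat (x y) (v y)) z :=
  contDiffAt_pi.2 fun _ => g.contDiffAt_form hx hv contDiffAt_const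

theorem contDiff_areaSq : ContDiff ℝ ∞ g.areaSq := by
  have h : ∀ i j, ContDiff ℝ ∞ (fun x => g.coeff x i j) := fun i j =>
    contDiff_iff_contDiffAt.2 fun x =>
      g.contDiffAt_form contDiffAt_id contDiffAt_const contDiffAt_const
  have e : g.areaSq = fun x => _ := funext g.areaSq_eq
  rw [e]
  fun_prop

theorem contDiffAt_areaDensity (hx : ContDiffAt ℝ ∞ x z) (h : 0 < g.areaSq (x z)) :
    ContDiffAt ℝ ∞ (fun y => g.areaDensity (x y)) z :=
  ContDiffAt.sqrt (f := fun y => g.areaSq (x y)) (g.contDiff_areaSq.contDiffAt.comp z hx) h.ne'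

theorem contDiffAt_rot (hx : ContDiffAt ℝ ∞ x z) (h : 0 < g.areaSq (x z))
    (hv : ContDiffAt ℝ ∞ v z) : ContDiffAt ℝ ∞ (fun y => g.rot (x y) (v y)) z :=
  ((g.contDiffAt_areaDensity hx h).inv (Real.sqrt_pos.2 h).ne').smul
    (contDiffAt_cross hx (g.contDiffAt_flat hx hv))

theorem contDiffAt_sharp (hx : ContDiffAt ℝ ∞ x z) (h : 0 < g.areaSq (x z))
    (hv : ContDiffAt ℝ ∞ v z) : ContDiffAt ℝ ∞ (fun y => g.sharp (x y) (v y)) z :=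
  ((((g.contDiffAt_areaDensity hx h).pow 2).inv (pow_pos (Real.sqrt_pos.2 h) 2).ne').smul
    (contDiffAt_cross hx (g.contDiffAt_flat hx (contDiffAt_cross hx hv)))).neg

theorem contDiffAt_covDeriv (hx : ContDiffAt ℝ ∞ x z) (h : 0 < g.areaSq (x z))
    (hv : ContDiffAt ℝ ∞ v z) (ha : ContDiffAt ℝ ∞ a z) (hb : ContDiffAt ℝ ∞ b z) :
    ContDiffAt ℝ ∞ (fun y => g.covDeriv (x y) (v y) (a y) (b y)) z := by
  refine g.contDiffAt_sharp hx h (contDiffAt_pi.2 fun i => ?_)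
  exact (g.contDiffAt_form hx hb contDiffAt_const).add
    ((((g.contDiffAt_fderiv_form hx ha hv contDiffAt_const).add
      (g.contDiffAt_fderiv_form hx hv ha contDiffAt_const)).sub
      (g.contDiffAt_fderiv_form hx contDiffAt_const ha hv)).div_const 2)

end Smoothness

theorem fderiv_form_symm (x a v w : R3) :
    fderiv ℝ g.form x a v w = fderiv ℝ g.form x a w v := by
  have hd : DifferentiableAt ℝ g.form x := g.smooth.differentiable (by simp) x
  have e : ∀ u y : R3, fderiv ℝ (fun p => g.form p u y) x a = fderiv ℝ g.form x a u y := by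
    intro u y
    have h := ((hd.hasFDerivAt.clm_apply (hasFDerivAt_const u x)).clm_apply
      (hasFDerivAt_const y x)).fderiv
    rw [h]; simp
  rw [← e, ← e]
  congr 2
  ext p
  exact g.symm p v w

theorem form_covDeriv {x y : R3} (hx : 0 < g.areaSq x) (hy : x ⬝ᵥ y = 0) (v a a' : R3) :
    g.form x (g.covDeriv x v a a') y = g.form x a' y +
      (fderiv ℝ g.form x a v y + fderiv ℝ g.form x v a y - fderiv ℝ g.form x y a v) / 2 := by
  have h : ∀ (A B C : R3 →L[ℝ] ℝ) (D : R3 →L[ℝ] ℝ),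
      (fun i => A (Pi.single i 1) + (B (Pi.single i 1) + C (Pi.single i 1)
        - D (Pi.single i 1)) / 2) ⬝ᵥ y = A y + (B y + C y - D y) / 2 := by
    intro A B C D
    rw [apply_eq_dot A y rfl, apply_eq_dot B y rfl, apply_eq_dot C y rfl, apply_eq_dot D y rfl]
    simp only [dot_eq]; ring
  rw [covDeriv, g.form_sharp hx hy]
  exact h (g.form x a') (fderiv ℝ g.form x a v) (fderiv ℝ g.form x v a)
    (((fderiv ℝ g.form x).flip a).flip v)

/-- The Levi-Civita connection is torsion-free. -/
theorem covDeriv_symm (x v a w : R3) : g.covDeriv x v a w = g.covDeriv x a v w := by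
  rw [covDeriv, covDeriv]
  congr 1
  ext i
  rw [g.fderiv_form_symm x _ a v]
  ring

theorem hasDerivAt_form {x v w : ℝ → R3} {x' v' w' : R3} {t : ℝ} (hx : HasDerivAt x x' t)
    (hv : HasDerivAt v v' t) (hw : HasDerivAt w w' t) :
    HasDerivAt (fun s => g.form (x s) (v s) (w s))
      (fderiv ℝ g.form (x t) x' (v t) (w t) + g.form (x t) v' (w t) + g.form (x t) (v t) w') t := by
  have hd : HasFDerivAt g.form (fderiv ℝ g.form (x t)) (x t) :=
    (g.smooth.differentiable (by simp) _).hasFDerivAt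
  have h0 : HasDerivAt (fun s => g.form (x s)) (fderiv ℝ g.form (x t) x') t :=
    hd.comp_hasDerivAt t hx
  have h1 : HasDerivAt (fun s => g.form (x s) (v s))
      (fderiv ℝ g.form (x t) x' (v t) + g.form (x t) v') t := h0.clm_apply hv
  exact h1.clm_apply hw

/-- The Levi-Civita connection is compatible with the metric. -/
theorem hasDerivAt_form_covDeriv {x v w : ℝ → R3} {x' v' w' : R3} {t : ℝ}
    (hx : HasDerivAt x x' t) (hv : HasDerivAt v v' t) (hw : HasDerivAt w w' t)
    (h : 0 < g.areaSq (x t)) (hvt : x t ⬝ᵥ v t = 0) (hwt : x t ⬝ᵥ w t = 0) :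
    HasDerivAt (fun s => g.form (x s) (v s) (w s))
      (g.form (x t) (g.covDeriv (x t) (v t) x' v') (w t)
        + g.form (x t) (v t) (g.covDeriv (x t) (w t) x' w')) t := by
  refine (g.hasDerivAt_form hx hv hw).congr_deriv ?_
  rw [g.symm _ (v t) (g.covDeriv _ _ _ _), g.form_covDeriv h hwt, g.form_covDeriv h hvt,
    g.symm (x t) w' (v t), g.fderiv_form_symm _ (w t) x', g.fderiv_form_symm _ (v t) x',
    g.fderiv_form_symm _ x' (w t) (v t)]
  ring

/-- The vertical vectors `(0, w)` of the tangent bundle have connection component `w`. -/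
theorem covDeriv_vertical {x w : R3} (hx : x ⬝ᵥ x = 1) (hw : x ⬝ᵥ w = 0) (v : R3) :
    g.covDeriv x v 0 w = w := by
  conv_rhs => rw [← g.sharp_flat hx hw]
  rw [covDeriv]
  congr 1
  ext i
  simp [flat]

theorem ne_zero_of_unit {x : R3} (hx : x ⬝ᵥ x = 1) : x ≠ 0 := by
  rintro rfl; simp at hx

/-- The rotation `ȷ` is parallel: it commutes with the covariant derivative along curves. -/
theorem exists_hasDerivAt_rot {x v : ℝ → R3} {x' v' : R3} {t : ℝ} (hx : HasDerivAt x x' t)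
    (hv : HasDerivAt v v' t) (hx1 : ∀ᶠ s in 𝓝 t, x s ⬝ᵥ x s = 1)
    (hxv : ∀ᶠ s in 𝓝 t, x s ⬝ᵥ v s = 0) (hv0 : v t ≠ 0) :
    ∃ J : R3, HasDerivAt (fun s => g.rot (x s) (v s)) J t ∧
      g.covDeriv (x t) (g.rot (x t) (v t)) x' J
        = g.rot (x t) (g.covDeriv (x t) (v t) x' v') := by
  have h1 := hx1.self_of_nhds
  have h2 := hxv.self_of_nhds
  have hp := g.areaSq_pos h1
  obtain ⟨J, hJ⟩ : ∃ J : R3, HasDerivAt (fun s => g.rot (x s) (v s)) J t := by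
    have hd := (g.contDiffAt_rot (E := R3 × R3) (x := Prod.fst) (v := Prod.snd)
      (z := (x t, v t)) contDiffAt_fst hp contDiffAt_snd).differentiableAt (by simp)
    have hd2 : HasFDerivAt (fun y : R3 × R3 => g.rot y.1 y.2) _ (x t, v t) := hd.hasFDerivAt
    exact ⟨_, HasFDerivAt.comp_hasDerivAt (f := fun s => (x s, v s)) t hd2 (hx.prodMk hv)⟩
  refine ⟨J, hJ, ?_⟩
  set T := g.covDeriv (x t) (v t) x' v' with hT
  have hTt : x t ⬝ᵥ T = 0 := g.covDeriv_tangent _ _ _ _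
  set R := g.covDeriv (x t) (g.rot (x t) (v t)) x' J with hR
  have hRt : x t ⬝ᵥ R = 0 := g.covDeriv_tangent _ _ _ _
  have hj := g.rot_tangent (x t) (v t)
  have e1 := g.hasDerivAt_form_covDeriv hx hJ hv hp hj h2
  have e2 := g.hasDerivAt_form_covDeriv hx hJ hJ hp hj hj
  have e3 := g.hasDerivAt_form_covDeriv hx hv hv hp h2 h2
  have c1 : HasDerivAt (fun s => g.form (x s) (g.rot (x s) (v s)) (v s)) 0 t := by
    refine (hasDerivAt_const t (0 : ℝ)).congr_of_eventuallyEq ?_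
    filter_upwards [hx1, hxv] with s hs1 hs2 using g.form_rot_self hs1 hs2
  have c2 : HasDerivAt (fun s => g.form (x s) (g.rot (x s) (v s)) (g.rot (x s) (v s)))
      (g.form (x t) T (v t) + g.form (x t) (v t) T) t := by
    refine e3.congr_of_eventuallyEq ?_
    filter_upwards [hx1, hxv] with s hs1 hs2 using g.form_rot_rot hs1 hs2 hs2
  have d1 := e1.unique c1
  have d2 := e2.unique c2
  rw [g.symm _ T (v t), g.symm _ _ R] at d2
  rw [g.symm _ R] at d1
  have hTr := g.rot_tangent (x t) T
  refine g.eq_of_form_eq h1 h2 hv0 hRt hTr ?_ ?_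
  · rw [g.symm _ _ (g.rot _ _), g.form_rot_swap h1 hTt h2]; linarith
  · rw [g.form_rot_rot h1 h2 hTt, g.symm]; linarith [g.symm (x t) R (g.rot (x t) (v t))]

end SphereMetric

theorem exists_sphere_curve {x a : R3} (hx : x ⬝ᵥ x = 1) (ha : x ⬝ᵥ a = 0) :
    ∃ c : ℝ → R3, c 0 = x ∧ (∀ s, c s ⬝ᵥ c s = 1) ∧ HasDerivAt c a 0 := by
  have hq : ∀ s : ℝ, (x + s • a) ⬝ᵥ (x + s • a) = 1 + s ^ 2 * (a ⬝ᵥ a) := by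
    intro s
    simp only [dotProduct_add, add_dotProduct, dotProduct_smul, smul_dotProduct, hx, ha,
      dotProduct_comm a x, smul_eq_mul]; ring
  have ha0 : 0 ≤ a ⬝ᵥ a := by rw [dot_eq]; nlinarith [sq_nonneg (a 0), sq_nonneg (a 1), sq_nonneg (a 2)]
  have hpos : ∀ s : ℝ, 0 < 1 + s ^ 2 * (a ⬝ᵥ a) := fun s => by positivity
  refine ⟨fun s => (√(1 + s ^ 2 * (a ⬝ᵥ a)))⁻¹ • (x + s • a), by simp, fun s => ?_, ?_⟩
  · rw [dotProduct_smul, smul_dotProduct, hq, smul_eq_mul, smul_eq_mul, ← mul_assoc, ← mul_inv,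
      Real.mul_self_sqrt (hpos s).le, inv_mul_cancel₀ (hpos s).ne']
  · have h1 : HasDerivAt (fun s : ℝ => 1 + s ^ 2 * (a ⬝ᵥ a)) 0 0 := by
      simpa using (((hasDerivAt_id (0 : ℝ)).fun_pow 2).mul_const (a ⬝ᵥ a)).const_add 1
    have h2 : HasDerivAt (fun s : ℝ => (√(1 + s ^ 2 * (a ⬝ᵥ a)))⁻¹) 0 0 := by
      simpa using (h1.sqrt (by simp)).fun_inv (by simp)
    have h3 : HasDerivAt (fun s : ℝ => x + s • a) a 0 := by
      simpa using ((hasDerivAt_id (0 : ℝ)).smul_const a).const_add x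
    simpa using h2.fun_smul h3

/-! ### The tangent bundle and its canonical 1-forms -/

theorem hasDerivAt_comp_curve {E F : Type*} [NormedAddCommGroup E] [NormedSpace ℝ E]
    [NormedAddCommGroup F] [NormedSpace ℝ F] {f : E → F} {f' : E →L[ℝ] F} {c : ℝ → E} {c' : E}
    {t : ℝ} (hf : HasFDerivAt f f' (c t)) (hc : HasDerivAt c c' t) :
    HasDerivAt (fun s => f (c s)) (f' c') t := hf.comp_hasDerivAt t hc

section BundleCurves

/-- The retraction of a neighbourhood of `T S²` in `ℝ³ × ℝ³` onto `T S²`. -/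
def bundleRetraction (z : R3 × R3) : R3 × R3 :=
  ((√(z.1 ⬝ᵥ z.1))⁻¹ • z.1, z.2 - ((z.1 ⬝ᵥ z.2) / (z.1 ⬝ᵥ z.1)) • z.1)

theorem bundleRetraction_fst {z : R3 × R3} (h : z.1 ≠ 0) :
    (bundleRetraction z).1 ⬝ᵥ (bundleRetraction z).1 = 1 := by
  have hp := dot_self_pos h
  simp only [bundleRetraction, dotProduct_smul, smul_dotProduct, smul_eq_mul]
  rw [← mul_assoc, ← mul_inv, Real.mul_self_sqrt hp.le, inv_mul_cancel₀ hp.ne']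

theorem bundleRetraction_snd {z : R3 × R3} (h : z.1 ≠ 0) :
    (bundleRetraction z).1 ⬝ᵥ (bundleRetraction z).2 = 0 := by
  have hp := dot_self_pos h
  simp only [bundleRetraction, dotProduct_smul, smul_dotProduct, smul_eq_mul, dotProduct_sub]
  field_simp
  ring

theorem bundleRetraction_eq_self {z : R3 × R3} (h : z.1 ⬝ᵥ z.1 = 1) (h' : z.1 ⬝ᵥ z.2 = 0) :
    bundleRetraction z = z := by
  simp [bundleRetraction, h, h']

theorem contDiffAt_bundleRetraction {z : R3 × R3} (h : z.1 ≠ 0) :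
    ContDiffAt ℝ ∞ bundleRetraction z := by
  have hp := dot_self_pos h
  have h1 : ContDiffAt ℝ ∞ (fun z : R3 × R3 => z.1 ⬝ᵥ z.1) z := by fun_prop
  have h2 : ContDiffAt ℝ ∞ (fun z : R3 × R3 => z.1 ⬝ᵥ z.2) z := by fun_prop
  exact (((h1.sqrt hp.ne').inv (Real.sqrt_pos.2 hp).ne').smul contDiffAt_fst).prodMk
    (contDiffAt_snd.sub ((h2.div h1 hp.ne').smul contDiffAt_fst))

/-- The vector `ξ` is tangent to `T S²` at `z ∈ T S²`. -/
def IsBundleTangent (z ξ : R3 × R3) : Prop := z.1 ⬝ᵥ ξ.1 = 0 ∧ z.1 ⬝ᵥ ξ.2 + z.2 ⬝ᵥ ξ.1 = 0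

theorem IsBundleTangent.of_hasDerivAt {c : ℝ → R3 × R3} {ξ : R3 × R3} {t : ℝ}
    (hc : HasDerivAt c ξ t) (h1 : ∀ᶠ s in 𝓝 t, (c s).1 ⬝ᵥ (c s).1 = 1)
    (h2 : ∀ᶠ s in 𝓝 t, (c s).1 ⬝ᵥ (c s).2 = 0) : IsBundleTangent (c t) ξ := by
  have d1 : HasDerivAt (fun s => (c s).1) ξ.1 t := hc.fst
  have d2 : HasDerivAt (fun s => (c s).2) ξ.2 t := hc.snd
  have e1 := (hasDerivAt_dot d1 d1).unique
    ((hasDerivAt_const t (1 : ℝ)).congr_of_eventuallyEq h1)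
  have e2 := (hasDerivAt_dot d1 d2).unique
    ((hasDerivAt_const t (0 : ℝ)).congr_of_eventuallyEq h2)
  rw [dotProduct_comm ξ.1] at e1 e2
  exact ⟨by linarith, by linarith⟩

theorem hasDerivAt_line (z ξ : R3 × R3) : HasDerivAt (fun s : ℝ => z + s • ξ) ξ 0 := by
  simpa using ((hasDerivAt_id (0 : ℝ)).smul_const ξ).const_add z

theorem isBundleTangent_fderiv_bundleRetraction {z : R3 × R3} (h : z.1 ≠ 0) (u : R3 × R3) :
    IsBundleTangent (bundleRetraction z) (fderiv ℝ bundleRetraction z u) := by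
  have hd : HasFDerivAt bundleRetraction (fderiv ℝ bundleRetraction z) (z + (0 : ℝ) • u) := by
    simpa using ((contDiffAt_bundleRetraction h).differentiableAt (by simp)).hasFDerivAt
  have hc : HasDerivAt (fun s : ℝ => bundleRetraction (z + s • u))
    (fderiv ℝ bundleRetraction z u) 0 :=
    hasDerivAt_comp_curve (c := fun s : ℝ => z + s • u) hd (hasDerivAt_line z u)
  have hne : ∀ᶠ s in 𝓝 (0 : ℝ), (z + s • u).1 ≠ 0 := by
    have : ContinuousAt (fun s : ℝ => (z + s • u).1) 0 := by fun_prop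
    exact this.eventually_ne (by simpa using h)
  have := IsBundleTangent.of_hasDerivAt hc (hne.mono fun s hs => bundleRetraction_fst hs)
    (hne.mono fun s hs => bundleRetraction_snd hs)
  simpa using this

/-- A curve on `T S²` through a point with a given tangent velocity. -/
theorem exists_bundle_curve {z ξ : R3 × R3} (hx : z.1 ⬝ᵥ z.1 = 1) (hv : z.1 ⬝ᵥ z.2 = 0)
    (hξ : IsBundleTangent z ξ) :
    ∃ c : ℝ → R3 × R3, c 0 = z ∧ (∀ s, (c s).1 ⬝ᵥ (c s).1 = 1) ∧ (∀ s, (c s).1 ⬝ᵥ (c s).2 = 0) ∧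
      HasDerivAt c ξ 0 := by
  obtain ⟨x, hx0, hx1, hxd⟩ := exists_sphere_curve hx hξ.1
  refine ⟨fun s => (x s, (z.2 + s • ξ.2) - (x s ⬝ᵥ (z.2 + s • ξ.2)) • x s), ?_, hx1, ?_, ?_⟩
  · simp [hx0, hv]
  · intro s
    simp [dotProduct_sub, dotProduct_smul, hx1]
  · have h1 : HasDerivAt (fun s : ℝ => z.2 + s • ξ.2) ξ.2 0 := by
      simpa using ((hasDerivAt_id (0 : ℝ)).smul_const ξ.2).const_add z.2
    have h2 := hasDerivAt_dot hxd h1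
    have h3 := hxd.prodMk (h1.fun_sub (h2.fun_smul hxd))
    refine h3.congr_deriv ?_
    have := hξ.2
    rw [dotProduct_comm z.2] at this
    simp only [hx0, zero_smul, add_zero, hv]
    rw [add_comm (ξ.1 ⬝ᵥ z.2), this]
    simp

theorem fderiv_bundleRetraction_eq {z ξ : R3 × R3} (hx : z.1 ⬝ᵥ z.1 = 1) (hv : z.1 ⬝ᵥ z.2 = 0)
    (hξ : IsBundleTangent z ξ) : fderiv ℝ bundleRetraction z ξ = ξ := by
  obtain ⟨c, hc0, hc1, hc2, hcd⟩ := exists_bundle_curve hx hv hξ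
  have h0 : z.1 ≠ 0 := SphereMetric.ne_zero_of_unit hx
  have hd : HasFDerivAt bundleRetraction (fderiv ℝ bundleRetraction z) (c 0) := by
    rw [hc0]; exact ((contDiffAt_bundleRetraction h0).differentiableAt (by simp)).hasFDerivAt
  have h1 : HasDerivAt (fun s => bundleRetraction (c s)) (fderiv ℝ bundleRetraction z ξ) 0 :=
    hd.comp_hasDerivAt 0 hcd
  have h2 : (fun s => bundleRetraction (c s)) = c :=
    funext fun s => bundleRetraction_eq_self (hc1 s) (hc2 s)
  rw [h2] at h1
  exact h1.unique hcd

end BundleCurves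

section Forms

variable {E F : Type*} [NormedAddCommGroup E] [NormedSpace ℝ E]
  [NormedAddCommGroup F] [NormedSpace ℝ F]

/-- The derivative of `α(c(t))(w(t))` along a curve. -/
theorem hasDerivAt_clm_apply_curve {α : E → E →L[ℝ] F} {c w : ℝ → E} {ξ w' : E} {t : ℝ}
    (hα : DifferentiableAt ℝ α (c t)) (hc : HasDerivAt c ξ t) (hw : HasDerivAt w w' t) :
    HasDerivAt (fun s => α (c s) (w s)) (fderiv ℝ α (c t) ξ (w t) + α (c t) w') t := by
  have h0 : HasDerivAt (fun s => α (c s)) (fderiv ℝ α (c t) ξ) t :=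
    hα.hasFDerivAt.comp_hasDerivAt t hc
  exact h0.clm_apply hw

theorem contDiffAt_clm_of_apply [FiniteDimensional ℝ E] {n : WithTop ℕ∞} {α : E → E →L[ℝ] F}
    {z : E} (h : ∀ u, ContDiffAt ℝ n (fun y => α y u) z) : ContDiffAt ℝ n α z := by
  let d := Module.finrank ℝ E
  have hd : d = Module.finrank ℝ (Fin d → ℝ) := (Module.finrank_fin_fun ℝ).symm
  let e₁ := ContinuousLinearEquiv.ofFinrankEq hd
  let e₂ := (e₁.arrowCongr (1 : F ≃L[ℝ] F)).trans (ContinuousLinearEquiv.piRing (Fin d))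
  rw [← Function.id_comp α, ← e₂.symm_comp_self]
  exact e₂.symm.contDiff.contDiffAt.comp z (contDiffAt_pi.mpr fun i => h _)

/-- Cartan's formula for the exterior derivative of a 1-form, in terms of two vector fields. -/
theorem dOne_vectorFields {α : E → E →L[ℝ] ℝ} {z : E} {A B : E → E}
    (hα : DifferentiableAt ℝ α z) (hA : DifferentiableAt ℝ A z) (hB : DifferentiableAt ℝ B z) :
    dOne α z (A z) (B z) = fderiv ℝ (fun y => α y (B y)) z (A z)
      - fderiv ℝ (fun y => α y (A y)) z (B z) - α z (VectorField.lieBracket ℝ A B z) := by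
  rw [dOne_apply hα, (hα.hasFDerivAt.clm_apply hB.hasFDerivAt).fderiv,
    (hα.hasFDerivAt.clm_apply hA.hasFDerivAt).fderiv, VectorField.lieBracket]
  simp
  ring

end Forms

namespace SphereMetric

variable (g : SphereMetric)

theorem contDiff_liouvilleForm : ContDiff ℝ ∞ g.liouvilleForm := by
  have h : ContDiff ℝ ∞ fun z : R3 × R3 => g.form z.1 z.2 :=
    (g.smooth.comp contDiff_fst).clm_apply contDiff_snd
  exact h.clm_comp contDiff_const

theorem angularForm_apply (z ξ : R3 × R3) :
    g.angularForm z ξ = g.form z.1 (g.rot z.1 z.2) (g.covDeriv z.1 z.2 ξ.1 ξ.2) := rfl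

theorem contDiffAt_angularForm {z : R3 × R3} (h : 0 < g.areaSq z.1) :
    ContDiffAt ℝ ∞ g.angularForm z := by
  refine contDiffAt_clm_of_apply fun u => ?_
  simp only [angularForm_apply]
  exact g.contDiffAt_form contDiffAt_fst (g.contDiffAt_rot contDiffAt_fst h contDiffAt_snd)
    (g.contDiffAt_covDeriv contDiffAt_fst h contDiffAt_snd contDiffAt_const contDiffAt_const)

theorem contDiff_energy : ContDiff ℝ ∞ g.energy :=
  (contDiff_iff_contDiffAt.2 fun _ =>
    g.contDiffAt_form contDiffAt_fst contDiffAt_snd contDiffAt_snd).div_const 2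

/-- The normalised angular form `τ / (2E)`, the connection form of the circle bundle of
directions. -/
def connectionForm (z : R3 × R3) : R3 × R3 →L[ℝ] ℝ := (2 * g.energy z)⁻¹ • g.angularForm z

theorem two_mul_energy (z : R3 × R3) : 2 * g.energy z = g.form z.1 z.2 z.2 := by
  rw [energy]; ring

theorem connectionForm_apply (z ξ : R3 × R3) : g.connectionForm z ξ =
    g.form z.1 (g.rot z.1 z.2) (g.covDeriv z.1 z.2 ξ.1 ξ.2) / g.form z.1 z.2 z.2 := by
  rw [connectionForm, two_mul_energy, smul_apply, angularForm_apply, smul_eq_mul,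
    inv_mul_eq_div]

theorem contDiffAt_connectionForm {z : R3 × R3} (h : 0 < g.areaSq z.1)
    (h0 : g.form z.1 z.2 z.2 ≠ 0) : ContDiffAt ℝ ∞ g.connectionForm z := by
  refine ContDiffAt.smul (ContDiffAt.inv (contDiffAt_const.mul g.contDiff_energy.contDiffAt) ?_)
    (g.contDiffAt_angularForm h)
  rwa [two_mul_energy]

/-- The differential of the Liouville form pairs the base components with the covariant components
of tangent vectors of the bundle; the torsion-free symmetry of the connection removes all other
terms. -/
theorem dOne_liouvilleForm {z ξ ζ : R3 × R3} (hx : 0 < g.areaSq z.1) (hξ : z.1 ⬝ᵥ ξ.1 = 0)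
    (hζ : z.1 ⬝ᵥ ζ.1 = 0) : dOne g.liouvilleForm z ξ ζ =
      g.form z.1 (g.covDeriv z.1 z.2 ξ.1 ξ.2) ζ.1
        - g.form z.1 (g.covDeriv z.1 z.2 ζ.1 ζ.2) ξ.1 := by
  have hd : DifferentiableAt ℝ g.liouvilleForm z := g.contDiff_liouvilleForm.differentiable
    (by simp) z
  have key : ∀ ξ ζ : R3 × R3, fderiv ℝ g.liouvilleForm z ξ ζ =
      fderiv ℝ g.form z.1 ξ.1 z.2 ζ.1 + g.form z.1 ξ.2 ζ.1 := by
    intro ξ ζ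
    have h1 := hasDerivAt_clm_apply_curve (α := g.liouvilleForm) (t := 0) (by simpa using hd)
      (hasDerivAt_line z ξ) (hasDerivAt_const 0 ζ)
    have h2 := g.hasDerivAt_form (hasDerivAt_line z ξ).fst (hasDerivAt_line z ξ).snd
      (hasDerivAt_const 0 ζ.1)
    have := h1.unique h2
    simpa using this
  rw [dOne_apply hd, key, key, g.form_covDeriv hx hζ, g.form_covDeriv hx hξ,
    g.fderiv_form_symm _ z.2 ζ.1 ξ.1, g.fderiv_form_symm _ ξ.1 ζ.1 z.2,
    g.fderiv_form_symm _ ζ.1 ξ.1 z.2]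
  ring

end SphereMetric

/-! ### The curvature form as the differential of the connection form -/

theorem two_le_infty : (2 : WithTop ℕ∞) ≤ ∞ := by
  exact WithTop.coe_le_coe.2 le_top

namespace SphereMetric

variable (g : SphereMetric)

theorem contDiff_extend (a : R3) : ContDiff ℝ ∞ (extend a) := by
  unfold extend; fun_prop

theorem extend_tangent (a : R3) {y : R3} (hy : y ⬝ᵥ y = 1) : y ⬝ᵥ extend a y = 0 := by
  simp [extend, dotProduct_sub, dotProduct_smul, hy]

theorem extend_eq {x a : R3} (ha : x ⬝ᵥ a = 0) : extend a x = a := by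
  simp [extend, ha]

theorem fderiv_extend (a y u : R3) :
    fderiv ℝ (extend a) y u = -((u ⬝ᵥ a) • y) - (y ⬝ᵥ a) • u := by
  have h0 : HasDerivAt (fun s : ℝ => y + s • u) u 0 := by
    simpa using ((hasDerivAt_id (0 : ℝ)).smul_const u).const_add y
  have hd : HasFDerivAt (extend a) (fderiv ℝ (extend a) y) ((fun s : ℝ => y + s • u) 0) := by
    simpa using ((contDiff_extend a).differentiable (by simp) y).hasFDerivAt
  have h1 := hasDerivAt_comp_curve hd h0
  have h2 : HasDerivAt (fun s : ℝ => a - ((y + s • u) ⬝ᵥ a) • (y + s • u)) _ 0 :=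
    ((hasDerivAt_dot h0 (hasDerivAt_const 0 a)).fun_smul h0).const_sub a
  rw [h1.unique h2]
  simp
  abel

theorem lieBracket_extend {x a b : R3} (ha : x ⬝ᵥ a = 0) (hb : x ⬝ᵥ b = 0) :
    VectorField.lieBracket ℝ (extend a) (extend b) x = 0 := by
  rw [VectorField.lieBracket, extend_eq ha, extend_eq hb, fderiv_extend, fderiv_extend, ha, hb,
    dotProduct_comm]
  simp

theorem covDeriv_zero (x v : R3) : g.covDeriv x v 0 0 = 0 := by
  simpa using g.covDeriv_smul x v 0 0 0

theorem contDiffAt_nabla {A B : R3 → R3} {x : R3} (hx : 0 < g.areaSq x) (hA : ContDiffAt ℝ ∞ A x)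
    (hB : ContDiffAt ℝ ∞ B x) : ContDiffAt ℝ ∞ (g.nabla A B) x :=
  g.contDiffAt_covDeriv contDiffAt_id hx hB hA
    ((hB.fderiv_right (m := ∞) (by simp)).clm_apply hA)

theorem nabla_tangent (A B : R3 → R3) (x : R3) : x ⬝ᵥ g.nabla A B x = 0 := g.covDeriv_tangent _ _ _ _

/-- Differentiation of a vector field along a curve on the sphere. -/
theorem hasDerivAt_field {B : R3 → R3} {c : ℝ → R3} {x a : R3} (hB : ContDiffAt ℝ ∞ B x)
    (hc : HasDerivAt c a 0) (h0 : c 0 = x) :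
    HasDerivAt (fun s => B (c s)) (fderiv ℝ B x a) 0 := by
  subst h0
  exact hasDerivAt_comp_curve (hB.differentiableAt (by simp)).hasFDerivAt hc

/-- The curvature operator is skew: both orders of the second derivatives of `g(b, b)` agree. -/
theorem form_curvature_self {x a a' b : R3} (hx : x ⬝ᵥ x = 1) (ha : x ⬝ᵥ a = 0)
    (ha' : x ⬝ᵥ a' = 0) (hb : x ⬝ᵥ b = 0) :
    g.form x b (g.curvature (extend a) (extend a') (extend b) x) = 0 := by
  set C := extend b
  set n : R3 → ℝ := fun y => g.form y (C y) (C y) with hn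
  have hC : ∀ y, ContDiffAt ℝ ∞ C y := fun y => (contDiff_extend b).contDiffAt
  have hsm : ∀ y, ContDiffAt ℝ ∞ n y := fun y => g.contDiffAt_form contDiffAt_id (hC y) (hC y)
  have hxp := g.areaSq_pos hx
  have hCx : C x = b := extend_eq hb
  have first : ∀ (d y : R3), y ⬝ᵥ y = 1 →
      fderiv ℝ n y (extend d y) = 2 * g.form y (C y) (g.nabla (extend d) C y) := by
    intro d y hy
    obtain ⟨c, hc0, hc1, hcd⟩ := exists_sphere_curve hy (extend_tangent d hy)
    have hd : HasFDerivAt n (fderiv ℝ n y) (c 0) := by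
      rw [hc0]; exact ((hsm y).differentiableAt (by simp)).hasFDerivAt
    have h1 := hasDerivAt_comp_curve hd hcd
    have hCc := hasDerivAt_field (hC y) hcd hc0
    have hCt : c 0 ⬝ᵥ C (c 0) = 0 := extend_tangent b (hc1 0)
    have h2 := g.hasDerivAt_form_covDeriv hcd hCc hCc (g.areaSq_pos (hc1 0)) hCt hCt
    rw [h1.unique h2, hc0, g.symm y (g.covDeriv _ _ _ _), nabla]
    ring
  have second : ∀ d d' : R3, x ⬝ᵥ d = 0 →
      fderiv ℝ (fun y => fderiv ℝ n y (extend d' y)) x (extend d x) =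
        2 * (g.form x (g.nabla (extend d) C x) (g.nabla (extend d') C x)
          + g.form x b (g.nabla (extend d) (g.nabla (extend d') C) x)) := by
    intro d d' hd
    obtain ⟨c, hc0, hc1, hcd⟩ := exists_sphere_curve hx (extend_tangent d hx)
    have hsm2 : ContDiffAt ℝ ∞ (fun y => fderiv ℝ n y (extend d' y)) x :=
      ((hsm x).fderiv_right (m := ∞) (by simp)).clm_apply (contDiff_extend d').contDiffAt
    have hd : HasFDerivAt (fun y => fderiv ℝ n y (extend d' y))
        (fderiv ℝ (fun y => fderiv ℝ n y (extend d' y)) x) (c 0) := by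
      rw [hc0]; exact (hsm2.differentiableAt (by simp)).hasFDerivAt
    have h1 := hasDerivAt_comp_curve hd hcd
    have hN : ContDiffAt ℝ ∞ (g.nabla (extend d') C) x :=
      g.contDiffAt_nabla hxp (contDiff_extend d').contDiffAt (hC x)
    have hCc := hasDerivAt_field (hC x) hcd hc0
    have hNc := hasDerivAt_field hN hcd hc0
    have h2 := (g.hasDerivAt_form_covDeriv hcd hCc hNc (g.areaSq_pos (hc1 0))
      (extend_tangent b (hc1 0)) (g.nabla_tangent _ _ _)).const_mul 2
    have h3 := h1.unique (h2.congr_of_eventuallyEq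
      (Filter.Eventually.of_forall fun s => first d' (c s) (hc1 s)))
    rw [h3, hc0, hCx]
    simp only [nabla, hCx]
  have key := dOne_fderiv (f := n) (z := x) ((hsm x).of_le two_le_infty)
    (extend a x) (extend a' x)
  rw [dOne_vectorFields (((hsm x).fderiv_right (m := ∞) (by simp)).differentiableAt (by simp))
    ((contDiff_extend a).differentiable (by simp) x)
    ((contDiff_extend a').differentiable (by simp) x), second a a' ha, second a' a ha',
    lieBracket_extend ha ha', map_zero, g.symm x (g.nabla (extend a') C x)] at key
  have e : g.curvature (extend a) (extend a') C x = g.nabla (extend a) (g.nabla (extend a') C) x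
      - g.nabla (extend a') (g.nabla (extend a) C) x := by
    have e0 : g.nabla (VectorField.lieBracket ℝ (extend a) (extend a')) C x = 0 := by
      rw [nabla, lieBracket_extend ha ha', map_zero, covDeriv_zero]
    rw [curvature, e0, sub_zero]
  rw [e, map_sub]
  linarith

/-- The pull-back of the connection form by the vector field `extend b`, viewed as a section of
the tangent bundle. -/
def sectionForm (b y : R3) : R3 →L[ℝ] ℝ :=
  (g.connectionForm (y, extend b y)).comp (fderiv ℝ (fun y => (y, extend b y)) y)

theorem sectionForm_apply (b y u : R3) : g.sectionForm b y u =
    g.form y (g.rot y (extend b y)) (g.covDeriv y (extend b y) u (fderiv ℝ (extend b) y u))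
      / g.form y (extend b y) (extend b y) := by
  have h : fderiv ℝ (fun y => (y, extend b y)) y
      = (ContinuousLinearMap.id ℝ R3).prod (fderiv ℝ (extend b) y) :=
    ((hasFDerivAt_id y).prodMk
      ((contDiff_extend b).differentiable (by simp) y).hasFDerivAt).fderiv
  rw [sectionForm, h, ContinuousLinearMap.comp_apply, connectionForm_apply]
  rfl

theorem contDiffAt_sectionForm_of_ne {b y : R3} (hy : 0 < g.areaSq y)
    (h0 : g.form y (extend b y) (extend b y) ≠ 0) : ContDiffAt ℝ ∞ (g.sectionForm b) y := by
  have hs : ContDiff ℝ ∞ (fun y => (y, extend b y)) := contDiff_id.prodMk (contDiff_extend b)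
  exact ((g.contDiffAt_connectionForm (z := (y, extend b y)) hy h0).comp y
    hs.contDiffAt).clm_comp (hs.fderiv_right (m := ∞) (by simp)).contDiffAt

theorem contDiffAt_sectionForm {b y : R3} (hy : y ⬝ᵥ y = 1) (h0 : extend b y ≠ 0) :
    ContDiffAt ℝ ∞ (g.sectionForm b) y :=
  g.contDiffAt_sectionForm_of_ne (g.areaSq_pos hy) (g.pos _ _ hy (extend_tangent b hy) h0).ne'

/-- The area form in the frame `(b, ȷb)`, up to the factor `g(b, b)`. -/
theorem form_rot_eq_frame {x b u : R3} (hx : x ⬝ᵥ x = 1) (hb : x ⬝ᵥ b = 0) (hu : x ⬝ᵥ u = 0)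
    (w : R3) : g.form x b b * g.form x (g.rot x u) w =
      g.form x b u * g.form x (g.rot x b) w - g.form x (g.rot x b) u * g.form x b w := by
  have h := g.frame_expand hx hb hu
  have h2 := congrArg (fun y => g.form x (g.rot x y) w) h
  simp only [rot_smul, rot_add, g.rot_rot hx hb, map_smul, map_add, add_apply, smul_apply,
    smul_eq_mul, map_neg, neg_apply, smul_neg] at h2
  rw [h2]; ring

/-- The connection form of a field of directions has the curvature as its differential. -/
theorem dOne_sectionForm {x a a' b : R3} (hx : x ⬝ᵥ x = 1) (ha : x ⬝ᵥ a = 0)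
    (ha' : x ⬝ᵥ a' = 0) (hb : x ⬝ᵥ b = 0) (hb0 : b ≠ 0) :
    dOne (g.sectionForm b) x a a' =
      g.form x (g.rot x b) (g.curvature (extend a) (extend a') (extend b) x) / g.form x b b := by
  set C := extend b with hCdef
  have hC : ∀ y, ContDiffAt ℝ ∞ C y := fun y => (contDiff_extend b).contDiffAt
  have hxp := g.areaSq_pos hx
  have hCx : C x = b := extend_eq hb
  have hn := (g.pos x b hx hb hb0).ne'
  have hsm : ContDiffAt ℝ ∞ (g.sectionForm b) x :=
    g.contDiffAt_sectionForm hx (by rw [← hCdef, hCx]; exact hb0)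
  have second : ∀ d d' : R3, x ⬝ᵥ d = 0 →
      fderiv ℝ (fun y => g.sectionForm b y (extend d' y)) x (extend d x) =
        ((g.form x (g.rot x (g.nabla (extend d) C x)) (g.nabla (extend d') C x)
          + g.form x (g.rot x b) (g.nabla (extend d) (g.nabla (extend d') C) x)) * g.form x b b
          - g.form x (g.rot x b) (g.nabla (extend d') C x) *
            (2 * g.form x b (g.nabla (extend d) C x))) / g.form x b b ^ 2 := by
    intro d d' hd
    obtain ⟨c, hc0, hc1, hcd⟩ := exists_sphere_curve hx (extend_tangent d hx)
    have hsm2 : ContDiffAt ℝ ∞ (fun y => g.sectionForm b y (extend d' y)) x :=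
      hsm.clm_apply (contDiff_extend d').contDiffAt
    have hd : HasFDerivAt (fun y => g.sectionForm b y (extend d' y))
        (fderiv ℝ (fun y => g.sectionForm b y (extend d' y)) x) (c 0) := by
      rw [hc0]; exact (hsm2.differentiableAt (by simp)).hasFDerivAt
    have h1 := hasDerivAt_comp_curve hd hcd
    have hN : ContDiffAt ℝ ∞ (g.nabla (extend d') C) x :=
      g.contDiffAt_nabla hxp (contDiff_extend d').contDiffAt (hC x)
    have hCc := hasDerivAt_field (hC x) hcd hc0
    have hNc := hasDerivAt_field hN hcd hc0
    have hC0 : C (c 0) ≠ 0 := by rw [hc0, hCx]; exact hb0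
    obtain ⟨J, hJ, hJ2⟩ := g.exists_hasDerivAt_rot hcd hCc (Filter.Eventually.of_forall hc1)
      (Filter.Eventually.of_forall fun s => extend_tangent b (hc1 s)) hC0
    have h2 := g.hasDerivAt_form_covDeriv hcd hJ hNc (g.areaSq_pos (hc1 0))
      (g.rot_tangent _ _) (g.nabla_tangent _ _ _)
    have h3 := g.hasDerivAt_form_covDeriv hcd hCc hCc (g.areaSq_pos (hc1 0))
      (extend_tangent b (hc1 0)) (extend_tangent b (hc1 0))
    have h4 := h2.fun_div h3 (by rw [hc0, hCx]; exact hn)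
    have h5 := h1.unique (h4.congr_of_eventuallyEq
      (Filter.Eventually.of_forall fun s => g.sectionForm_apply b (c s) (extend d' (c s))))
    rw [h5, hJ2, hc0, hCx, g.symm x (g.covDeriv x b _ _) b]
    simp only [nabla, hCx]
    rw [two_mul]
  have key := dOne_vectorFields (α := g.sectionForm b) (z := x) (A := extend a) (B := extend a')
    (hsm.differentiableAt (by simp)) ((contDiff_extend a).differentiable (by simp) x)
    ((contDiff_extend a').differentiable (by simp) x)
  rw [second a a' ha, second a' a ha', lieBracket_extend ha ha', map_zero, extend_eq ha,
    extend_eq ha'] at key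
  have e : g.curvature (extend a) (extend a') C x = g.nabla (extend a) (g.nabla (extend a') C) x
      - g.nabla (extend a') (g.nabla (extend a) C) x := by
    have e0 : g.nabla (VectorField.lieBracket ℝ (extend a) (extend a')) C x = 0 := by
      rw [nabla, lieBracket_extend ha ha', map_zero, covDeriv_zero]
    rw [curvature, e0, sub_zero]
  have t1 := g.nabla_tangent (extend a) C x
  have t2 := g.nabla_tangent (extend a') C x
  have f1 := g.form_rot_eq_frame hx hb t1 (g.nabla (extend a') C x)
  have f2 := g.form_rot_swap hx t2 t1
  rw [key, e, map_sub, f2]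
  field_simp
  linear_combination 2 * f1

theorem dOne_sectionForm_eq_zero {x a a' : R3} (b : R3) (hx : x ⬝ᵥ x = 1) (ha : x ⬝ᵥ a = 0)
    (ha' : x ⬝ᵥ a' = 0) (h : x ⬝ᵥ (a ⨯₃ a') = 0) : dOne (g.sectionForm b) x a a' = 0 := by
  by_cases h0 : a = 0
  · have := dOne_smul_left (g.sectionForm b) x 0 a' 0
    rw [h0]; simpa using this
  · have e := g.frame_expand hx ha ha'
    rw [g.form_rot hx ha ha', h, mul_zero, zero_smul, add_zero] at e
    have hp := (g.pos x a hx ha h0).ne'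
    have : g.form x a a * dOne (g.sectionForm b) x a a' = 0 := by
      rw [← dOne_smul_right, e, dOne_smul_right, dOne_self, mul_zero]
    exact (mul_eq_zero.1 this).resolve_left hp

/-- The definition of `curvatureForm` at `a, b` uses the curvature of the field `extend b`, so the
second argument here is the vector `b` of the section. -/
theorem dOne_sectionForm_eq_curvatureForm {x a b : R3} (hx : x ⬝ᵥ x = 1) (ha : x ⬝ᵥ a = 0)
    (hb : x ⬝ᵥ b = 0) (h : x ⬝ᵥ (a ⨯₃ b) ≠ 0) :
    dOne (g.sectionForm b) x a b = - g.curvatureForm x a b := by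
  have hb0 : b ≠ 0 := by rintro rfl; simp at h
  rw [g.dOne_sectionForm hx ha hb hb hb0, curvatureForm, gaussCurvature]
  set R := g.curvature (extend a) (extend b) (extend b) x with hR
  have hRt : x ⬝ᵥ R = 0 := by
    rw [hR, curvature]
    simp [dotProduct_sub, nabla_tangent]
  have h0 : g.form x b R = 0 := g.form_curvature_self hx ha hb hb
  have e := congrArg (fun y => g.form x y a) (g.frame_expand hx hb hRt)
  simp only [h0, zero_smul, zero_add, map_smul, smul_apply, smul_eq_mul] at e
  have hgram := g.gram_eq hx ha hb
  have hba : g.form x (g.rot x b) a = - (g.areaDensity x * (x ⬝ᵥ (a ⨯₃ b))) := by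
    rw [g.form_rot hx hb ha, triple_swap]; ring
  have hn := (g.pos x b hx hb hb0).ne'
  have hρ := (g.areaDensity_pos hx).ne'
  rw [hgram, areaForm, ← g.areaDensity_sq (g.areaSq_pos hx)]
  rw [hba] at e
  field_simp
  linear_combination e

end SphereMetric

/-- The angular 1-form `(F dH - H dF) / (F² + H²)` is closed. -/
theorem dOne_angle {E : Type*} [NormedAddCommGroup E] [NormedSpace ℝ E] {F H : E → ℝ} {z : E}
    (hF : ContDiffAt ℝ 2 F z) (hH : ContDiffAt ℝ 2 H z) (h0 : F z ^ 2 + H z ^ 2 ≠ 0) (ξ ζ : E) :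
    dOne (fun y => (F y ^ 2 + H y ^ 2)⁻¹ • (F y • fderiv ℝ H y - H y • fderiv ℝ F y)) z ξ ζ
      = 0 := by
  have dF : DifferentiableAt ℝ F z := hF.differentiableAt (by norm_num)
  have dH : DifferentiableAt ℝ H z := hH.differentiableAt (by norm_num)
  have dF' : DifferentiableAt ℝ (fun y => fderiv ℝ F y) z :=
    (hF.fderiv_right (m := 1) (by norm_num)).differentiableAt (by norm_num)
  have dH' : DifferentiableAt ℝ (fun y => fderiv ℝ H y) z :=
    (hH.fderiv_right (m := 1) (by norm_num)).differentiableAt (by norm_num)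
  have d1 : DifferentiableAt ℝ (fun y => F y • fderiv ℝ H y) z := dF.fun_smul dH'
  have d2 : DifferentiableAt ℝ (fun y => H y • fderiv ℝ F y) z := dH.fun_smul dF'
  have d3 : HasFDerivAt (fun y => F y ^ 2 + H y ^ 2)
      ((2 * F z) • fderiv ℝ F z + (2 * H z) • fderiv ℝ H z) z := by
    have h := (dF.hasFDerivAt.mul dF.hasFDerivAt).fun_add (dH.hasFDerivAt.mul dH.hasFDerivAt)
    refine HasFDerivAt.congr_fderiv (h.congr_of_eventuallyEq
      (Filter.Eventually.of_forall fun y => by simp [sq])) ?_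
    ext η
    simp only [add_apply, smul_apply, smul_eq_mul]
    ring
  have d4 : HasFDerivAt (fun y => (F y ^ 2 + H y ^ 2)⁻¹)
      (-((F z ^ 2 + H z ^ 2) ^ 2)⁻¹ • ((2 * F z) • fderiv ℝ F z + (2 * H z) • fderiv ℝ H z)) z :=
    (hasDerivAt_inv h0).comp_hasFDerivAt z d3
  rw [dOne_smul d4.differentiableAt (d1.fun_sub d2), dOne_sub d1 d2, dOne_smul dF dH',
    dOne_smul dH dF', dOne_fderiv hF, dOne_fderiv hH, d4.fderiv]
  simp only [smul_apply, add_apply, sub_apply, smul_eq_mul]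
  field_simp
  ring

namespace SphereMetric

variable (g : SphereMetric)

/-- The covariant derivative of `F B + H ȷB` for functions `F, H` along a curve. -/
theorem covDeriv_combination {x a b b' j j' : R3} (F H F' H' : ℝ) (hx : x ⬝ᵥ x = 1)
    (hb : x ⬝ᵥ b = 0) (hj : x ⬝ᵥ j = 0) :
    g.covDeriv x (F • b + H • j) a (F' • b + F • b' + (H' • j + H • j')) =
      F' • b + F • g.covDeriv x b a b' + (H' • j + H • g.covDeriv x j a j') := by
  have hs : ∀ (c c' : ℝ) (u u' : R3), x ⬝ᵥ u = 0 →
      g.covDeriv x a (c • u) (c' • u + c • u') = c' • u + c • g.covDeriv x u a u' := by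
    intro c c' u u' hu
    have e : g.covDeriv x a (c • u) (c' • u + c • u')
        = g.covDeriv x a (c • u) (c • u') + g.covDeriv x a 0 (c' • u) := by
      rw [← covDeriv_add, add_zero, add_comm (c • u')]
    rw [e, covDeriv_smul, g.covDeriv_vertical hx (by simp [dotProduct_smul, hu]),
      g.covDeriv_symm x u a u', add_comm]
  rw [covDeriv_symm, covDeriv_add, hs _ _ _ _ hb, hs _ _ _ _ hj]

/-- In a frame `(B, ȷB)` with `B = extend b`, the connection form is the sum of the pull-back of
`sectionForm b` and of the differential of the angle of the coordinates. -/
theorem connectionForm_eq_sectionForm_add {b : R3} {z ξ : R3 × R3} (hx : z.1 ⬝ᵥ z.1 = 1)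
    (hv : z.1 ⬝ᵥ z.2 = 0) (hv0 : z.2 ≠ 0) (hb0 : extend b z.1 ≠ 0) (hξ : IsBundleTangent z ξ)
    {F H : R3 × R3 → ℝ}
    (hF : F = fun z => g.form z.1 (extend b z.1) z.2 / g.form z.1 (extend b z.1) (extend b z.1))
    (hH : H = fun z => g.form z.1 (g.rot z.1 (extend b z.1)) z.2 /
      g.form z.1 (extend b z.1) (extend b z.1))
    (dF : DifferentiableAt ℝ F z) (dH : DifferentiableAt ℝ H z) :
    F z ^ 2 + H z ^ 2 ≠ 0 ∧
    g.connectionForm z ξ = g.sectionForm b z.1 ξ.1 +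
      (F z ^ 2 + H z ^ 2)⁻¹ * (F z * fderiv ℝ H z ξ - H z * fderiv ℝ F z ξ) := by
  obtain ⟨c, hc0, hc1, hc2, hcd⟩ := exists_bundle_curve hx hv hξ
  have hdF : HasDerivAt (fun s => F (c s)) (fderiv ℝ F z ξ) 0 :=
    hasDerivAt_comp_curve (by rw [hc0]; exact dF.hasFDerivAt) hcd
  have hdH : HasDerivAt (fun s => H (c s)) (fderiv ℝ H z ξ) 0 :=
    hasDerivAt_comp_curve (by rw [hc0]; exact dH.hasFDerivAt) hcd
  have hx1 : HasDerivAt (fun s => (c s).1) ξ.1 0 := hcd.fst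
  have hBt : z.1 ⬝ᵥ extend b z.1 = 0 := extend_tangent b hx
  have hB : HasDerivAt (fun s => extend b (c s).1) (fderiv ℝ (extend b) z.1 ξ.1) 0 :=
    hasDerivAt_field (contDiff_extend b).contDiffAt hx1 (by rw [hc0])
  obtain ⟨J, hJ, hJ2⟩ := g.exists_hasDerivAt_rot hx1 hB (Filter.Eventually.of_forall hc1)
    (Filter.Eventually.of_forall fun s => extend_tangent b (hc1 s)) (by rw [hc0]; exact hb0)
  have expand : ∀ y : R3 × R3, y.1 ⬝ᵥ y.1 = 1 → y.1 ⬝ᵥ y.2 = 0 → extend b y.1 ≠ 0 →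
      y.2 = F y • extend b y.1 + H y • g.rot y.1 (extend b y.1) := by
    intro y h1 h2 h3
    have hn := (g.pos y.1 _ h1 (extend_tangent b h1) h3).ne'
    apply smul_right_injective _ hn
    simp only [hF, hH]
    rw [g.frame_expand h1 (extend_tangent b h1) h2, smul_add, smul_smul, smul_smul,
      mul_div_cancel₀ _ hn, mul_div_cancel₀ _ hn]
  have hne : ∀ᶠ s in 𝓝 (0 : ℝ), extend b (c s).1 ≠ 0 :=
    hB.continuousAt.eventually_ne (by rw [hc0]; exact hb0)
  have hv' : HasDerivAt (fun s => (c s).2) (fderiv ℝ F z ξ • extend b z.1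
      + F z • fderiv ℝ (extend b) z.1 ξ.1 + (fderiv ℝ H z ξ • g.rot z.1 (extend b z.1)
      + H z • J)) 0 := by
    have h := ((hdF.fun_smul hB).fun_add (hdH.fun_smul hJ)).congr_of_eventuallyEq
      (hne.mono fun s hs => expand (c s) (hc1 s) (hc2 s) hs)
    refine h.congr_deriv ?_
    rw [hc0]; abel
  have hx2 : HasDerivAt (fun s => (c s).2) ξ.2 0 := hcd.snd
  have hξ2 := hx2.unique hv'
  have hz := expand z hx hv hb0
  set B := extend b z.1
  set j := g.rot z.1 B with hj
  have hjt : z.1 ⬝ᵥ j = 0 := g.rot_tangent _ _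
  have hn := (g.pos z.1 _ hx hBt hb0)
  have hjB : g.form z.1 j B = 0 := g.form_rot_self hx hBt
  have hjj : g.form z.1 j j = g.form z.1 B B := g.form_rot_rot hx hBt hBt
  have hBj : g.form z.1 B j = 0 := by rw [g.symm]; exact hjB
  have hvv : g.form z.1 z.2 z.2 = (F z ^ 2 + H z ^ 2) * g.form z.1 B B := by
    conv_lhs => rw [hz]
    simp only [map_add, map_smul, add_apply, smul_apply, smul_eq_mul, hjB, hjj, hBj]
    ring
  have hvpos := g.pos z.1 _ hx hv hv0
  have hFH : F z ^ 2 + H z ^ 2 ≠ 0 := by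
    intro h; rw [h, zero_mul] at hvv; exact hvpos.ne' hvv
  refine ⟨hFH, ?_⟩
  have hrot : g.rot z.1 z.2 = F z • j + H z • -B := by
    conv_lhs => rw [hz]
    rw [rot_add, rot_smul, rot_smul, hj, g.rot_rot hx hBt]
  have hcov : g.covDeriv z.1 z.2 ξ.1 ξ.2 = fderiv ℝ F z ξ • B
      + F z • g.covDeriv z.1 B ξ.1 (fderiv ℝ (extend b) z.1 ξ.1)
      + (fderiv ℝ H z ξ • j + H z • g.rot z.1
        (g.covDeriv z.1 B ξ.1 (fderiv ℝ (extend b) z.1 ξ.1))) := by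
    rw [hc0] at hJ2
    rw [← hJ2, ← g.covDeriv_combination _ _ _ _ hx hBt hjt, ← hz, ← hξ2]
  set T := g.covDeriv z.1 B ξ.1 (fderiv ℝ (extend b) z.1 ξ.1) with hT
  have hTt : z.1 ⬝ᵥ T = 0 := g.covDeriv_tangent _ _ _ _
  have hjT : g.form z.1 j (g.rot z.1 T) = g.form z.1 B T := g.form_rot_rot hx hBt hTt
  have hBT : g.form z.1 B (g.rot z.1 T) = - g.form z.1 j T := by
    rw [g.symm, g.form_rot_swap hx hTt hBt]
  have hsec : g.sectionForm b z.1 ξ.1 = g.form z.1 j T / g.form z.1 B B := by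
    rw [sectionForm_apply]
  rw [connectionForm_apply, hsec, hvv, hrot, hcov]
  simp only [map_add, map_smul, add_apply, smul_apply, smul_eq_mul, map_neg, neg_apply, hjB, hjj,
    hBj, hjT, hBT]
  have hn' := hn.ne'
  field_simp
  ring

/-- The structure equation `d(τ/2E) = -π^*σ_g` on `T S²` off the zero section. -/
theorem dOne_connectionForm {z ξ ζ : R3 × R3} (hx : z.1 ⬝ᵥ z.1 = 1) (hv : z.1 ⬝ᵥ z.2 = 0)
    (hv0 : z.2 ≠ 0) (hξ : IsBundleTangent z ξ) (hζ : IsBundleTangent z ζ) :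
    dOne g.connectionForm z ξ ζ = - g.curvatureForm z.1 ξ.1 ζ.1 := by
  have key : ∀ b : R3, z.1 ⬝ᵥ b = 0 → b ≠ 0 →
      dOne g.connectionForm z ξ ζ = dOne (g.sectionForm b) z.1 ξ.1 ζ.1 := by
    intro b hb hb0
    have hne : extend b z.1 ≠ 0 := by rwa [extend_eq hb]
    let F : R3 × R3 → ℝ := fun z =>
      g.form z.1 (extend b z.1) z.2 / g.form z.1 (extend b z.1) (extend b z.1)
    let H : R3 × R3 → ℝ := fun z =>
      g.form z.1 (g.rot z.1 (extend b z.1)) z.2 / g.form z.1 (extend b z.1) (extend b z.1)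
    have hBs : ∀ y : R3 × R3, ContDiffAt ℝ ∞ (fun z : R3 × R3 => extend b z.1) y := fun y =>
      ((contDiff_extend b).comp contDiff_fst).contDiffAt
    have hFs : ∀ y : R3 × R3, y.1 ⬝ᵥ y.1 = 1 → extend b y.1 ≠ 0 → ContDiffAt ℝ ∞ F y :=
      fun y h1 h2 => (g.contDiffAt_form contDiffAt_fst (hBs y) contDiffAt_snd).div
        (g.contDiffAt_form contDiffAt_fst (hBs y) (hBs y))
        (g.pos y.1 _ h1 (extend_tangent b h1) h2).ne'
    have hHs : ∀ y : R3 × R3, y.1 ⬝ᵥ y.1 = 1 → extend b y.1 ≠ 0 → ContDiffAt ℝ ∞ H y :=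
      fun y h1 h2 => (g.contDiffAt_form contDiffAt_fst
        (g.contDiffAt_rot contDiffAt_fst (g.areaSq_pos h1) (hBs y)) contDiffAt_snd).div
        (g.contDiffAt_form contDiffAt_fst (hBs y) (hBs y))
        (g.pos y.1 _ h1 (extend_tangent b h1) h2).ne'
    have pt : ∀ y : R3 × R3, y.1 ⬝ᵥ y.1 = 1 → y.1 ⬝ᵥ y.2 = 0 → y.2 ≠ 0 → extend b y.1 ≠ 0 →
        ∀ u, IsBundleTangent y u → F y ^ 2 + H y ^ 2 ≠ 0 ∧ g.connectionForm y u =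
          g.sectionForm b y.1 u.1 +
          (F y ^ 2 + H y ^ 2)⁻¹ * (F y * fderiv ℝ H y u - H y * fderiv ℝ F y u) :=
      fun y h1 h2 h3 h4 u hu => g.connectionForm_eq_sectionForm_add h1 h2 h3 h4 hu rfl rfl
        ((hFs y h1 h4).differentiableAt (by simp)) ((hHs y h1 h4).differentiableAt (by simp))
    have hFz := (hFs z hx hne).of_le two_le_infty
    have hHz := (hHs z hx hne).of_le two_le_infty
    have hFH := (pt z hx hv hv0 hne ξ hξ).1
    have d0 : DifferentiableAt ℝ g.connectionForm z :=
      (g.contDiffAt_connectionForm (g.areaSq_pos hx) (g.pos _ _ hx hv hv0).ne').differentiableAt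
        (by simp)
    have d1 : DifferentiableAt ℝ (g.sectionForm b) z.1 :=
      (g.contDiffAt_sectionForm hx hne).differentiableAt (by simp)
    have d2 : DifferentiableAt ℝ
        (fun y : R3 × R3 => (g.sectionForm b y.1).comp (ContinuousLinearMap.fst ℝ R3 R3)) z :=
      (d1.comp z differentiableAt_fst).clm_comp (differentiableAt_const _)
    have d3 : DifferentiableAt ℝ
        (fun y => (F y ^ 2 + H y ^ 2)⁻¹ • (F y • fderiv ℝ H y - H y • fderiv ℝ F y)) z := by
      have dF : DifferentiableAt ℝ F z := hFz.differentiableAt (by norm_num)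
      have dH : DifferentiableAt ℝ H z := hHz.differentiableAt (by norm_num)
      exact (((dF.fun_pow 2).fun_add (dH.fun_pow 2)).fun_inv hFH).fun_smul
        ((dF.fun_smul ((hHz.fderiv_right (m := 1) (by norm_num)).differentiableAt
          (by norm_num))).fun_sub (dH.fun_smul
          ((hFz.fderiv_right (m := 1) (by norm_num)).differentiableAt (by norm_num))))
    have hz1 : z.1 ≠ 0 := ne_zero_of_unit hx
    have hret := contDiffAt_bundleRetraction hz1
    rw [dOne_eq_of_retraction d0 (d2.fun_add d3) (hret.of_le two_le_infty)
      (bundleRetraction_eq_self hx hv) ?_ (fderiv_bundleRetraction_eq hx hv hξ)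
      (fderiv_bundleRetraction_eq hx hv hζ), dOne_add d2 d3, dOne_angle hFz hHz hFH, add_zero,
      dOne_comp_fst d1]
    have c0 : ∀ᶠ y : R3 × R3 in 𝓝 z, y.1 ≠ 0 := continuousAt_fst.eventually_ne hz1
    have c1 : ∀ᶠ y in 𝓝 z, (bundleRetraction y).2 ≠ 0 :=
      (continuousAt_snd.comp hret.continuousAt).eventually_ne
        (by simpa [bundleRetraction_eq_self hx hv] using hv0)
    have c2 : ∀ᶠ y in 𝓝 z, extend b (bundleRetraction y).1 ≠ 0 :=
      ((contDiff_extend b).continuous.continuousAt.comp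
        (continuousAt_fst.comp hret.continuousAt)).eventually_ne
        (by simpa [bundleRetraction_eq_self hx hv] using hne)
    filter_upwards [c0, c1, c2] with y h0 h1 h2 u
    rw [(pt _ (bundleRetraction_fst h0) (bundleRetraction_snd h0) h1 h2 _
      (isBundleTangent_fderiv_bundleRetraction h0 u)).2]
    simp
  by_cases h : z.1 ⬝ᵥ (ξ.1 ⨯₃ ζ.1) = 0
  · rw [key z.2 hv hv0, g.dOne_sectionForm_eq_zero _ hx hξ.1 hζ.1 h, curvatureForm, areaForm, h]
    simp
  · have hb0 : ζ.1 ≠ 0 := by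
      intro h0; rw [h0] at h; simp at h
    rw [key ζ.1 hζ.1 hb0, g.dOne_sectionForm_eq_curvatureForm hx hξ.1 hζ.1 h]

end SphereMetric

/-! ### Energy levels and their coframe -/

section Alternating

variable {E : Type*} [NormedAddCommGroup E] [NormedSpace ℝ E] (A : E [⋀^Fin 2]→L[ℝ] ℝ)

theorem alternating_swap (u w : E) : A ![u, w] = - A ![w, u] := by
  have := A.toAlternatingMap.map_swap ![w, u] (i := 0) (j := 1) (by decide)
  rw [ContinuousAlternatingMap.coe_toAlternatingMap] at this
  rw [← this]
  congr 1
  funext i; fin_cases i <;> simp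

theorem alternating_self (u : E) : A ![u, u] = 0 :=
  ContinuousAlternatingMap.map_eq_zero_of_eq _ _ (i := 0) (j := 1) rfl (by decide)

theorem alternating_add_right (u w w' : E) : A ![u, w + w'] = A ![u, w] + A ![u, w'] := by
  have h := A.map_update_add ![u, 0] 1 w w'
  have e : ∀ w : E, Function.update ![u, 0] (1 : Fin 2) w = ![u, w] := by
    intro w; funext i; fin_cases i <;> simp
  rwa [e, e, e] at h

theorem alternating_smul_right (u w : E) (c : ℝ) : A ![u, c • w] = c * A ![u, w] := by
  have h := A.map_update_smul ![u, 0] 1 c w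
  have e : ∀ w : E, Function.update ![u, 0] (1 : Fin 2) w = ![u, w] := by
    intro w; funext i; fin_cases i <;> simp
  rwa [e, e] at h

theorem alternating_add_left (u u' w : E) : A ![u + u', w] = A ![u, w] + A ![u', w] := by
  rw [alternating_swap, alternating_add_right, alternating_swap A u, alternating_swap A u']; ring

theorem alternating_smul_left (u w : E) (c : ℝ) : A ![c • u, w] = c * A ![u, w] := by
  rw [alternating_swap, alternating_smul_right, alternating_swap A u]; ring

/-- Every 2-form is a multiple of the Euclidean area on the tangent planes of the sphere. -/
theorem alternating_eq_triple (A : R3 [⋀^Fin 2]→L[ℝ] ℝ) {x u w : R3} (hx : x ⬝ᵥ x = 1)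
    (hu : x ⬝ᵥ u = 0) (hw : x ⬝ᵥ w = 0) :
    A ![u, w] = (x 0 * A ![Pi.single 1 1, Pi.single 2 1] + x 1 * A ![Pi.single 2 1, Pi.single 0 1]
      + x 2 * A ![Pi.single 0 1, Pi.single 1 1]) * (x ⬝ᵥ (u ⨯₃ w)) := by
  have h := cross_eq_triple_smul hx hu hw
  have h0 := congrFun h 0
  have h1 := congrFun h 1
  have h2 := congrFun h 2
  simp only [cross_zero, cross_one, cross_two, Pi.smul_apply, smul_eq_mul] at h0 h1 h2
  have e : A ![u, w] = (u 1 * w 2 - u 2 * w 1) * A ![Pi.single 1 1, Pi.single 2 1]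
      + (u 2 * w 0 - u 0 * w 2) * A ![Pi.single 2 1, Pi.single 0 1]
      + (u 0 * w 1 - u 1 * w 0) * A ![Pi.single 0 1, Pi.single 1 1] := by
    conv_lhs => rw [SphereMetric.sum_single u, SphereMetric.sum_single w]
    simp only [alternating_add_left, alternating_add_right, alternating_smul_left,
      alternating_smul_right, alternating_self]
    rw [alternating_swap _ (Pi.single 1 1) (Pi.single 0 1),
      alternating_swap _ (Pi.single 2 1) (Pi.single 1 1),
      alternating_swap _ (Pi.single 0 1) (Pi.single 2 1)]
    ring
  rw [e, h0, h1, h2]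
  ring

end Alternating

namespace SphereSymplecticForm

variable (σ : SphereSymplecticForm)

/-- The density of `σ` with respect to the Euclidean area of `S²`. -/
def density (x : R3) : ℝ :=
  x 0 * σ.form x ![Pi.single 1 1, Pi.single 2 1] + x 1 * σ.form x ![Pi.single 2 1, Pi.single 0 1]
    + x 2 * σ.form x ![Pi.single 0 1, Pi.single 1 1]

theorem contDiff_density : ContDiff ℝ ∞ σ.density := by
  have h : ∀ u : Fin 2 → R3, ContDiff ℝ ∞ (fun x => σ.form x u) := fun u =>
    (ContinuousAlternatingMap.apply ℝ R3 ℝ u).contDiff.comp σ.smooth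
  unfold density
  have := h ![Pi.single 1 1, Pi.single 2 1]
  have := h ![Pi.single 2 1, Pi.single 0 1]
  have := h ![Pi.single 0 1, Pi.single 1 1]
  fun_prop

theorem form_eq_density {x u w : R3} (hx : x ⬝ᵥ x = 1) (hu : x ⬝ᵥ u = 0) (hw : x ⬝ᵥ w = 0) :
    σ.form x ![u, w] = σ.density x * (x ⬝ᵥ (u ⨯₃ w)) :=
  alternating_eq_triple _ hx hu hw

theorem density_ne_zero {x : R3} (hx : x ⬝ᵥ x = 1) : σ.density x ≠ 0 := by
  intro h0
  obtain ⟨u, hu, hu0⟩ := exists_tangent x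
  obtain ⟨w, hw, h⟩ := σ.nondegenerate x u hx hu hu0
  rw [σ.form_eq_density hx hu hw, h0, zero_mul] at h
  exact h rfl

/-- The constant `[σ] / 4π`. -/
def mean : ℝ := σ.integral / (4 * Real.pi)

end SphereSymplecticForm

namespace SphereMetric

variable (g : SphereMetric)

theorem mem_energyLevel {m : ℝ} {z : R3 × R3} : z ∈ g.energyLevel m ↔
    z.1 ⬝ᵥ z.1 = 1 ∧ z.1 ⬝ᵥ z.2 = 0 ∧ g.form z.1 z.2 z.2 = m ^ 2 := by
  simp only [energyLevel, Set.mem_ofPred_eq, levelMap, Prod.mk.injEq, energy]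
  constructor
  · rintro ⟨h1, h2, h3⟩; exact ⟨h1, h2, by linarith⟩
  · rintro ⟨h1, h2, h3⟩; exact ⟨h1, h2, by rw [h3]⟩

theorem contDiff_levelMap : ContDiff ℝ ∞ g.levelMap := by
  have h := g.contDiff_energy
  unfold levelMap
  fun_prop

/-- The derivative of the defining functions of `Σ_m`. -/
theorem fderiv_levelMap {z : R3 × R3} (hx : 0 < g.areaSq z.1) (hv : z.1 ⬝ᵥ z.2 = 0)
    (ξ : R3 × R3) : fderiv ℝ g.levelMap z ξ =
      (2 * (z.1 ⬝ᵥ ξ.1), z.1 ⬝ᵥ ξ.2 + z.2 ⬝ᵥ ξ.1,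
        g.form z.1 (g.covDeriv z.1 z.2 ξ.1 ξ.2) z.2) := by
  have hl := hasDerivAt_line z ξ
  have hd : HasFDerivAt g.levelMap (fderiv ℝ g.levelMap z) (z + (0 : ℝ) • ξ) := by
    simpa using (g.contDiff_levelMap.differentiable (by simp) z).hasFDerivAt
  have h1 := hasDerivAt_comp_curve (c := fun s : ℝ => z + s • ξ) hd hl
  have l1 : HasDerivAt (fun s : ℝ => (z + s • ξ).1) ξ.1 0 := hl.fst
  have l2 : HasDerivAt (fun s : ℝ => (z + s • ξ).2) ξ.2 0 := hl.snd
  have h2 := (g.hasDerivAt_form_covDeriv l1 l2 l2 (by simpa using hx) (by simpa using hv)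
    (by simpa using hv)).div_const 2
  have h3 := (hasDerivAt_dot l1 l1).prodMk ((hasDerivAt_dot l1 l2).prodMk h2)
  rw [h1.unique h3]
  simp only [zero_smul, add_zero]
  rw [g.symm _ z.2, dotProduct_comm ξ.1 z.1, dotProduct_comm ξ.1 z.2]
  refine Prod.ext ?_ (Prod.ext ?_ ?_)
  · simp only; ring
  · simp only; ring
  · simp only; ring

theorem mem_levelTangent {z ξ : R3 × R3} (hx : 0 < g.areaSq z.1) (hv : z.1 ⬝ᵥ z.2 = 0) :
    ξ ∈ g.levelTangent z ↔
      IsBundleTangent z ξ ∧ g.form z.1 (g.covDeriv z.1 z.2 ξ.1 ξ.2) z.2 = 0 := by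
  rw [levelTangent, LinearMap.mem_ker, ContinuousLinearMap.coe_coe, g.fderiv_levelMap hx hv,
    IsBundleTangent]
  simp only [Prod.mk_eq_zero, mul_eq_zero, OfNat.ofNat_ne_zero, false_or]
  tauto

/-- The tangent vector of `T S²` at `z` with projection `a` to the base and with covariant
derivative `k`. -/
def bundleLift (z : R3 × R3) (a k : R3) : R3 × R3 :=
  (a, k - (z.2 ⬝ᵥ a) • z.1 - g.covDeriv z.1 z.2 a (-(z.2 ⬝ᵥ a) • z.1))

theorem covDeriv_bundleLift {z : R3 × R3} (hx : z.1 ⬝ᵥ z.1 = 1) {a k : R3} (hk : z.1 ⬝ᵥ k = 0) :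
    g.covDeriv z.1 z.2 (g.bundleLift z a k).1 (g.bundleLift z a k).2 = k := by
  set C := g.covDeriv z.1 z.2 a (-(z.2 ⬝ᵥ a) • z.1) with hC
  have e : g.bundleLift z a k = (a + 0, -(z.2 ⬝ᵥ a) • z.1 + (k - C)) := by
    rw [bundleLift, add_zero, ← hC]; congr 1; rw [neg_smul]; abel
  rw [e, covDeriv_add, ← hC, g.covDeriv_vertical hx]
  · abel
  · rw [dotProduct_sub, hk, hC, g.covDeriv_tangent, sub_zero]

theorem isBundleTangent_bundleLift {z : R3 × R3} (hx : z.1 ⬝ᵥ z.1 = 1) {a k : R3}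
    (ha : z.1 ⬝ᵥ a = 0) (hk : z.1 ⬝ᵥ k = 0) : IsBundleTangent z (g.bundleLift z a k) := by
  refine ⟨ha, ?_⟩
  simp only [bundleLift, dotProduct_sub, hk, dotProduct_smul, hx, g.covDeriv_tangent]
  simp

/-- A tangent vector of `T S²` is determined by its projection and its covariant component. -/
theorem eq_bundleLift {z ξ : R3 × R3} (hx : z.1 ⬝ᵥ z.1 = 1) (hξ : IsBundleTangent z ξ) :
    ξ = g.bundleLift z ξ.1 (g.covDeriv z.1 z.2 ξ.1 ξ.2) := by
  set C := g.covDeriv z.1 z.2 ξ.1 (-(z.2 ⬝ᵥ ξ.1) • z.1) with hC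
  have h2 : z.1 ⬝ᵥ (ξ.2 + (z.2 ⬝ᵥ ξ.1) • z.1) = 0 := by
    rw [dotProduct_add, dotProduct_smul, hx, smul_eq_mul, mul_one, hξ.2]
  have e : g.covDeriv z.1 z.2 ξ.1 ξ.2 = C + (ξ.2 + (z.2 ⬝ᵥ ξ.1) • z.1) := by
    conv_lhs => rw [show ξ.1 = ξ.1 + 0 by simp, show ξ.2 = -(z.2 ⬝ᵥ ξ.1) • z.1 +
      (ξ.2 + (z.2 ⬝ᵥ ξ.1) • z.1) by rw [neg_smul]; abel]
    rw [covDeriv_add, g.covDeriv_vertical hx h2]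
  refine Prod.ext rfl ?_
  simp only [bundleLift]
  rw [e, ← hC]; abel

/-- The component `p` of `dπ ξ = p v + q ȷv`. -/
def radialForm (z : R3 × R3) : R3 × R3 →L[ℝ] ℝ :=
  (g.form z.1 z.2 z.2)⁻¹ • g.liouvilleForm z

/-- The component `q` of `dπ ξ = p v + q ȷv`. -/
def transverseForm (z : R3 × R3) : R3 × R3 →L[ℝ] ℝ :=
  (g.form z.1 z.2 z.2)⁻¹ •
    (g.form z.1 (g.rot z.1 z.2)).comp (ContinuousLinearMap.fst ℝ R3 R3)

theorem radialForm_apply (z ξ : R3 × R3) :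
    g.radialForm z ξ = g.form z.1 z.2 ξ.1 / g.form z.1 z.2 z.2 := by
  rw [radialForm, smul_apply, smul_eq_mul, inv_mul_eq_div]; rfl

theorem transverseForm_apply (z ξ : R3 × R3) :
    g.transverseForm z ξ = g.form z.1 (g.rot z.1 z.2) ξ.1 / g.form z.1 z.2 z.2 := by
  rw [transverseForm, smul_apply, smul_eq_mul, inv_mul_eq_div]; rfl

section Coframe

variable {m : ℝ} (hm : 0 < m) {z : R3 × R3} (hz : z ∈ g.energyLevel m)
include hm hz

theorem form_pos_of_mem : 0 < g.form z.1 z.2 z.2 := by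
  rw [(g.mem_energyLevel.1 hz).2.2]; positivity

theorem ne_zero_of_mem : z.2 ≠ 0 := by
  intro h; have := g.form_pos_of_mem hm hz; rw [h] at this; simp at this

theorem fst_eq_coframe {ξ : R3 × R3} (hξ : z.1 ⬝ᵥ ξ.1 = 0) :
    ξ.1 = g.radialForm z ξ • z.2 + g.transverseForm z ξ • g.rot z.1 z.2 := by
  obtain ⟨hx, hv, -⟩ := g.mem_energyLevel.1 hz
  have hp := (g.form_pos_of_mem hm hz).ne'
  apply smul_right_injective _ hp
  simp only
  rw [g.frame_expand hx hv hξ, smul_add, smul_smul, smul_smul, radialForm_apply,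
    transverseForm_apply, mul_div_cancel₀ _ hp, mul_div_cancel₀ _ hp]

theorem covDeriv_eq_coframe {ξ : R3 × R3} (hξ : ξ ∈ g.levelTangent z) :
    g.covDeriv z.1 z.2 ξ.1 ξ.2 = g.connectionForm z ξ • g.rot z.1 z.2 := by
  obtain ⟨hx, hv, -⟩ := g.mem_energyLevel.1 hz
  have hp := (g.form_pos_of_mem hm hz).ne'
  have h := ((g.mem_levelTangent (g.areaSq_pos hx) hv).1 hξ).2
  apply smul_right_injective _ hp
  simp only
  rw [g.frame_expand hx hv (g.covDeriv_tangent _ _ _ _), g.symm _ z.2, h, smul_smul,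
    connectionForm_apply, mul_div_cancel₀ _ hp]
  simp

omit hm in
theorem mem_levelTangent_bundleLift (p q r : ℝ) :
    g.bundleLift z (p • z.2 + q • g.rot z.1 z.2) (r • g.rot z.1 z.2) ∈ g.levelTangent z := by
  obtain ⟨hx, hv, -⟩ := g.mem_energyLevel.1 hz
  have hj := g.rot_tangent z.1 z.2
  have ha : z.1 ⬝ᵥ (p • z.2 + q • g.rot z.1 z.2) = 0 := by
    simp [dotProduct_add, dotProduct_smul, hv, hj]
  have hk : z.1 ⬝ᵥ (r • g.rot z.1 z.2) = 0 := by simp [dotProduct_smul, hj]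
  rw [g.mem_levelTangent (g.areaSq_pos hx) hv, g.covDeriv_bundleLift hx hk]
  refine ⟨g.isBundleTangent_bundleLift hx ha hk, ?_⟩
  simp [g.form_rot_self hx hv]

/-- The vectors of the frame dual to the coframe `p, q, r` of `Σ_m`. -/
theorem coframe_bundleLift (p q r : ℝ) :
    let ξ := g.bundleLift z (p • z.2 + q • g.rot z.1 z.2) (r • g.rot z.1 z.2)
    g.radialForm z ξ = p ∧ g.transverseForm z ξ = q ∧ g.connectionForm z ξ = r := by
  obtain ⟨hx, hv, -⟩ := g.mem_energyLevel.1 hz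
  have hp := (g.form_pos_of_mem hm hz).ne'
  have hj := g.rot_tangent z.1 z.2
  have hk : z.1 ⬝ᵥ (r • g.rot z.1 z.2) = 0 := by simp [dotProduct_smul, hj]
  have h1 : g.form z.1 (g.rot z.1 z.2) z.2 = 0 := g.form_rot_self hx hv
  have h2 : g.form z.1 z.2 (g.rot z.1 z.2) = 0 := by rw [g.symm]; exact h1
  have h3 := g.form_rot_rot hx hv hv
  refine ⟨?_, ?_, ?_⟩
  · rw [radialForm_apply]
    simp only [bundleLift, map_add, map_smul, smul_eq_mul, h2]
    field_simp; ring
  · rw [transverseForm_apply]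
    simp only [bundleLift, map_add, map_smul, smul_eq_mul, h1, h3]
    field_simp; ring
  · rw [connectionForm_apply, g.covDeriv_bundleLift hx hk]
    simp only [map_smul, smul_eq_mul, h3]
    field_simp

theorem eq_bundleLift_coframe {ξ : R3 × R3} (hξ : ξ ∈ g.levelTangent z) :
    ξ = g.bundleLift z (g.radialForm z ξ • z.2 + g.transverseForm z ξ • g.rot z.1 z.2)
      (g.connectionForm z ξ • g.rot z.1 z.2) := by
  obtain ⟨hx, hv, -⟩ := g.mem_energyLevel.1 hz
  have hb := ((g.mem_levelTangent (g.areaSq_pos hx) hv).1 hξ).1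
  rw [← g.covDeriv_eq_coframe hm hz hξ, ← g.fst_eq_coframe hm hz hb.1]
  exact g.eq_bundleLift hx hb

/-- The forms `p, q, r` are a coframe of `Σ_m`. -/
theorem eq_of_coframe {ξ ζ : R3 × R3} (hξ : ξ ∈ g.levelTangent z) (hζ : ζ ∈ g.levelTangent z)
    (h1 : g.radialForm z ξ = g.radialForm z ζ) (h2 : g.transverseForm z ξ = g.transverseForm z ζ)
    (h3 : g.connectionForm z ξ = g.connectionForm z ζ) : ξ = ζ := by
  rw [g.eq_bundleLift_coframe hm hz hξ, g.eq_bundleLift_coframe hm hz hζ, h1, h2, h3]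

/-- `dλ = g(v,v) r ∧ q` on `Σ_m`. -/
theorem dOne_liouvilleForm_coframe {ξ ζ : R3 × R3} (hξ : ξ ∈ g.levelTangent z)
    (hζ : ζ ∈ g.levelTangent z) : dOne g.liouvilleForm z ξ ζ =
      m ^ 2 * (g.connectionForm z ξ * g.transverseForm z ζ
        - g.connectionForm z ζ * g.transverseForm z ξ) := by
  obtain ⟨hx, hv, hE⟩ := g.mem_energyLevel.1 hz
  have hp := (g.form_pos_of_mem hm hz).ne'
  have hxp := g.areaSq_pos hx
  rw [g.dOne_liouvilleForm hxp ((g.mem_levelTangent hxp hv).1 hξ).1.1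
    ((g.mem_levelTangent hxp hv).1 hζ).1.1, g.covDeriv_eq_coframe hm hz hξ,
    g.covDeriv_eq_coframe hm hz hζ, transverseForm_apply, transverseForm_apply, ← hE]
  simp only [map_smul, smul_apply, smul_eq_mul]
  field_simp

end Coframe

/-- The function `f` with `σ = f μ`. -/
def strength (σ : SphereSymplecticForm) (x : R3) : ℝ := σ.density x / g.areaDensity x

theorem contDiffAt_strength (σ : SphereSymplecticForm) {E : Type*} [NormedAddCommGroup E]
    [NormedSpace ℝ E] {x : E → R3} {z : E} (hx : ContDiffAt ℝ ∞ x z) (h : 0 < g.areaSq (x z)) :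
    ContDiffAt ℝ ∞ (fun y => g.strength σ (x y)) z :=
  ((σ.contDiff_density.contDiffAt.comp z hx)).div (g.contDiffAt_areaDensity hx h)
    (Real.sqrt_pos.2 h).ne'

/-- `σ = f g(v,v) p ∧ q` on `Σ_m`. -/
theorem form_coframe (σ : SphereSymplecticForm) {m : ℝ} (hm : 0 < m) {z : R3 × R3}
    (hz : z ∈ g.energyLevel m) {ξ ζ : R3 × R3} (hξ : z.1 ⬝ᵥ ξ.1 = 0) (hζ : z.1 ⬝ᵥ ζ.1 = 0) :
    σ.form z.1 ![ξ.1, ζ.1] = m ^ 2 * g.strength σ z.1 *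
      (g.radialForm z ξ * g.transverseForm z ζ - g.radialForm z ζ * g.transverseForm z ξ) := by
  obtain ⟨hx, hv, hE⟩ := g.mem_energyLevel.1 hz
  have hj := g.rot_tangent z.1 z.2
  have h := g.form_rot hx hv hj
  have hρ := (g.areaDensity_pos hx).ne'
  rw [g.form_rot_rot hx hv hv, hE] at h
  have h' : z.1 ⬝ᵥ (z.2 ⨯₃ g.rot z.1 z.2) = m ^ 2 / g.areaDensity z.1 := by
    rw [h]; field_simp
  rw [g.fst_eq_coframe hm hz hξ, g.fst_eq_coframe hm hz hζ]
  simp only [alternating_add_left, alternating_add_right, alternating_smul_left,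
    alternating_smul_right, alternating_self]
  rw [alternating_swap _ (g.rot z.1 z.2), σ.form_eq_density hx hv hj, h', strength]
  ring

end SphereMetric

/-! ### The contact form and its Reeb vector field -/

namespace SphereMetric

variable (g : SphereMetric) (σ : SphereSymplecticForm) (β : R3 → R3 →L[ℝ] ℝ)

theorem contactPrimitive_eq (z : R3 × R3) : g.contactPrimitive σ β z =
    g.liouvilleForm z + σ.mean • g.connectionForm z
      - (β z.1).comp (ContinuousLinearMap.fst ℝ R3 R3) := by
  rw [contactPrimitive, connectionForm, smul_smul, SphereSymplecticForm.mean, div_eq_mul_inv _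
    (2 * g.energy z)]

theorem contDiffAt_contactPrimitive (hβ : ContDiff ℝ ∞ β) {z : R3 × R3} (h : 0 < g.areaSq z.1)
    (h0 : g.form z.1 z.2 z.2 ≠ 0) : ContDiffAt ℝ ∞ (g.contactPrimitive σ β) z := by
  have e : g.contactPrimitive σ β = fun z => _ := funext (g.contactPrimitive_eq σ β)
  rw [e]
  have h1 : ContDiffAt ℝ ∞ (fun z => σ.mean • g.connectionForm z) z :=
    (g.contDiffAt_connectionForm h h0).const_smul σ.mean
  have h2 : ContDiff ℝ ∞ fun z : R3 × R3 => β z.1 := hβ.comp contDiff_fst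
  have h3 : ContDiff ℝ ∞
      (fun z : R3 × R3 => (β z.1).comp (ContinuousLinearMap.fst ℝ R3 R3)) :=
    h2.clm_comp contDiff_const
  exact (g.contDiff_liouvilleForm.contDiffAt.add h1).sub h3.contDiffAt

/-- `λ + c τ/2E - π^*β` is a primitive of `ω_σ` on `T S²` off the zero section. -/
theorem dOne_contactPrimitive (hβ : g.IsCurvaturePrimitive σ β) {z ξ ζ : R3 × R3}
    (hx : z.1 ⬝ᵥ z.1 = 1) (hv : z.1 ⬝ᵥ z.2 = 0) (hv0 : z.2 ≠ 0) (hξ : IsBundleTangent z ξ)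
    (hζ : IsBundleTangent z ζ) :
    dOne (g.contactPrimitive σ β) z ξ ζ = g.twistedForm σ z ξ ζ := by
  have e : g.contactPrimitive σ β = fun z => _ := funext (g.contactPrimitive_eq σ β)
  have d1 : DifferentiableAt ℝ g.liouvilleForm z :=
    g.contDiff_liouvilleForm.differentiable (by simp) z
  have d2 : DifferentiableAt ℝ g.connectionForm z :=
    (g.contDiffAt_connectionForm (g.areaSq_pos hx) (g.pos _ _ hx hv hv0).ne').differentiableAt
      (by simp)
  have d3 : DifferentiableAt ℝ β z.1 := hβ.1.differentiable (by simp) _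
  have d4 : DifferentiableAt ℝ
      (fun z : R3 × R3 => (β z.1).comp (ContinuousLinearMap.fst ℝ R3 R3)) z :=
    (d3.comp z differentiableAt_fst).clm_comp (differentiableAt_const _)
  rw [e, dOne_sub (d1.fun_add (d2.fun_const_smul σ.mean)) d4, dOne_add d1 (d2.fun_const_smul σ.mean),
    dOne_const_smul d2, dOne_comp_fst d3, g.dOne_connectionForm hx hv hv0 hξ hζ,
    hβ.2 _ _ _ hx hξ.1 hζ.1, twistedForm, SphereSymplecticForm.mean]
  ring

/-- The function `h = g(v,v) + c f - β(v)` by which the Reeb vector field differs from the magnetic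
vector field. -/
def reebScale (z : R3 × R3) : ℝ :=
  g.form z.1 z.2 z.2 + σ.mean * g.strength σ z.1 - β z.1 z.2

theorem contDiffAt_reebScale (hβ : ContDiff ℝ ∞ β) {z : R3 × R3} (h : 0 < g.areaSq z.1) :
    ContDiffAt ℝ ∞ (g.reebScale σ β) z :=
  ((g.contDiffAt_form contDiffAt_fst contDiffAt_snd contDiffAt_snd).add
    (contDiffAt_const.mul (g.contDiffAt_strength σ contDiffAt_fst h))).sub
    ((hβ.contDiffAt.comp z contDiffAt_fst).clm_apply contDiffAt_snd)

section Level

variable {m : ℝ} (hm : 0 < m) {z : R3 × R3} (hz : z ∈ g.energyLevel m)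
include hm hz

/-- The contact form is `(g(v,v) - β(v)) p - β(ȷv) q + c r`. -/
theorem contactPrimitive_coframe {ξ : R3 × R3} (hξ : z.1 ⬝ᵥ ξ.1 = 0) :
    g.contactPrimitive σ β z ξ = (m ^ 2 - β z.1 z.2) * g.radialForm z ξ
      - β z.1 (g.rot z.1 z.2) * g.transverseForm z ξ + σ.mean * g.connectionForm z ξ := by
  have hE := (g.mem_energyLevel.1 hz).2.2
  have hp := (g.form_pos_of_mem hm hz).ne'
  have h1 : g.liouvilleForm z ξ = m ^ 2 * g.radialForm z ξ := by
    rw [radialForm_apply, ← hE, mul_div_cancel₀ _ hp]; rfl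
  rw [contactPrimitive_eq, sub_apply, add_apply, smul_apply, h1]
  have h2 : β z.1 ξ.1 = g.radialForm z ξ * β z.1 z.2
      + g.transverseForm z ξ * β z.1 (g.rot z.1 z.2) := by
    conv_lhs => rw [g.fst_eq_coframe hm hz hξ]
    simp
  simp only [ContinuousLinearMap.comp_apply, ContinuousLinearMap.coe_fst', h2, smul_eq_mul]
  ring

/-- In the coframe, `dα = g(v,v) (r ∧ q - f p ∧ q)`. -/
theorem dOne_contactPrimitive_coframe (hβ : g.IsCurvaturePrimitive σ β) {ξ ζ : R3 × R3}
    (hξ : ξ ∈ g.levelTangent z) (hζ : ζ ∈ g.levelTangent z) :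
    dOne (g.contactPrimitive σ β) z ξ ζ =
      m ^ 2 * (g.connectionForm z ξ * g.transverseForm z ζ
          - g.connectionForm z ζ * g.transverseForm z ξ
        - g.strength σ z.1 * (g.radialForm z ξ * g.transverseForm z ζ
          - g.radialForm z ζ * g.transverseForm z ξ)) := by
  obtain ⟨hx, hv, hE⟩ := g.mem_energyLevel.1 hz
  have h1 := ((g.mem_levelTangent (g.areaSq_pos hx) hv).1 hξ).1
  have h2 := ((g.mem_levelTangent (g.areaSq_pos hx) hv).1 hζ).1
  rw [g.dOne_contactPrimitive σ β hβ hx hv (g.ne_zero_of_mem hm hz) h1 h2, twistedForm,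
    g.dOne_liouvilleForm_coframe hm hz hξ hζ, g.form_coframe σ hm hz h1.1 h2.1]
  ring

/-- In the coframe, `α ∧ dα = - g(v,v) h p ∧ q ∧ r`. -/
theorem contactVolume_ne_zero (hβ : g.IsCurvaturePrimitive σ β) (hh : g.reebScale σ β z ≠ 0)
    {ξ : Fin 3 → R3 × R3} (hξ : ∀ i, ξ i ∈ g.levelTangent z) (hli : LinearIndependent ℝ ξ) :
    let α := g.contactPrimitive σ β
    α z (ξ 0) * dOne α z (ξ 1) (ξ 2) + α z (ξ 1) * dOne α z (ξ 2) (ξ 0)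
      + α z (ξ 2) * dOne α z (ξ 0) (ξ 1) ≠ 0 := by
  intro α
  obtain ⟨hx, hv, hE⟩ := g.mem_energyLevel.1 hz
  have hb := fun i => ((g.mem_levelTangent (g.areaSq_pos hx) hv).1 (hξ i)).1.1
  let M : Matrix (Fin 3) (Fin 3) ℝ := Matrix.of fun i =>
    ![g.radialForm z (ξ i), g.transverseForm z (ξ i), g.connectionForm z (ξ i)]
  have hM : M.det ≠ 0 := by
    intro h0
    obtain ⟨t, ht, ht0⟩ := Matrix.exists_vecMul_eq_zero_iff.2 h0
    have hs : ∀ L : R3 × R3 →L[ℝ] ℝ, L (∑ i, t i • ξ i) = t 0 * L (ξ 0) + t 1 * L (ξ 1)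
        + t 2 * L (ξ 2) := by
      intro L; simp [Fin.sum_univ_three]
    have hc : ∀ j, t 0 * M 0 j + t 1 * M 1 j + t 2 * M 2 j = 0 := by
      intro j
      have := congrFun ht0 j
      simpa [Matrix.vecMul, dotProduct, Fin.sum_univ_three] using this
    have hz0 : ∑ i, t i • ξ i = 0 := by
      refine g.eq_of_coframe hm hz (Submodule.sum_mem _ fun i _ =>
        Submodule.smul_mem _ _ (hξ i)) (Submodule.zero_mem _) ?_ ?_ ?_
      · rw [hs, map_zero]; exact hc 0
      · rw [hs, map_zero]; exact hc 1
      · rw [hs, map_zero]; exact hc 2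
    exact ht (funext (Fintype.linearIndependent_iff.1 hli t hz0))
  have key : α z (ξ 0) * dOne α z (ξ 1) (ξ 2) + α z (ξ 1) * dOne α z (ξ 2) (ξ 0)
      + α z (ξ 2) * dOne α z (ξ 0) (ξ 1) = - (m ^ 2 * g.reebScale σ β z) * M.det := by
    rw [g.contactPrimitive_coframe σ β hm hz (hb 0), g.contactPrimitive_coframe σ β hm hz (hb 1),
      g.contactPrimitive_coframe σ β hm hz (hb 2),
      g.dOne_contactPrimitive_coframe σ β hm hz hβ (hξ 1) (hξ 2),
      g.dOne_contactPrimitive_coframe σ β hm hz hβ (hξ 2) (hξ 0),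
      g.dOne_contactPrimitive_coframe σ β hm hz hβ (hξ 0) (hξ 1), Matrix.det_fin_three, reebScale,
      hE]
    have hM' : ∀ i, M i 0 = g.radialForm z (ξ i) ∧ M i 1 = g.transverseForm z (ξ i) ∧
        M i 2 = g.connectionForm z (ξ i) := fun i => ⟨rfl, rfl, rfl⟩
    simp only [hM']
    ring
  rw [key]
  exact mul_ne_zero (neg_ne_zero.2 (mul_ne_zero (by positivity) hh)) hM

end Level

/-- The Reeb vector field `(v + f ȷv) / h`, the first summand being horizontal and the second one
vertical. -/
def reebField (z : R3 × R3) : R3 × R3 :=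
  g.bundleLift z ((g.reebScale σ β z)⁻¹ • z.2)
    ((g.strength σ z.1 / g.reebScale σ β z) • g.rot z.1 z.2)

/-- The Reeb vector spans the kernel of `r ∧ q - f p ∧ q`, which is the line `q = 0`, `r = f p`; the
value of `α` on it fixes the factor `1 / h`. -/
theorem isReebVector_iff (hβ : g.IsCurvaturePrimitive σ β) {m : ℝ} (hm : 0 < m) {z r : R3 × R3}
    (hz : z ∈ g.energyLevel m) (hh : g.reebScale σ β z ≠ 0) :
    IsReebVector g.levelTangent (g.contactPrimitive σ β) z r ↔ r = g.reebField σ β z := by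
  obtain ⟨hx, hv, hE⟩ := g.mem_energyLevel.1 hz
  have hm2 : m ^ 2 ≠ 0 := by positivity
  have hX := g.mem_levelTangent_bundleLift hz (g.reebScale σ β z)⁻¹ 0
    (g.strength σ z.1 / g.reebScale σ β z)
  obtain ⟨h1, h2, h3⟩ := g.coframe_bundleLift hm hz (g.reebScale σ β z)⁻¹ 0
    (g.strength σ z.1 / g.reebScale σ β z)
  rw [zero_smul, add_zero, ← reebField] at hX h1 h2 h3
  have tang : ∀ {ξ}, ξ ∈ g.levelTangent z → z.1 ⬝ᵥ ξ.1 = 0 := fun h =>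
    ((g.mem_levelTangent (g.areaSq_pos hx) hv).1 h).1.1
  constructor
  · rintro ⟨hr, hr1, hr2⟩
    have e : ∀ p q s : ℝ, g.connectionForm z r * q - s * g.transverseForm z r
        - g.strength σ z.1 * (g.radialForm z r * q - p * g.transverseForm z r) = 0 := by
      intro p q s
      have := hr2 _ (g.mem_levelTangent_bundleLift hz p q s)
      obtain ⟨k1, k2, k3⟩ := g.coframe_bundleLift hm hz p q s
      rw [g.dOne_contactPrimitive_coframe σ β hm hz hβ hr
        (g.mem_levelTangent_bundleLift hz p q s), k1, k2, k3] at this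
      exact (mul_eq_zero.1 this).resolve_left hm2
    have hq : g.transverseForm z r = 0 := by simpa using e 0 0 1
    have hs := e 0 1 0
    rw [g.contactPrimitive_coframe σ β hm hz (tang hr), hq] at hr1
    have hs' : g.connectionForm z r = g.strength σ z.1 * g.radialForm z r := by linarith
    rw [hs'] at hr1
    have hp : g.reebScale σ β z * g.radialForm z r = 1 := by
      rw [reebScale, hE]; linarith
    have hp' : g.radialForm z r = (g.reebScale σ β z)⁻¹ := eq_inv_of_mul_eq_one_right hp
    refine g.eq_of_coframe hm hz hr hX ?_ ?_ ?_
    · rw [h1, hp']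
    · rw [h2, hq]
    · rw [h3, hs', hp', div_eq_mul_inv]
  · rintro rfl
    refine ⟨hX, ?_, fun ζ hζ => ?_⟩
    · rw [g.contactPrimitive_coframe σ β hm hz (tang hX), h1, h2, h3]
      have : g.reebScale σ β z = m ^ 2 + σ.mean * g.strength σ z.1 - β z.1 z.2 := by
        rw [reebScale, hE]
      field_simp
      rw [this]; ring
    · rw [g.dOne_contactPrimitive_coframe σ β hm hz hβ hX hζ, h1, h2, h3, div_eq_mul_inv]
      ring

end SphereMetric

/-! ### Parametric integrals and Stokes' theorem on a rectangle -/

/-- Integrals over a bounded interval depend smoothly on parameters. -/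
theorem contDiff_intervalIntegral {E : Type*} [NormedAddCommGroup E] [NormedSpace ℝ E]
    {Φ : E → ℝ → ℝ} (hΦ : ContDiff ℝ ∞ (fun q : E × ℝ => Φ q.1 q.2)) {b : ℝ} (hb : 0 ≤ b) :
    ContDiff ℝ ∞ (fun x => ∫ s in (0 : ℝ)..b, Φ x s) := by
  -- The integral is the value at `0` of the convolution of the indicator function of the interval
  -- with a family of functions with a common compact support.
  let χ : ContDiffBump (0 : ℝ) := ⟨b + 1, b + 2, by linarith, by linarith⟩
  let f : ℝ → ℝ := Set.indicator (Set.Ioc 0 b) fun _ => 1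
  let G : E → ℝ → ℝ := fun x y => χ y * Φ x (-y)
  have hf : MeasureTheory.LocallyIntegrable f MeasureTheory.volume :=
    ((MeasureTheory.integrableOn_const (by simp)).integrable_indicator
      measurableSet_Ioc).locallyIntegrable
  have hG : ContDiffOn ℝ ∞ (Function.uncurry G) (Set.univ ×ˢ Set.univ) := by
    refine ContDiff.contDiffOn ?_
    have h1 : ContDiff ℝ ∞ fun q : E × ℝ => χ q.2 := χ.contDiff.comp contDiff_snd
    have h2 : ContDiff ℝ ∞ fun q : E × ℝ => Φ q.1 (-q.2) :=
      hΦ.comp (contDiff_fst.prodMk contDiff_snd.neg)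
    exact h1.mul h2
  have key := MeasureTheory.contDiffOn_convolution_right_with_param (n := ⊤) (μ := MeasureTheory.volume)
    (ContinuousLinearMap.mul ℝ ℝ)
    isOpen_univ χ.hasCompactSupport.isCompact (g := G) (f := f)
    (fun p x _ hx => by
      have : χ x = 0 := image_eq_zero_of_notMem_tsupport hx
      simp [G, this]) hf hG
  rw [Set.univ_prod_univ, contDiffOn_univ] at key
  have key2 := key.comp (contDiff_id.prodMk (contDiff_const (c := (0 : ℝ))) :
    ContDiff ℝ ∞ fun x : E => (x, (0 : ℝ)))
  convert key2 using 1
  ext x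
  simp only [Function.comp, MeasureTheory.convolution, id]
  rw [intervalIntegral.integral_of_le hb, ← MeasureTheory.integral_indicator measurableSet_Ioc]
  congr 1
  ext s
  by_cases hs : s ∈ Set.Ioc 0 b
  · have : χ (-s) = 1 := χ.one_of_mem_closedBall (by
      simp [abs_of_pos hs.1]; linarith [hs.2])
    simp [f, G, hs, this]
  · simp [f, hs]

/-- Stokes' theorem for the pull-back of a 1-form to the rectangle `[0, π] × [0, 2π]` by a map
which is periodic in the second variable. -/
theorem integral_dOne_rectangle {E : Type*} [NormedAddCommGroup E] [NormedSpace ℝ E]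
    {α : E → E →L[ℝ] ℝ} {Z : ℝ × ℝ → E} (hZ : ContDiff ℝ ∞ Z)
    (hα : ∀ p, ContDiffAt ℝ ∞ α (Z p))
    (hper : ∀ θ, Z (θ, 2 * Real.pi) = Z (θ, 0) ∧
      fderiv ℝ Z (θ, 2 * Real.pi) (1, 0) = fderiv ℝ Z (θ, 0) (1, 0)) :
    ∫ θ in (0 : ℝ)..Real.pi, ∫ φ in (0 : ℝ)..(2 * Real.pi),
      dOne α (Z (θ, φ)) (fderiv ℝ Z (θ, φ) (1, 0)) (fderiv ℝ Z (θ, φ) (0, 1)) =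
    (∫ φ in (0 : ℝ)..(2 * Real.pi), α (Z (Real.pi, φ)) (fderiv ℝ Z (Real.pi, φ) (0, 1)))
      - ∫ φ in (0 : ℝ)..(2 * Real.pi), α (Z (0, φ)) (fderiv ℝ Z (0, φ) (0, 1)) := by
  let η : ℝ × ℝ → ℝ × ℝ →L[ℝ] ℝ := fun p => (α (Z p)).comp (fderiv ℝ Z p)
  have hη : ContDiff ℝ ∞ η := by
    have h1 : ContDiff ℝ ∞ fun p => α (Z p) :=
      contDiff_iff_contDiffAt.2 fun p => (hα p).comp p hZ.contDiffAt
    exact h1.clm_comp (hZ.fderiv_right (m := ∞) (by simp))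
  have hd : ∀ p, HasFDerivAt η (fderiv ℝ η p) p := fun p =>
    (hη.differentiable (by simp) p).hasFDerivAt
  have hη' : Continuous (fderiv ℝ η) := (hη.fderiv_right (m := 0) (by simp)).continuous
  let f : ℝ × ℝ → ℝ := fun p => η p (0, 1)
  let k : ℝ × ℝ → ℝ := fun p => - η p (1, 0)
  let f' : ℝ × ℝ → ℝ × ℝ →L[ℝ] ℝ := fun p => (fderiv ℝ η p).flip (0, 1)
  let k' : ℝ × ℝ → ℝ × ℝ →L[ℝ] ℝ := fun p => - (fderiv ℝ η p).flip (1, 0)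
  have hf : ∀ p, HasFDerivAt f (f' p) p := fun p => by
    have := (hd p).clm_apply (hasFDerivAt_const ((0 : ℝ), (1 : ℝ)) p)
    refine this.congr_fderiv ?_
    ext <;> simp [f']
  have hk : ∀ p, HasFDerivAt k (k' p) p := fun p => by
    have := ((hd p).clm_apply (hasFDerivAt_const ((1 : ℝ), (0 : ℝ)) p)).neg
    refine this.congr_fderiv ?_
    ext <;> simp [k']
  have hc : Continuous fun p => f' p (1, 0) + k' p (0, 1) := by
    have h1 : Continuous fun p => fderiv ℝ η p (1, 0) (0, 1) :=
      (hη'.clm_apply continuous_const).clm_apply continuous_const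
    have h2 : Continuous fun p => fderiv ℝ η p (0, 1) (1, 0) :=
      (hη'.clm_apply continuous_const).clm_apply continuous_const
    exact h1.add h2.neg
  have main := MeasureTheory.integral2_divergence_prod_of_hasFDerivAt f k f' k' 0 0 Real.pi
    (2 * Real.pi) (fun p _ => (hf p).continuousAt.continuousWithinAt)
    (fun p _ => (hk p).continuousAt.continuousWithinAt) (fun p _ => hf p) (fun p _ => hk p)
    (hc.continuousOn.integrableOn_compact (isCompact_uIcc.prod isCompact_uIcc))
  have e1 : ∀ p, f' p (1, 0) + k' p (0, 1) =
      dOne α (Z p) (fderiv ℝ Z p (1, 0)) (fderiv ℝ Z p (0, 1)) := by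
    intro p
    rw [← dOne_pullback ((hα p).differentiableAt (by simp)) (hZ.contDiffAt.of_le two_le_infty),
      dOne_apply (hd p).differentiableAt, sub_eq_add_neg]
    rfl
  have e2 : (∫ x in (0 : ℝ)..Real.pi, k (x, 2 * Real.pi)) = ∫ x in (0 : ℝ)..Real.pi, k (x, 0) := by
    congr 1
    ext x
    simp only [k, η, ContinuousLinearMap.comp_apply, (hper x).1, (hper x).2]
  simp only [e1] at main
  rw [main, e2, sub_self, zero_add]
  rfl

/-! ### Spherical coordinates -/

/-- Spherical coordinates. -/
def spherical (p : ℝ × ℝ) : R3 :=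
  ![Real.sin p.1 * Real.cos p.2, Real.sin p.1 * Real.sin p.2, Real.cos p.1]

/-- The derivative of the spherical coordinates with respect to the polar angle. -/
def sphericalTheta (p : ℝ × ℝ) : R3 :=
  ![Real.cos p.1 * Real.cos p.2, Real.cos p.1 * Real.sin p.2, -Real.sin p.1]

/-- The derivative of the spherical coordinates with respect to the azimuth. -/
def sphericalPhi (p : ℝ × ℝ) : R3 :=
  ![-(Real.sin p.1 * Real.sin p.2), Real.sin p.1 * Real.cos p.2, 0]

theorem contDiff_spherical : ContDiff ℝ ∞ spherical := by
  refine contDiff_pi.2 fun i => ?_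
  fin_cases i <;> simp only [spherical] <;> simp <;> fun_prop

theorem contDiff_sphericalTheta : ContDiff ℝ ∞ sphericalTheta := by
  refine contDiff_pi.2 fun i => ?_
  fin_cases i <;> simp only [sphericalTheta] <;> simp <;> fun_prop

theorem fderiv_eq_of_hasDerivAt {E F : Type*} [NormedAddCommGroup E] [NormedSpace ℝ E]
    [NormedAddCommGroup F] [NormedSpace ℝ F] {f : E → F} {p u : E} {f' : F}
    (hf : DifferentiableAt ℝ f p) (h : HasDerivAt (fun s : ℝ => f (p + s • u)) f' 0) :
    fderiv ℝ f p u = f' := by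
  have hl : HasDerivAt (fun s : ℝ => p + s • u) u 0 := by
    simpa using ((hasDerivAt_id (0 : ℝ)).smul_const u).const_add p
  have hd : HasFDerivAt f (fderiv ℝ f p) (p + (0 : ℝ) • u) := by simpa using hf.hasFDerivAt
  exact (hasDerivAt_comp_curve (c := fun s : ℝ => p + s • u) hd hl).unique h

theorem fderiv_spherical_theta (p : ℝ × ℝ) : fderiv ℝ spherical p (1, 0) = sphericalTheta p := by
  refine fderiv_eq_of_hasDerivAt (contDiff_spherical.differentiable (by simp) p)
    (hasDerivAt_pi.2 fun i => ?_)
  have h1 : HasDerivAt (fun s : ℝ => p.1 + s) 1 0 := (hasDerivAt_id 0).const_add _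
  have hs := h1.sin
  have hc := h1.cos
  simp only [add_zero, mul_one] at hs hc
  fin_cases i <;> simp [spherical, sphericalTheta]
  · exact hs.mul_const _
  · exact hs.mul_const _
  · exact hc

theorem fderiv_spherical_phi (p : ℝ × ℝ) : fderiv ℝ spherical p (0, 1) = sphericalPhi p := by
  refine fderiv_eq_of_hasDerivAt (contDiff_spherical.differentiable (by simp) p)
    (hasDerivAt_pi.2 fun i => ?_)
  have h1 : HasDerivAt (fun s : ℝ => p.2 + s) 1 0 := (hasDerivAt_id 0).const_add _
  have hs := h1.sin
  have hc := h1.cos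
  simp only [add_zero, mul_one] at hs hc
  fin_cases i <;> simp [spherical, sphericalPhi]
  · simpa using hc.const_mul (Real.sin p.1)
  · exact hs.const_mul _
  · exact hasDerivAt_const _ _

theorem spherical_unit (p : ℝ × ℝ) : spherical p ⬝ᵥ spherical p = 1 := by
  rw [dot_eq]; simp [spherical]
  linear_combination (Real.sin p.1 ^ 2) * Real.sin_sq_add_cos_sq p.2 + Real.sin_sq_add_cos_sq p.1

theorem spherical_theta_tangent (p : ℝ × ℝ) : spherical p ⬝ᵥ sphericalTheta p = 0 := by
  rw [dot_eq]; simp [spherical, sphericalTheta]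
  linear_combination (Real.sin p.1 * Real.cos p.1) * Real.sin_sq_add_cos_sq p.2

theorem spherical_phi_tangent (p : ℝ × ℝ) : spherical p ⬝ᵥ sphericalPhi p = 0 := by
  rw [dot_eq]; simp [spherical, sphericalPhi]; ring

theorem spherical_triple (p : ℝ × ℝ) :
    spherical p ⬝ᵥ (sphericalTheta p ⨯₃ sphericalPhi p) = Real.sin p.1 := by
  rw [triple_eq]; simp [spherical, sphericalTheta, sphericalPhi]
  linear_combination (Real.sin p.1 * (Real.sin p.1 ^ 2 + Real.cos p.1 ^ 2)) *
    Real.sin_sq_add_cos_sq p.2 + Real.sin p.1 * Real.sin_sq_add_cos_sq p.1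

theorem sphericalTheta_unit (p : ℝ × ℝ) : sphericalTheta p ⬝ᵥ sphericalTheta p = 1 := by
  rw [dot_eq]; simp [sphericalTheta]
  linear_combination (Real.cos p.1 ^ 2) * Real.sin_sq_add_cos_sq p.2 + Real.sin_sq_add_cos_sq p.1

theorem exists_spherical {x : R3} (hx : x ⬝ᵥ x = 1) : ∃ p, spherical p = x := by
  rw [dot_eq] at hx
  have h2 : x 2 ^ 2 ≤ 1 := by nlinarith [sq_nonneg (x 0), sq_nonneg (x 1)]
  have hc : Real.cos (Real.arccos (x 2)) = x 2 :=
    Real.cos_arccos (by nlinarith [sq_nonneg (x 2 - 1), sq_nonneg (x 2 + 1)])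
      (by nlinarith [sq_nonneg (x 2 - 1), sq_nonneg (x 2 + 1)])
  have hs : Real.sin (Real.arccos (x 2)) = ‖(⟨x 0, x 1⟩ : ℂ)‖ := by
    rw [Real.sin_arccos, Complex.norm_eq_sqrt_sq_add_sq]; congr 1; simp; linarith
  refine ⟨(Real.arccos (x 2), Complex.arg ⟨x 0, x 1⟩), ?_⟩
  ext i
  fin_cases i <;> simp [spherical, hc, hs]

/-- The integral over the sphere of a function with respect to the Euclidean area. -/
def sphereIntegral (h : R3 → ℝ) : ℝ :=
  ∫ θ in (0 : ℝ)..Real.pi, ∫ φ in (0 : ℝ)..(2 * Real.pi), h (spherical (θ, φ)) * Real.sin θ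

theorem sphereIntegral_sub {h k : R3 → ℝ} (hh : Continuous h) (hk : Continuous k) :
    sphereIntegral (fun x => h x - k x) = sphereIntegral h - sphereIntegral k := by
  have hs := contDiff_spherical.continuous
  have c1 : ∀ h : R3 → ℝ, Continuous h → Continuous fun p : ℝ × ℝ =>
      h (spherical p) * Real.sin p.1 := fun h hh => by fun_prop
  have c2 : ∀ h : R3 → ℝ, Continuous h → Continuous fun θ : ℝ =>
      ∫ φ in (0 : ℝ)..(2 * Real.pi), h (spherical (θ, φ)) * Real.sin θ := fun h hh =>
    intervalIntegral.continuous_parametric_intervalIntegral_of_continuous'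
      (f := fun θ φ => h (spherical (θ, φ)) * Real.sin θ) (c1 h hh) _ _
  rw [sphereIntegral, sphereIntegral, sphereIntegral, ← intervalIntegral.integral_sub
    ((c2 h hh).intervalIntegrable _ _) ((c2 k hk).intervalIntegrable _ _)]
  congr 1
  ext θ
  have c3 : ∀ h : R3 → ℝ, Continuous h → Continuous fun φ : ℝ =>
    h (spherical (θ, φ)) * Real.sin θ := fun h hh => (c1 h hh).comp (by fun_prop)
  rw [← intervalIntegral.integral_sub ((c3 h hh).intervalIntegrable _ _)
    ((c3 k hk).intervalIntegrable _ _)]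
  congr 1
  ext φ
  ring

theorem sphereIntegral_const_mul (c : ℝ) (h : R3 → ℝ) :
    sphereIntegral (fun x => c * h x) = c * sphereIntegral h := by
  simp only [sphereIntegral, mul_assoc, intervalIntegral.integral_const_mul]

/-! ### Exactness of 2-forms of vanishing integral on the sphere -/

/-- The 2-form on `S²` with density `h` with respect to the Euclidean area is exact. -/
def IsExactDensity (h : R3 → ℝ) : Prop :=
  ∃ η : R3 → R3 →L[ℝ] ℝ, ContDiff ℝ ∞ η ∧ ∀ x u w, x ⬝ᵥ x = 1 → x ⬝ᵥ u = 0 → x ⬝ᵥ w = 0 →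
    dOne η x u w = h x * (x ⬝ᵥ (u ⨯₃ w))

theorem IsExactDensity.congr {h k : R3 → ℝ} (hh : IsExactDensity h)
    (e : ∀ x, x ⬝ᵥ x = 1 → h x = k x) : IsExactDensity k := by
  obtain ⟨η, h1, h2⟩ := hh
  exact ⟨η, h1, fun x u w hx hu hw => by rw [h2 x u w hx hu hw, e x hx]⟩

theorem IsExactDensity.sub {h k : R3 → ℝ} (hh : IsExactDensity h) (hk : IsExactDensity k) :
    IsExactDensity (fun x => h x - k x) := by
  obtain ⟨η, h1, h2⟩ := hh
  obtain ⟨ζ, k1, k2⟩ := hk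
  refine ⟨fun x => η x - ζ x, h1.sub k1, fun x u w hx hu hw => ?_⟩
  rw [dOne_sub (h1.differentiable (by simp) x) (k1.differentiable (by simp) x),
    h2 x u w hx hu hw, k2 x u w hx hu hw]
  ring

theorem IsExactDensity.add {h k : R3 → ℝ} (hh : IsExactDensity h) (hk : IsExactDensity k) :
    IsExactDensity (fun x => h x + k x) :=
  (hh.sub ((hk.sub hk).sub hk)).congr fun x _ => by ring

theorem IsExactDensity.sphereIntegral_eq_zero {h : R3 → ℝ} (hh : IsExactDensity h) :
    sphereIntegral h = 0 := by
  obtain ⟨η, h1, h2⟩ := hh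
  have key := integral_dOne_rectangle (α := η) contDiff_spherical (fun p => h1.contDiffAt)
    (fun θ => by
      rw [fderiv_spherical_theta, fderiv_spherical_theta]
      simp [spherical, sphericalTheta])
  simp only [fderiv_spherical_theta, fderiv_spherical_phi] at key
  have e : ∀ φ : ℝ, sphericalPhi (0, φ) = 0 ∧ sphericalPhi (Real.pi, φ) = 0 := by
    intro φ
    constructor <;> ext i <;> fin_cases i <;> simp [sphericalPhi]
  simp only [(e _).1, (e _).2, map_zero, intervalIntegral.integral_zero, sub_zero] at key
  rw [← key, sphereIntegral]
  simp only [h2 _ _ _ (spherical_unit _) (spherical_theta_tangent _) (spherical_phi_tangent _),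
    spherical_triple]

/-- For a rotation field `V` the form `(V f) · area` is the differential of the 1-form `f e · dx`,
which restricts to `S²` as the contraction of `f · area` with `V`. -/
theorem isExactDensity_rotationField {f : R3 → ℝ} (hf : ContDiff ℝ ∞ f) (e : R3) :
    IsExactDensity (fun x => fderiv ℝ f x (e ⨯₃ x)) := by
  let L : R3 →L[ℝ] ℝ := LinearMap.toContinuousLinearMap (dotProductBilin ℝ ℝ e)
  have hL : ∀ u, L u = e ⬝ᵥ u := fun u => rfl
  refine ⟨fun x => f x • L, hf.smul contDiff_const, fun x u w hx hu hw => ?_⟩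
  rw [dOne_smul (hf.differentiable (by simp) x) (differentiableAt_const _), dOne_apply
    (differentiableAt_const _), fderiv_const_apply, hL, hL]
  have key : (x ⬝ᵥ (u ⨯₃ w)) • (e ⨯₃ x) = (e ⬝ᵥ w) • u - (e ⬝ᵥ u) • w := by
    rw [← map_smul, ← cross_eq_triple_smul hx hu hw]
    ext i
    fin_cases i <;> simp [cross_apply, dot_eq] <;> ring
  have := congrArg (fderiv ℝ f x) key
  simp only [map_smul, map_sub, smul_eq_mul] at this
  rw [mul_comm (fderiv ℝ f x (e ⨯₃ x)), this]
  simp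
  ring

/-- The rotation about the unit vector `e` by the angle `s`. -/
def rotation (e : R3) (s : ℝ) (x : R3) : R3 :=
  x + Real.sin s • (e ⨯₃ x) + (1 - Real.cos s) • (e ⨯₃ (e ⨯₃ x))

theorem rotation_zero (e x : R3) : rotation e 0 x = x := by simp [rotation]

theorem contDiff_rotation (e : R3) : ContDiff ℝ ∞ (fun p : R3 × ℝ => rotation e p.2 p.1) := by
  unfold rotation; fun_prop

theorem rotation_add {e : R3} (he : e ⬝ᵥ e = 1) (s t : ℝ) (x : R3) :
    rotation e (s + t) x = rotation e s (rotation e t x) := by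
  have h3 : e ⨯₃ (e ⨯₃ (e ⨯₃ x)) = -(e ⨯₃ x) := by
    rw [cross_cross_eq e (e ⨯₃ x), cross_self_left, he]; simp
  simp only [rotation, map_add, map_smul, h3, map_neg, Real.sin_add, Real.cos_add]
  module

theorem hasDerivAt_rotation (e x : R3) : HasDerivAt (fun t => rotation e t x) (e ⨯₃ x) 0 := by
  have h1 := (Real.hasDerivAt_sin 0).smul_const (e ⨯₃ x)
  have h2 := ((Real.hasDerivAt_cos 0).const_sub 1).smul_const (e ⨯₃ (e ⨯₃ x))
  simpa [rotation] using (h1.const_add x).fun_add h2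

/-- The derivative of a weighted integral over an orbit of rotations. -/
theorem fderiv_integral_rotation {e : R3} (he : e ⬝ᵥ e = 1) {k : R3 → ℝ} (hk : ContDiff ℝ ∞ k)
    {b : ℝ} (hb : 0 ≤ b) (p q : ℝ) :
    ContDiff ℝ ∞ (fun x => ∫ s in (0 : ℝ)..b, (p + q * s) * k (rotation e s x)) ∧
    ∀ x, fderiv ℝ (fun x => ∫ s in (0 : ℝ)..b, (p + q * s) * k (rotation e s x)) x (e ⨯₃ x) =
      (p + q * b) * k (rotation e b x) - p * k x - q * ∫ s in (0 : ℝ)..b, k (rotation e s x) := by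
  have hF : ContDiff ℝ ∞ (fun x => ∫ s in (0 : ℝ)..b, (p + q * s) * k (rotation e s x)) := by
    refine contDiff_intervalIntegral (Φ := fun x s => (p + q * s) * k (rotation e s x)) ?_ hb
    have := hk.comp (contDiff_rotation e)
    exact (by fun_prop : ContDiff ℝ ∞ fun q' : R3 × ℝ => p + q * q'.2).mul this
  refine ⟨hF, fun x => ?_⟩
  set F := fun x => ∫ s in (0 : ℝ)..b, (p + q * s) * k (rotation e s x) with hFdef
  let κ : ℝ → ℝ := fun s => k (rotation e s x)
  have hκ : Continuous κ :=
    hk.continuous.comp ((contDiff_rotation e).continuous.comp (by fun_prop :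
      Continuous fun s : ℝ => (x, s)))
  have hκ1 : Continuous fun s => (p + q * s) * κ s := by fun_prop
  let H0 : ℝ → ℝ := fun t => ∫ s in (0 : ℝ)..t, κ s
  let H1 : ℝ → ℝ := fun t => ∫ s in (0 : ℝ)..t, (p + q * s) * κ s
  have d0 : ∀ t, HasDerivAt H0 (κ t) t := fun t => hκ.integral_hasStrictDerivAt 0 t |>.hasDerivAt
  have d1 : ∀ t, HasDerivAt H1 ((p + q * t) * κ t) t := fun t =>
    hκ1.integral_hasStrictDerivAt 0 t |>.hasDerivAt
  have e1 : ∀ t, F (rotation e t x) = (H1 (b + t) - H1 t) - q * t * (H0 (b + t) - H0 t) := by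
    intro t
    have i0 : ∀ a c, IntervalIntegrable κ MeasureTheory.volume a c := fun a c =>
      hκ.intervalIntegrable a c
    have i1 : ∀ a c, IntervalIntegrable (fun s => (p + q * s) * κ s) MeasureTheory.volume a c :=
      fun a c => hκ1.intervalIntegrable a c
    have s1 : F (rotation e t x) = ∫ s in (0 : ℝ)..b, (fun u => (p + q * (u - t)) * κ u) (s + t) := by
      simp only [hFdef, κ, ← rotation_add he, add_sub_cancel_right]
    rw [s1, intervalIntegral.integral_comp_add_right (fun u => (p + q * (u - t)) * κ u), zero_add]
    have s2 : (fun u => (p + q * (u - t)) * κ u)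
        = fun u => (p + q * u) * κ u - (q * t) * κ u := by ext u; ring
    rw [s2, intervalIntegral.integral_sub (i1 _ _) ((i0 _ _).const_mul _),
      intervalIntegral.integral_const_mul]
    congr 1
    · rw [intervalIntegral.integral_interval_sub_left (i1 _ _) (i1 _ _)]
    · rw [intervalIntegral.integral_interval_sub_left (i0 _ _) (i0 _ _)]
  have hd : HasFDerivAt F (fderiv ℝ F x) (rotation e 0 x) := by
    rw [rotation_zero]; exact (hF.differentiable (by simp) x).hasFDerivAt
  have l := hasDerivAt_comp_curve (c := fun t => rotation e t x) hd (hasDerivAt_rotation e x)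
  have hb' : HasDerivAt (fun t : ℝ => b + t) 1 0 := (hasDerivAt_id 0).const_add b
  have c1 : HasDerivAt (fun t => H1 (b + t)) ((p + q * b) * κ b) 0 := by
    have h : HasDerivAt H1 ((p + q * b) * κ b) (b + 0) := by rw [add_zero]; exact d1 b
    simpa using h.comp_const_add b 0
  have c0 : HasDerivAt (fun t => H0 (b + t)) (κ b) 0 := by
    have h : HasDerivAt H0 (κ b) (b + 0) := by rw [add_zero]; exact d0 b
    simpa using h.comp_const_add b 0
  have hq : HasDerivAt (fun t : ℝ => q * t) q 0 := by
    simpa using (hasDerivAt_id (0 : ℝ)).const_mul q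
  have r := (c1.fun_sub (d1 0)).fun_sub (hq.fun_mul (c0.fun_sub (d0 0)))
  have r' := r.congr_of_eventuallyEq (f₁ := fun t => F (rotation e t x))
    (Filter.Eventually.of_forall e1)
  rw [l.unique r']
  have z0 : H0 0 = 0 := intervalIntegral.integral_same
  have κ0 : κ 0 = k x := by simp only [κ, rotation_zero]
  simp only [z0, κ0, add_zero, mul_zero, zero_mul, sub_zero]
  rfl

/-- A zonal density of vanishing integral which vanishes near the poles is exact. -/
theorem isExactDensity_zonal {A : R3 → ℝ} (hA : ContDiff ℝ ∞ A)
    (hinv : ∀ t x, A (rotation ![0, 0, 1] t x) = A x)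
    (hpole : ∀ x, x ⬝ᵥ x = 1 → 3 / 4 ≤ x 2 ^ 2 → A x = 0) (hint : sphereIntegral A = 0) :
    IsExactDensity A := by
  -- The function `k` is the profile of `A` along the meridian `mer`. It vanishes near the poles,
  -- which keeps it smooth although the meridian is not smooth there.
  let mer : ℝ → R3 := fun z => ![√(1 - z ^ 2), 0, z]
  have hmer : ∀ z : ℝ, z ^ 2 < 1 → mer z ⬝ᵥ mer z = 1 := by
    intro z hz
    rw [dot_eq]; simp [mer]
    rw [Real.mul_self_sqrt (by linarith)]; ring
  let k : ℝ → ℝ := fun z => if z ^ 2 < 3 / 4 then A (mer z) else 0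
  have hk0 : ∀ z, 3 / 4 ≤ z ^ 2 → k z = 0 := fun z hz => if_neg (not_lt.2 hz)
  have hk1 : ∀ z : ℝ, z ^ 2 < 1 → k z = A (mer z) := by
    intro z hz
    by_cases h : z ^ 2 < 3 / 4
    · exact if_pos h
    · rw [hk0 z (not_lt.1 h), hpole _ (hmer z hz) (by simpa [mer] using h)]
  have hks : ContDiff ℝ ∞ k := by
    refine contDiff_iff_contDiffAt.2 fun z => ?_
    by_cases h : z ^ 2 < 1
    · have hm : ContDiffAt ℝ ∞ mer z := by
        refine contDiffAt_pi.2 fun i => ?_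
        fin_cases i
        · have : ContDiffAt ℝ ∞ (fun z : ℝ => 1 - z ^ 2) z := by fun_prop
          exact this.sqrt (by simpa [sub_eq_zero] using h.ne')
        · exact contDiffAt_const
        · exact contDiffAt_id
      refine (hA.contDiffAt.comp z hm).congr_of_eventuallyEq ?_
      have : ∀ᶠ y : ℝ in 𝓝 z, y ^ 2 < 1 :=
        (by fun_prop : ContinuousAt (fun y : ℝ => y ^ 2) z).eventually_lt continuousAt_const h
      exact this.mono fun y hy => hk1 y hy
    · refine (contDiffAt_const (c := (0 : ℝ))).congr_of_eventuallyEq ?_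
      have : ∀ᶠ y : ℝ in 𝓝 z, 3 / 4 < y ^ 2 :=
        continuousAt_const.eventually_lt (by fun_prop : ContinuousAt (fun y : ℝ => y ^ 2) z)
          (by linarith)
      exact this.mono fun y hy => hk0 y hy.le
  have hAk : ∀ x, x ⬝ᵥ x = 1 → A x = k (x 2) := by
    intro x hx
    rw [dot_eq] at hx
    by_cases h : x 2 ^ 2 < 3 / 4
    · rw [hk1 _ (by linarith), ← hinv (Complex.arg ⟨x 0, x 1⟩) (mer (x 2))]
      congr 1
      have hs : √(1 - x 2 ^ 2) = ‖(⟨x 0, x 1⟩ : ℂ)‖ := by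
        rw [Complex.norm_eq_sqrt_sq_add_sq]; congr 1; simp; linarith
      ext i
      fin_cases i
      · simp [rotation, mer, cross_apply, hs]
        rw [sub_mul, one_mul, mul_comm (Real.cos _), Complex.norm_mul_cos_arg]; ring
      · simp [rotation, mer, cross_apply, hs]
        rw [mul_comm, Complex.norm_mul_sin_arg]
      · simp [rotation, mer, cross_apply]
    · rw [hk0 _ (not_lt.1 h), hpole x (by rw [dot_eq]; exact hx) (not_lt.1 h)]
  -- The form `C(z) (x dy - y dx)` has the differential `-B'(z)` times the area form for `(1 - z²) C
  -- = B`. With the sign of `B` reversed its density is `k`. Both ends of `B` vanish, at `z = 1`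
  -- because of the vanishing integral, so that `C` is smooth.
  let B : ℝ → ℝ := fun z => ∫ s in (-1 : ℝ)..z, k s
  have hB : ∀ z, HasDerivAt B (k z) z := fun z =>
    (hks.continuous.integral_hasStrictDerivAt (-1) z).hasDerivAt
  have hBs : ContDiff ℝ ∞ B := by
    rw [contDiff_infty_iff_deriv]
    refine ⟨fun z => (hB z).differentiableAt, ?_⟩
    rw [show deriv B = k from funext fun z => (hB z).deriv]
    exact hks
  have hB1 : B (-1) = 0 := intervalIntegral.integral_same
  have hB2 : B 1 = 0 := by
    have e1 : sphereIntegral A = ∫ θ in (0 : ℝ)..Real.pi,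
        2 * Real.pi * (k (Real.cos θ) * Real.sin θ) := by
      rw [sphereIntegral]
      congr 1
      ext θ
      simp only [hAk _ (spherical_unit _)]
      have : ∀ φ, spherical (θ, φ) 2 = Real.cos θ := fun φ => by simp [spherical]
      simp [this]
      ring
    have hc : Continuous fun θ => 2 * Real.pi * (k (Real.cos θ) * Real.sin θ) := by
      have := hks.continuous
      fun_prop
    have e2 := intervalIntegral.integral_eq_sub_of_hasDerivAt (a := 0) (b := Real.pi)
      (f := fun θ => -(2 * Real.pi) * B (Real.cos θ))
      (f' := fun θ => 2 * Real.pi * (k (Real.cos θ) * Real.sin θ))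
      (fun θ _ => (((hB _).comp θ (Real.hasDerivAt_cos θ)).const_mul (-(2 * Real.pi))).congr_deriv
        (by ring)) (hc.intervalIntegrable _ _)
    rw [← e1, hint] at e2
    simp only [Real.cos_pi, Real.cos_zero, hB1] at e2
    have := Real.pi_pos
    nlinarith
  have hB0 : ∀ z : ℝ, 3 / 4 ≤ z ^ 2 → B z = 0 := by
    have zero : ∀ a b : ℝ, 3 / 4 ≤ a ^ 2 → 3 / 4 ≤ b ^ 2 → 0 < a * b →
        ∫ s in a..b, k s = 0 := by
      intro a b ha hb hab
      have : Set.EqOn k (fun _ => 0) (Set.uIcc a b) := by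
        intro s hs
        apply hk0
        rw [Set.mem_uIcc] at hs
        rcases pos_and_pos_or_neg_and_neg_of_mul_pos hab with h | h <;> rcases hs with hs | hs <;>
          nlinarith
      rw [intervalIntegral.integral_congr this]; simp
    intro z hz
    have hz0 : z ≠ 0 := by rintro rfl; norm_num at hz
    rcases lt_or_gt_of_ne hz0 with h | h
    · exact zero _ _ (by norm_num) hz (by linarith)
    · have := intervalIntegral.integral_add_adjacent_intervals (μ := MeasureTheory.volume) (a := -1) (b := 1) (c := z)
        (hks.continuous.intervalIntegrable _ _) (hks.continuous.intervalIntegrable _ _)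
      rw [zero 1 z (by norm_num) hz (by linarith), add_zero] at this
      change ∫ s in (-1 : ℝ)..z, k s = 0
      rw [← this]; exact hB2
  let C : ℝ → ℝ := fun z => -B z / (1 - z ^ 2)
  have hCs : ContDiff ℝ ∞ C := by
    refine contDiff_iff_contDiffAt.2 fun z => ?_
    by_cases h : z ^ 2 < 1
    · exact hBs.contDiffAt.neg.div (by fun_prop) (by linarith)
    · refine (contDiffAt_const (c := (0 : ℝ))).congr_of_eventuallyEq ?_
      have : ∀ᶠ y : ℝ in 𝓝 z, 3 / 4 < y ^ 2 :=
        continuousAt_const.eventually_lt (by fun_prop : ContinuousAt (fun y : ℝ => y ^ 2) z)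
          (by linarith)
      exact this.mono fun y hy => by simp [C, hB0 y hy.le]
  have hC : ∀ z, HasDerivAt C (deriv C z) z := fun z =>
    (hCs.differentiable (by simp) z).hasDerivAt
  have hCB : ∀ z, (1 - z ^ 2) * C z = - B z := by
    intro z
    by_cases h : 1 - z ^ 2 = 0
    · rw [h, zero_mul, hB0 z (by linarith), neg_zero]
    · simp only [C]; field_simp
  have hCd : ∀ z, 2 * z * C z - (1 - z ^ 2) * deriv C z = k z := by
    intro z
    have h1 : HasDerivAt (fun z : ℝ => 1 - z ^ 2) (-(2 * z)) z := by
      simpa using (hasDerivAt_pow 2 z).const_sub 1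
    have h2 := (h1.fun_mul (hC z)).unique
      ((hB z).fun_neg.congr_of_eventuallyEq (Filter.Eventually.of_forall hCB))
    linarith
  let P : R3 → R3 →L[ℝ] ℝ := fun x =>
    x 0 • ContinuousLinearMap.proj 1 - x 1 • ContinuousLinearMap.proj 0
  have hP : ContDiff ℝ ∞ P := by
    have h0 : ContDiff ℝ ∞ fun x : R3 => x 0 := contDiff_apply ℝ ℝ 0
    have h1 : ContDiff ℝ ∞ fun x : R3 => x 1 := contDiff_apply ℝ ℝ 1
    exact (h0.smul contDiff_const).sub (h1.smul contDiff_const)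
  have hC2 : ContDiff ℝ ∞ fun x : R3 => C (x 2) := hCs.comp (contDiff_apply ℝ ℝ 2)
  refine ⟨fun x => C (x 2) • P x, hC2.smul hP, fun x u w hx hu hw => ?_⟩
  have hPd : ∀ u w : R3, fderiv ℝ P x u w = u 0 * w 1 - u 1 * w 0 := by
    intro u w
    have h := ((hasFDerivAt_apply (𝕜 := ℝ) (0 : Fin 3) x).smul_const
      (ContinuousLinearMap.proj 1 : R3 →L[ℝ] ℝ)).fun_sub
      ((hasFDerivAt_apply (𝕜 := ℝ) (1 : Fin 3) x).smul_const
      (ContinuousLinearMap.proj 0 : R3 →L[ℝ] ℝ))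
    rw [show fderiv ℝ P x = _ from h.fderiv]
    simp
  have hCd2 : ∀ u : R3, fderiv ℝ (fun x : R3 => C (x 2)) x u = deriv C (x 2) * u 2 := by
    intro u
    have h := (hC (x 2)).comp_hasFDerivAt x (hasFDerivAt_apply (𝕜 := ℝ) (2 : Fin 3) x)
    rw [show (fun x : R3 => C (x 2)) = C ∘ (fun x : R3 => x 2) from rfl, h.fderiv]
    simp
  rw [dOne_smul (hC2.differentiable (by simp) x) (hP.differentiable (by simp) x),
    dOne_apply (hP.differentiable (by simp) x), hPd, hPd, hCd2, hCd2, hAk x hx, ← hCd (x 2)]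
  have h := cross_eq_triple_smul hx hu hw
  have h0 := congrFun h 0
  have h1 := congrFun h 1
  have h2 := congrFun h 2
  rw [dot_eq] at hx
  simp only [cross_zero, cross_one, cross_two, Pi.smul_apply, smul_eq_mul] at h0 h1 h2
  set D := x ⬝ᵥ (u ⨯₃ w)
  simp [P]
  linear_combination (2 * C (x 2)) * h2 - deriv C (x 2) * (x 0 * h0 + x 1 * h1)
    - deriv C (x 2) * D * hx

/-- A smooth density on the sphere with vanishing integral is exact. -/
theorem isExactDensity_of_sphereIntegral_eq_zero {h : R3 → ℝ} (hh : ContDiff ℝ ∞ h)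
    (hint : sphereIntegral h = 0) : IsExactDensity h := by
  -- A partition of unity splits off the part of `h` near the poles, and a rotation by a right angle
  -- moves this part away from the poles.
  let χ : R3 → ℝ := fun x => Real.smoothTransition (4 * x 2 ^ 2 - 2)
  have hχ : ContDiff ℝ ∞ χ := by
    have h2 : ContDiff ℝ ∞ fun x : R3 => x 2 := contDiff_apply ℝ ℝ 2
    exact Real.smoothTransition.contDiff.comp (by fun_prop)
  let k : R3 → ℝ := fun x => χ x * h x
  have hk : ContDiff ℝ ∞ k := hχ.mul hh
  let e₂ : R3 := ![0, 1, 0]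
  let e₃ : R3 := ![0, 0, 1]
  have he₂ : e₂ ⬝ᵥ e₂ = 1 := by rw [dot_eq]; simp [e₂]
  have he₃ : e₃ ⬝ᵥ e₃ = 1 := by rw [dot_eq]; simp [e₃]
  have hpi := Real.pi_pos
  obtain ⟨s1, s2⟩ := fderiv_integral_rotation he₂ hk (b := Real.pi / 2) (by linarith) 1 0
  have ex1 := isExactDensity_rotationField s1 e₂
  let h' : R3 → ℝ := fun x => h x + (k (rotation e₂ (Real.pi / 2) x) - k x)
  have hkr : ContDiff ℝ ∞ fun x => k (rotation e₂ (Real.pi / 2) x) :=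
    hk.comp ((contDiff_rotation e₂).comp (contDiff_id.prodMk contDiff_const))
  have hh' : ContDiff ℝ ∞ h' := hh.add (hkr.sub hk)
  have ex1' : IsExactDensity (fun x => h' x - h x) := ex1.congr fun x _ => by
    rw [s2]; simp [h']
  have int1 : sphereIntegral h' = 0 := by
    have := ex1'.sphereIntegral_eq_zero
    rw [sphereIntegral_sub hh'.continuous hh.continuous, hint, sub_zero] at this
    exact this
  have hr : ∀ x : R3, rotation e₂ (Real.pi / 2) x = ![x 2, x 1, -x 0] := by
    intro x
    ext i
    fin_cases i <;> simp [rotation, e₂, cross_apply, Matrix.vecHead, Matrix.vecTail]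
  have hp' : ∀ x, x ⬝ᵥ x = 1 → 3 / 4 ≤ x 2 ^ 2 → h' x = 0 := by
    intro x hx hx2
    rw [dot_eq] at hx
    have c1 : χ x = 1 := Real.smoothTransition.one_of_one_le (by linarith)
    have c2 : χ (rotation e₂ (Real.pi / 2) x) = 0 := by
      rw [hr]
      exact Real.smoothTransition.zero_of_nonpos (by simp; nlinarith [sq_nonneg (x 1)])
    simp [h', k, c1, c2]
  -- Averaging over the rotations about the axis changes a density by an exact one.
  obtain ⟨t1, t2⟩ := fderiv_integral_rotation he₃ hh' (b := 2 * Real.pi) (by linarith) 0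
    (1 / (2 * Real.pi))
  have ex2 := isExactDensity_rotationField t1 e₃
  let A : R3 → ℝ := fun x => (1 / (2 * Real.pi)) *
    ∫ s in (0 : ℝ)..(2 * Real.pi), h' (rotation e₃ s x)
  have hA : ContDiff ℝ ∞ A := contDiff_const.mul
    (contDiff_intervalIntegral (Φ := fun x s => h' (rotation e₃ s x))
      (hh'.comp (contDiff_rotation e₃)) (by linarith))
  have h2pi : ∀ x, rotation e₃ (2 * Real.pi) x = x := fun x => by simp [rotation]
  have ex2' : IsExactDensity (fun x => h' x - A x) := ex2.congr fun x _ => by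
    rw [t2, h2pi]
    simp only [A]
    field_simp
    ring
  have int2 : sphereIntegral A = 0 := by
    have := ex2'.sphereIntegral_eq_zero
    rw [sphereIntegral_sub hh'.continuous hA.continuous, int1] at this
    linarith
  have hr3 : ∀ (s : ℝ) (x : R3), rotation e₃ s x = ![Real.cos s * x 0 - Real.sin s * x 1,
      Real.sin s * x 0 + Real.cos s * x 1, x 2] := by
    intro s x
    ext i
    fin_cases i <;> simp [rotation, e₃, cross_apply, Matrix.vecHead, Matrix.vecTail] <;> ring
  have ex3 : IsExactDensity A := by
    refine isExactDensity_zonal hA ?_ ?_ int2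
    · intro t x
      have per : Function.Periodic (fun s => h' (rotation e₃ s x)) (2 * Real.pi) := by
        intro s
        simp only [rotation_add he₃, h2pi]
      simp only [A]
      congr 1
      have := intervalIntegral.integral_comp_add_right (a := 0) (b := 2 * Real.pi)
        (fun s => h' (rotation e₃ s x)) t
      simp only [rotation_add he₃] at this
      change ∫ s in (0 : ℝ)..(2 * Real.pi), h' (rotation e₃ s (rotation e₃ t x)) = _
      rw [this, zero_add, add_comm, per.intervalIntegral_add_eq t 0, zero_add]
    · intro x hx hx2
      have : ∀ s, h' (rotation e₃ s x) = 0 := by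
        intro s
        rw [dot_eq] at hx
        apply hp'
        · rw [hr3, dot_eq]
          simp
          linear_combination hx + (x 0 ^ 2 + x 1 ^ 2) * Real.sin_sq_add_cos_sq s
        · rw [hr3]; simpa using hx2
      simp [A, this]
  refine ((ex2'.sub ex1').add ex3).congr fun x _ => ?_
  ring

/-! ### The Gauss-Bonnet theorem and the primitives of `σ - c σ_g` -/

/-- The total angle of the unit circle is `2π` with respect to any inner product. The angle for the
inner product and the Euclidean angle differ by a function with values in `(-π/2, π/2)`. -/
theorem integral_angle {e f k ρ : ℝ} (hρ : 0 < ρ) (hdet : ρ ^ 2 = e * k - f ^ 2)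
    (hpos : ∀ φ, 0 < e * Real.cos φ ^ 2 + 2 * f * Real.cos φ * Real.sin φ + k * Real.sin φ ^ 2) :
    ∫ φ in (0 : ℝ)..(2 * Real.pi),
      ρ / (e * Real.cos φ ^ 2 + 2 * f * Real.cos φ * Real.sin φ + k * Real.sin φ ^ 2)
      = 2 * Real.pi := by
  set Q : ℝ → ℝ := fun φ =>
    e * Real.cos φ ^ 2 + 2 * f * Real.cos φ * Real.sin φ + k * Real.sin φ ^ 2 with hQ
  let N : ℝ → ℝ := fun φ => (k - e) * (Real.sin φ * Real.cos φ)
    + f * (Real.cos φ ^ 2 - Real.sin φ ^ 2)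
  have hN : ∀ φ, HasDerivAt N ((k - e) * (Real.cos φ ^ 2 - Real.sin φ ^ 2)
      - 4 * f * (Real.sin φ * Real.cos φ)) φ := by
    intro φ
    have hs := Real.hasDerivAt_sin φ
    have hc := Real.hasDerivAt_cos φ
    refine (((hs.fun_mul hc).const_mul (k - e)).fun_add
      (((hc.fun_pow 2).fun_sub (hs.fun_pow 2)).const_mul f)).congr_deriv ?_
    ring
  have hD : ∀ φ, HasDerivAt Q (2 * N φ) φ := by
    intro φ
    have hs := Real.hasDerivAt_sin φ
    have hc := Real.hasDerivAt_cos φ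
    refine ((((hc.fun_pow 2).const_mul e).fun_add ((hc.const_mul (2 * f)).fun_mul hs)).fun_add
      ((hs.fun_pow 2).const_mul k)).congr_deriv ?_
    simp only [N]
    ring
  -- The angle of the inner product is `φ` plus the argument of `Q + ρ + i N`, whose real part is
  -- positive; so it has a global formula.
  have hΘ : ∀ φ, HasDerivAt (fun φ => φ + Real.arctan (N φ / (Q φ + ρ))) (ρ / Q φ) φ := by
    intro φ
    have hDp : Q φ + ρ ≠ 0 := (add_pos (hpos φ) hρ).ne'
    have h := (hasDerivAt_id φ).fun_add ((hN φ).fun_div ((hD φ).add_const ρ) hDp).arctan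
    refine h.congr_deriv ?_
    have hQ0 : Q φ ≠ 0 := (hpos φ).ne'
    have hq0 : (Q φ + ρ) ^ 2 + N φ ^ 2 ≠ 0 := by
      have : 0 < (Q φ + ρ) ^ 2 := by have := add_pos (hpos φ) hρ; positivity
      positivity
    have t := Real.sin_sq_add_cos_sq φ
    set s := Real.sin φ
    set c := Real.cos φ
    set R := e * s ^ 2 - 2 * f * s * c + k * c ^ 2 with hR
    have g1 : N φ ^ 2 = Q φ * R - ρ ^ 2 := by
      have e1 : Q φ * R - N φ ^ 2 = (e * k - f ^ 2) * (s ^ 2 + c ^ 2) ^ 2 := by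
        simp only [N, hQ, hR]; ring
      rw [t] at e1
      rw [hdet]; linarith
    have g2 : (k - e) * (c ^ 2 - s ^ 2) - 4 * f * (s * c) = R - Q φ := by
      simp only [hQ, hR]; ring
    rw [g2]
    field_simp
    rw [g1]
    have hRQ : Q φ + 2 * ρ + R ≠ 0 := by
      intro h0
      apply hq0
      rw [g1]
      linear_combination Q φ * h0
    have e3 : (Q φ + ρ) ^ 2 + (Q φ * R - ρ ^ 2) = Q φ * (Q φ + 2 * ρ + R) := by ring
    rw [e3]
    field_simp
    ring
  have hc : Continuous fun φ => ρ / Q φ := by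
    have : Continuous Q := by simp only [hQ]; fun_prop
    exact continuous_const.div this fun φ => (hpos φ).ne'
  rw [intervalIntegral.integral_eq_sub_of_hasDerivAt (fun φ _ => hΘ φ)
    (hc.intervalIntegrable _ _)]
  simp [N, hQ]

theorem fderiv_sphericalTheta_theta (p : ℝ × ℝ) :
    fderiv ℝ sphericalTheta p (1, 0) = -spherical p := by
  refine fderiv_eq_of_hasDerivAt (contDiff_sphericalTheta.differentiable (by simp) p)
    (hasDerivAt_pi.2 fun i => ?_)
  have h1 : HasDerivAt (fun s : ℝ => p.1 + s) 1 0 := (hasDerivAt_id 0).const_add _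
  have hs := h1.sin
  have hc := h1.cos
  simp only [add_zero, mul_one] at hs hc
  fin_cases i <;> simp [spherical, sphericalTheta]
  · simpa using hc.mul_const (Real.cos p.2)
  · simpa using hc.mul_const (Real.sin p.2)
  · exact hs.fun_neg

theorem fderiv_sphericalTheta_phi (p : ℝ × ℝ) : fderiv ℝ sphericalTheta p (0, 1) =
    ![-(Real.cos p.1 * Real.sin p.2), Real.cos p.1 * Real.cos p.2, 0] := by
  refine fderiv_eq_of_hasDerivAt (contDiff_sphericalTheta.differentiable (by simp) p)
    (hasDerivAt_pi.2 fun i => ?_)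
  have h1 : HasDerivAt (fun s : ℝ => p.2 + s) 1 0 := (hasDerivAt_id 0).const_add _
  have hs := h1.sin
  have hc := h1.cos
  simp only [add_zero, mul_one] at hs hc
  fin_cases i <;> simp [sphericalTheta]
  · simpa using hc.const_mul (Real.cos p.1)
  · exact hs.const_mul _
  · exact hasDerivAt_const _ _

namespace SphereMetric

variable (g : SphereMetric)

/-- The integral of the connection form over the circle of directions at a point. -/
theorem integral_connectionForm_fibre {x a b : R3} (hx : x ⬝ᵥ x = 1) (ha : x ⬝ᵥ a = 0)
    (hb : x ⬝ᵥ b = 0) {ε : ℝ} (hε : x ⬝ᵥ (a ⨯₃ b) = ε) (hε1 : ε ^ 2 = 1) :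
    ∫ φ in (0 : ℝ)..(2 * Real.pi),
      g.connectionForm (x, Real.cos φ • a + Real.sin φ • b)
        (0, -Real.sin φ • a + Real.cos φ • b) = ε * (2 * Real.pi) := by
  have hρ := g.areaDensity_pos hx
  have hgram := g.gram_eq hx ha hb
  rw [hε, hε1, mul_one, ← g.areaDensity_sq (g.areaSq_pos hx)] at hgram
  have tang : ∀ s t : ℝ, x ⬝ᵥ (s • a + t • b) = 0 := fun s t => by
    simp [dotProduct_add, dotProduct_smul, ha, hb]
  have triple : ∀ s t s' t' : ℝ, x ⬝ᵥ ((s • a + t • b) ⨯₃ (s' • a + t' • b))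
      = (s * t' - t * s') * ε := by
    intro s t s' t'
    simp only [map_add, map_smul, LinearMap.add_apply, LinearMap.smul_apply, cross_self,
      dotProduct_add, dotProduct_smul, smul_eq_mul, smul_zero, add_zero, zero_add]
    rw [← cross_anticomm a b, dotProduct_neg, hε]
    ring
  have hQ : ∀ s t : ℝ, g.form x (s • a + t • b) (s • a + t • b)
      = g.form x a a * s ^ 2 + 2 * g.form x a b * s * t + g.form x b b * t ^ 2 := by
    intro s t
    simp only [map_add, map_smul, add_apply, smul_apply, smul_eq_mul, g.symm x b a]
    ring
  have hpos : ∀ φ, 0 < g.form x a a * Real.cos φ ^ 2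
      + 2 * g.form x a b * Real.cos φ * Real.sin φ + g.form x b b * Real.sin φ ^ 2 := by
    intro φ
    rw [← hQ]
    refine g.pos x _ hx (tang _ _) fun h0 => ?_
    have := triple (Real.cos φ) (Real.sin φ) (-Real.sin φ) (Real.cos φ)
    rw [h0] at this
    simp only [map_zero, LinearMap.zero_apply, dotProduct_zero] at this
    have t := Real.sin_sq_add_cos_sq φ
    have h1 : ε = 0 := by linear_combination -this - ε * t
    rw [h1] at hε1; norm_num at hε1
  have hI := integral_angle hρ hgram.symm hpos
  refine Eq.trans ?_ (congrArg (ε * ·) hI)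
  rw [← intervalIntegral.integral_const_mul]
  congr 1
  ext φ
  rw [connectionForm_apply, g.covDeriv_vertical hx (tang _ _), g.form_rot hx (tang _ _) (tang _ _),
    triple, hQ]
  have t := Real.sin_sq_add_cos_sq φ
  rw [show (Real.cos φ * Real.cos φ - Real.sin φ * -Real.sin φ) = 1 by linear_combination t]
  ring

/-- The Gauss-Bonnet theorem: Stokes' theorem for the connection form on the unit field `∂_θ`, which
turns once about each of the poles. -/
theorem integral_curvatureForm :
    ∫ θ in (0 : ℝ)..Real.pi, ∫ φ in (0 : ℝ)..(2 * Real.pi),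
      g.curvatureForm (spherical (θ, φ)) (sphericalTheta (θ, φ)) (sphericalPhi (θ, φ))
      = 4 * Real.pi := by
  let Z : ℝ × ℝ → R3 × R3 := fun p => (spherical p, sphericalTheta p)
  have hZ : ContDiff ℝ ∞ Z := contDiff_spherical.prodMk contDiff_sphericalTheta
  have hZd : ∀ p u, fderiv ℝ Z p u = (fderiv ℝ spherical p u, fderiv ℝ sphericalTheta p u) := by
    intro p u
    have := ((contDiff_spherical.differentiable (by simp) p).hasFDerivAt.prodMk
      (contDiff_sphericalTheta.differentiable (by simp) p).hasFDerivAt).fderiv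
    rw [show fderiv ℝ Z p = _ from this]
    rfl
  have hne : ∀ p, sphericalTheta p ≠ 0 := fun p => ne_zero_of_unit (sphericalTheta_unit p)
  have key := integral_dOne_rectangle (α := g.connectionForm) hZ
    (fun p => g.contDiffAt_connectionForm (g.areaSq_pos (spherical_unit p))
      (g.pos _ _ (spherical_unit p) (spherical_theta_tangent p) (hne p)).ne')
    (fun θ => by
      rw [hZd, hZd, fderiv_spherical_theta, fderiv_spherical_theta, fderiv_sphericalTheta_theta,
        fderiv_sphericalTheta_theta]
      simp [Z, spherical, sphericalTheta])
  have e1 : ∀ p, dOne g.connectionForm (Z p) (fderiv ℝ Z p (1, 0)) (fderiv ℝ Z p (0, 1)) =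
      - g.curvatureForm (spherical p) (sphericalTheta p) (sphericalPhi p) := by
    intro p
    rw [hZd, hZd, fderiv_spherical_theta, fderiv_sphericalTheta_theta, fderiv_spherical_phi,
      fderiv_sphericalTheta_phi]
    refine g.dOne_connectionForm (spherical_unit p) (spherical_theta_tangent p) (hne p)
      ⟨spherical_theta_tangent p, ?_⟩ ⟨spherical_phi_tangent p, ?_⟩
    · simp only [Z, dotProduct_neg, spherical_unit, sphericalTheta_unit]; ring
    · simp only [Z]
      rw [dot_eq, dot_eq]
      simp [spherical, sphericalTheta, sphericalPhi]
      ring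
  have hz : (![0, 0, 0] : R3) = 0 := by ext i; fin_cases i <;> rfl
  have e2 : ∀ φ, g.connectionForm (Z (0, φ)) (fderiv ℝ Z (0, φ) (0, 1)) =
      g.connectionForm (![0, 0, 1], Real.cos φ • ![1, 0, 0] + Real.sin φ • ![0, 1, 0])
        (0, -Real.sin φ • ![1, 0, 0] + Real.cos φ • ![0, 1, 0]) := by
    intro φ
    rw [hZd, fderiv_spherical_phi, fderiv_sphericalTheta_phi]
    simp [Z, spherical, sphericalTheta, sphericalPhi, hz]
  have e3 : ∀ φ, g.connectionForm (Z (Real.pi, φ)) (fderiv ℝ Z (Real.pi, φ) (0, 1)) =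
      g.connectionForm (![0, 0, -1], Real.cos φ • ![-1, 0, 0] + Real.sin φ • ![0, -1, 0])
        (0, -Real.sin φ • ![-1, 0, 0] + Real.cos φ • ![0, -1, 0]) := by
    intro φ
    rw [hZd, fderiv_spherical_phi, fderiv_sphericalTheta_phi]
    simp [Z, spherical, sphericalTheta, sphericalPhi, hz]
  simp only [e1, e2, e3] at key
  rw [g.integral_connectionForm_fibre (ε := -1) (by simp) (by simp)
    (by simp) (by rw [triple_eq]; simp) (by norm_num),
    g.integral_connectionForm_fibre (ε := 1) (by simp) (by simp)
    (by simp) (by rw [triple_eq]; simp) (by norm_num)] at key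
  simp only [intervalIntegral.integral_neg] at key
  linarith

/-- The pull-back of the connection form by a vector field is a primitive of `-σ_g`. -/
theorem dOne_sectionForm_eq {x u w b : R3} (hx : x ⬝ᵥ x = 1) (hu : x ⬝ᵥ u = 0)
    (hw : x ⬝ᵥ w = 0) (hb : extend b x ≠ 0) :
    dOne (g.sectionForm b) x u w = - g.curvatureForm x u w := by
  have hs : ContDiff ℝ ∞ (fun y => (y, extend b y)) := contDiff_id.prodMk (contDiff_extend b)
  have hd : ∀ u, fderiv ℝ (fun y => (y, extend b y)) x u = (u, fderiv ℝ (extend b) x u) := by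
    intro u
    have := ((hasFDerivAt_id x).prodMk
      ((contDiff_extend b).differentiable (by simp) x).hasFDerivAt).fderiv
    rw [show fderiv ℝ (fun y => (y, extend b y)) x = _ from this]
    rfl
  have ht : ∀ u, x ⬝ᵥ u = 0 → IsBundleTangent (x, extend b x) (u, fderiv ℝ (extend b) x u) := by
    intro u hu
    refine ⟨hu, ?_⟩
    simp only [fderiv_extend, extend, dotProduct_sub, dotProduct_neg, dotProduct_smul,
      sub_dotProduct, smul_dotProduct, hx, hu, dotProduct_comm b u, smul_eq_mul]
    ring
  have hB := g.pos _ _ hx (extend_tangent b hx) hb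
  have h1 : DifferentiableAt ℝ g.connectionForm (x, extend b x) :=
    (g.contDiffAt_connectionForm (z := (x, extend b x)) (g.areaSq_pos hx)
      hB.ne').differentiableAt (by simp)
  have key := dOne_pullback (f := fun y => (y, extend b y)) h1
    (hs.contDiffAt.of_le two_le_infty) u w
  rw [hd, hd, g.dOne_connectionForm (z := (x, extend b x)) hx (extend_tangent b hx) hb (ht u hu)
    (ht w hw)] at key
  exact key

open scoped Manifold in
/-- The density of the curvature form with respect to the Euclidean area is the restriction of a
smooth function. -/
theorem exists_curvature_density : ∃ k : R3 → ℝ, ContDiff ℝ ∞ k ∧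
    ∀ x u w, x ⬝ᵥ x = 1 → x ⬝ᵥ u = 0 → x ⬝ᵥ w = 0 →
      g.curvatureForm x u w = k x * (x ⬝ᵥ (u ⨯₃ w)) := by
  let t : R3 → Set ℝ := fun x => {k | x ⬝ᵥ x = 1 → ∀ u w, x ⬝ᵥ u = 0 → x ⬝ᵥ w = 0 →
    g.curvatureForm x u w = k * (x ⬝ᵥ (u ⨯₃ w))}
  have ht : ∀ x, Convex ℝ (t x) := by
    intro x k hk l hl a b _ _ hab hx u w hu hw
    have h1 := hk hx u w hu hw
    have h2 := hl hx u w hu hw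
    simp only [smul_eq_mul]
    linear_combination a * h1 + b * h2 - g.curvatureForm x u w * hab
  -- Near each point a primitive `-sectionForm b` gives a smooth formula for the density. The
  -- condition on the value at a point is convex, so the local formulas are glued by a partition of
  -- unity.
  obtain ⟨k, hk⟩ := exists_contMDiffMap_forall_mem_convex_of_local (n := ⊤) 𝓘(ℝ, R3) ht (by
    intro x
    by_cases hx : x ⬝ᵥ x = 1
    · obtain ⟨b, hb, hb0⟩ := exists_tangent x
      let α := g.sectionForm b
      let k : R3 → ℝ := fun y => -(
        y 0 * (fderiv ℝ α y (Pi.single 1 1) (Pi.single 2 1)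
          - fderiv ℝ α y (Pi.single 2 1) (Pi.single 1 1))
        + y 1 * (fderiv ℝ α y (Pi.single 2 1) (Pi.single 0 1)
          - fderiv ℝ α y (Pi.single 0 1) (Pi.single 2 1))
        + y 2 * (fderiv ℝ α y (Pi.single 0 1) (Pi.single 1 1)
          - fderiv ℝ α y (Pi.single 1 1) (Pi.single 0 1)))
      have c1 : Continuous fun y => g.form y (extend b y) (extend b y) :=
        (contDiff_iff_contDiffAt.2 fun y => g.contDiffAt_form contDiffAt_id
          (contDiff_extend b).contDiffAt (contDiff_extend b).contDiffAt).continuous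
      let U : Set R3 := {y | 0 < g.areaSq y ∧ 0 < g.form y (extend b y) (extend b y)}
      have hU : IsOpen U := (isOpen_lt continuous_const g.contDiff_areaSq.continuous).inter
        (isOpen_lt continuous_const c1)
      have hxU : x ∈ U := ⟨g.areaSq_pos hx, g.pos _ _ hx (extend_tangent b hx)
        (by rwa [extend_eq hb])⟩
      have hα : ∀ y ∈ U, ContDiffAt ℝ ∞ α y := fun y hy =>
        g.contDiffAt_sectionForm_of_ne hy.1 hy.2.ne'
      refine ⟨U, hU.mem_nhds hxU, k, ContDiffOn.contMDiffOn fun y hy =>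
        ContDiffAt.contDiffWithinAt ?_, ?_⟩
      · have h : ∀ u w : R3, ContDiffAt ℝ ∞ (fun y => fderiv ℝ α y u w) y := fun u w =>
          (((hα y hy).fderiv_right (m := ∞) (by simp)).clm_apply contDiffAt_const).clm_apply
            contDiffAt_const
        have h0 : ∀ i, ContDiffAt ℝ ∞ (fun y : R3 => y i) y := fun i =>
          (contDiff_apply ℝ ℝ i).contDiffAt
        exact ((((h0 0).mul ((h _ _).sub (h _ _))).add ((h0 1).mul ((h _ _).sub (h _ _)))).add
          ((h0 2).mul ((h _ _).sub (h _ _)))).neg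
      · intro y hy hy1 u w hu hw
        have hb' : extend b y ≠ 0 := by
          intro h0; have := hy.2; rw [h0] at this; simp at this
        have hd := (hα y hy).differentiableAt (by simp)
        have e := g.dOne_sectionForm_eq hy1 hu hw hb'
        have e' : dOne α y u w = (y 0 * dOne α y (Pi.single 1 1) (Pi.single 2 1)
          + y 1 * dOne α y (Pi.single 2 1) (Pi.single 0 1)
          + y 2 * dOne α y (Pi.single 0 1) (Pi.single 1 1)) * (y ⬝ᵥ (u ⨯₃ w)) :=
          alternating_eq_triple _ hy1 hu hw
        rw [dOne_apply hd (Pi.single 1 1), dOne_apply hd (Pi.single 2 1),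
          dOne_apply hd (Pi.single 0 1)] at e'
        simp only [k]
        linear_combination e - e'
    · have : IsOpen {y : R3 | y ⬝ᵥ y ≠ 1} :=
        isOpen_ne_fun (contDiff_dot (n := 0) contDiff_id contDiff_id).continuous continuous_const
      exact ⟨_, this.mem_nhds hx, fun _ => 0, contMDiffOn_const, fun y hy h => (hy h).elim⟩)
  exact ⟨k, k.contMDiff.contDiff, fun x u w hx hu hw => hk x hx u w hu hw⟩

theorem _root_.MagneticSphere.SphereSymplecticForm.integral_eq (σ : SphereSymplecticForm) :
    σ.integral = sphereIntegral σ.density := by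
  rw [SphereSymplecticForm.integral, sphereIntegral]
  congr 1; ext θ; congr 1; ext φ
  have h := σ.form_eq_density (spherical_unit (θ, φ)) (spherical_theta_tangent (θ, φ))
    (spherical_phi_tangent (θ, φ))
  rw [spherical_triple] at h
  exact h

/-- The form `σ - ([σ]/4π) σ_g` is exact, as its integral vanishes by the Gauss-Bonnet theorem. -/
theorem exists_isCurvaturePrimitive (σ : SphereSymplecticForm) :
    ∃ β, g.IsCurvaturePrimitive σ β := by
  obtain ⟨k, hk, hk2⟩ := g.exists_curvature_density
  have hGB : sphereIntegral k = 4 * Real.pi := by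
    rw [← g.integral_curvatureForm, sphereIntegral]
    congr 1; ext θ; congr 1; ext φ
    rw [hk2 _ _ _ (spherical_unit _) (spherical_theta_tangent _) (spherical_phi_tangent _),
      spherical_triple]
  have hint : sphereIntegral (fun x => σ.density x - σ.mean * k x) = 0 := by
    rw [sphereIntegral_sub σ.contDiff_density.continuous (k := fun x => σ.mean * k x)
      (by have := hk.continuous; fun_prop),
      sphereIntegral_const_mul, hGB, ← σ.integral_eq, SphereSymplecticForm.mean]
    have := Real.pi_pos
    field_simp
    ring
  obtain ⟨η, h1, h2⟩ := isExactDensity_of_sphereIntegral_eq_zero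
    (h := fun x => σ.density x - σ.mean * k x)
    (σ.contDiff_density.sub (contDiff_const.mul hk)) hint
  refine ⟨η, h1, fun x u w hx hu hw => ?_⟩
  rw [h2 x u w hx hu hw, σ.form_eq_density hx hu hw, hk2 x u w hx hu hw,
    SphereSymplecticForm.mean]
  ring

end SphereMetric

/-! ### Flows of compactly supported vector fields -/

section Flow

open Metric Set

variable {E : Type*} [NormedAddCommGroup E] [NormedSpace ℝ E]

/-- Integral curves of a compactly supported vector field are determined by their initial values. -/
theorem integralCurve_unique {X : E → E} (hX : ContDiff ℝ ∞ X) (hc : HasCompactSupport X)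
    {γ δ : ℝ → E} (hγ : ∀ t, HasDerivAt γ (X (γ t)) t) (hδ : ∀ t, HasDerivAt δ (X (δ t)) t)
    (h0 : γ 0 = δ 0) : γ = δ := by
  obtain ⟨K, hK⟩ := hX.lipschitzWith_of_hasCompactSupport hc (by simp)
  exact ODE_solution_unique_univ (v := fun _ => X) (s := fun _ => univ) (t₀ := 0)
    (fun _ => hK.lipschitzOnWith) (fun t => ⟨hγ t, trivial⟩) (fun t => ⟨hδ t, trivial⟩) h0

variable [FiniteDimensional ℝ E]

open scoped Manifold in
/-- A vector field of linear growth has global integral curves: there is a lower bound for the time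
of existence which does not depend on the initial value. -/
theorem exists_integralCurve {V : E → E} (hV : ContDiff ℝ 1 V) {B : ℝ} (hB : 0 < B)
    (hg : ∀ z, ‖V z‖ ≤ B * (1 + ‖z‖)) (x : E) :
    ∃ γ : ℝ → E, γ 0 = x ∧ ∀ t, HasDerivAt γ (V (γ t)) t := by
  have hloc : ∀ x : E, ∃ γ : ℝ → E, γ 0 = x ∧
      ∀ t ∈ Ioo (-(1 / (2 * B))) (1 / (2 * B)), HasDerivAt γ (V (γ t)) t := by
    intro x
    have hε : 0 < 1 / (2 * B) := by positivity
    obtain ⟨C, hC⟩ := (isCompact_closedBall x (1 + ‖x‖)).exists_bound_of_continuousOn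
      (hV.continuous_fderiv (by simp)).continuousOn
    have hL : LipschitzOnWith (.mk (max C 0) (le_max_right _ _)) V (closedBall x (1 + ‖x‖)) :=
      (convex_closedBall _ _).lipschitzOnWith_of_nnnorm_fderiv_le
        (fun y _ => hV.differentiable (by simp) y)
        (fun y hy => by simp [← NNReal.coe_le_coe, hC y hy])
    have hx1 : 0 ≤ 1 + ‖x‖ := by positivity
    have hpl : IsPicardLindelof (fun _ => V) (tmin := -(1 / (2 * B))) (tmax := 1 / (2 * B))
        ⟨0, by constructor <;> linarith⟩ x (.mk (1 + ‖x‖) hx1) 0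
        (.mk (2 * B * (1 + ‖x‖)) (by positivity)) (.mk (max C 0) (le_max_right _ _)) := by
      refine IsPicardLindelof.of_time_independent (fun y hy => ?_) hL ?_
      · have h1 : ‖y‖ ≤ 1 + ‖x‖ + ‖x‖ := by
          have h2 : ‖y - x‖ ≤ 1 + ‖x‖ := mem_closedBall_iff_norm.1 hy
          have := norm_add_le (y - x) x
          rw [sub_add_cancel] at this
          linarith
        have := hg y
        have h3 : B * (1 + ‖y‖) ≤ B * (2 * (1 + ‖x‖)) := by gcongr; linarith
        show ‖V y‖ ≤ 2 * B * (1 + ‖x‖)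
        linarith
      · show 2 * B * (1 + ‖x‖) * max (1 / (2 * B) - 0) (0 - -(1 / (2 * B))) ≤ 1 + ‖x‖ - 0
        rw [sub_zero, sub_zero, zero_sub, neg_neg, max_self]
        apply le_of_eq
        field_simp
    obtain ⟨γ, h0, h1⟩ := hpl.exists_eq_forall_mem_Icc_hasDerivWithinAt₀
    exact ⟨γ, h0, fun t ht =>
      (h1 t (Ioo_subset_Icc_self ht)).hasDerivAt (Icc_mem_nhds ht.1 ht.2)⟩
  have hV' : CMDiff 1 (fun x : E => (⟨x, V x⟩ : TangentBundle 𝓘(ℝ, E) E)) :=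
    contMDiff_vectorSpace_iff_contDiff.2 hV
  obtain ⟨γ, h0, h1⟩ := exists_isMIntegralCurve_of_isMIntegralCurveOn (I := 𝓘(ℝ, E)) (v := V) hV'
    (ε := 1 / (2 * B)) (by positivity) (fun x => by
      obtain ⟨γ, h0, h1⟩ := hloc x
      exact ⟨γ, h0, fun t ht => (h1 t ht).hasFDerivAt.hasMFDerivAt.hasMFDerivWithinAt⟩) x
  refine ⟨γ, h0, fun t => ?_⟩
  have h2 : HasFDerivAt γ ((1 : ℝ →L[ℝ] ℝ).smulRight (V (γ t)) : ℝ →L[ℝ] E) t :=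
    hasMFDerivAt_iff_hasFDerivAt.1 (h1 t)
  simpa using h2.hasDerivAt

/-- The flow of a compactly supported vector field, together with its differential, which solves the
linearised equation. -/
theorem exists_flow {X : E → E} (hX : ContDiff ℝ ∞ X) (hc : HasCompactSupport X) :
    ∃ (φ : ℝ → E → E) (M : ℝ → E → E →L[ℝ] E),
      (∀ x, φ 0 x = x) ∧ (∀ t x, HasDerivAt (fun s => φ s x) (X (φ t x)) t) ∧
      (∀ x, M 0 x = .id ℝ E) ∧
      (∀ t x, HasDerivAt (fun s => M s x) ((fderiv ℝ X (φ t x)).comp (M t x)) t) ∧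
      ∀ t x, 0 ≤ t → HasFDerivAt (φ t) (M t x) x := by
  have hdX : ContDiff ℝ ∞ (fderiv ℝ X) := hX.fderiv_right (by simp)
  obtain ⟨K, hK⟩ := hX.lipschitzWith_of_hasCompactSupport hc (by simp)
  obtain ⟨C, hC⟩ := hdX.lipschitzWith_of_hasCompactSupport (hc.fderiv ℝ) (by simp)
  obtain ⟨BX, hBX⟩ := hc.exists_bound_of_continuous hX.continuous
  obtain ⟨BD, hBD⟩ := (hc.fderiv ℝ).exists_bound_of_continuous hdX.continuous
  let V : E × (E →L[ℝ] E) → E × (E →L[ℝ] E) := fun p => (X p.1, (fderiv ℝ X p.1).comp p.2)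
  have hV : ContDiff ℝ 1 V :=
    ContDiff.of_le (n := ∞) ((hX.comp contDiff_fst).prodMk
      ((hdX.comp contDiff_fst).clm_comp contDiff_snd)) (by exact_mod_cast le_top)
  have hBX0 : 0 ≤ BX := (norm_nonneg _).trans (hBX 0)
  have hBD0 : 0 ≤ BD := (norm_nonneg _).trans (hBD 0)
  have hVg : ∀ p, ‖V p‖ ≤ (BX + BD + 1) * (1 + ‖p‖) := by
    intro p
    refine max_le ?_ ?_
    · have := hBX p.1
      have h2 : 0 ≤ ‖p‖ := norm_nonneg p
      show ‖X p.1‖ ≤ _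
      nlinarith
    · have h1 := (fderiv ℝ X p.1).opNorm_comp_le p.2
      have h2 : ‖p.2‖ ≤ ‖p‖ := norm_snd_le p
      have h3 : ‖fderiv ℝ X p.1‖ * ‖p.2‖ ≤ BD * ‖p‖ :=
        mul_le_mul (hBD _) h2 (norm_nonneg _) hBD0
      have h4 : 0 ≤ ‖p‖ := norm_nonneg p
      show ‖(fderiv ℝ X p.1).comp p.2‖ ≤ _
      nlinarith
  have hex := fun x => exists_integralCurve hV (by positivity) hVg (x, .id ℝ E)
  choose γ h0 h1 using hex
  have hφ : ∀ t x, HasDerivAt (fun s => (γ x s).1) (X (γ x t).1) t := fun t x => (h1 x t).fst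
  have hM : ∀ t x, HasDerivAt (fun s => (γ x s).2) ((fderiv ℝ X (γ x t).1).comp (γ x t).2) t :=
    fun t x => (h1 x t).snd
  refine ⟨fun t x => (γ x t).1, fun t x => (γ x t).2, fun x => by simp only [h0], hφ,
    fun x => by simp only [h0], hM, fun t x ht => ?_⟩
  have htaylor : ∀ y z : E, ‖X z - X y - fderiv ℝ X y (z - y)‖ ≤ C * ‖z - y‖ ^ 2 := by
    intro y z
    have := (convex_closedBall y ‖z - y‖).norm_image_sub_le_of_norm_hasFDerivWithin_le' (f := X)
      (φ := fderiv ℝ X y) (C := C * ‖z - y‖) (x := y) (y := z)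
      (fun w _ => (hX.differentiable (by simp) w).hasFDerivAt.hasFDerivWithinAt)
      (fun w hw => by
        have h1 := hC.dist_le_mul w y
        rw [dist_eq_norm, dist_eq_norm] at h1
        have h2 : ‖w - y‖ ≤ ‖z - y‖ := mem_closedBall_iff_norm.1 hw
        exact h1.trans (by gcongr))
      (mem_closedBall_self (norm_nonneg _)) (mem_closedBall_iff_norm.2 le_rfl)
    rw [pow_two, ← mul_assoc]
    exact this
  have hDK : ∀ y, ‖fderiv ℝ X y‖ ≤ K + 1 := fun y =>
    (norm_fderiv_le_of_lipschitz ℝ hK).trans (by linarith)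
  let K' : ℝ := K + 1
  have hK' : 0 < K' := by have := K.2; show 0 < (K : ℝ) + 1; positivity
  let A : ℝ := C * Real.exp (K * t) ^ 2 / K' * (Real.exp (K' * t) - 1)
  have hest : ∀ h : E, ‖(γ (x + h) t).1 - (γ x t).1 - (γ x t).2 h‖ ≤ A * ‖h‖ ^ 2 := by
    intro h
    have hd : ∀ s ∈ Icc 0 t, ‖(γ (x + h) s).1 - (γ x s).1‖ ≤ ‖h‖ * Real.exp (K * t) := by
      intro s hs
      have := dist_le_of_trajectories_ODE (v := fun _ => X) (K := K) (a := 0) (b := t)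
        (f := fun s => (γ (x + h) s).1) (g := fun s => (γ x s).1) (δ := ‖h‖) (fun _ => hK)
        (fun s _ => (hφ s _).continuousAt.continuousWithinAt)
        (fun s _ => (hφ s _).hasDerivWithinAt)
        (fun s _ => (hφ s _).continuousAt.continuousWithinAt)
        (fun s _ => (hφ s _).hasDerivWithinAt) (by simp [h0]) s hs
      rw [dist_eq_norm, sub_zero] at this
      have hs2 := hs.2
      exact this.trans (by gcongr)
    have hMh : ∀ s, HasDerivAt (fun s => (γ x s).2 h) (fderiv ℝ X (γ x s).1 ((γ x s).2 h)) s :=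
      fun s => by simpa using (hM s x).clm_apply (hasDerivAt_const s h)
    have hf := fun s => ((hφ s (x + h)).fun_sub (hφ s x)).fun_sub (hMh s)
    have := norm_le_gronwallBound_of_norm_deriv_right_le (a := 0) (b := t) (δ := 0) (K := K')
      (ε := C * (‖h‖ * Real.exp (K * t)) ^ 2)
      (fun s _ => (hf s).continuousAt.continuousWithinAt) (fun s _ => (hf s).hasDerivWithinAt)
      (by simp [h0]) (fun s hs => by
        have e : X (γ (x + h) s).1 - X (γ x s).1 - fderiv ℝ X (γ x s).1 ((γ x s).2 h) =
            (X (γ (x + h) s).1 - X (γ x s).1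
              - fderiv ℝ X (γ x s).1 ((γ (x + h) s).1 - (γ x s).1))
            + fderiv ℝ X (γ x s).1 ((γ (x + h) s).1 - (γ x s).1 - (γ x s).2 h) := by
          rw [map_sub (fderiv ℝ X (γ x s).1) _ ((γ x s).2 h)]; abel
        rw [e]
        refine (norm_add_le _ _).trans ?_
        have b1 := htaylor (γ x s).1 (γ (x + h) s).1
        have b2 := hd s (Ico_subset_Icc_self hs)
        have b3 := (fderiv ℝ X (γ x s).1).le_of_opNorm_le (hDK _)
          ((γ (x + h) s).1 - (γ x s).1 - (γ x s).2 h)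
        have b4 : (C : ℝ) * ‖(γ (x + h) s).1 - (γ x s).1‖ ^ 2
          ≤ C * (‖h‖ * Real.exp (K * t)) ^ 2 := by gcongr
        linarith) t (right_mem_Icc.2 ht)
    rw [gronwallBound_of_K_ne_0 hK'.ne', sub_zero] at this
    refine this.trans (le_of_eq ?_)
    simp only [A]
    ring
  rw [hasFDerivAt_iff_isLittleO_nhds_zero]
  refine (Asymptotics.IsBigO.of_bound A (Filter.Eventually.of_forall fun h => ?_)).trans_isLittleO
    (Asymptotics.isLittleO_norm_pow_id one_lt_two)
  rw [Real.norm_of_nonneg (by positivity)]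
  exact hest h

open scoped Manifold in
/-- A cut-off function makes a function which is smooth near a compact set globally smooth. -/
theorem exists_cutoff {F : Type*} [NormedAddCommGroup F] [NormedSpace ℝ F]
    {f : E → F} {K : Set E} (hK : IsCompact K) {U : Set E} (hU : IsOpen U) (hKU : K ⊆ U)
    (hf : ∀ z ∈ U, ContDiffAt ℝ ∞ f z) :
    ∃ χ : E → ℝ, ContDiff ℝ ∞ (fun z => χ z • f z) ∧ HasCompactSupport (fun z => χ z • f z) ∧
      ∀ z ∈ K, ∀ᶠ y in 𝓝 z, χ y = 1 := by
  obtain ⟨L, hL, hKL, hLU⟩ := exists_compact_between hK hU hKU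
  obtain ⟨χ, h1, hχ0, -⟩ := exists_contMDiffMap_one_nhds_of_subset_interior (n := ⊤) 𝓘(ℝ, E)
    hK.isClosed hKL
  refine ⟨χ, contDiff_iff_contDiffAt.2 fun z => ?_,
    HasCompactSupport.intro hL fun z hz => by rw [hχ0 z hz, zero_smul], fun z hz =>
      Filter.Eventually.filter_mono (nhds_le_nhdsSet hz) h1⟩
  by_cases hz : z ∈ U
  · exact χ.contMDiff.contDiff.contDiffAt.smul (hf z hz)
  · have hz' : Lᶜ ∈ 𝓝 z := hL.isClosed.isOpen_compl.mem_nhds fun h => hz (hLU h)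
    refine (contDiffAt_const (c := (0 : F))).congr_of_eventuallyEq ?_
    filter_upwards [hz'] with y hy
    rw [hχ0 y hy, zero_smul]

end Flow

/-! ### The Reeb flow and its linearisation -/

theorem norm_sq_le_dot (u : R3) : ‖u‖ ^ 2 ≤ u ⬝ᵥ u := by
  have h0 : 0 ≤ u ⬝ᵥ u := by
    rw [dot_eq]; nlinarith [sq_nonneg (u 0), sq_nonneg (u 1), sq_nonneg (u 2)]
  have : ‖u‖ ≤ √(u ⬝ᵥ u) := by
    refine (pi_norm_le_iff_of_nonneg (Real.sqrt_nonneg _)).2 fun i => ?_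
    rw [Real.norm_eq_abs]
    apply Real.abs_le_sqrt
    rw [dot_eq]
    fin_cases i
    · simp only [Fin.zero_eta]; nlinarith [sq_nonneg (u 1), sq_nonneg (u 2)]
    · simp only [Fin.mk_one]; nlinarith [sq_nonneg (u 0), sq_nonneg (u 2)]
    · simp only [Fin.reduceFinMk]; nlinarith [sq_nonneg (u 1), sq_nonneg (u 0)]
  calc ‖u‖ ^ 2 ≤ √(u ⬝ᵥ u) ^ 2 := by gcongr
    _ = u ⬝ᵥ u := Real.sq_sqrt h0

theorem norm_le_one_of_unit {x : R3} (hx : x ⬝ᵥ x = 1) : ‖x‖ ≤ 1 := by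
  have := norm_sq_le_dot x
  rw [hx] at this
  nlinarith [norm_nonneg x]

theorem isCompact_unitBundle :
    IsCompact {z : R3 × R3 | z.1 ⬝ᵥ z.1 = 1 ∧ z.1 ⬝ᵥ z.2 = 0 ∧ z.2 ⬝ᵥ z.2 = 1} := by
  refine Metric.isCompact_of_isClosed_isBounded ?_ ?_
  · have c : ∀ {f h : R3 × R3 → R3}, ContDiff ℝ 0 f → ContDiff ℝ 0 h →
        Continuous fun z => f z ⬝ᵥ h z := fun hf hh => (contDiff_dot hf hh).continuous
    exact (isClosed_eq (c contDiff_fst contDiff_fst) continuous_const).inter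
      ((isClosed_eq (c contDiff_fst contDiff_snd) continuous_const).inter
        (isClosed_eq (c contDiff_snd contDiff_snd) continuous_const))
  · refine (Metric.isBounded_closedBall (x := (0 : R3 × R3)) (r := 1)).subset fun z hz => ?_
    rw [mem_closedBall_zero_iff]
    exact max_le (norm_le_one_of_unit hz.1) (norm_le_one_of_unit hz.2.2)

namespace SphereMetric

variable (g : SphereMetric)

theorem continuous_form {X : Type*} [TopologicalSpace X] {x v w : X → R3} (hx : Continuous x)
    (hv : Continuous v) (hw : Continuous w) : Continuous fun y => g.form (x y) (v y) (w y) :=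
  ((g.smooth.continuous.comp hx).clm_apply hv).clm_apply hw

/-- The metric is uniformly equivalent to the Euclidean one. -/
theorem exists_form_ge : ∃ δ : ℝ, 0 < δ ∧ ∀ x u : R3, x ⬝ᵥ x = 1 → x ⬝ᵥ u = 0 →
    δ * ‖u‖ ^ 2 ≤ g.form x u u := by
  have hne : {z : R3 × R3 | z.1 ⬝ᵥ z.1 = 1 ∧ z.1 ⬝ᵥ z.2 = 0 ∧ z.2 ⬝ᵥ z.2 = 1}.Nonempty :=
    ⟨(![1, 0, 0], ![0, 1, 0]), by simp, by simp, by simp⟩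
  obtain ⟨z₀, hz₀, hmin⟩ := isCompact_unitBundle.exists_isMinOn hne
    (g.continuous_form continuous_fst continuous_snd continuous_snd).continuousOn
  refine ⟨g.form z₀.1 z₀.2 z₀.2, g.pos _ _ hz₀.1 hz₀.2.1 (ne_zero_of_unit hz₀.2.2),
    fun x u hx hu => ?_⟩
  by_cases hu0 : u = 0
  · simp [hu0]
  have hp := dot_self_pos hu0
  have hs := Real.sqrt_pos.2 hp
  have h := hmin (show ((x, (√(u ⬝ᵥ u))⁻¹ • u) : R3 × R3) ∈ _ from ⟨hx, by simp [hu], by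
    simp only [dotProduct_smul, smul_dotProduct, smul_eq_mul]
    field_simp
    rw [Real.sq_sqrt hp.le]⟩)
  simp only [Set.mem_ofPred_eq, map_smul, smul_apply, smul_eq_mul] at h
  have h2 : g.form z₀.1 z₀.2 z₀.2 * (u ⬝ᵥ u) ≤ g.form x u u := by
    have e : (√(u ⬝ᵥ u))⁻¹ * ((√(u ⬝ᵥ u))⁻¹ * g.form x u u) = g.form x u u / (u ⬝ᵥ u) := by
      rw [← mul_assoc, ← mul_inv, Real.mul_self_sqrt hp.le, inv_mul_eq_div]
    rw [e, le_div_iff₀ hp] at h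
    exact h
  have h3 := norm_sq_le_dot u
  have h4 := g.pos _ _ hz₀.1 hz₀.2.1 (ne_zero_of_unit hz₀.2.2)
  nlinarith

/-- The Euclidean length of the vectors of `Σ_m` is at most a constant multiple of `m`. -/
theorem exists_norm_le : ∃ R : ℝ, 0 < R ∧ ∀ m : ℝ, 0 < m → ∀ z ∈ g.energyLevel m,
    ‖z.2‖ ≤ R * m := by
  obtain ⟨δ, hδ, h⟩ := g.exists_form_ge
  refine ⟨(√δ)⁻¹, by positivity, fun m hm z hz => ?_⟩
  obtain ⟨hx, hv, hE⟩ := g.mem_energyLevel.1 hz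
  have h1 := h _ _ hx hv
  rw [hE] at h1
  have h2 : √δ * ‖z.2‖ ≤ m := by
    refine abs_le_of_sq_le_sq' (b := m) ?_ hm.le |>.2
    rw [mul_pow, Real.sq_sqrt hδ.le]; exact h1
  rw [inv_mul_eq_div, le_div_iff₀ (by positivity)]
  linarith

theorem isCompact_energyLevel {m : ℝ} (hm : 0 < m) : IsCompact (g.energyLevel m) := by
  obtain ⟨R, hR, h⟩ := g.exists_norm_le
  refine Metric.isCompact_of_isClosed_isBounded ?_ ?_
  · exact isClosed_eq g.contDiff_levelMap.continuous continuous_const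
  · refine (Metric.isBounded_closedBall (x := (0 : R3 × R3)) (r := max 1 (R * m))).subset
      fun z hz => ?_
    rw [mem_closedBall_zero_iff]
    exact max_le_max (norm_le_one_of_unit (g.mem_energyLevel.1 hz).1) (h m hm z hz)

variable (σ : SphereSymplecticForm) (β : R3 → R3 →L[ℝ] ℝ)

/-- A vector field on `ℝ³ × ℝ³` which extends the Reeb vector field and along which `x ⬝ᵥ x` and
`x ⬝ᵥ v` are constant. -/
def reebExtension (z : R3 × R3) : R3 × R3 :=
  let a := (g.reebScale σ β z)⁻¹ • (z.2 - ((z.1 ⬝ᵥ z.2) / (z.1 ⬝ᵥ z.1)) • z.1)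
  let b := (g.bundleLift z a ((g.strength σ z.1 / g.reebScale σ β z) • g.rot z.1 z.2)).2
  (a, b - ((z.1 ⬝ᵥ b + z.2 ⬝ᵥ a) / (z.1 ⬝ᵥ z.1)) • z.1)

theorem isBundleTangent_reebExtension {z : R3 × R3} (hx : z.1 ⬝ᵥ z.1 ≠ 0) :
    IsBundleTangent z (g.reebExtension σ β z) := by
  simp only [IsBundleTangent, reebExtension, dotProduct_smul, dotProduct_sub, smul_eq_mul]
  constructor
  · field_simp; ring
  · field_simp; ring

theorem reebExtension_eq {z : R3 × R3} (hx : z.1 ⬝ᵥ z.1 = 1) (hv : z.1 ⬝ᵥ z.2 = 0) :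
    g.reebExtension σ β z = g.reebField σ β z := by
  have h := (g.isBundleTangent_bundleLift (z := z) hx (a := (g.reebScale σ β z)⁻¹ • z.2)
    (k := (g.strength σ z.1 / g.reebScale σ β z) • g.rot z.1 z.2)
    (by simp [dotProduct_smul, hv]) (by simp [dotProduct_smul, g.rot_tangent])).2
  refine Prod.ext ?_ ?_
  · simp [reebExtension, reebField, bundleLift, hv]
  · simp only [reebExtension, hv, zero_div, zero_smul, sub_zero]
    rw [show (g.bundleLift z ((g.reebScale σ β z)⁻¹ • z.2) ((g.strength σ z.1 /
      g.reebScale σ β z) • g.rot z.1 z.2)).1 = (g.reebScale σ β z)⁻¹ • z.2 from rfl] at h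
    rw [h, zero_div, zero_smul, sub_zero, reebField]

theorem contDiffAt_reebExtension (hβ : ContDiff ℝ ∞ β) {z : R3 × R3} (h : 0 < g.areaSq z.1)
    (hx : z.1 ⬝ᵥ z.1 ≠ 0) (hh : g.reebScale σ β z ≠ 0) :
    ContDiffAt ℝ ∞ (g.reebExtension σ β) z := by
  have h1 := g.contDiffAt_reebScale σ β hβ h
  have f1 : ContDiffAt ℝ ∞ (fun z : R3 × R3 => z.1) z := contDiffAt_fst
  have f2 : ContDiffAt ℝ ∞ (fun z : R3 × R3 => z.2) z := contDiffAt_snd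
  have ha : ContDiffAt ℝ ∞ (fun z : R3 × R3 => (g.reebScale σ β z)⁻¹ •
      (z.2 - ((z.1 ⬝ᵥ z.2) / (z.1 ⬝ᵥ z.1)) • z.1)) z :=
    (h1.inv hh).smul (f2.sub (((contDiffAt_dot f1 f2).div (contDiffAt_dot f1 f1) hx).smul f1))
  have hk : ContDiffAt ℝ ∞ (fun z : R3 × R3 =>
      (g.strength σ z.1 / g.reebScale σ β z) • g.rot z.1 z.2) z :=
    ((g.contDiffAt_strength σ f1 h).div h1 hh).smul (g.contDiffAt_rot f1 h f2)
  have hb := (hk.sub ((contDiffAt_dot f2 ha).smul f1)).sub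
    (g.contDiffAt_covDeriv f1 h f2 ha ((contDiffAt_dot f2 ha).neg.smul f1))
  exact ha.prodMk (hb.sub ((((contDiffAt_dot f1 hb).add (contDiffAt_dot f2 ha)).div
    (contDiffAt_dot f1 f1) hx).smul f1))

end SphereMetric

namespace SphereMetric

variable (g : SphereMetric) (σ : SphereSymplecticForm) (β : R3 → R3 →L[ℝ] ℝ)

/-- `φ` restricts on `Σ_m` to the flow of the Reeb vector field, and `M t z` is the differential of
`φ t` at the points `z` of `Σ_m`. The derivative `Y'` of a solution `Y` of the linearised equation is
described by its projection to the base, and by the equation obtained by differentiating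
`α(X) = 1` for the Reeb vector field `X`. -/
structure IsSmoothReebFlow (m : ℝ) (φ : ℝ → R3 × R3 → R3 × R3)
    (M : ℝ → R3 × R3 → R3 × R3 →L[ℝ] R3 × R3) : Prop where
  zero : ∀ z, φ 0 z = z
  mem : ∀ z ∈ g.energyLevel m, ∀ t, φ t z ∈ g.energyLevel m
  hasDerivAt : ∀ z ∈ g.energyLevel m, ∀ t,
    HasDerivAt (fun s => φ s z) (g.reebField σ β (φ t z)) t
  unique : ∀ γ : ℝ → R3 × R3, (∀ t, γ t ∈ g.energyLevel m) →
    (∀ t, HasDerivAt γ (g.reebField σ β (γ t)) t) → ∀ t, γ t = φ t (γ 0)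
  differential_zero : ∀ z, M 0 z = .id ℝ (R3 × R3)
  hasFDerivAt : ∀ z ∈ g.energyLevel m, ∀ t, 0 ≤ t → HasFDerivAt (φ t) (M t z) z
  differential_mem : ∀ z ∈ g.energyLevel m, ∀ ξ ∈ g.levelTangent z, ∀ t, 0 ≤ t →
    M t z ξ ∈ g.levelTangent (φ t z)
  linearised : ∀ z ∈ g.energyLevel m, ∀ ξ ∈ g.levelTangent z, ∀ t, 0 ≤ t →
    ∃ Y' : R3 × R3, HasDerivAt (fun s => M s z ξ) Y' t ∧
      Y'.1 = (g.reebScale σ β (φ t z))⁻¹ • (M t z ξ).2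
        - (fderiv ℝ (g.reebScale σ β) (φ t z) (M t z ξ) / g.reebScale σ β (φ t z) ^ 2)
          • (φ t z).2 ∧
      fderiv ℝ (g.contactPrimitive σ β) (φ t z) (M t z ξ) (g.reebField σ β (φ t z))
        + g.contactPrimitive σ β (φ t z) Y' = 0

theorem contactPrimitive_reebField (hβ : g.IsCurvaturePrimitive σ β) {z : R3 × R3}
    (hx : z.1 ⬝ᵥ z.1 = 1) (hv : z.1 ⬝ᵥ z.2 = 0) (hv0 : z.2 ≠ 0) (hh : g.reebScale σ β z ≠ 0) :
    g.contactPrimitive σ β z (g.reebField σ β z) = 1 := by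
  have hp := g.pos _ _ hx hv hv0
  have hz : z ∈ g.energyLevel √(g.form z.1 z.2 z.2) :=
    g.mem_energyLevel.2 ⟨hx, hv, (Real.sq_sqrt hp.le).symm⟩
  exact ((g.isReebVector_iff σ β hβ (Real.sqrt_pos.2 hp) hz hh).2 rfl).2.1

/-- The Reeb vector field extends to a compactly supported field on `ℝ³ × ℝ³`, the flow of which
preserves `Σ_m`. -/
theorem exists_isSmoothReebFlow (hβ : g.IsCurvaturePrimitive σ β) {m : ℝ} (hm : 0 < m)
    (hh : ∀ z ∈ g.energyLevel m, g.reebScale σ β z ≠ 0) :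
    ∃ φ M, g.IsSmoothReebFlow σ β m φ M := by
  have hS := fun z (hz : z ∈ g.energyLevel m) => g.mem_energyLevel.1 hz
  let U : Set (R3 × R3) := {z | 0 < g.areaSq z.1 ∧ z.1 ⬝ᵥ z.1 ≠ 0 ∧ g.reebScale σ β z ≠ 0}
  have hU : IsOpen U := by
    rw [isOpen_iff_mem_nhds]
    intro z hz
    have c1 : ContinuousAt (fun z : R3 × R3 => g.areaSq z.1) z :=
      (g.contDiff_areaSq.continuous.comp continuous_fst).continuousAt
    have c2 : ContinuousAt (fun z : R3 × R3 => z.1 ⬝ᵥ z.1) z :=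
      (contDiff_dot (n := 0) contDiff_fst contDiff_fst).continuous.continuousAt
    have c3 := (g.contDiffAt_reebScale σ β hβ.1 hz.1).continuousAt
    filter_upwards [c1.eventually_const_lt hz.1, c2.eventually_ne hz.2.1,
      c3.eventually_ne hz.2.2] with y h1 h2 h3 using ⟨h1, h2, h3⟩
  have hSU : g.energyLevel m ⊆ U := fun z hz =>
    ⟨g.areaSq_pos (hS z hz).1, by rw [(hS z hz).1]; exact one_ne_zero, hh z hz⟩
  obtain ⟨χ, hX, hc, h1⟩ := exists_cutoff (g.isCompact_energyLevel hm) hU hSU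
    (fun z hz => g.contDiffAt_reebExtension σ β hβ.1 hz.1 hz.2.1 hz.2.2)
  set X : R3 × R3 → R3 × R3 := fun z => χ z • g.reebExtension σ β z with hXd
  obtain ⟨φ, M, hφ0, hφ, hM0, hM, hφM⟩ := exists_flow hX hc
  have hXS : ∀ z ∈ g.energyLevel m, X z = g.reebField σ β z := fun z hz => by
    simp only [hXd]
    rw [(h1 z hz).self_of_nhds, one_smul, g.reebExtension_eq σ β (hS z hz).1 (hS z hz).2.1]
  -- The flow preserves `T S²` and the energy on `T S²`.
  have hlev : ∀ z : R3 × R3, z.1 ⬝ᵥ z.1 = 1 → z.1 ⬝ᵥ z.2 = 0 →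
      ∀ t, g.levelMap (φ t z) = g.levelMap z := by
    intro z hx hv
    have d1 : ∀ t, HasDerivAt (fun s => (φ s z).1) (X (φ t z)).1 t := fun t => (hφ t z).fst
    have d2 : ∀ t, HasDerivAt (fun s => (φ s z).2) (X (φ t z)).2 t := fun t => (hφ t z).snd
    have e1 : ∀ t, (φ t z).1 ⬝ᵥ (φ t z).1 = 1 := by
      have hd : ∀ t, HasDerivAt (fun s => (φ s z).1 ⬝ᵥ (φ s z).1) 0 t := fun t => by
        refine (hasDerivAt_dot (d1 t) (d1 t)).congr_deriv ?_
        have h0 : (φ t z).1 ⬝ᵥ (X (φ t z)).1 = 0 := by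
          by_cases h : (φ t z).1 ⬝ᵥ (φ t z).1 = 0
          · rw [dotProduct_self_eq_zero.1 h, zero_dotProduct]
          · simp only [hXd, Prod.smul_fst, dotProduct_smul,
              (g.isBundleTangent_reebExtension σ β h).1, smul_zero]
        rw [dotProduct_comm _ (φ t z).1, h0, add_zero]
      intro t
      rw [is_const_of_deriv_eq_zero (fun t => (hd t).differentiableAt) (fun t => (hd t).deriv) t 0,
        hφ0, hx]
    have e1' : ∀ t, (φ t z).1 ⬝ᵥ (φ t z).1 ≠ 0 := fun t => by rw [e1]; exact one_ne_zero
    have e2 : ∀ t, (φ t z).1 ⬝ᵥ (φ t z).2 = 0 := by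
      have hd : ∀ t, HasDerivAt (fun s => (φ s z).1 ⬝ᵥ (φ s z).2) 0 t := fun t => by
        refine (hasDerivAt_dot (d1 t) (d2 t)).congr_deriv ?_
        have h0 := (g.isBundleTangent_reebExtension σ β (e1' t)).2
        simp only [hXd, Prod.smul_fst, Prod.smul_snd, dotProduct_smul, smul_dotProduct,
          smul_eq_mul, dotProduct_comm (g.reebExtension σ β (φ t z)).1]
        linear_combination χ (φ t z) * h0
      intro t
      rw [is_const_of_deriv_eq_zero (fun t => (hd t).differentiableAt) (fun t => (hd t).deriv) t 0,
        hφ0, hv]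
    have e3 : ∀ t, g.form (φ t z).1 (φ t z).2 (φ t z).2 = g.form z.1 z.2 z.2 := by
      have hd : ∀ t, HasDerivAt (fun s => g.form (φ s z).1 (φ s z).2 (φ s z).2) 0 t := fun t => by
        refine (g.hasDerivAt_form_covDeriv (d1 t) (d2 t) (d2 t) (g.areaSq_pos (e1 t)) (e2 t)
          (e2 t)).congr_deriv ?_
        have h0 : g.covDeriv (φ t z).1 (φ t z).2 (X (φ t z)).1 (X (φ t z)).2 =
            χ (φ t z) • ((g.strength σ (φ t z).1 / g.reebScale σ β (φ t z)) •
              g.rot (φ t z).1 (φ t z).2) := by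
          simp only [hXd, Prod.smul_fst, Prod.smul_snd, covDeriv_smul]
          rw [g.reebExtension_eq σ β (e1 t) (e2 t), reebField, g.covDeriv_bundleLift (e1 t)
            (by simp [dotProduct_smul, g.rot_tangent])]
        rw [g.symm _ (φ t z).2 (g.covDeriv _ _ _ _), h0]
        simp only [map_smul, smul_apply, g.form_rot_self (e1 t) (e2 t), smul_zero, add_zero]
      intro t
      rw [is_const_of_deriv_eq_zero (fun t => (hd t).differentiableAt) (fun t => (hd t).deriv) t 0,
        hφ0]
    intro t
    simp only [levelMap, energy, e1, e2, e3, hx, hv]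
  have hmem : ∀ z ∈ g.energyLevel m, ∀ t, φ t z ∈ g.energyLevel m := fun z hz t =>
    (hlev z (hS z hz).1 (hS z hz).2.1 t).trans hz
  have hbt : ∀ z ∈ g.energyLevel m, ∀ ξ ∈ g.levelTangent z, IsBundleTangent z ξ := fun z hz ξ hξ =>
    ((g.mem_levelTangent (g.areaSq_pos (hS z hz).1) (hS z hz).2.1).1 hξ).1
  have hdmem : ∀ z ∈ g.energyLevel m, ∀ ξ ∈ g.levelTangent z, ∀ t, 0 ≤ t →
      M t z ξ ∈ g.levelTangent (φ t z) := by
    intro z hz ξ hξ t ht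
    obtain ⟨c, hc0, hc1, hc2, hcd⟩ := exists_bundle_curve (hS z hz).1 (hS z hz).2.1 (hbt z hz ξ hξ)
    have f1 : HasFDerivAt (φ t) (M t z) (c 0) := by rw [hc0]; exact hφM t z ht
    have f2 := hasDerivAt_comp_curve f1 hcd
    have f3 : HasFDerivAt g.levelMap (fderiv ℝ g.levelMap (φ t z)) (φ t (c 0)) := by
      rw [hc0]; exact (g.contDiff_levelMap.differentiable (by simp) _).hasFDerivAt
    have f4 := hasDerivAt_comp_curve f3 f2
    have f5 : HasFDerivAt g.levelMap (fderiv ℝ g.levelMap z) (c 0) := by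
      rw [hc0]; exact (g.contDiff_levelMap.differentiable (by simp) _).hasFDerivAt
    have f6 := hasDerivAt_comp_curve f5 hcd
    simp only [hlev _ (hc1 _) (hc2 _)] at f4
    have : fderiv ℝ g.levelMap z ξ = 0 := LinearMap.mem_ker.1 hξ
    rw [levelTangent, LinearMap.mem_ker, ContinuousLinearMap.coe_coe, f4.unique f6, this]
  refine ⟨φ, M, ⟨hφ0, hmem, fun z hz t => ?_, fun γ hγ hγ' t => ?_, hM0,
    fun z _ t ht => hφM t z ht, hdmem, fun z hz ξ hξ t ht => ?_⟩⟩
  · rw [← hXS _ (hmem z hz t)]; exact hφ t z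
  · have := integralCurve_unique hX hc (γ := γ) (δ := fun t => φ t (γ 0))
      (fun t => by rw [hXS _ (hγ t)]; exact hγ' t) (fun t => hφ t _) (hφ0 _).symm
    exact congrFun this t
  · set w := φ t z with hw
    set Y := M t z ξ with hY
    have hwS := hmem z hz t
    have hYt := hdmem z hz ξ hξ t ht
    obtain ⟨c, hc0, hc1, hc2, hcd⟩ := exists_bundle_curve (hS w hwS).1 (hS w hwS).2.1
      (hbt w hwS Y hYt)
    have hY' : HasDerivAt (fun s => M s z ξ) (fderiv ℝ X w Y) t := by
      simpa using (hM t z).clm_apply (hasDerivAt_const t ξ)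
    have hXc : HasDerivAt (fun s => X (c s)) (fderiv ℝ X w Y) 0 :=
      hasDerivAt_comp_curve (f := X) (by
        rw [hc0]; exact (hX.differentiable (by simp) w).hasFDerivAt) hcd
    have hχc : ∀ᶠ s in 𝓝 0, X (c s) = g.reebField σ β (c s) := by
      have hcc : ContinuousAt c 0 := hcd.continuousAt
      have := h1 w hwS
      rw [← hc0] at this
      filter_upwards [hcc.eventually this] with s hs
      simp only [hXd]
      rw [hs, one_smul, g.reebExtension_eq σ β (hc1 s) (hc2 s)]
    have hXr : HasDerivAt (fun s => g.reebField σ β (c s)) (fderiv ℝ X w Y) 0 :=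
      hXc.congr_of_eventuallyEq (by filter_upwards [hχc] with s hs using hs.symm)
    have hw0 := hh w hwS
    have hsc := g.contDiffAt_reebScale σ β hβ.1 (g.areaSq_pos (hS w hwS).1)
    have hs1 : HasDerivAt (fun s => g.reebScale σ β (c s)) (fderiv ℝ (g.reebScale σ β) w Y) 0 :=
      hasDerivAt_comp_curve (f := g.reebScale σ β) (by
        rw [hc0]; exact (hsc.differentiableAt (by simp)).hasFDerivAt) hcd
    refine ⟨fderiv ℝ X w Y, hY', ?_, ?_⟩
    · have hr1 : HasDerivAt (fun s => (g.reebField σ β (c s)).1) (fderiv ℝ X w Y).1 0 := hXr.fst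
      have hv : HasDerivAt (fun s => (c s).2) Y.2 0 := hcd.snd
      have := (hs1.fun_inv (by rw [hc0]; exact hw0)).fun_smul hv
      rw [hr1.unique this, hc0, neg_div, neg_smul, sub_eq_add_neg]
    · have hα := (g.contDiffAt_contactPrimitive σ β hβ.1 (g.areaSq_pos (hS w hwS).1)
        (g.form_pos_of_mem hm hwS).ne').differentiableAt (by simp)
      have h2 : HasDerivAt (fun s => g.contactPrimitive σ β (c s))
          (fderiv ℝ (g.contactPrimitive σ β) w Y) 0 :=
        hasDerivAt_comp_curve (f := g.contactPrimitive σ β) (by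
          rw [hc0]; exact hα.hasFDerivAt) hcd
      have h3 := h2.clm_apply hXr
      have h4 : HasDerivAt (fun s => g.contactPrimitive σ β (c s) (g.reebField σ β (c s))) 0 0 := by
        refine (hasDerivAt_const (0 : ℝ) (1 : ℝ)).congr_of_eventuallyEq ?_
        have hv : HasDerivAt (fun s => (c s).2) Y.2 0 := hcd.snd
        filter_upwards [hs1.continuousAt.eventually_ne (by rw [hc0]; exact hw0),
          hv.continuousAt.eventually_ne (by rw [hc0]; exact g.ne_zero_of_mem hm hwS)] with s k1 k2
        exact g.contactPrimitive_reebField σ β hβ (hc1 s) (hc2 s) k2 k1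
      rw [hc0] at h3
      exact h3.unique h4

end SphereMetric

namespace SphereMetric

variable (g : SphereMetric) (σ : SphereSymplecticForm) (β : R3 → R3 →L[ℝ] ℝ)

/-- A curve on `Σ_m` through a point with a given tangent velocity. -/
theorem exists_level_curve {m : ℝ} (hm : 0 < m) {z ξ : R3 × R3} (hz : z ∈ g.energyLevel m)
    (hξ : ξ ∈ g.levelTangent z) :
    ∃ c : ℝ → R3 × R3, c 0 = z ∧ (∀ᶠ s in 𝓝 0, c s ∈ g.energyLevel m) ∧ HasDerivAt c ξ 0 := by
  obtain ⟨hx, hv, hE⟩ := g.mem_energyLevel.1 hz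
  obtain ⟨hb, h0⟩ := (g.mem_levelTangent (g.areaSq_pos hx) hv).1 hξ
  obtain ⟨c, hc0, hc1, hc2, hcd⟩ := exists_bundle_curve hx hv hb
  have d1 : HasDerivAt (fun s => (c s).1) ξ.1 0 := hcd.fst
  have d2 : HasDerivAt (fun s => (c s).2) ξ.2 0 := hcd.snd
  have d3 : HasDerivAt (fun s => g.form (c s).1 (c s).2 (c s).2) 0 0 := by
    refine (g.hasDerivAt_form_covDeriv d1 d2 d2 (g.areaSq_pos (hc1 0)) (hc2 0)
      (hc2 0)).congr_deriv ?_
    rw [g.symm _ (c 0).2 (g.covDeriv _ _ _ _), hc0, h0, add_zero]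
  have hm2 : 0 < m ^ 2 := by positivity
  have hE0 : g.form (c 0).1 (c 0).2 (c 0).2 = m ^ 2 := by rw [hc0, hE]
  have d4 : HasDerivAt (fun s => m * (√(g.form (c s).1 (c s).2 (c s).2))⁻¹) 0 0 := by
    refine (((d3.sqrt (by rw [hE0]; exact hm2.ne')).fun_inv
      (by rw [hE0]; positivity)).const_mul m).congr_deriv ?_
    simp
  refine ⟨fun s => ((c s).1, (m * (√(g.form (c s).1 (c s).2 (c s).2))⁻¹) • (c s).2), ?_, ?_, ?_⟩
  · simp only
    rw [hc0, hE, Real.sqrt_sq hm.le, mul_inv_cancel₀ hm.ne', one_smul]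
  · filter_upwards [d3.continuousAt.eventually_const_lt
      (show 0 < g.form (c 0).1 (c 0).2 (c 0).2 by rw [hE0]; exact hm2)] with s hs
    refine g.mem_energyLevel.2 ⟨hc1 s, by simp [dotProduct_smul, hc2 s], ?_⟩
    simp only [map_smul, smul_apply, smul_eq_mul]
    have := Real.sq_sqrt hs.le
    have h1 := (Real.sqrt_pos.2 hs).ne'
    field_simp
    rw [this]
  · refine (d1.prodMk (d4.fun_smul d2)).congr_deriv ?_
    rw [hE0, Real.sqrt_sq hm.le, mul_inv_cancel₀ hm.ne', one_smul, zero_smul, add_zero]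

variable {g σ β} {m : ℝ} {φ : ℝ → R3 × R3 → R3 × R3} {M : ℝ → R3 × R3 → R3 × R3 →L[ℝ] R3 × R3}
  (hφ : g.IsSmoothReebFlow σ β m φ M) (hm : 0 < m) (hβ : g.IsCurvaturePrimitive σ β)
  (hh : ∀ z ∈ g.energyLevel m, g.reebScale σ β z ≠ 0)

include hm hβ hh in
theorem isReebTrajectory_iff {γ : ℝ → R3 × R3} :
    IsReebTrajectory (g.energyLevel m) g.levelTangent (g.contactPrimitive σ β) γ ↔
      ∀ t, γ t ∈ g.energyLevel m ∧ HasDerivAt γ (g.reebField σ β (γ t)) t := by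
  refine forall_congr' fun t => and_congr_right fun ht => ?_
  simp only [g.isReebVector_iff σ β hβ hm ht (hh _ ht), exists_eq_left]

include hφ hm hβ hh

namespace IsSmoothReebFlow

theorem isReebFlow :
    IsReebFlow (g.energyLevel m) g.levelTangent (g.contactPrimitive σ β) φ := fun z hz =>
  ⟨hφ.zero z, (isReebTrajectory_iff hm hβ hh).2 fun t => ⟨hφ.mem z hz t, hφ.hasDerivAt z hz t⟩⟩

theorem eq_of_isReebTrajectory {γ : ℝ → R3 × R3}
    (hγ : IsReebTrajectory (g.energyLevel m) g.levelTangent (g.contactPrimitive σ β) γ) (t : ℝ) :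
    γ t = φ t (γ 0) :=
  have h := (isReebTrajectory_iff hm hβ hh).1 hγ
  hφ.unique γ (fun t => (h t).1) (fun t => (h t).2) t

/-- The differential of the Reeb flow on `Σ_m` does not depend on the choices made in
describing it. -/
theorem differential_eq {Φ : ℝ → R3 × R3 → R3 × R3}
    (hΦ : IsReebFlow (g.energyLevel m) g.levelTangent (g.contactPrimitive σ β) Φ) {z ξ : R3 × R3}
    (hz : z ∈ g.energyLevel m) (hξ : ξ ∈ g.levelTangent z) {t : ℝ} (ht : 0 ≤ t)
    {D : R3 × R3 →L[ℝ] R3 × R3} (hD : HasFDerivWithinAt (Φ t) D (g.energyLevel m) z) :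
    D ξ = M t z ξ := by
  have heq : ∀ y ∈ g.energyLevel m, φ t y = Φ t y := fun y hy => by
    rw [hφ.eq_of_isReebTrajectory hm hβ hh (hΦ y hy).2 t, (hΦ y hy).1]
  obtain ⟨c, hc0, hc1, hcd⟩ := g.exists_level_curve hm hz hξ
  have h1 : HasFDerivWithinAt (φ t) D (g.energyLevel m) (c 0) := by
    rw [hc0]; exact hD.congr heq (heq z hz)
  have h2 : HasFDerivWithinAt (φ t) (M t z) (g.energyLevel m) (c 0) := by
    rw [hc0]; exact (hφ.hasFDerivAt z hz t ht).hasFDerivWithinAt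
  have hs : {s | c s ∈ g.energyLevel m} ∈ 𝓝 (0 : ℝ) := hc1
  have k1 := (h1.comp_hasDerivWithinAt (0 : ℝ) (s := {s | c s ∈ g.energyLevel m})
    hcd.hasDerivWithinAt fun s hs => hs).hasDerivAt hs
  have k2 := (h2.comp_hasDerivWithinAt (0 : ℝ) (s := {s | c s ∈ g.energyLevel m})
    hcd.hasDerivWithinAt fun s hs => hs).hasDerivAt hs
  exact k1.unique k2

/-- The Reeb flow preserves the contact form. -/
theorem contactPrimitive_differential {z ξ : R3 × R3} (hz : z ∈ g.energyLevel m)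
    (hξ : ξ ∈ g.levelTangent z) {t : ℝ} (ht : 0 ≤ t) :
    g.contactPrimitive σ β (φ t z) (M t z ξ) = g.contactPrimitive σ β z ξ := by
  have hd : ∀ s, 0 ≤ s → HasDerivAt (fun s => g.contactPrimitive σ β (φ s z) (M s z ξ)) 0 s := by
    intro s hs
    obtain ⟨Y', h1, -, h2⟩ := hφ.linearised z hz ξ hξ s hs
    have hw := hφ.mem z hz s
    have hx := (g.mem_energyLevel.1 hw).1
    have hα : DifferentiableAt ℝ (g.contactPrimitive σ β) (φ s z) :=
      (g.contDiffAt_contactPrimitive σ β hβ.1 (g.areaSq_pos hx)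
        (g.form_pos_of_mem hm hw).ne').differentiableAt (by simp)
    have h3 : HasDerivAt (fun s => g.contactPrimitive σ β (φ s z))
        (fderiv ℝ (g.contactPrimitive σ β) (φ s z) (g.reebField σ β (φ s z))) s :=
      hasDerivAt_comp_curve (c := fun s => φ s z) hα.hasFDerivAt (hφ.hasDerivAt z hz s)
    have h5 := h3.clm_apply h1
    refine h5.congr_deriv ?_
    have h4 := ((g.isReebVector_iff σ β hβ hm hw (hh _ hw)).2 rfl).2.2 _
      (hφ.differential_mem z hz ξ hξ s hs)
    rw [dOne_apply hα] at h4
    linarith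
  have := (convex_Ici (0 : ℝ)).is_const_of_fderivWithin_eq_zero (𝕜 := ℝ)
    (f := fun s => g.contactPrimitive σ β (φ s z) (M s z ξ))
    (fun s hs => (hd s hs).differentiableAt.differentiableWithinAt)
    (fun s hs => by
      rw [(hd s hs).hasFDerivAt.hasFDerivWithinAt.fderivWithin (uniqueDiffOn_Ici 0 s hs)]
      ext; simp) (Set.mem_Ici.2 ht) (Set.mem_Ici.2 le_rfl)
  simpa [hφ.zero, hφ.differential_zero] using this

omit hβ in
/-- The linearised equation in the coframe `p, q, r`. -/
theorem hasDerivAt_coframe {z ξ : R3 × R3} (hz : z ∈ g.energyLevel m)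
    (hξ : ξ ∈ g.levelTangent z) {t : ℝ} (ht : 0 ≤ t) :
    let w := φ t z
    let Y := M t z ξ
    HasDerivAt (fun s => g.radialForm (φ s z) (M s z ξ))
      (g.strength σ w.1 / g.reebScale σ β w * g.transverseForm w Y
        - fderiv ℝ (g.reebScale σ β) w Y / g.reebScale σ β w ^ 2) t ∧
    HasDerivAt (fun s => g.transverseForm (φ s z) (M s z ξ))
      (-(g.strength σ w.1 / g.reebScale σ β w * g.radialForm w Y)
        + g.connectionForm w Y / g.reebScale σ β w) t := by
  intro w Y
  have hS := fun s => g.mem_energyLevel.1 (hφ.mem z hz s)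
  have hwS := hφ.mem z hz t
  obtain ⟨hx, hv, hE⟩ := hS t
  have hp := g.areaSq_pos hx
  have hm2 : m ^ 2 ≠ 0 := by positivity
  have hw0 : g.reebScale σ β w ≠ 0 := hh w hwS
  have hYt := hφ.differential_mem z hz ξ hξ t ht
  have hb : ∀ s, 0 ≤ s → IsBundleTangent (φ s z) (M s z ξ) := fun s hs =>
    ((g.mem_levelTangent (g.areaSq_pos (hS s).1) (hS s).2.1).1
      (hφ.differential_mem z hz ξ hξ s hs)).1
  obtain ⟨Y', hY', hY1, -⟩ := hφ.linearised z hz ξ hξ t ht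
  have d1 : HasDerivAt (fun s => (φ s z).1) (g.reebField σ β (φ t z)).1 t :=
    (hφ.hasDerivAt z hz t).fst
  have d2 : HasDerivAt (fun s => (φ s z).2) (g.reebField σ β (φ t z)).2 t :=
    (hφ.hasDerivAt z hz t).snd
  have d3 : HasDerivAt (fun s => (M s z ξ).1) Y'.1 t := hY'.fst
  have hj := g.rot_tangent (φ t z).1 (φ t z).2
  have c1 : g.covDeriv (φ t z).1 (φ t z).2 (g.reebField σ β (φ t z)).1
      (g.reebField σ β (φ t z)).2
      = (g.strength σ (φ t z).1 / g.reebScale σ β (φ t z)) • g.rot (φ t z).1 (φ t z).2 :=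
    g.covDeriv_bundleLift hx (by simp [dotProduct_smul, hj])
  -- The symmetry of the connection turns the derivative of the field `Y.1` along the orbit into the
  -- variation of the velocity.
  have c2 : g.covDeriv (φ t z).1 (M t z ξ).1 (g.reebField σ β (φ t z)).1 Y'.1
      = (g.connectionForm w Y / g.reebScale σ β w) • g.rot w.1 w.2
        - (fderiv ℝ (g.reebScale σ β) w Y / g.reebScale σ β w ^ 2) • w.2 := by
    have e1 : (g.reebField σ β (φ t z)).1 = (g.reebScale σ β w)⁻¹ • w.2 + 0 := by
      rw [add_zero]; rfl
    have e2 : Y'.1 = (g.reebScale σ β w)⁻¹ • Y.2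
        + (-(fderiv ℝ (g.reebScale σ β) w Y / g.reebScale σ β w ^ 2)) • w.2 := by
      rw [hY1, neg_smul, ← sub_eq_add_neg]
    rw [e1, e2, covDeriv_add, covDeriv_smul,
      g.covDeriv_vertical hx (by simp [dotProduct_smul, w, hv]), g.covDeriv_symm, g.covDeriv_eq_coframe hm hwS hYt, smul_smul, neg_smul, ← sub_eq_add_neg,
      inv_mul_eq_div]
  have r1 : g.form w.1 w.2 (g.rot w.1 w.2) = 0 := by rw [g.symm]; exact g.form_rot_self hx hv
  have r2 : g.form w.1 (g.rot w.1 w.2) (g.rot w.1 w.2) = m ^ 2 := by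
    rw [g.form_rot_rot hx hv hv]; exact hE
  have r3 : g.form w.1 (g.rot w.1 w.2) w.2 = 0 := g.form_rot_self hx hv
  constructor
  · have h1 := (g.hasDerivAt_form_covDeriv d1 d2 d3 hp hv (hb t ht).1).div_const (m ^ 2)
    have e : (fun s => g.radialForm (φ s z) (M s z ξ)) =
        fun s => g.form (φ s z).1 (φ s z).2 (M s z ξ).1 / m ^ 2 := funext fun s => by
      rw [radialForm_apply, (hS s).2.2]
    rw [e]
    refine h1.congr_deriv ?_
    rw [c1, c2, transverseForm_apply]
    simp only [map_smul, map_sub, smul_apply, smul_eq_mul]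
    rw [show φ t z = w from rfl, show M t z ξ = Y from rfl, r1,
      show g.form w.1 w.2 w.2 = m ^ 2 from hE]
    field_simp
    ring
  · have hev1 : ∀ᶠ s in 𝓝 t, (φ s z).1 ⬝ᵥ (φ s z).1 = 1 :=
      Filter.Eventually.of_forall fun s => (hS s).1
    have hev2 : ∀ᶠ s in 𝓝 t, (φ s z).1 ⬝ᵥ (φ s z).2 = 0 :=
      Filter.Eventually.of_forall fun s => (hS s).2.1
    obtain ⟨J, hJ, hJ2⟩ := g.exists_hasDerivAt_rot d1 d2 hev1 hev2 (g.ne_zero_of_mem hm hwS)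
    have h1 := (g.hasDerivAt_form_covDeriv d1 hJ d3 hp hj (hb t ht).1).div_const (m ^ 2)
    have e : (fun s => g.transverseForm (φ s z) (M s z ξ)) =
        fun s => g.form (φ s z).1 (g.rot (φ s z).1 (φ s z).2) (M s z ξ).1 / m ^ 2 :=
      funext fun s => by rw [transverseForm_apply, (hS s).2.2]
    rw [e]
    refine h1.congr_deriv ?_
    rw [hJ2, c1, c2, radialForm_apply, rot_smul, g.rot_rot hx hv]
    simp only [map_smul, map_sub, map_neg, neg_apply, smul_apply, smul_eq_mul]
    rw [show φ t z = w from rfl, show M t z ξ = Y from rfl, r2, r3,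
      show g.form w.1 w.2 w.2 = m ^ 2 from hE]
    field_simp
    ring

end IsSmoothReebFlow

end SphereMetric

/-! ### Estimates for small `m` -/

theorem isCompact_sphere : IsCompact {x : R3 | x ⬝ᵥ x = 1} := by
  refine Metric.isCompact_of_isClosed_isBounded ?_ ?_
  · exact isClosed_eq (contDiff_dot (n := 0) contDiff_id contDiff_id).continuous continuous_const
  · refine (Metric.isBounded_closedBall (x := (0 : R3)) (r := 1)).subset fun x hx => ?_
    rw [mem_closedBall_zero_iff]
    exact norm_le_one_of_unit hx

theorem abs_dot_le (u w : R3) : |u ⬝ᵥ w| ≤ 3 * (‖u‖ * ‖w‖) := by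
  have h : ∀ i, |u i * w i| ≤ ‖u‖ * ‖w‖ := fun i => by
    rw [abs_mul]
    exact mul_le_mul (norm_le_pi_norm u i) (norm_le_pi_norm w i) (abs_nonneg _) (norm_nonneg _)
  rw [dot_eq]
  have h0 := h 0
  have h1 := h 1
  have h2 := h 2
  have := abs_add_three (u 0 * w 0) (u 1 * w 1) (u 2 * w 2)
  linarith

theorem sphereIntegral_pos {h : R3 → ℝ} (hc : Continuous h)
    (hpos : ∀ x : R3, x ⬝ᵥ x = 1 → 0 < h x) : 0 < sphereIntegral h := by
  have hs := contDiff_spherical.continuous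
  have c1 : Continuous fun p : ℝ × ℝ => h (spherical p) * Real.sin p.1 :=
    (hc.comp hs).mul (Real.continuous_sin.comp continuous_fst)
  rw [sphereIntegral]
  refine intervalIntegral.intervalIntegral_pos_of_pos_on ?_ (fun θ hθ => ?_) Real.pi_pos
  · exact (intervalIntegral.continuous_parametric_intervalIntegral_of_continuous'
      (f := fun θ φ => h (spherical (θ, φ)) * Real.sin θ) c1 _ _).intervalIntegrable _ _
  · refine intervalIntegral.intervalIntegral_pos_of_pos_on
      (Continuous.intervalIntegrable (by fun_prop) _ _) (fun φ _ => ?_) Real.two_pi_pos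
    exact mul_pos (hpos _ (spherical_unit _)) (Real.sin_pos_of_mem_Ioo hθ)

/-- The density of a symplectic form has the same sign as its integral. -/
theorem SphereSymplecticForm.mean_mul_density_pos (σ : SphereSymplecticForm) {x : R3}
    (hx : x ⬝ᵥ x = 1) : 0 < σ.mean * σ.density x := by
  have hc := σ.contDiff_density.continuous
  have hk : 0 < sphereIntegral fun y => σ.density x * σ.density y := by
    refine sphereIntegral_pos (by fun_prop) fun y hy => ?_
    by_contra hn
    obtain ⟨p, hp⟩ := exists_spherical hx
    obtain ⟨q, hq⟩ := exists_spherical hy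
    have h := mem_range_of_exists_le_of_exists_ge (c := (0 : ℝ))
      (f := fun r => σ.density x * σ.density (spherical r))
      (by have := contDiff_spherical.continuous; fun_prop) ⟨q, by rw [hq]; exact not_lt.1 hn⟩
      ⟨p, by rw [hp]; exact mul_self_nonneg _⟩
    obtain ⟨r, hr⟩ := h
    exact mul_ne_zero (σ.density_ne_zero hx) (σ.density_ne_zero (spherical_unit r)) hr
  rw [sphereIntegral_const_mul, ← σ.integral_eq] at hk
  rw [SphereSymplecticForm.mean, div_mul_eq_mul_div, mul_comm]
  exact div_pos hk (by positivity)

theorem SphereSymplecticForm.mean_ne_zero (σ : SphereSymplecticForm) : σ.mean ≠ 0 := by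
  have := σ.mean_mul_density_pos (x := ![1, 0, 0]) (by simp)
  exact left_ne_zero_of_mul this.ne'

namespace SphereMetric

variable (g : SphereMetric) (σ : SphereSymplecticForm) (β : R3 → R3 →L[ℝ] ℝ)

/-- By compactness `c f` has a positive lower bound. -/
theorem exists_mean_mul_strength_ge : ∃ δ : ℝ, 0 < δ ∧ ∀ x : R3, x ⬝ᵥ x = 1 →
    δ ≤ σ.mean * g.strength σ x := by
  have hne : {x : R3 | x ⬝ᵥ x = 1}.Nonempty := ⟨![1, 0, 0], by simp⟩
  obtain ⟨x₀, hx₀, hmin⟩ := isCompact_sphere.exists_isMinOn hne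
    (f := fun x => σ.mean * g.strength σ x) (fun x hx =>
      (continuousAt_const.mul (g.contDiffAt_strength σ contDiffAt_id
        (g.areaSq_pos hx)).continuousAt).continuousWithinAt)
  refine ⟨σ.mean * g.strength σ x₀, ?_, fun x hx => hmin hx⟩
  rw [strength, ← mul_div_assoc]
  exact div_pos (σ.mean_mul_density_pos hx₀) (g.areaDensity_pos hx₀)

/-- The covariant derivative is linear in the velocities, with bounds uniform on the sphere. -/
theorem exists_norm_covDeriv_le (R : ℝ) : ∃ C : ℝ, 0 < C ∧ ∀ x v a b : R3, x ⬝ᵥ x = 1 → ‖v‖ ≤ R →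
    ‖g.covDeriv x v a b‖ ≤ C * (‖a‖ + ‖b‖) := by
  let K : Set (R3 × R3 × R3 × R3) := {x | x ⬝ᵥ x = 1} ×ˢ Metric.closedBall 0 R ×ˢ
    Metric.closedBall 0 1 ×ˢ Metric.closedBall 0 1
  have hK : IsCompact K := isCompact_sphere.prod ((isCompact_closedBall _ _).prod
    ((isCompact_closedBall _ _).prod (isCompact_closedBall _ _)))
  obtain ⟨C, hC⟩ := hK.exists_bound_of_continuousOn
    (f := fun p => g.covDeriv p.1 p.2.1 p.2.2.1 p.2.2.2) (fun p hp =>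
      (g.contDiffAt_covDeriv contDiffAt_fst (g.areaSq_pos hp.1) (contDiffAt_fst.comp p contDiffAt_snd)
        (contDiffAt_fst.comp p (contDiffAt_snd.comp p contDiffAt_snd))
        (contDiffAt_snd.comp p (contDiffAt_snd.comp p contDiffAt_snd))).continuousAt.continuousWithinAt)
  refine ⟨max C 1, by positivity, fun x v a b hx hv => ?_⟩
  by_cases h0 : ‖a‖ + ‖b‖ = 0
  · have ha : a = 0 := norm_eq_zero.1 (by linarith [norm_nonneg a, norm_nonneg b])
    have hb : b = 0 := norm_eq_zero.1 (by linarith [norm_nonneg a, norm_nonneg b])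
    have := g.covDeriv_smul x v 0 0 0
    rw [smul_zero, zero_smul] at this
    rw [ha, hb, this]; simp
  set N := ‖a‖ + ‖b‖ with hN
  have hNp : 0 < N := lt_of_le_of_ne (by positivity) (Ne.symm h0)
  have hle : ∀ u : R3, ‖u‖ ≤ N → ‖N⁻¹ • u‖ ≤ 1 := fun u hu => by
    rw [norm_smul, norm_inv, Real.norm_of_nonneg hNp.le, inv_mul_le_iff₀ hNp, mul_one]; exact hu
  have h := hC (x, v, N⁻¹ • a, N⁻¹ • b) ⟨hx, mem_closedBall_zero_iff.2 hv,
    mem_closedBall_zero_iff.2 (hle a (by linarith [norm_nonneg b])),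
    mem_closedBall_zero_iff.2 (hle b (by linarith [norm_nonneg a]))⟩
  simp only [covDeriv_smul] at h
  rw [norm_smul, norm_inv, Real.norm_of_nonneg hNp.le, inv_mul_le_iff₀ hNp, mul_comm] at h
  exact h.trans (mul_le_mul_of_nonneg_right (le_max_left _ _) hNp.le)

/-- The size of a tangent vector of `Σ_m` in terms of the coframe. -/
theorem exists_norm_le_coframe : ∃ C : ℝ, 0 < C ∧ ∀ m : ℝ, 0 < m → m < 1 → ∀ z ∈ g.energyLevel m,
    ∀ ξ ∈ g.levelTangent z,
      ‖ξ‖ ≤ C * m * (|g.radialForm z ξ| + |g.transverseForm z ξ| + |g.connectionForm z ξ|) ∧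
      ‖ξ.1‖ ≤ C * m * (|g.radialForm z ξ| + |g.transverseForm z ξ|) := by
  obtain ⟨R, hR, hv⟩ := g.exists_norm_le
  obtain ⟨C, hC, hcov⟩ := g.exists_norm_covDeriv_le R
  refine ⟨R * (1 + 3 * R + 4 * C * R + C) + R, by positivity, fun m hm hm1 z hz ξ hξ => ?_⟩
  obtain ⟨hx, hxv, hE⟩ := g.mem_energyLevel.1 hz
  have hj : ‖g.rot z.1 z.2‖ ≤ R * m := hv m hm (z.1, g.rot z.1 z.2) (g.mem_energyLevel.2
    ⟨hx, g.rot_tangent _ _, by rw [g.form_rot_rot hx hxv hxv]; exact hE⟩)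
  have hvz := hv m hm z hz
  set p := g.radialForm z ξ
  set q := g.transverseForm z ξ
  set r := g.connectionForm z ξ
  have hRm : 0 ≤ R * m := by positivity
  have hRm1 : R * m ≤ R := by nlinarith
  have e := g.eq_bundleLift_coframe hm hz hξ
  have h1 : ‖p • z.2 + q • g.rot z.1 z.2‖ ≤ R * m * (|p| + |q|) := by
    refine (norm_add_le _ _).trans ?_
    rw [norm_smul, norm_smul, Real.norm_eq_abs, Real.norm_eq_abs]
    nlinarith [abs_nonneg p, abs_nonneg q]
  have hx1 := norm_le_one_of_unit hx
  have e1 : ξ.1 = p • z.2 + q • g.rot z.1 z.2 := congrArg Prod.fst e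
  have e2 : ξ.2 = r • g.rot z.1 z.2 - (z.2 ⬝ᵥ ξ.1) • z.1
      - g.covDeriv z.1 z.2 ξ.1 (-(z.2 ⬝ᵥ ξ.1) • z.1) := by
    rw [e1]; exact congrArg Prod.snd e
  rw [← e1] at h1
  have hd := abs_dot_le z.2 ξ.1
  set A := ‖ξ.1‖
  have hA : 0 ≤ A := norm_nonneg _
  have hd' : |z.2 ⬝ᵥ ξ.1| ≤ 3 * R * A := by nlinarith
  have n1 : ‖(z.2 ⬝ᵥ ξ.1) • z.1‖ ≤ 3 * R * A := by
    rw [norm_smul, Real.norm_eq_abs]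
    nlinarith [abs_nonneg (z.2 ⬝ᵥ ξ.1), norm_nonneg z.1]
  have n2 := hcov z.1 z.2 ξ.1 (-(z.2 ⬝ᵥ ξ.1) • z.1) hx (hvz.trans hRm1)
  rw [neg_smul, norm_neg] at n2
  have n3 : ‖r • g.rot z.1 z.2‖ ≤ R * m * |r| := by
    rw [norm_smul, Real.norm_eq_abs, mul_comm]
    exact mul_le_mul_of_nonneg_right hj (abs_nonneg r)
  have n4 : ‖ξ.2‖ ≤ R * m * |r| + 3 * R * A + C * (A + 3 * R * A) := by
    rw [e2]
    refine (norm_sub_le _ _).trans (add_le_add ((norm_sub_le _ _).trans (add_le_add n3 n1)) ?_)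
    rw [neg_smul]
    exact n2.trans (mul_le_mul_of_nonneg_left (by linarith) hC.le)
  have hs : 0 ≤ |p| + |q| := by positivity
  have hr0 := abs_nonneg r
  have n5 : R * m * |r| + 3 * R * A + C * (A + 3 * R * A)
      ≤ R * m * |r| + (3 * R + C + 3 * C * R) * (R * m * (|p| + |q|)) := by
    have : (3 * R + C + 3 * C * R) * A ≤ (3 * R + C + 3 * C * R) * (R * m * (|p| + |q|)) := by
      gcongr
    linarith
  have hcoef : R * (1 + 3 * R + 4 * C * R + C) + R
      = R + R * (3 * R + C + 3 * C * R) + R + R * (C * R) := by ring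
  have k1 : A ≤ (R * (1 + 3 * R + 4 * C * R + C) + R) * m * (|p| + |q|) := by
    refine h1.trans ?_
    gcongr
    rw [hcoef]
    have : 0 ≤ R * (3 * R + C + 3 * C * R) + R + R * (C * R) := by positivity
    linarith
  refine ⟨max_le (k1.trans ?_) (n4.trans (n5.trans ?_)), k1⟩
  · exact mul_le_mul_of_nonneg_left (by linarith) (by positivity)
  · have a1 : 0 ≤ R * (3 * R + C + 3 * C * R) * m * |r| := by positivity
    have a2 : 0 ≤ (2 * R + R * (C * R)) * m * (|p| + |q|) := by positivity
    have a3 : 0 ≤ (R + R * (C * R)) * m * |r| := by positivity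
    rw [hcoef]
    nlinarith

/-- The estimates by which, for small `m`, the linearised Reeb flow on `ker α` is close to the
rotation with velocity `1 / c`. They hold because `v = O(m)` on `Σ_m`, so that `h = c f + O(m)`, and
`c r = O(m) (|p| + |q|)` on `ker α`; the derivative of `h` is bounded, but tangent vectors of `Σ_m`
have length `O(m)` in terms of the coframe. -/
theorem exists_estimates (hβ : ContDiff ℝ ∞ β) : ∃ C m₁ : ℝ, 0 < C ∧ 0 < m₁ ∧ m₁ ≤ 1 ∧
    ∀ m : ℝ, 0 < m → m < m₁ → ∀ z ∈ g.energyLevel m,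
      0 < g.reebScale σ β z ∧
      |g.strength σ z.1 / g.reebScale σ β z - σ.mean⁻¹| ≤ C * m ∧
      ‖(g.reebField σ β z).1‖ ≤ C * m ∧
      ∀ ξ ∈ g.levelTangent z, g.contactPrimitive σ β z ξ = 0 →
        |fderiv ℝ (g.reebScale σ β) z ξ / g.reebScale σ β z ^ 2|
          ≤ C * m * (|g.radialForm z ξ| + |g.transverseForm z ξ|) ∧
        |g.connectionForm z ξ / g.reebScale σ β z|
          ≤ C * m * (|g.radialForm z ξ| + |g.transverseForm z ξ|) := by
  obtain ⟨R, hR, hv⟩ := g.exists_norm_le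
  obtain ⟨δ, hδ, hf⟩ := g.exists_mean_mul_strength_ge σ
  obtain ⟨C, hC, hξC⟩ := g.exists_norm_le_coframe
  obtain ⟨B, hB⟩ := isCompact_sphere.exists_bound_of_continuousOn hβ.continuous.continuousOn
  have hKD : IsCompact ({x : R3 | x ⬝ᵥ x = 1} ×ˢ Metric.closedBall (0 : R3) R) :=
    isCompact_sphere.prod (isCompact_closedBall _ _)
  obtain ⟨D, hD⟩ := hKD.exists_bound_of_continuousOn (f := fderiv ℝ (g.reebScale σ β))
    (fun z hz => ((g.contDiffAt_reebScale σ β hβ (g.areaSq_pos hz.1)).fderiv_right (m := 0)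
      (by simp)).continuousAt.continuousWithinAt)
  have hc := σ.mean_ne_zero
  set c := σ.mean
  have hc0 : 0 < |c| := abs_pos.2 hc
  have hB0 : 0 ≤ B := (norm_nonneg _).trans (hB ![1, 0, 0] (by simp))
  have hD0 : 0 ≤ D := (norm_nonneg _).trans
    (hD (![1, 0, 0], 0) ⟨by simp, Metric.mem_closedBall_self hR.le⟩)
  -- `L m` bounds `m² - β(v)`, and `η` is half of the lower bound of `c f`; for `L m ≤ η` it is a
  -- lower bound of `h`.
  set L := B * R + 1 with hL
  have hL0 : 0 < L := by positivity
  set η := δ / 2 with hη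
  have hη0 : 0 < η := by positivity
  refine ⟨L / (|c| * η) + R / η + D * (C * (1 + L / |c|)) / η ^ 2 + L / (|c| * η),
    min 1 (η / L), by positivity, by positivity, min_le_left _ _, fun m hm hm1 z hz => ?_⟩
  have hm1' : m < 1 := hm1.trans_le (min_le_left _ _)
  have hmL : L * m ≤ η := by
    have := hm1.trans_le (min_le_right _ _)
    rw [lt_div_iff₀ hL0] at this
    linarith
  obtain ⟨hx, hxv, hE⟩ := g.mem_energyLevel.1 hz
  have hvz := hv m hm z hz
  have hj : ‖g.rot z.1 z.2‖ ≤ R * m := hv m hm (z.1, g.rot z.1 z.2) (g.mem_energyLevel.2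
    ⟨hx, g.rot_tangent _ _, by rw [g.form_rot_rot hx hxv hxv]; exact hE⟩)
  have hβw : ∀ w : R3, ‖w‖ ≤ R * m → |β z.1 w| ≤ B * R * m := fun w hw => by
    have := (β z.1).le_of_opNorm_le (hB z.1 hx) w
    rw [Real.norm_eq_abs] at this
    exact this.trans ((mul_le_mul_of_nonneg_left hw hB0).trans_eq (by ring))
  have hβv := hβw _ hvz
  have hβj := hβw _ hj
  have hRm1 : R * m ≤ R := mul_le_of_le_one_right hR.le hm1'.le
  have hBRm : 0 ≤ B * R * m := by positivity
  have hscale : g.reebScale σ β z = m ^ 2 + c * g.strength σ z.1 - β z.1 z.2 := by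
    rw [reebScale, hE]
  set h := g.reebScale σ β z
  have hh : η ≤ h := by
    rw [hscale]
    have := hf z.1 hx
    have h2 := le_abs_self (β z.1 z.2)
    have h3 : 0 ≤ m ^ 2 := by positivity
    have h4 : B * R * m ≤ η := by rw [hL] at hmL; nlinarith
    linarith
  have hh0 : 0 < h := hη0.trans_le hh
  have hinv : h⁻¹ ≤ η⁻¹ := inv_anti₀ hη0 hh
  have hLm : |β z.1 z.2 - m ^ 2| ≤ L * m := by
    have := abs_sub (β z.1 z.2) (m ^ 2)
    have h2 : |m ^ 2| ≤ m := by rw [abs_of_pos (by positivity)]; nlinarith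
    rw [hL]; linarith
  have t1 : 0 ≤ L / (|c| * η) := by positivity
  have t2 : 0 ≤ R / η := by positivity
  have t3 : 0 ≤ D * (C * (1 + L / |c|)) / η ^ 2 := by positivity
  refine ⟨hh0, ?_, ?_, fun ξ hξ hα => ?_⟩
  · have e : g.strength σ z.1 / h - c⁻¹ = (β z.1 z.2 - m ^ 2) / (c * h) := by
      field_simp
      rw [hscale]; ring
    rw [e, abs_div, abs_mul, abs_of_pos hh0]
    have h1 : |β z.1 z.2 - m ^ 2| / (|c| * h) ≤ L * m / (|c| * η) := by gcongr
    have h2 : L * m / (|c| * η) = L / (|c| * η) * m := by ring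
    refine (h1.trans_eq h2).trans ?_
    gcongr
    linarith
  · rw [show (g.reebField σ β z).1 = h⁻¹ • z.2 from rfl, norm_smul, norm_inv,
      Real.norm_of_nonneg hh0.le]
    have h1 : h⁻¹ * ‖z.2‖ ≤ η⁻¹ * (R * m) := by gcongr
    have h2 : η⁻¹ * (R * m) = R / η * m := by ring
    refine (h1.trans_eq h2).trans ?_
    gcongr
    linarith
  · have hb := ((g.mem_levelTangent (g.areaSq_pos hx) hxv).1 hξ).1.1
    rw [g.contactPrimitive_coframe σ β hm hz hb] at hα
    have hn := (hξC m hm hm1' z hz ξ hξ).1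
    set p := g.radialForm z ξ
    set q := g.transverseForm z ξ
    set r := g.connectionForm z ξ
    have hs : 0 ≤ |p| + |q| := by positivity
    have hr : |r| ≤ L / |c| * m * (|p| + |q|) := by
      have e : c * r = (β z.1 z.2 - m ^ 2) * p + β z.1 (g.rot z.1 z.2) * q := by
        linear_combination hα
      have h1 : |c| * |r| ≤ L * m * |p| + B * R * m * |q| := by
        rw [← abs_mul, e]
        refine (abs_add_le _ _).trans ?_
        rw [abs_mul, abs_mul]
        gcongr
      have h2 : B * R * m * |q| ≤ L * m * |q| := by
        have : B * R ≤ L := by rw [hL]; linarith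
        gcongr
      have h3 : |r| ≤ (L * m * (|p| + |q|)) / |c| := by
        rw [le_div_iff₀ hc0]; linarith
      refine h3.trans (le_of_eq ?_)
      ring
    have hr1 : |r| ≤ L / |c| * (|p| + |q|) := by
      refine hr.trans ?_
      have : L / |c| * m ≤ L / |c| := mul_le_of_le_one_right (by positivity) hm1'.le
      exact mul_le_mul_of_nonneg_right this hs
    constructor
    · have h1 := (fderiv ℝ (g.reebScale σ β) z).le_of_opNorm_le
        (hD z ⟨hx, mem_closedBall_zero_iff.2 (hvz.trans hRm1)⟩) ξ
      rw [Real.norm_eq_abs] at h1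
      have h2 : ‖ξ‖ ≤ C * m * ((|p| + |q|) * (1 + L / |c|)) := by
        refine hn.trans ?_
        gcongr
        linarith
      rw [abs_div, abs_of_pos (pow_pos hh0 2)]
      have h3 : |fderiv ℝ (g.reebScale σ β) z ξ| / h ^ 2
          ≤ D * (C * m * ((|p| + |q|) * (1 + L / |c|))) / η ^ 2 := by
        gcongr
        exact h1.trans (by gcongr)
      refine h3.trans ?_
      have h4 : D * (C * m * ((|p| + |q|) * (1 + L / |c|))) / η ^ 2
          = D * (C * (1 + L / |c|)) / η ^ 2 * m * (|p| + |q|) := by ring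
      rw [h4]
      gcongr
      linarith
    · rw [abs_div, abs_of_pos hh0]
      have h3 : |r| / h ≤ L / |c| * m * (|p| + |q|) / η := by gcongr
      refine h3.trans ?_
      have h4 : L / |c| * m * (|p| + |q|) / η = L / (|c| * η) * m * (|p| + |q|) := by
        field_simp
      rw [h4]
      gcongr
      linarith

end SphereMetric

/-! ### Continuous angles -/

section Angle

open Set

/-- A nowhere vanishing function on the plane has a continuous logarithm. -/
theorem exists_log {f : ℝ × ℝ → ℂ} (hf : Continuous f) (h0 : ∀ p, f p ≠ 0) :
    ∃ L : ℝ × ℝ → ℂ, Continuous L ∧ ∀ p, Complex.exp (L p) = f p := by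
  obtain ⟨L, ⟨-, h⟩, -⟩ := Complex.isCoveringMapOn_exp.existsUnique_continuousMap_lifts
    (⟨f, hf⟩ : C(ℝ × ℝ, ℂ)) (a₀ := 0) (Complex.exp_log (h0 0)) h0
  exact ⟨L, L.continuous, fun p => congrFun h p⟩

theorem exists_log_Icc {T : ℝ} (hT : 0 ≤ T) {f : ℝ → ℂ} (hf : ContinuousOn f (Icc 0 T))
    (h0 : ∀ t ∈ Icc 0 T, f t ≠ 0) :
    ∃ L : ℝ → ℂ, ContinuousOn L (Icc 0 T) ∧ ∀ t ∈ Icc 0 T, Complex.exp (L t) = f t := by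
  have hc : Continuous fun t : ℝ × ℝ => f (projIcc 0 T hT t.1) :=
    (continuousOn_iff_continuous_domRestrict.1 hf).comp (continuous_projIcc.comp continuous_fst)
  obtain ⟨L, hL, h⟩ := exists_log hc fun p => h0 _ (projIcc 0 T hT p.1).2
  refine ⟨fun t => L (t, 0), (hL.comp (by fun_prop)).continuousOn, fun t ht => ?_⟩
  rw [h, projIcc_of_mem hT ht]

/-- A continuous function on an interval with values in `2πi ℤ` is constant. -/
theorem eq_of_exp_eq_one {T : ℝ} (hT : 0 ≤ T) {f : ℝ → ℂ} (hf : ContinuousOn f (Icc 0 T))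
    (h : ∀ t ∈ Icc 0 T, Complex.exp (f t) = 1) : f T = f 0 := by
  have h2 : ∀ t ∈ Icc 0 T, ∃ n : ℤ, f t = n * (2 * Real.pi * Complex.I) := fun t ht =>
    Complex.exp_eq_one_iff.1 (h t ht)
  have hpi := Real.pi_pos
  have hg : ContinuousOn (fun t => (f t).im / (2 * Real.pi)) (Icc 0 T) :=
    (Complex.continuous_im.comp_continuousOn hf).div_const _
  have hr : MapsTo (fun t => (f t).im / (2 * Real.pi)) (Icc 0 T) (range ((↑) : ℤ → ℝ)) := by
    intro t ht
    obtain ⟨n, hn⟩ := h2 t ht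
    refine ⟨n, ?_⟩
    simp only [hn]
    simp
  have hc := isPreconnected_Icc.constant_of_mapsTo
    Int.isClosedEmbedding_coe_real.isEmbedding.isInducing.isDiscrete_range hg hr (right_mem_Icc.2 hT) (left_mem_Icc.2 hT)
  obtain ⟨n, hn⟩ := h2 T (right_mem_Icc.2 hT)
  obtain ⟨k, hk⟩ := h2 0 (left_mem_Icc.2 hT)
  simp only [hn, hk] at hc ⊢
  have : n = k := by
    have h3 : (n : ℝ) = k := by simpa using hc
    exact_mod_cast h3
  rw [this]

/-- A continuous logarithm of a differentiable function is differentiable. -/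
theorem hasDerivWithinAt_log {T : ℝ} {ℓ w : ℝ → ℂ} (hℓ : ContinuousOn ℓ (Icc 0 T))
    (he : ∀ t ∈ Icc 0 T, Complex.exp (ℓ t) = w t) {t : ℝ} (ht : t ∈ Icc 0 T) {w' : ℂ}
    (hw : HasDerivWithinAt w w' (Icc 0 T) t) : HasDerivWithinAt ℓ (w' / w t) (Icc 0 T) t := by
  have hw0 : w t ≠ 0 := by rw [← he t ht]; exact Complex.exp_ne_zero _
  have h1 : HasDerivWithinAt (fun s => ℓ t + Complex.log (w s / w t)) (w' / w t) (Icc 0 T) t := by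
    have h2 := (hw.div_const (w t)).clog_real (by simp [div_self hw0])
    refine (h2.const_add (ℓ t)).congr_deriv ?_
    rw [div_self hw0, div_one]
  refine h1.congr_of_eventuallyEq ?_ (by simp [div_self hw0])
  have hc : ContinuousWithinAt (fun s => (ℓ s - ℓ t).im) (Icc 0 T) t :=
    Complex.continuous_im.continuousAt.comp_continuousWithinAt ((hℓ t ht).sub
      continuousWithinAt_const)
  have e1 : ∀ᶠ s in 𝓝[Icc 0 T] t, (ℓ s - ℓ t).im < Real.pi :=
    hc.eventually_lt_const (by simpa using Real.pi_pos)
  have e2 : ∀ᶠ s in 𝓝[Icc 0 T] t, -Real.pi < (ℓ s - ℓ t).im :=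
    hc.eventually_const_lt (by simpa using Real.pi_pos)
  filter_upwards [e1, e2, self_mem_nhdsWithin] with s h1 h2 hs
  rw [← he s hs, ← he t ht, ← Complex.exp_sub, Complex.log_exp h2 h1.le]
  ring

/-- If `w` nearly rotates with angular velocity `ν`, then its total angle is nearly `ν T`. -/
theorem abs_angle_sub_le {T ν η : ℝ} (hT : 0 ≤ T) {ℓ w w' : ℝ → ℂ}
    (hℓ : ContinuousOn ℓ (Icc 0 T)) (he : ∀ t ∈ Icc 0 T, Complex.exp (ℓ t) = w t)
    (hw : ∀ t ∈ Icc 0 T, HasDerivAt w (w' t) t)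
    (hb : ∀ t ∈ Icc 0 T, ‖w' t - ν * Complex.I * w t‖ ≤ η * ‖w t‖) :
    |(ℓ T).im - (ℓ 0).im - ν * T| ≤ η * T := by
  have hd : ∀ t ∈ Icc 0 T, HasDerivWithinAt (fun t : ℝ => ℓ t - (t : ℂ) * (ν * Complex.I))
      (w' t / w t - ν * Complex.I) (Icc 0 T) t := fun t ht => by
    have h1 : HasDerivWithinAt (fun t : ℝ => (t : ℂ) * (ν * Complex.I)) (1 * (ν * Complex.I))
        (Icc 0 T) t := (Complex.ofRealCLM.hasDerivAt.mul_const _).hasDerivWithinAt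
    simpa using (hasDerivWithinAt_log hℓ he ht (hw t ht).hasDerivWithinAt).fun_sub h1
  have h := norm_image_sub_le_of_norm_deriv_le_segment' (C := η) hd (fun t ht => by
    have ht' := Ico_subset_Icc_self ht
    have hw0 : w t ≠ 0 := by rw [← he t ht']; exact Complex.exp_ne_zero _
    have e : w' t / w t - ν * Complex.I = (w' t - ν * Complex.I * w t) / w t := by
      field_simp
    rw [e, norm_div, div_le_iff₀ (norm_pos_iff.2 hw0)]
    exact hb t ht') T (right_mem_Icc.2 hT)
  have h2 := (Complex.abs_im_le_norm _).trans h
  simpa [sub_right_comm, mul_comm] using h2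

/-- A solution of a linear equation which does not vanish initially does not vanish later. -/
theorem ne_zero_of_norm_deriv_le {K : ℝ} {w w' : ℝ → ℂ} (h0 : w 0 ≠ 0)
    (hw : ∀ t, 0 ≤ t → HasDerivAt w (w' t) t) (hb : ∀ t, 0 ≤ t → ‖w' t‖ ≤ K * ‖w t‖) {t : ℝ}
    (ht : 0 ≤ t) : w t ≠ 0 := by
  intro h
  have hd : ∀ s ∈ Icc 0 t, HasDerivAt (fun s => w (t - s)) (-w' (t - s)) s := fun s hs => by
    have : HasDerivAt (w ∘ fun s => t - s) _ s :=
      (hw (t - s) (by linarith [hs.2])).scomp s ((hasDerivAt_id s).const_sub t)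
    simpa [Function.comp_def] using this
  have := eq_zero_of_abs_deriv_le_mul_abs_self_of_eq_zero_right (K := K) (a := 0) (b := t)
    (fun s hs => (hd s hs).continuousAt.continuousWithinAt)
    (fun s hs => (hd s (Ico_subset_Icc_self hs)).hasDerivWithinAt) (by simpa using h)
    (fun s hs => by rw [norm_neg]; exact hb _ (by linarith [hs.2])) t (right_mem_Icc.2 ht)
  exact h0 (by simpa using this)

/-- Total angles are the same, up to an error less than `π`, in a frame which extends to a frame
over a disc. The real frame `u, v` of `ℂ` depends on two parameters; in terms of `y = y₀ + i y₁` the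
vector `y₀ u + y₁ v` is `a y + b ȳ` with `|b| < |a|`, and `a` has no total angle along a
contractible loop. -/
theorem exists_log_frame {T : ℝ} (hT : 0 < T) {u v : ℝ → ℝ → ℂ}
    (hu : ContinuousOn (fun p : ℝ × ℝ => u p.1 p.2) (Icc 0 1 ×ˢ univ))
    (hv : ContinuousOn (fun p : ℝ × ℝ => v p.1 p.2) (Icc 0 1 ×ˢ univ))
    (hper : ∀ s ∈ Icc (0 : ℝ) 1, ∀ t, u s (t + T) = u s t ∧ v s (t + T) = v s t)
    (hconst : ∀ t, u 0 t = u 0 0 ∧ v 0 t = v 0 0)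
    (hpos : ∀ s ∈ Icc (0 : ℝ) 1, ∀ t, 0 < (starRingEnd ℂ (u s t) * v s t).im)
    {θ ρ : ℝ → ℝ} {w : ℝ → ℂ} (hθ : ContinuousOn θ (Icc 0 T)) (hρ : ∀ t ∈ Icc 0 T, 0 < ρ t)
    (hw : ContinuousOn w (Icc 0 T))
    (he : ∀ t ∈ Icc 0 T,
      w t = (ρ t * Real.cos (θ t) : ℝ) * u 1 t + (ρ t * Real.sin (θ t) : ℝ) * v 1 t) :
    ∃ ℓ : ℝ → ℂ, ContinuousOn ℓ (Icc 0 T) ∧ (∀ t ∈ Icc 0 T, Complex.exp (ℓ t) = w t) ∧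
      |((ℓ T).im - (ℓ 0).im) - (θ T - θ 0)| < Real.pi := by
  let P : ℝ × ℝ → ℝ × ℝ := fun p => (projIcc 0 1 zero_le_one p.1, p.2)
  have hP : Continuous P := by
    have : Continuous fun p : ℝ × ℝ => ((projIcc (0 : ℝ) 1 zero_le_one p.1 : ℝ)) :=
      continuous_subtype_val.comp (continuous_projIcc.comp continuous_fst)
    exact this.prodMk continuous_snd
  have hPm : ∀ p, P p ∈ Icc (0 : ℝ) 1 ×ˢ univ := fun p => ⟨(projIcc 0 1 zero_le_one p.1).2, trivial⟩
  have hPeq : ∀ s ∈ Icc (0 : ℝ) 1, ∀ t, P (s, t) = (s, t) := fun s hs t => by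
    simp only [P]; rw [projIcc_of_mem zero_le_one hs]
  have hnorm : ∀ x y : ℂ, Complex.normSq ((x - Complex.I * y) / 2)
      - Complex.normSq ((x + Complex.I * y) / 2) = (starRingEnd ℂ x * y).im := by
    intro x y
    simp [Complex.normSq_apply]
    ring
  let a : ℝ → ℝ → ℂ := fun s t => (u s t - Complex.I * v s t) / 2
  let b : ℝ → ℝ → ℂ := fun s t => (u s t + Complex.I * v s t) / 2
  have hab : ∀ s ∈ Icc (0 : ℝ) 1, ∀ t, ‖b s t‖ < ‖a s t‖ := fun s hs t => by
    have h1 := hnorm (u s t) (v s t)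
    have h2 := hpos s hs t
    rw [Complex.normSq_eq_norm_sq, Complex.normSq_eq_norm_sq] at h1
    exact lt_of_pow_lt_pow_left₀ 2 (norm_nonneg _) (by simp only [a, b]; linarith)
  have ha0 : ∀ s ∈ Icc (0 : ℝ) 1, ∀ t, a s t ≠ 0 := fun s hs t =>
    norm_pos_iff.1 ((norm_nonneg _).trans_lt (hab s hs t))
  have hac : ContinuousOn (fun p : ℝ × ℝ => a p.1 p.2) (Icc 0 1 ×ˢ univ) :=
    (hu.sub (continuousOn_const.mul hv)).div_const 2
  have hbc : ContinuousOn (fun p : ℝ × ℝ => b p.1 p.2) (Icc 0 1 ×ˢ univ) :=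
    (hu.add (continuousOn_const.mul hv)).div_const 2
  obtain ⟨L, hL, hLe⟩ := exists_log (f := fun p => a (P p).1 (P p).2)
    (hac.comp_continuous hP hPm) (fun p => ha0 _ (hPm p).1 _)
  have hLe' : ∀ s ∈ Icc (0 : ℝ) 1, ∀ t, Complex.exp (L (s, t)) = a s t := fun s hs t => by
    rw [hLe, hPeq s hs t]
  -- The total angle of `a` along the loops is continuous, and vanishes for the constant loop.
  have hL0 : L (0, T) = L (0, 0) := by
    have := eq_of_exp_eq_one (f := fun t => L (0, t) - L (0, 0)) hT.le
      (((hL.comp (by fun_prop)).sub continuous_const).continuousOn) (fun t _ => by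
        rw [Complex.exp_sub, hLe' 0 (by simp), hLe' 0 (by simp)]
        have : a 0 t = a 0 0 := by simp only [a, (hconst t).1, (hconst t).2]
        rw [this, div_self (ha0 0 (by simp) 0)])
    exact sub_eq_zero.1 (by simpa using this)
  have hL1 : L (1, T) = L (1, 0) := by
    have := eq_of_exp_eq_one (f := fun s => L (s, T) - L (s, 0)) zero_le_one
      (((hL.comp (by fun_prop)).sub (hL.comp (by fun_prop))).continuousOn) (fun s hs => by
        rw [Complex.exp_sub, hLe' s hs, hLe' s hs]
        have h1 := hper s hs 0
        rw [zero_add] at h1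
        have : a s T = a s 0 := by simp only [a, h1.1, h1.2]
        rw [this, div_self (ha0 s hs 0)])
    rw [hL0, sub_self] at this
    exact sub_eq_zero.1 this
  have h1mem : (1 : ℝ) ∈ Icc (0 : ℝ) 1 := by simp
  -- Along `y = ρ exp(iθ)` one has `w = ρ a exp(iθ) κ`, and `κ` stays in the right half-plane as
  -- `|b| < |a|`; so `arg κ` contributes less than `π`.
  let κ : ℝ → ℂ := fun t => 1 + b 1 t / a 1 t * Complex.exp (-(2 * θ t * Complex.I))
  have hκre : ∀ t, 0 < (κ t).re := fun t => by
    have h1 : ‖b 1 t / a 1 t * Complex.exp (-(2 * θ t * Complex.I))‖ < 1 := by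
      have h2 : ‖Complex.exp (-(2 * θ t * Complex.I))‖ = 1 := by
        rw [Complex.norm_exp]; simp
      rw [norm_mul, norm_div, h2, mul_one, div_lt_one (norm_pos_iff.2 (ha0 1 h1mem t))]
      exact hab 1 h1mem t
    have h3 := (abs_lt.1 ((Complex.abs_re_le_norm _).trans_lt h1)).1
    simp only [κ, Complex.add_re, Complex.one_re]
    linarith
  have hκ0 : ∀ t, κ t ≠ 0 := fun t h => by have := hκre t; rw [h] at this; simp at this
  have hcs : ∀ f : ℝ → ℝ → ℂ, ContinuousOn (fun p : ℝ × ℝ => f p.1 p.2) (Icc 0 1 ×ˢ univ) →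
      Continuous (f 1) := fun f hf =>
    hf.comp_continuous (f := fun t : ℝ => ((1 : ℝ), t)) (by fun_prop) fun t => ⟨h1mem, trivial⟩
  have hθc : ContinuousOn (fun t => (θ t : ℂ)) (Icc 0 T) :=
    Complex.continuous_ofReal.comp_continuousOn hθ
  have hκc : ContinuousOn κ (Icc 0 T) := by
    refine continuousOn_const.add (ContinuousOn.mul ?_ ?_)
    · exact ((hcs b hbc).div (hcs a hac) (ha0 1 h1mem)).continuousOn
    · exact Complex.continuous_exp.comp_continuousOn
        ((continuousOn_const.mul hθc).mul continuousOn_const).neg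
  let ℓ₀ : ℝ → ℂ := fun t => L (1, t) + θ t * Complex.I + Complex.log (κ t)
  have hℓ₀c : ContinuousOn ℓ₀ (Icc 0 T) := by
    refine ContinuousOn.add (ContinuousOn.add (hL.comp (by fun_prop)).continuousOn
      (hθc.mul continuousOn_const)) (hκc.clog fun t _ => ?_)
    exact Or.inl (hκre t)
  have hkey : ∀ t ∈ Icc 0 T, w t = ρ t * Complex.exp (ℓ₀ t) := fun t ht => by
    have e1 : Complex.exp (ℓ₀ t) = a 1 t * Complex.exp (θ t * Complex.I) * κ t := by
      simp only [ℓ₀]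
      rw [Complex.exp_add, Complex.exp_add, hLe' 1 h1mem, Complex.exp_log (hκ0 t)]
    have e2 : Complex.exp (θ t * Complex.I) * Complex.exp (-(2 * θ t * Complex.I))
        = Complex.exp (-(θ t) * Complex.I) := by
      rw [← Complex.exp_add]; congr 1; ring
    have e3 : a 1 t * Complex.exp (θ t * Complex.I) * κ t = a 1 t * Complex.exp (θ t * Complex.I)
        + b 1 t * Complex.exp (-(θ t) * Complex.I) := by
      rw [← e2]
      simp only [κ]
      field_simp [ha0 1 h1mem t]
    rw [he t ht, e1, e3, Complex.exp_mul_I, Complex.exp_mul_I, Complex.cos_neg, Complex.sin_neg]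
    simp only [a, b]
    push_cast
    linear_combination ((ρ t : ℂ) * Complex.sin (θ t) * v 1 t) * Complex.I_sq
  have hρc : ContinuousOn ρ (Icc 0 T) := by
    have : ContinuousOn (fun t => ‖w t‖ / ‖Complex.exp (ℓ₀ t)‖) (Icc 0 T) :=
      hw.norm.div (Complex.continuous_exp.comp_continuousOn hℓ₀c).norm fun t _ =>
        norm_ne_zero_iff.2 (Complex.exp_ne_zero _)
    refine this.congr fun t ht => ?_
    simp only
    rw [hkey t ht, norm_mul, Complex.norm_real, Real.norm_of_nonneg (hρ t ht).le,
      mul_div_cancel_right₀ _ (norm_ne_zero_iff.2 (Complex.exp_ne_zero _))]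
  refine ⟨fun t => ℓ₀ t + (Real.log (ρ t) : ℝ), hℓ₀c.add (Complex.continuous_ofReal.comp_continuousOn
    (hρc.log fun t ht => (hρ t ht).ne')), fun t ht => ?_, ?_⟩
  · simp only
    rw [Complex.exp_add, hkey t ht, ← Complex.ofReal_exp, Real.exp_log (hρ t ht), mul_comm]
  · have harg : ∀ t, |(Complex.log (κ t)).im| < Real.pi / 2 := fun t => by
      rw [Complex.log_im, Complex.abs_arg_lt_pi_div_two_iff]
      exact Or.inl (hκre t)
    have h1 := abs_lt.1 (harg T)
    have h2 := abs_lt.1 (harg 0)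
    simp only [ℓ₀, hL1, Complex.add_im, Complex.mul_im, Complex.ofReal_re, Complex.ofReal_im,
      Complex.I_re, Complex.I_im]
    rw [abs_lt]
    constructor <;> linarith

/-- The total angles of two functions whose quotient avoids the negative real axis differ by the
difference of the arguments of this quotient at the ends. -/
theorem angle_sub_angle_of_mem_slitPlane {T : ℝ} (hT : 0 ≤ T) {ℓ₁ ℓ₂ : ℝ → ℂ}
    (h₁ : ContinuousOn ℓ₁ (Icc 0 T)) (h₂ : ContinuousOn ℓ₂ (Icc 0 T))
    (h : ∀ t ∈ Icc 0 T, Complex.exp (ℓ₁ t) / Complex.exp (ℓ₂ t) ∈ Complex.slitPlane) :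
    ((ℓ₁ T).im - (ℓ₁ 0).im) - ((ℓ₂ T).im - (ℓ₂ 0).im) =
      (Complex.exp (ℓ₁ T) / Complex.exp (ℓ₂ T)).arg
        - (Complex.exp (ℓ₁ 0) / Complex.exp (ℓ₂ 0)).arg := by
  simp only [← Complex.exp_sub] at h ⊢
  have hc : ContinuousOn (fun t => ℓ₁ t - ℓ₂ t - Complex.log (Complex.exp (ℓ₁ t - ℓ₂ t)))
      (Icc 0 T) :=
    (h₁.sub h₂).sub ((Complex.continuous_exp.comp_continuousOn (h₁.sub h₂)).clog h)
  have := congrArg Complex.im (eq_of_exp_eq_one hT hc fun t _ => by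
    rw [Complex.exp_sub, Complex.exp_log (Complex.exp_ne_zero _), div_self (Complex.exp_ne_zero _)])
  simp only [Complex.sub_im, Complex.log_im] at this
  linarith

end Angle

/-! ### The Maslov index of a path of matrices -/

section Index

open Set

/-- Every compact interval has a lower index. -/
theorem exists_isIntervalIndex (A B : ℝ) :
    ∃ n, ∀ᶠ ε in 𝓝[>] (0 : ℝ), IsIntervalIndex ((fun r => r - ε) '' Icc A B) n := by
  have h1 := Int.ceil_lt_add_one B
  have h2 := Int.le_ceil B
  have hev : ∀ {a : ℝ}, 0 < a → ∀ᶠ ε in 𝓝[>] (0 : ℝ), ε ∈ Ioo 0 a := fun ha =>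
    Ioo_mem_nhdsGT ha
  by_cases hA : A ≤ (⌈B⌉ - 1 : ℤ)
  · refine ⟨2 * (⌈B⌉ - 1), ?_⟩
    push_cast at hA
    filter_upwards [hev (a := B - (⌈B⌉ - 1)) (by linarith)] with ε hε
    refine ⟨⌈B⌉ - 1, Or.inl ⟨rfl, (⌈B⌉ - 1) + ε, ⟨?_, ?_⟩, ?_⟩⟩
    · linarith [hε.1]
    · linarith [hε.2]
    · push_cast; ring
  · refine ⟨2 * (⌈B⌉ - 1) + 1, ?_⟩
    push_cast at hA
    filter_upwards [hev (a := A - (⌈B⌉ - 1)) (by linarith)] with ε hε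
    refine ⟨⌈B⌉ - 1, Or.inr ⟨rfl, ?_⟩⟩
    rintro _ ⟨r, hr, rfl⟩
    push_cast
    exact ⟨by linarith [hε.2, hr.1], by linarith [hε.1, hr.2]⟩

/-- An interval to the right of some `a > 1` stays to the right of `1` after a small shift. -/
theorem three_le_of_isIntervalIndex {I : Set ℝ} (hI : I.Nonempty) {a : ℝ} (ha : 1 < a)
    (h : ∀ r ∈ I, a ≤ r) {n : ℤ}
    (hn : ∀ᶠ ε in 𝓝[>] (0 : ℝ), IsIntervalIndex ((fun r => r - ε) '' I) n) : 3 ≤ n := by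
  obtain ⟨ε, ⟨k, hk⟩, hε⟩ := (hn.and (Ioo_mem_nhdsGT (sub_pos.2 ha))).exists
  rcases hk with ⟨rfl, r, hr, hk⟩ | ⟨rfl, hk⟩
  · have h1 : (1 : ℝ) < k := by
      rw [← hk]
      linarith [h r hr, hε.2]
    have h2 : 1 < k := by exact_mod_cast h1
    lia
  · obtain ⟨r, hr⟩ := hI
    have h1 : (0 : ℝ) < k := by linarith [(hk ⟨r, hr, rfl⟩).2, h r hr, hε.2]
    have h2 : 0 < k := by exact_mod_cast h1
    lia

/-- A vector of the plane as a complex number. -/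
def toComplex (u : Fin 2 → ℝ) : ℂ := ⟨u 0, u 1⟩

theorem toComplex_polar (ρ θ : ℝ) :
    toComplex ![ρ * Real.cos θ, ρ * Real.sin θ] = ρ * Complex.exp (θ * Complex.I) := by
  rw [Complex.exp_mul_I]
  apply Complex.ext <;> simp [toComplex, Complex.cos_ofReal_re, Complex.sin_ofReal_re]

theorem toComplex_ne_zero {u : Fin 2 → ℝ} (hu : u ≠ 0) : toComplex u ≠ 0 := by
  intro h
  apply hu
  ext i
  fin_cases i
  · exact congrArg Complex.re h
  · exact congrArg Complex.im h

theorem toComplex_injective : Function.Injective toComplex := fun u v h => by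
  ext i
  fin_cases i
  · exact congrArg Complex.re h
  · exact congrArg Complex.im h

theorem toComplex_smul (a : ℝ) (u : Fin 2 → ℝ) : toComplex (a • u) = a * toComplex u := by
  apply Complex.ext <;> simp [toComplex]

theorem continuous_toComplex : Continuous toComplex := by
  have : toComplex = fun u => (u 0 : ℂ) + u 1 * Complex.I := by
    funext u
    apply Complex.ext <;> simp [toComplex]
  rw [this]
  fun_prop

theorem exists_polar {u : Fin 2 → ℝ} (hu : u ≠ 0) :
    ∃ R x : ℝ, 0 < R ∧ x ∈ Icc (-Real.pi) Real.pi ∧ u = R • ![Real.cos x, Real.sin x] := by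
  refine ⟨‖toComplex u‖, (toComplex u).arg, norm_pos_iff.2 (toComplex_ne_zero hu),
    ⟨(Complex.neg_pi_lt_arg _).le, Complex.arg_le_pi _⟩, toComplex_injective ?_⟩
  have := toComplex_polar 1 (toComplex u).arg
  simp only [one_mul, Complex.ofReal_one] at this
  rw [toComplex_smul, this, Complex.norm_mul_exp_arg_mul_I]

/-- The interval `I(Ψ)` is compact and not empty: it is the image of the circle of directions. -/
theorem exists_rotationInterval_eq_Icc {T : ℝ} (hT : 0 ≤ T) {Ψ : ℝ → Matrix (Fin 2) (Fin 2) ℝ}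
    (hc : ContinuousOn Ψ (Icc 0 T)) (h0 : ∀ t ∈ Icc 0 T, ∀ u, u ≠ 0 → Ψ t *ᵥ u ≠ 0) :
    ∃ A B, A ≤ B ∧ rotationInterval Ψ T = Icc A B := by
  have hpi := Real.pi_pos
  let c : ℝ → Icc 0 T := projIcc 0 T hT
  have hΨ : Continuous fun t => Ψ (c t) :=
    (continuousOn_iff_continuous_domRestrict.1 hc).comp continuous_projIcc
  have hcs : ∀ x : ℝ, ![Real.cos x, Real.sin x] ≠ 0 := fun x h => by
    have h1 : Real.cos x = 0 := congrFun h 0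
    have h2 : Real.sin x = 0 := congrFun h 1
    have := Real.sin_sq_add_cos_sq x
    rw [h1, h2] at this
    norm_num at this
  obtain ⟨L, hL, hLe⟩ := exists_log
    (f := fun p => toComplex (Ψ (c p.2) *ᵥ ![Real.cos p.1, Real.sin p.1]))
    (continuous_toComplex.comp ((hΨ.comp continuous_snd).matrix_mulVec (by
      refine continuous_pi fun i => ?_
      fin_cases i
      · exact Real.continuous_cos.comp continuous_fst
      · exact Real.continuous_sin.comp continuous_fst)))
    (fun p => toComplex_ne_zero (h0 _ (c p.2).2 _ (hcs _)))
  have hLe' : ∀ x, ∀ t ∈ Icc 0 T,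
      Complex.exp (L (x, t)) = toComplex (Ψ t *ᵥ ![Real.cos x, Real.sin x]) := fun x t ht => by
    rw [hLe]
    simp only [c]
    rw [projIcc_of_mem hT ht]
  -- `F x` is the winding number of the vector in the direction `x`.
  let F : ℝ → ℝ := fun x => ((L (x, T)).im - (L (x, 0)).im) / (2 * Real.pi)
  have hF : Continuous F :=
    ((Complex.continuous_im.comp (hL.comp (by fun_prop))).sub
      (Complex.continuous_im.comp (hL.comp (by fun_prop)))).div_const _
  have hI : rotationInterval Ψ T = F '' Icc (-Real.pi) Real.pi := by
    apply Subset.antisymm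
    · rintro _ ⟨u, hu, θ, ρ, hθ, hρ, rfl⟩
      obtain ⟨R, x, hR, hx, rfl⟩ := exists_polar hu
      refine ⟨x, hx, ?_⟩
      have := angle_sub_angle_of_mem_slitPlane hT (ℓ₁ := fun t => L (x, t))
        (ℓ₂ := fun t => θ t * Complex.I) (hL.comp (by fun_prop)).continuousOn
        ((Complex.continuous_ofReal.comp_continuousOn hθ).mul continuousOn_const)
      have key : ∀ t ∈ Icc 0 T, Complex.exp (L (x, t)) / Complex.exp (θ t * Complex.I)
          = (ρ t / R : ℝ) := fun t ht => by
        have h1 := congrArg toComplex (hρ t ht).2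
        rw [toComplex_polar, Matrix.mulVec_smul, toComplex_smul, ← hLe' x t ht] at h1
        have h2 : (R : ℂ) ≠ 0 := by exact_mod_cast hR.ne'
        rw [div_eq_iff (Complex.exp_ne_zero _)]
        push_cast
        field_simp
        linear_combination h1
      have h3 := this fun t ht => by
        rw [key t ht]
        exact Complex.ofReal_mem_slitPlane.2 (div_pos (hρ t ht).1 hR)
      rw [key T (right_mem_Icc.2 hT), key 0 (left_mem_Icc.2 hT),
        Complex.arg_ofReal_of_nonneg (div_pos (hρ T (right_mem_Icc.2 hT)).1 hR).le,
        Complex.arg_ofReal_of_nonneg (div_pos (hρ 0 (left_mem_Icc.2 hT)).1 hR).le] at h3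
      simp only [Complex.mul_im, Complex.ofReal_re, Complex.ofReal_im, Complex.I_re,
        Complex.I_im] at h3
      simp only [F]
      congr 1
      linarith
    · rintro _ ⟨x, -, rfl⟩
      refine ⟨![Real.cos x, Real.sin x], hcs x, fun t => (L (x, t)).im,
        fun t => Real.exp (L (x, t)).re,
        (Complex.continuous_im.comp (hL.comp (by fun_prop))).continuousOn,
        fun t ht => ⟨Real.exp_pos _, toComplex_injective ?_⟩, rfl⟩
      rw [toComplex_polar, ← hLe' x t ht, Complex.ofReal_exp, ← Complex.exp_add,
        Complex.re_add_im]
  have hle : -Real.pi ≤ Real.pi := by linarith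
  refine ⟨sInf (F '' Icc (-Real.pi) Real.pi), sSup (F '' Icc (-Real.pi) Real.pi), ?_, ?_⟩
  · exact Real.sInf_le_sSup _ (isCompact_Icc.image hF).bddBelow (isCompact_Icc.image hF).bddAbove
  · rw [hI]
    exact hF.continuousOn.image_Icc hle

end Index

section Rotation

open Set

theorem im_conj_mul_combination (u v : ℂ) (a b : ℝ) :
    (starRingEnd ℂ u * (a * u + b * v)).im = b * (starRingEnd ℂ u * v).im ∧
    (starRingEnd ℂ (a * u + b * v) * v).im = a * (starRingEnd ℂ u * v).im := by
  constructor <;> simp <;> ring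

/-- Bounds on the rotation interval of a path `Ψ` which, in a frame `u, v` extending over a disc,
describes the fundamental solution of a linear equation close to `w' = ν i w`. -/
theorem rotationInterval_of_frame {T ν η : ℝ} (hT : 0 < T) {u v : ℝ → ℝ → ℂ}
    (hu : ContinuousOn (fun p : ℝ × ℝ => u p.1 p.2) (Icc 0 1 ×ˢ univ))
    (hv : ContinuousOn (fun p : ℝ × ℝ => v p.1 p.2) (Icc 0 1 ×ˢ univ))
    (hper : ∀ s ∈ Icc (0 : ℝ) 1, ∀ t, u s (t + T) = u s t ∧ v s (t + T) = v s t)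
    (hconst : ∀ t, u 0 t = u 0 0 ∧ v 0 t = v 0 0)
    (hpos : ∀ s ∈ Icc (0 : ℝ) 1, ∀ t, 0 < (starRingEnd ℂ (u s t) * v s t).im)
    {Ψ : ℝ → Matrix (Fin 2) (Fin 2) ℝ} {w w' : (Fin 2 → ℝ) → ℝ → ℂ}
    (h0 : ∀ a, w a 0 = a 0 * u 1 0 + a 1 * v 1 0)
    (hΨ : ∀ a, ∀ t ∈ Icc 0 T, w a t = (Ψ t *ᵥ a) 0 * u 1 t + (Ψ t *ᵥ a) 1 * v 1 t)
    (hw : ∀ a t, 0 ≤ t → HasDerivAt (w a) (w' a t) t)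
    (hb : ∀ a t, 0 ≤ t → ‖w' a t - ν * Complex.I * w a t‖ ≤ η * ‖w a t‖) :
    (∃ A B, A ≤ B ∧ rotationInterval Ψ T = Icc A B) ∧
      ∀ r ∈ rotationInterval Ψ T, (ν - η) * T - Real.pi ≤ 2 * Real.pi * r := by
  have h1mem : (1 : ℝ) ∈ Icc (0 : ℝ) 1 := by simp
  have hcs : ∀ f : ℝ → ℝ → ℂ, ContinuousOn (fun p : ℝ × ℝ => f p.1 p.2) (Icc 0 1 ×ˢ univ) →
      Continuous (f 1) := fun f hf =>
    hf.comp_continuous (f := fun t : ℝ => ((1 : ℝ), t)) (by fun_prop) fun t => ⟨h1mem, trivial⟩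
  have hne : ∀ a, a ≠ 0 → ∀ t, 0 ≤ t → w a t ≠ 0 := fun a ha t ht => by
    refine ne_zero_of_norm_deriv_le (K := η + |ν|) ?_ (hw a) (fun s hs => ?_) ht
    · intro h
      apply ha
      have e := im_conj_mul_combination (u 1 0) (v 1 0) (a 0) (a 1)
      rw [← h0, h] at e
      have hp := (hpos 1 h1mem 0).ne'
      ext i
      fin_cases i
      · exact (mul_eq_zero.1 (e.2.symm.trans (by simp))).resolve_right hp
      · exact (mul_eq_zero.1 (e.1.symm.trans (by simp))).resolve_right hp
    · have e : w' a s = (w' a s - ν * Complex.I * w a s) + ν * Complex.I * w a s := by ring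
      rw [e]
      refine (norm_add_le _ _).trans ?_
      have : ‖(ν : ℂ) * Complex.I * w a s‖ = |ν| * ‖w a s‖ := by simp
      rw [this, add_mul]
      gcongr
      exact hb a s hs
  have hwc : ∀ a, ContinuousOn (w a) (Icc 0 T) := fun a t ht =>
    (hw a t ht.1).continuousAt.continuousWithinAt
  have hΨc : ∀ a, ContinuousOn (fun t => Ψ t *ᵥ a) (Icc 0 T) := by
    intro a
    have hp : ContinuousOn (fun t => (starRingEnd ℂ (u 1 t) * v 1 t).im) (Icc 0 T) :=
      (Complex.continuous_im.comp ((Complex.continuous_conj.comp (hcs u hu)).mul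
        (hcs v hv))).continuousOn
    refine continuousOn_pi.2 fun i => ?_
    fin_cases i
    · have : ContinuousOn (fun t => (starRingEnd ℂ (w a t) * v 1 t).im
          / (starRingEnd ℂ (u 1 t) * v 1 t).im) (Icc 0 T) :=
        (Complex.continuous_im.comp_continuousOn ((Complex.continuous_conj.comp_continuousOn
          (hwc a)).mul (hcs v hv).continuousOn)).div hp fun t _ => (hpos 1 h1mem t).ne'
      refine this.congr fun t ht => ?_
      simp only [hΨ a t ht]
      rw [(im_conj_mul_combination _ _ _ _).2, mul_div_cancel_right₀ _ (hpos 1 h1mem t).ne']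
      rfl
    · have : ContinuousOn (fun t => (starRingEnd ℂ (u 1 t) * w a t).im
          / (starRingEnd ℂ (u 1 t) * v 1 t).im) (Icc 0 T) :=
        (Complex.continuous_im.comp_continuousOn ((Complex.continuous_conj.comp
          (hcs u hu)).continuousOn.mul (hwc a))).div hp fun t _ => (hpos 1 h1mem t).ne'
      refine this.congr fun t ht => ?_
      simp only [hΨ a t ht]
      rw [(im_conj_mul_combination _ _ _ _).1, mul_div_cancel_right₀ _ (hpos 1 h1mem t).ne']
      rfl
  refine ⟨exists_rotationInterval_eq_Icc hT.le ?_ fun t ht a ha h => hne a ha t ht.1 ?_, ?_⟩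
  · refine continuousOn_pi.2 fun i => continuousOn_pi.2 fun j => ?_
    have := continuousOn_pi.1 (hΨc (Pi.single j 1)) i
    simpa using this
  · rw [hΨ a t ht, h]
    simp
  · rintro r ⟨a, ha, θ, ρ, hθ, hρ, rfl⟩
    obtain ⟨ℓ, hℓ, hℓe, hℓθ⟩ := exists_log_frame hT hu hv hper hconst hpos hθ
      (fun t ht => (hρ t ht).1) (hwc a) (fun t ht => by
        rw [hΨ a t ht, (hρ t ht).2]
        simp)
    have h1 := abs_le.1 (abs_angle_sub_le hT.le hℓ hℓe (fun t ht => hw a t ht.1)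
      (fun t ht => hb a t ht.1))
    have h2 := abs_lt.1 hℓθ
    have hpi := Real.pi_pos
    rw [mul_div_cancel₀ _ (by positivity)]
    linarith [h1.1, h2.2]

end Rotation

/-! ### The rotation of the linearised Reeb flow -/

namespace SphereSymplecticForm

variable (σ : SphereSymplecticForm)

/-- The sign of `[σ]`. -/
def sgn : ℝ := σ.mean / |σ.mean|

theorem sgn_mul_sgn : σ.sgn * σ.sgn = 1 := by
  have h := σ.mean_ne_zero
  rw [sgn, div_mul_div_comm, abs_mul_abs_self, div_self (mul_ne_zero h h)]

theorem sgn_mul_abs_mean : σ.sgn * |σ.mean| = σ.mean :=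
  div_mul_cancel₀ _ (abs_ne_zero.2 σ.mean_ne_zero)

theorem sgn_mul_mean : σ.sgn * σ.mean = |σ.mean| := by
  rw [← σ.sgn_mul_abs_mean, ← mul_assoc, sgn_mul_sgn, one_mul, abs_mul, abs_abs]
  have : |σ.sgn| = 1 := by
    rw [sgn, abs_div, abs_abs, div_self (abs_ne_zero.2 σ.mean_ne_zero)]
  rw [this, one_mul]

theorem abs_sgn : |σ.sgn| = 1 := by
  rw [sgn, abs_div, abs_abs, div_self (abs_ne_zero.2 σ.mean_ne_zero)]

end SphereSymplecticForm

namespace SphereMetric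

variable (g : SphereMetric) (σ : SphereSymplecticForm) (β : R3 → R3 →L[ℝ] ℝ)

/-- The complex coordinate `q ± i p` on `ker α`, oriented by `dα`. -/
def fibreCoord (z ξ : R3 × R3) : ℂ := ⟨g.transverseForm z ξ, σ.sgn * g.radialForm z ξ⟩

theorem fibreCoord_combination (z ξ ζ : R3 × R3) (a b : ℝ) :
    g.fibreCoord σ z (a • ξ + b • ζ) = a * g.fibreCoord σ z ξ + b * g.fibreCoord σ z ζ := by
  apply Complex.ext <;> simp [fibreCoord]
  ring

theorem continuousOn_fibreCoord {m : ℝ} (hm : 0 < m) :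
    ContinuousOn (fun p : (R3 × R3) × (R3 × R3) => g.fibreCoord σ p.1 p.2)
      (g.energyLevel m ×ˢ Set.univ) := by
  rintro ⟨z, ξ⟩ ⟨hz, -⟩
  have hx := g.areaSq_pos (g.mem_energyLevel.1 hz).1
  have hp := (g.form_pos_of_mem hm hz).ne'
  have c1 : ContDiffAt ℝ ∞ (fun p : (R3 × R3) × (R3 × R3) => p.1.1) (z, ξ) := by fun_prop
  have c2 : ContDiffAt ℝ ∞ (fun p : (R3 × R3) × (R3 × R3) => p.1.2) (z, ξ) := by fun_prop
  have c3 : ContDiffAt ℝ ∞ (fun p : (R3 × R3) × (R3 × R3) => p.2.1) (z, ξ) := by fun_prop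
  have e1 : ContDiffAt ℝ ∞ (fun p : (R3 × R3) × (R3 × R3) => g.transverseForm p.1 p.2) (z, ξ) := by
    simp only [transverseForm_apply]
    exact (g.contDiffAt_form c1 (g.contDiffAt_rot c1 hx c2) c3).div (g.contDiffAt_form c1 c2 c2) hp
  have e2 : ContDiffAt ℝ ∞ (fun p : (R3 × R3) × (R3 × R3) => g.radialForm p.1 p.2) (z, ξ) := by
    simp only [radialForm_apply]
    exact (g.contDiffAt_form c1 c2 c3).div (g.contDiffAt_form c1 c2 c2) hp
  have e3 : (fun p : (R3 × R3) × (R3 × R3) => g.fibreCoord σ p.1 p.2) = fun p =>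
      (g.transverseForm p.1 p.2 : ℂ) + ((σ.sgn * g.radialForm p.1 p.2 : ℝ) : ℂ) * Complex.I := by
    funext p
    apply Complex.ext <;> simp [fibreCoord]
  rw [e3]
  exact ((Complex.continuous_ofReal.continuousAt.comp e1.continuousAt).add
    ((Complex.continuous_ofReal.continuousAt.comp (continuousAt_const.mul e2.continuousAt)).mul
      continuousAt_const)).continuousWithinAt

theorem continuousOn_fibreCoord_comp {m : ℝ} (hm : 0 < m) {X : Type*} [TopologicalSpace X]
    {s : Set X} {z ξ : X → R3 × R3} (hz : ContinuousOn z s) (hξ : ContinuousOn ξ s)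
    (hs : ∀ x ∈ s, z x ∈ g.energyLevel m) :
    ContinuousOn (fun x => g.fibreCoord σ (z x) (ξ x)) s :=
  ContinuousOn.comp (g := fun p : (R3 × R3) × (R3 × R3) => g.fibreCoord σ p.1 p.2)
    (f := fun x => (z x, ξ x)) (g.continuousOn_fibreCoord σ hm) (hz.prodMk hξ)
    fun x hx => ⟨hs x hx, trivial⟩

theorem abs_radialForm_le (z ξ : R3 × R3) : |g.radialForm z ξ| ≤ ‖g.fibreCoord σ z ξ‖ := by
  have := Complex.abs_im_le_norm (g.fibreCoord σ z ξ)
  simpa [fibreCoord, abs_mul, σ.abs_sgn] using this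

theorem abs_transverseForm_le (z ξ : R3 × R3) : |g.transverseForm z ξ| ≤ ‖g.fibreCoord σ z ξ‖ :=
  Complex.abs_re_le_norm (g.fibreCoord σ z ξ)

/-- The orientation of `ker α` by `dα`. -/
theorem abs_mean_mul_dOne_contactPrimitive {m : ℝ} (hm : 0 < m) (hβ : g.IsCurvaturePrimitive σ β)
    {z ξ ζ : R3 × R3} (hz : z ∈ g.energyLevel m) (hξ : ξ ∈ g.levelTangent z)
    (hζ : ζ ∈ g.levelTangent z) (hξα : g.contactPrimitive σ β z ξ = 0)
    (hζα : g.contactPrimitive σ β z ζ = 0) :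
    |σ.mean| * dOne (g.contactPrimitive σ β) z ξ ζ = m ^ 2 * g.reebScale σ β z *
      (starRingEnd ℂ (g.fibreCoord σ z ξ) * g.fibreCoord σ z ζ).im := by
  obtain ⟨hx, hv, hE⟩ := g.mem_energyLevel.1 hz
  have hb := fun ξ hξ => ((g.mem_levelTangent (g.areaSq_pos hx) hv (ξ := ξ)).1 hξ).1.1
  rw [g.contactPrimitive_coframe σ β hm hz (hb _ hξ)] at hξα
  rw [g.contactPrimitive_coframe σ β hm hz (hb _ hζ)] at hζα
  rw [g.dOne_contactPrimitive_coframe σ β hm hz hβ hξ hζ, ← σ.sgn_mul_mean, reebScale, hE]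
  simp only [fibreCoord, Complex.mul_im, Complex.conj_re, Complex.conj_im]
  linear_combination σ.sgn * m ^ 2 * g.transverseForm z ζ * hξα
    - σ.sgn * m ^ 2 * g.transverseForm z ξ * hζα

section Orbit

variable {g σ β} {m C : ℝ} {φ : ℝ → R3 × R3 → R3 × R3}
  {M : ℝ → R3 × R3 → R3 × R3 →L[ℝ] R3 × R3}
  (hφ : g.IsSmoothReebFlow σ β m φ M) (hm : 0 < m) (hβ : g.IsCurvaturePrimitive σ β)
  (hh : ∀ z ∈ g.energyLevel m, 0 < g.reebScale σ β z)
  (hest : ∀ z ∈ g.energyLevel m, |g.strength σ z.1 / g.reebScale σ β z - σ.mean⁻¹| ≤ C * m ∧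
    ∀ ξ ∈ g.levelTangent z, g.contactPrimitive σ β z ξ = 0 →
      |fderiv ℝ (g.reebScale σ β) z ξ / g.reebScale σ β z ^ 2|
        ≤ C * m * (|g.radialForm z ξ| + |g.transverseForm z ξ|) ∧
      |g.connectionForm z ξ / g.reebScale σ β z|
        ≤ C * m * (|g.radialForm z ξ| + |g.transverseForm z ξ|))

include hφ hm hβ hh hest in
/-- On `ker α` the linearised equation is `w' = (i / |c|) w` up to an error of size `O(m) |w|`. -/
theorem hasDerivAt_fibreCoord {z ξ : R3 × R3} (hz : z ∈ g.energyLevel m)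
    (hξ : ξ ∈ g.levelTangent z) (hα : g.contactPrimitive σ β z ξ = 0) {t : ℝ} (ht : 0 ≤ t) :
    ∃ w' : ℂ, HasDerivAt (fun s => g.fibreCoord σ (φ s z) (M s z ξ)) w' t ∧
      ‖w' - (|σ.mean|⁻¹ : ℝ) * Complex.I * g.fibreCoord σ (φ t z) (M t z ξ)‖
        ≤ 5 * C * m * ‖g.fibreCoord σ (φ t z) (M t z ξ)‖ := by
  have hh' := fun z hz => (hh z hz).ne'
  obtain ⟨dp, dq⟩ := hφ.hasDerivAt_coframe hm hh' hz hξ ht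
  have hα' := hφ.contactPrimitive_differential hm hβ hh' hz hξ ht
  rw [hα] at hα'
  obtain ⟨e1, e2⟩ := hest _ (hφ.mem z hz t)
  obtain ⟨e2, e3⟩ := e2 _ (hφ.differential_mem z hz ξ hξ t ht) hα'
  have a1 := g.abs_radialForm_le σ (φ t z) (M t z ξ)
  have a2 := g.abs_transverseForm_le σ (φ t z) (M t z ξ)
  set F := g.strength σ (φ t z).1 / g.reebScale σ β (φ t z)
  set D := fderiv ℝ (g.reebScale σ β) (φ t z) (M t z ξ) / g.reebScale σ β (φ t z) ^ 2
  set r := g.connectionForm (φ t z) (M t z ξ) / g.reebScale σ β (φ t z)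
  have hfun : (fun s => g.fibreCoord σ (φ s z) (M s z ξ)) = fun s =>
      (g.transverseForm (φ s z) (M s z ξ) : ℂ)
        + ((σ.sgn * g.radialForm (φ s z) (M s z ξ) : ℝ) : ℂ) * Complex.I := by
    funext s
    apply Complex.ext <;> simp [fibreCoord]
  have hd := (dq.ofReal_comp).fun_add (((dp.const_mul σ.sgn).ofReal_comp).mul_const Complex.I)
  refine ⟨_, by rw [hfun]; exact hd, ?_⟩
  have hs : (σ.sgn : ℂ) * σ.sgn = 1 := by exact_mod_cast σ.sgn_mul_sgn
  have hc : |σ.mean|⁻¹ = σ.sgn * σ.mean⁻¹ := by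
    rw [SphereSymplecticForm.sgn]
    field_simp [σ.mean_ne_zero]
  have hw : g.fibreCoord σ (φ t z) (M t z ξ) = (g.transverseForm (φ t z) (M t z ξ) : ℂ)
      + (σ.sgn * g.radialForm (φ t z) (M t z ξ)) * Complex.I := by
    apply Complex.ext <;> simp [fibreCoord]
  set w := g.fibreCoord σ (φ t z) (M t z ξ)
  set p := g.radialForm (φ t z) (M t z ξ)
  set q := g.transverseForm (φ t z) (M t z ξ)
  have key : ((-(F * p) + r : ℝ) : ℂ) + ((σ.sgn * (F * q - D) : ℝ) : ℂ) * Complex.I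
      - (|σ.mean|⁻¹ : ℝ) * Complex.I * w
      = (σ.sgn * (F - σ.mean⁻¹) : ℝ) * Complex.I * w + (r : ℂ) - (σ.sgn * D : ℝ) * Complex.I := by
    rw [hc, hw]
    push_cast
    linear_combination (-(F : ℂ) * p * Complex.I ^ 2) * hs - (F : ℂ) * p * Complex.I_sq
  rw [key]
  have n1 : ‖((σ.sgn * (F - σ.mean⁻¹) : ℝ) : ℂ) * Complex.I * w‖ ≤ C * m * ‖w‖ := by
    rw [norm_mul, norm_mul, Complex.norm_I, Complex.norm_real, Real.norm_eq_abs, abs_mul,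
      σ.abs_sgn, one_mul, mul_one]
    gcongr
  have hCm : 0 ≤ C * m := (abs_nonneg _).trans e1
  have n2 : ‖(r : ℂ)‖ ≤ C * m * (‖w‖ + ‖w‖) := by
    rw [Complex.norm_real, Real.norm_eq_abs]
    exact e3.trans (by gcongr)
  have n3 : ‖((σ.sgn * D : ℝ) : ℂ) * Complex.I‖ ≤ C * m * (‖w‖ + ‖w‖) := by
    rw [norm_mul, Complex.norm_I, Complex.norm_real, Real.norm_eq_abs, abs_mul,
      σ.abs_sgn, one_mul, mul_one]
    exact e2.trans (by gcongr)
  calc _ ≤ C * m * ‖w‖ + C * m * (‖w‖ + ‖w‖) + C * m * (‖w‖ + ‖w‖) :=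
        (norm_sub_le _ _).trans (add_le_add ((norm_add_le _ _).trans (add_le_add n1 n2)) n3)
    _ = _ := by ring

include hφ hm hβ hh hest in
/-- The linearised Reeb flow along an orbit rotates `ker α` at least with angular velocity
`1 / |c| - 5 C m`, up to half a turn. -/
theorem rotationInterval_of_orbit {γ : ℝ → R3 × R3} {T : ℝ} {i e f : ℝ → ℝ → R3 × R3}
    {Ψ : ℝ → Matrix (Fin 2) (Fin 2) ℝ}
    (hγ : IsPeriodicReebOrbit (g.energyLevel m) g.levelTangent (g.contactPrimitive σ β) γ T)
    (hi : IsCappingCylinder (g.energyLevel m) γ T i)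
    (hf : IsSymplecticFrame g.levelTangent (g.contactPrimitive σ β) T i e f)
    (hΨ : IsLinearisedFlow (g.energyLevel m) g.levelTangent (g.contactPrimitive σ β) γ T (e 1) (f 1)
      Ψ) :
    (∃ A B, A ≤ B ∧ rotationInterval Ψ T = Set.Icc A B) ∧
      ∀ r ∈ rotationInterval Ψ T, (|σ.mean|⁻¹ - 5 * C * m) * T - Real.pi ≤ 2 * Real.pi * r := by
  obtain ⟨hT, htraj, hper⟩ := hγ
  obtain ⟨hic, hiS, hi0, hi1⟩ := hi
  obtain ⟨hec, hfc, hef, hef0⟩ := hf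
  obtain ⟨Φ, D, hΦ, hD⟩ := hΨ
  have h1mem : (1 : ℝ) ∈ Set.Icc (0 : ℝ) 1 := by simp
  have hh' := fun z hz => (hh z hz).ne'
  have hγφ : ∀ t, γ t = φ t (γ 0) := hφ.eq_of_isReebTrajectory hm hβ hh' htraj
  have hγ0 : γ 0 ∈ g.energyLevel m := (htraj 0).1
  have hmem : ∀ p ∈ Set.Icc (0 : ℝ) 1 ×ˢ (Set.univ : Set ℝ), i p.1 p.2 ∈ g.energyLevel m :=
    fun p hp => (hiS p.1 hp.1 p.2).1
  have hξ : ∀ a : Fin 2 → ℝ, a 0 • e 1 0 + a 1 • f 1 0 ∈ g.levelTangent (γ 0) ∧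
      g.contactPrimitive σ β (γ 0) (a 0 • e 1 0 + a 1 • f 1 0) = 0 := by
    intro a
    obtain ⟨h1, h2, h3, h4, -⟩ := hef 1 h1mem 0
    rw [hi1] at h1 h2 h3 h4
    refine ⟨add_mem (Submodule.smul_mem _ _ h1) (Submodule.smul_mem _ _ h2), ?_⟩
    rw [map_add, map_smul, map_smul, h3, h4]
    simp
  let u : ℝ → ℝ → ℂ := fun s t => g.fibreCoord σ (i s t) (e s t)
  let v : ℝ → ℝ → ℂ := fun s t => g.fibreCoord σ (i s t) (f s t)
  let w : (Fin 2 → ℝ) → ℝ → ℂ := fun a t =>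
    g.fibreCoord σ (φ t (γ 0)) (M t (γ 0) (a 0 • e 1 0 + a 1 • f 1 0))
  have hw : ∀ a t, 0 ≤ t → ∃ w', HasDerivAt (w a) w' t ∧
      ‖w' - (|σ.mean|⁻¹ : ℝ) * Complex.I * w a t‖ ≤ 5 * C * m * ‖w a t‖ := fun a t ht =>
    hasDerivAt_fibreCoord hφ hm hβ hh hest hγ0 (hξ a).1 (hξ a).2 ht
  choose! w' hw' using hw
  have hu : ContinuousOn (fun p : ℝ × ℝ => u p.1 p.2) (Set.Icc 0 1 ×ˢ Set.univ) :=
    g.continuousOn_fibreCoord_comp σ hm (z := fun p : ℝ × ℝ => i p.1 p.2)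
      (ξ := fun p : ℝ × ℝ => e p.1 p.2) hic hec hmem
  have hv : ContinuousOn (fun p : ℝ × ℝ => v p.1 p.2) (Set.Icc 0 1 ×ˢ Set.univ) :=
    g.continuousOn_fibreCoord_comp σ hm (z := fun p : ℝ × ℝ => i p.1 p.2)
      (ξ := fun p : ℝ × ℝ => f p.1 p.2) hic hfc hmem
  have hper : ∀ s ∈ Set.Icc (0 : ℝ) 1, ∀ t, u s (t + T) = u s t ∧ v s (t + T) = v s t := by
    intro s hs t
    obtain ⟨-, -, -, -, -, h1, h2⟩ := hef s hs t
    simp only [u, v, (hiS s hs t).2, h1, h2, and_self]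
  have hconst : ∀ t, u 0 t = u 0 0 ∧ v 0 t = v 0 0 := by
    intro t
    simp only [u, v]
    rw [hi0 t, (hef0 t).1, (hef0 t).2]
    exact ⟨rfl, rfl⟩
  have hpos : ∀ s ∈ Set.Icc (0 : ℝ) 1, ∀ t, 0 < (starRingEnd ℂ (u s t) * v s t).im := by
    intro s hs t
    obtain ⟨h1, h2, h3, h4, h5, -⟩ := hef s hs t
    have hz := (hiS s hs t).1
    have h6 := g.abs_mean_mul_dOne_contactPrimitive σ β hm hβ hz h1 h2 h3 h4
    rw [h5, mul_one] at h6
    have h7 : 0 < |σ.mean| := abs_pos.2 σ.mean_ne_zero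
    rw [h6] at h7
    exact pos_of_mul_pos_right h7 (mul_pos (by positivity) (hh _ hz)).le
  have h0 : ∀ a, w a 0 = a 0 * u 1 0 + a 1 * v 1 0 := by
    intro a
    simp only [w, u, v, hφ.differential_zero, hφ.zero, hi1]
    exact g.fibreCoord_combination σ _ _ _ _ _
  have hΨ : ∀ a, ∀ t ∈ Set.Icc 0 T,
      w a t = (Ψ t *ᵥ a) 0 * u 1 t + (Ψ t *ᵥ a) 1 * v 1 t := by
    intro a t ht
    have h1 := (hD t ht).2 a
    rw [hφ.differential_eq hm hβ hh' hΦ hγ0 (hξ a).1 ht.1 (hD t ht).1] at h1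
    simp only [w, u, v]
    rw [h1, hi1, ← hγφ t]
    exact g.fibreCoord_combination σ _ _ _ _ _
  exact rotationInterval_of_frame hT hu hv hper hconst hpos h0 hΨ (fun a t ht => (hw' a t ht).1)
    (fun a t ht => (hw' a t ht).2)

end Orbit

end SphereMetric

/-! ### Existence of the Conley-Zehnder index -/

namespace SphereMetric

variable (g : SphereMetric) (σ : SphereSymplecticForm) (β : R3 → R3 →L[ℝ] ℝ)

/-- The vector of `ker α` with a given complex coordinate. -/
def kerLift (z : R3 × R3) (w : ℂ) : R3 × R3 :=
  g.bundleLift z ((σ.sgn * w.im) • z.2 + w.re • g.rot z.1 z.2)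
    (((β z.1 (g.rot z.1 z.2) * w.re - (g.form z.1 z.2 z.2 - β z.1 z.2) * (σ.sgn * w.im)) / σ.mean)
      • g.rot z.1 z.2)

section Level

variable {m : ℝ} (hm : 0 < m) {z : R3 × R3} (hz : z ∈ g.energyLevel m)
include hm hz

omit hm in
theorem kerLift_mem (w : ℂ) : g.kerLift σ β z w ∈ g.levelTangent z :=
  g.mem_levelTangent_bundleLift hz _ _ _

theorem contactPrimitive_kerLift (w : ℂ) :
    g.contactPrimitive σ β z (g.kerLift σ β z w) = 0 := by
  obtain ⟨hx, hv, hE⟩ := g.mem_energyLevel.1 hz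
  have hb := ((g.mem_levelTangent (g.areaSq_pos hx) hv).1 (g.kerLift_mem σ β hz w)).1.1
  obtain ⟨e1, e2, e3⟩ := g.coframe_bundleLift hm hz (σ.sgn * w.im) w.re
    ((β z.1 (g.rot z.1 z.2) * w.re - (g.form z.1 z.2 z.2 - β z.1 z.2) * (σ.sgn * w.im)) / σ.mean)
  rw [g.contactPrimitive_coframe σ β hm hz hb, kerLift, e1, e2, e3, hE,
    mul_div_cancel₀ _ σ.mean_ne_zero]
  ring

theorem fibreCoord_kerLift (w : ℂ) : g.fibreCoord σ z (g.kerLift σ β z w) = w := by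
  obtain ⟨e1, e2, e3⟩ := g.coframe_bundleLift hm hz (σ.sgn * w.im) w.re
    ((β z.1 (g.rot z.1 z.2) * w.re - (g.form z.1 z.2 z.2 - β z.1 z.2) * (σ.sgn * w.im)) / σ.mean)
  rw [fibreCoord, kerLift, e1, e2, ← mul_assoc, σ.sgn_mul_sgn, one_mul]

theorem eq_of_fibreCoord_eq {ξ ζ : R3 × R3} (hξ : ξ ∈ g.levelTangent z)
    (hζ : ζ ∈ g.levelTangent z) (hξα : g.contactPrimitive σ β z ξ = 0)
    (hζα : g.contactPrimitive σ β z ζ = 0) (h : g.fibreCoord σ z ξ = g.fibreCoord σ z ζ) :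
    ξ = ζ := by
  obtain ⟨hx, hv, hE⟩ := g.mem_energyLevel.1 hz
  have hb := fun ξ hξ => ((g.mem_levelTangent (g.areaSq_pos hx) hv (ξ := ξ)).1 hξ).1.1
  have hq : g.transverseForm z ξ = g.transverseForm z ζ := congrArg Complex.re h
  have hs : σ.sgn ≠ 0 := left_ne_zero_of_mul (σ.sgn_mul_sgn.trans_ne one_ne_zero)
  have hp : g.radialForm z ξ = g.radialForm z ζ :=
    mul_left_cancel₀ hs (congrArg Complex.im h)
  rw [g.contactPrimitive_coframe σ β hm hz (hb _ hξ)] at hξα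
  rw [g.contactPrimitive_coframe σ β hm hz (hb _ hζ), ← hp, ← hq] at hζα
  exact g.eq_of_coframe hm hz hξ hζ hp hq (mul_left_cancel₀ σ.mean_ne_zero (by linarith))

end Level

theorem contDiffAt_bundleLift {E : Type*} [NormedAddCommGroup E] [NormedSpace ℝ E]
    {z : E → R3 × R3} {a k : E → R3} {y : E} (hz : ContDiffAt ℝ ∞ z y)
    (h : 0 < g.areaSq (z y).1) (ha : ContDiffAt ℝ ∞ a y) (hk : ContDiffAt ℝ ∞ k y) :
    ContDiffAt ℝ ∞ (fun y => g.bundleLift (z y) (a y) (k y)) y := by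
  have h1 : ContDiffAt ℝ ∞ (fun y => (z y).1) y := hz.fst
  have h2 : ContDiffAt ℝ ∞ (fun y => (z y).2) y := hz.snd
  have h3 : ContDiffAt ℝ ∞ (fun y => (z y).2 ⬝ᵥ a y) y := contDiffAt_dot h2 ha
  exact ha.prodMk ((hk.sub (h3.smul h1)).sub
    (g.contDiffAt_covDeriv h1 h h2 ha (h3.neg.smul h1)))

theorem continuousOn_kerLift (hβ : ContDiff ℝ ∞ β) {m : ℝ} :
    ContinuousOn (fun p : (R3 × R3) × ℂ => g.kerLift σ β p.1 p.2)
      (g.energyLevel m ×ˢ Set.univ) := by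
  rintro ⟨z, w⟩ ⟨hz, -⟩
  have hx := g.areaSq_pos (g.mem_energyLevel.1 hz).1
  have c1 : ContDiffAt ℝ ∞ (fun p : (R3 × R3) × ℂ => p.1.1) (z, w) := by fun_prop
  have c2 : ContDiffAt ℝ ∞ (fun p : (R3 × R3) × ℂ => p.1.2) (z, w) := by fun_prop
  have c3 : ContDiffAt ℝ ∞ (fun p : (R3 × R3) × ℂ => p.2.re) (z, w) :=
    Complex.reCLM.contDiff.contDiffAt.comp _ contDiffAt_snd
  have c4 : ContDiffAt ℝ ∞ (fun p : (R3 × R3) × ℂ => σ.sgn * p.2.im) (z, w) :=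
    contDiffAt_const.mul (Complex.imCLM.contDiff.contDiffAt.comp _ contDiffAt_snd)
  have cj : ContDiffAt ℝ ∞ (fun p : (R3 × R3) × ℂ => g.rot p.1.1 p.1.2) (z, w) :=
    g.contDiffAt_rot c1 hx c2
  have cβ : ContDiffAt ℝ ∞ (fun p : (R3 × R3) × ℂ => β p.1.1) (z, w) :=
    hβ.contDiffAt.comp (z, w) c1
  exact (g.contDiffAt_bundleLift contDiffAt_fst hx ((c4.smul c2).add (c3.smul cj))
    ((((((cβ.clm_apply cj).mul c3).sub (((g.contDiffAt_form c1 c2 c2).sub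
      (cβ.clm_apply c2)).mul c4)).div_const σ.mean)).smul cj)).continuousAt.continuousWithinAt

variable {g σ β} {m C : ℝ} {φ : ℝ → R3 × R3 → R3 × R3}
  {M : ℝ → R3 × R3 → R3 × R3 →L[ℝ] R3 × R3}
  (hφ : g.IsSmoothReebFlow σ β m φ M) (hm : 0 < m) (hβ : g.IsCurvaturePrimitive σ β)
  (hh : ∀ z ∈ g.energyLevel m, 0 < g.reebScale σ β z)

include hφ hm hβ hh in
/-- The frame of `ker α` with coordinates `κ` and `κ i` is defined on all of `Σ_m`, and so gives a
trivialisation over every capping cylinder. The factor `κ` makes it symplectic. -/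
theorem exists_isLinearisedFlow {γ : ℝ → R3 × R3} {T : ℝ} {i : ℝ → ℝ → R3 × R3}
    (hγ : IsPeriodicReebOrbit (g.energyLevel m) g.levelTangent (g.contactPrimitive σ β) γ T)
    (hi : IsCappingCylinder (g.energyLevel m) γ T i) : ∃ e f Ψ,
    IsSymplecticFrame g.levelTangent (g.contactPrimitive σ β) T i e f ∧
    IsLinearisedFlow (g.energyLevel m) g.levelTangent (g.contactPrimitive σ β) γ T (e 1) (f 1)
      Ψ := by
  obtain ⟨hT, htraj, hper⟩ := hγ
  obtain ⟨hic, hiS, hi0, hi1⟩ := hi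
  have hh' := fun z hz => (hh z hz).ne'
  have hγφ : ∀ t, γ t = φ t (γ 0) := hφ.eq_of_isReebTrajectory hm hβ hh' htraj
  have hγ0 : γ 0 ∈ g.energyLevel m := (htraj 0).1
  have hc : 0 < |σ.mean| := abs_pos.2 σ.mean_ne_zero
  let κ : R3 × R3 → ℝ := fun z => √(|σ.mean| / (m ^ 2 * g.reebScale σ β z))
  have hκ : ∀ z ∈ g.energyLevel m, 0 < κ z := fun z hz =>
    Real.sqrt_pos.2 (div_pos hc (mul_pos (by positivity) (hh z hz)))
  have hκ2 : ∀ z ∈ g.energyLevel m, m ^ 2 * g.reebScale σ β z * (κ z * κ z) = |σ.mean| :=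
    fun z hz => by
      have h1 : 0 < m ^ 2 * g.reebScale σ β z := mul_pos (by positivity) (hh z hz)
      rw [Real.mul_self_sqrt (div_pos hc h1).le, mul_div_cancel₀ _ h1.ne']
  have hmem : ∀ p ∈ Set.Icc (0 : ℝ) 1 ×ˢ (Set.univ : Set ℝ), i p.1 p.2 ∈ g.energyLevel m :=
    fun p hp => (hiS p.1 hp.1 p.2).1
  have hκc : ContinuousOn κ (g.energyLevel m) := fun z hz => by
    have h1 : 0 < m ^ 2 * g.reebScale σ β z := mul_pos (by positivity) (hh z hz)
    have h2 := (g.contDiffAt_reebScale σ β hβ.1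
      (g.areaSq_pos (g.mem_energyLevel.1 hz).1)).continuousAt
    exact (Real.continuous_sqrt.continuousAt.comp
      (continuousAt_const.div (continuousAt_const.mul h2) h1.ne')).continuousWithinAt
  have hκi : ContinuousOn (fun p : ℝ × ℝ => (κ (i p.1 p.2) : ℂ)) (Set.Icc 0 1 ×ˢ Set.univ) :=
    Complex.continuous_ofReal.comp_continuousOn
      (hκc.comp (f := fun p : ℝ × ℝ => i p.1 p.2) hic hmem)
  have hlift : ∀ w : ℂ, ContinuousOn
      (fun p : ℝ × ℝ => g.kerLift σ β (i p.1 p.2) (κ (i p.1 p.2) * w))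
      (Set.Icc 0 1 ×ˢ Set.univ) := fun w =>
    ContinuousOn.comp (g := fun p : (R3 × R3) × ℂ => g.kerLift σ β p.1 p.2)
      (f := fun p : ℝ × ℝ => (i p.1 p.2, (κ (i p.1 p.2) : ℂ) * w))
      (g.continuousOn_kerLift σ β hβ.1) (hic.prodMk (hκi.mul continuousOn_const))
      fun p hp => ⟨hmem p hp, trivial⟩
  let e : ℝ → ℝ → R3 × R3 := fun s t => g.kerLift σ β (i s t) (κ (i s t) * 1)
  let f : ℝ → ℝ → R3 × R3 := fun s t => g.kerLift σ β (i s t) (κ (i s t) * Complex.I)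
  let w : (R3 × R3) → ℝ → ℂ := fun ξ t => g.fibreCoord σ (φ t (γ 0)) (M t (γ 0) ξ)
  refine ⟨e, f, fun t => !![(w (e 1 0) t).re / κ (γ t), (w (f 1 0) t).re / κ (γ t);
    (w (e 1 0) t).im / κ (γ t), (w (f 1 0) t).im / κ (γ t)], ⟨hlift 1, hlift Complex.I, ?_, ?_⟩,
    φ, fun t => M t (γ 0), hφ.isReebFlow hm hβ hh', fun t ht =>
      ⟨(hφ.hasFDerivAt _ hγ0 t ht.1).hasFDerivWithinAt, ?_⟩⟩
  · intro s hs t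
    have hz := (hiS s hs t).1
    have h1 := g.kerLift_mem σ β hz (κ (i s t) * 1)
    have h2 := g.kerLift_mem σ β hz (κ (i s t) * Complex.I)
    have h3 := g.contactPrimitive_kerLift σ β hm hz (κ (i s t) * 1)
    have h4 := g.contactPrimitive_kerLift σ β hm hz (κ (i s t) * Complex.I)
    refine ⟨h1, h2, h3, h4, ?_, by simp only [e, (hiS s hs t).2], by simp only [f, (hiS s hs t).2]⟩
    have h5 := g.abs_mean_mul_dOne_contactPrimitive σ β hm hβ hz h1 h2 h3 h4
    rw [g.fibreCoord_kerLift σ β hm hz, g.fibreCoord_kerLift σ β hm hz] at h5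
    have h6 : (starRingEnd ℂ ((κ (i s t) : ℂ) * 1) * (κ (i s t) * Complex.I)).im
        = κ (i s t) * κ (i s t) := by simp
    rw [h6, hκ2 _ hz] at h5
    exact mul_left_cancel₀ hc.ne' (h5.trans (mul_one _).symm)
  · intro t
    simp only [e, f]
    rw [hi0 t]
    exact ⟨rfl, rfl⟩
  · intro a
    have hz := hφ.mem _ hγ0 t
    have hz' : γ t ∈ g.energyLevel m := (htraj t).1
    have hξ : ∀ w : ℂ, g.kerLift σ β (i 1 0) w ∈ g.levelTangent (γ 0) ∧
        g.contactPrimitive σ β (γ 0) (g.kerLift σ β (i 1 0) w) = 0 := fun w => by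
      rw [hi1]
      exact ⟨g.kerLift_mem σ β hγ0 w, g.contactPrimitive_kerLift σ β hm hγ0 w⟩
    have hM : ∀ ξ ∈ g.levelTangent (γ 0), g.contactPrimitive σ β (γ 0) ξ = 0 →
        M t (γ 0) ξ ∈ g.levelTangent (γ t) ∧ g.contactPrimitive σ β (γ t) (M t (γ 0) ξ) = 0 :=
      fun ξ h1 h2 => by
        rw [hγφ t]
        exact ⟨hφ.differential_mem _ hγ0 ξ h1 t ht.1,
          (hφ.contactPrimitive_differential hm hβ hh' hγ0 h1 ht.1).trans h2⟩
    obtain ⟨m1, m2⟩ := hM (e 1 0) (hξ _).1 (hξ _).2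
    obtain ⟨m3, m4⟩ := hM (f 1 0) (hξ _).1 (hξ _).2
    have k1 : e 1 t ∈ g.levelTangent (γ t) := by
      simp only [e]; rw [hi1]; exact g.kerLift_mem σ β hz' _
    have k2 : f 1 t ∈ g.levelTangent (γ t) := by
      simp only [f]; rw [hi1]; exact g.kerLift_mem σ β hz' _
    have k3 : g.contactPrimitive σ β (γ t) (e 1 t) = 0 := by
      simp only [e]; rw [hi1]; exact g.contactPrimitive_kerLift σ β hm hz' _
    have k4 : g.contactPrimitive σ β (γ t) (f 1 t) = 0 := by
      simp only [f]; rw [hi1]; exact g.contactPrimitive_kerLift σ β hm hz' _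
    have k5 : g.fibreCoord σ (γ t) (e 1 t) = κ (γ t) := by
      simp only [e]; rw [hi1, g.fibreCoord_kerLift σ β hm hz', mul_one]
    have k6 : g.fibreCoord σ (γ t) (f 1 t) = κ (γ t) * Complex.I := by
      simp only [f]; rw [hi1, g.fibreCoord_kerLift σ β hm hz']
    simp only [map_add, map_smul]
    refine g.eq_of_fibreCoord_eq σ β hm hz'
      (add_mem (Submodule.smul_mem _ _ m1) (Submodule.smul_mem _ _ m3))
      (add_mem (Submodule.smul_mem _ _ k1) (Submodule.smul_mem _ _ k2))
      (by rw [map_add, map_smul, map_smul, m2, m4]; simp)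
      (by rw [map_add, map_smul, map_smul, k3, k4]; simp) ?_
    have w1 : g.fibreCoord σ (γ t) (M t (γ 0) (e 1 0)) = w (e 1 0) t := by
      simp only [w]; rw [← hγφ t]
    have w2 : g.fibreCoord σ (γ t) (M t (γ 0) (f 1 0)) = w (f 1 0) t := by
      simp only [w]; rw [← hγφ t]
    rw [fibreCoord_combination, fibreCoord_combination, k5, k6, w1, w2]
    have hk := (hκ _ hz').ne'
    apply Complex.ext <;> simp [Matrix.mulVec, dotProduct, Fin.sum_univ_two] <;> field_simp

end SphereMetric

/-! ### Spinors: the double cover of the bundle of orthonormal frames -/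

section Spinor

/-- The isotropic vector of `ℂ³` associated with a spinor; its real and imaginary parts are
orthogonal and have the same length. -/
def spinorSquare (w : ℂ × ℂ) : Fin 3 → ℂ :=
  ![w.1 ^ 2 - w.2 ^ 2, Complex.I * (w.1 ^ 2 + w.2 ^ 2), -(2 * w.1 * w.2)]

/-- The three-sphere. -/
def unitSpinors : Set (ℂ × ℂ) := {w | ‖w.1‖ ^ 2 + ‖w.2‖ ^ 2 = 1}

/-- The hermitian product of spinors. -/
def spinorInner (w w' : ℂ × ℂ) : ℂ := w.1 * starRingEnd ℂ w'.1 + w.2 * starRingEnd ℂ w'.2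

theorem spinorInner_self_eq (w : ℂ × ℂ) :
    spinorInner w w = ((‖w.1‖ ^ 2 + ‖w.2‖ ^ 2 : ℝ) : ℂ) := by
  rw [spinorInner, Complex.mul_conj, Complex.mul_conj, Complex.normSq_eq_norm_sq,
    Complex.normSq_eq_norm_sq]
  push_cast; ring

theorem spinorInner_self {w : ℂ × ℂ} (hw : w ∈ unitSpinors) : spinorInner w w = 1 := by
  rw [spinorInner_self_eq]
  exact_mod_cast hw

theorem contDiff_spinorSquare : ContDiff ℝ ∞ spinorSquare := by
  refine contDiff_pi.2 fun i => ?_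
  fin_cases i
  · exact (contDiff_fst.pow 2).sub (contDiff_snd.pow 2)
  · exact contDiff_const.mul ((contDiff_fst.pow 2).add (contDiff_snd.pow 2))
  · exact ((contDiff_const.mul contDiff_fst).mul contDiff_snd).neg

theorem spinorSquare_dot_self (w : ℂ × ℂ) : spinorSquare w ⬝ᵥ spinorSquare w = 0 := by
  simp only [spinorSquare, dotProduct, Fin.sum_univ_three, Matrix.cons_val]
  linear_combination (w.1 ^ 2 + w.2 ^ 2) ^ 2 * Complex.I_sq

/-- The hermitian product of two isotropic vectors is, up to the factor `2`, the square of the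
product of the spinors. Hence angles in the frames are twice the angles of the spinors. -/
theorem spinorSquare_dot_conj (w w' : ℂ × ℂ) :
    spinorSquare w ⬝ᵥ (fun i => starRingEnd ℂ (spinorSquare w' i)) = 2 * spinorInner w w' ^ 2 := by
  simp only [spinorSquare, dotProduct, Fin.sum_univ_three, Matrix.cons_val, spinorInner, map_sub,
    map_mul, map_neg, map_add, map_pow, Complex.conj_I, map_ofNat]
  linear_combination -(w.1 ^ 2 + w.2 ^ 2) * ((starRingEnd ℂ w'.1) ^ 2 + (starRingEnd ℂ w'.2) ^ 2)
    * Complex.I_sq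

theorem exists_spinorSquare_eq {N : Fin 3 → ℂ} (hN : N ⬝ᵥ N = 0) : ∃ w, spinorSquare w = N := by
  have hN' : N 0 ^ 2 + N 1 ^ 2 + N 2 ^ 2 = 0 := by
    rw [← hN, dotProduct, Fin.sum_univ_three]; ring
  have hI := Complex.I_sq
  obtain ⟨a, ha⟩ := IsAlgClosed.exists_pow_nat_eq ((N 0 - Complex.I * N 1) / 2) two_pos
  by_cases h : a = 0
  · obtain ⟨b, hb⟩ := IsAlgClosed.exists_pow_nat_eq (-(N 0 + Complex.I * N 1) / 2) two_pos
    have h1 : N 0 - Complex.I * N 1 = 0 := by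
      rw [h] at ha
      linear_combination -2 * ha
    have h2 : N 2 = 0 := by
      have : N 2 ^ 2 = 0 := by
        linear_combination hN' - (N 0 + Complex.I * N 1) * h1 - N 1 ^ 2 * hI
      exact pow_eq_zero_iff two_ne_zero |>.1 this
    refine ⟨(a, b), ?_⟩
    ext i
    fin_cases i
    · simp only [spinorSquare, ha, hb, Fin.zero_eta, Matrix.cons_val]; ring
    · simp only [spinorSquare, ha, hb, Fin.mk_one, Matrix.cons_val]
      linear_combination -(N 1) * hI
    · simp [spinorSquare, h, h2]
  · have hb : (-(N 2) / (2 * a)) ^ 2 = -(N 0 + Complex.I * N 1) / 2 := by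
      rw [div_pow, div_eq_iff (pow_ne_zero 2 (mul_ne_zero two_ne_zero h)), mul_pow, ha]
      linear_combination hN' - N 1 ^ 2 * hI
    refine ⟨(a, -(N 2) / (2 * a)), ?_⟩
    ext i
    fin_cases i
    · simp only [spinorSquare, ha, hb, Fin.zero_eta, Matrix.cons_val]; ring
    · simp only [spinorSquare, ha, hb, Fin.mk_one, Matrix.cons_val]
      linear_combination -(N 1) * hI
    · simp only [spinorSquare, Fin.reduceFinMk, Matrix.cons_val]
      field_simp

theorem spinorSquare_eq_iff {w w' : ℂ × ℂ} : spinorSquare w = spinorSquare w' ↔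
    w = w' ∨ w = -w' := by
  constructor
  · intro h
    have h0 : w.1 ^ 2 - w.2 ^ 2 = w'.1 ^ 2 - w'.2 ^ 2 := congrFun h 0
    have h1 : w.1 ^ 2 + w.2 ^ 2 = w'.1 ^ 2 + w'.2 ^ 2 :=
      mul_left_cancel₀ Complex.I_ne_zero (congrFun h 1)
    have h2 : -(2 * w.1 * w.2) = -(2 * w'.1 * w'.2) := congrFun h 2
    have e1 : w.1 ^ 2 = w'.1 ^ 2 := by linear_combination (h0 + h1) / 2
    have e2 : w.2 ^ 2 = w'.2 ^ 2 := by linear_combination (h1 - h0) / 2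
    have e3 : w.1 * w.2 = w'.1 * w'.2 := by linear_combination -h2 / 2
    rcases sq_eq_sq_iff_eq_or_eq_neg.1 e1 with h | h <;>
      rcases sq_eq_sq_iff_eq_or_eq_neg.1 e2 with k | k
    · exact Or.inl (Prod.ext h k)
    · by_cases h3 : w'.1 = 0
      · exact Or.inr (Prod.ext (by simp [h, h3]) k)
      · have : w'.2 = 0 := by
          rw [h, k] at e3
          have : w'.1 * w'.2 = 0 := by linear_combination -e3 / 2
          exact (mul_eq_zero.1 this).resolve_left h3
        exact Or.inl (Prod.ext h (by simp [k, this]))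
    · by_cases h3 : w'.1 = 0
      · exact Or.inl (Prod.ext (by simp [h, h3]) k)
      · have : w'.2 = 0 := by
          rw [h, k] at e3
          have : w'.1 * w'.2 = 0 := by linear_combination -e3 / 2
          exact (mul_eq_zero.1 this).resolve_left h3
        exact Or.inr (Prod.ext h (by simp [k, this]))
    · exact Or.inr (Prod.ext h k)
  · rintro (rfl | rfl)
    · rfl
    · simp [spinorSquare]

theorem neg_mem_unitSpinors {w : ℂ × ℂ} (hw : w ∈ unitSpinors) : -w ∈ unitSpinors := by
  simpa [unitSpinors] using hw

theorem isCompact_unitSpinors : IsCompact unitSpinors := by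
  refine (isCompact_closedBall (0 : ℂ × ℂ) 1).of_isClosed_subset
    (isClosed_eq (by fun_prop) continuous_const) fun w hw => ?_
  have hw' : ‖w.1‖ ^ 2 + ‖w.2‖ ^ 2 = 1 := hw
  rw [mem_closedBall_zero_iff, Prod.norm_def, max_le_iff]
  constructor <;> nlinarith [norm_nonneg w.1, norm_nonneg w.2]

instance : MulAction ℤˣ unitSpinors where
  smul u w := ⟨u • w.1, by
    rcases Int.units_eq_one_or u with rfl | rfl
    · rw [one_smul]; exact w.2
    · rw [Units.neg_smul, one_smul]; exact neg_mem_unitSpinors w.2⟩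
  one_smul w := Subtype.ext (one_smul _ _)
  mul_smul u u' w := Subtype.ext (mul_smul _ _ _)

theorem coe_units_smul (u : ℤˣ) (w : unitSpinors) : ((u • w : unitSpinors) : ℂ × ℂ) = u • w.1 := rfl

/-- The double cover of the set of orthonormal frames by the three-sphere. -/
theorem isCoveringMap_spinorSquare :
    IsCoveringMap (fun w : unitSpinors => (⟨spinorSquare w, Set.mem_image_of_mem _ w.2⟩ :
      spinorSquare '' unitSpinors)) := by
  have : CompactSpace unitSpinors := isCompact_iff_compactSpace.1 isCompact_unitSpinors
  have hc : Continuous (fun w : unitSpinors => (⟨spinorSquare w, Set.mem_image_of_mem _ w.2⟩ :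
      spinorSquare '' unitSpinors)) :=
    (contDiff_spinorSquare.continuous.comp continuous_subtype_val).subtype_mk _
  have hs : Function.Surjective (fun w : unitSpinors => (⟨spinorSquare w, Set.mem_image_of_mem _ w.2⟩ :
      spinorSquare '' unitSpinors)) := by
    rintro ⟨_, w, hw, rfl⟩
    exact ⟨⟨w, hw⟩, rfl⟩
  have hq := hc.isClosedMap.isQuotientMap hc hs
  have : ContinuousConstSMul ℤˣ unitSpinors := ⟨fun u => by
    refine Continuous.subtype_mk ?_ _
    rcases Int.units_eq_one_or u with rfl | rfl
    · simpa only [one_smul] using continuous_subtype_val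
    · simp only [Units.neg_smul, one_smul]
      exact continuous_subtype_val.neg⟩
  have hne : ∀ w : unitSpinors, (w : ℂ × ℂ) ≠ 0 := fun w h => by
    have := w.2
    rw [h] at this
    simp [unitSpinors] at this
  have : IsCancelSMul ℤˣ unitSpinors := isCancelSMul_iff_eq_one_of_smul_eq.2 fun u w h => by
    rcases Int.units_eq_one_or u with rfl | rfl
    · rfl
    · have h1 := congrArg Subtype.val h
      rw [coe_units_smul, Units.neg_smul, one_smul] at h1
      exact absurd (self_eq_neg.1 h1.symm) (hne w)
  refine (hq.isQuotientCoveringMap_of_properlyDiscontinuousSMul (G := ℤˣ) fun {w w'} => ?_).isCoveringMap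
  rw [Subtype.ext_iff]
  simp only [spinorSquare_eq_iff]
  constructor
  · rintro (h | h)
    · exact ⟨1, Subtype.ext (by simp [h])⟩
    · exact ⟨-1, Subtype.ext (by simp [coe_units_smul, h])⟩
  · rintro ⟨u, rfl⟩
    rcases Int.units_eq_one_or u with rfl | rfl
    · left; simp
    · right; simp [coe_units_smul]

end Spinor

section SpinLift

open Set

/-- A family of orthonormal frames over the plane lifts to the three-sphere. -/
theorem exists_spinor_lift {N : ℝ × ℝ → Fin 3 → ℂ} (hc : Continuous N)
    (h : ∀ p, N p ∈ spinorSquare '' unitSpinors) :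
    ∃ W : ℝ × ℝ → ℂ × ℂ, Continuous W ∧ (∀ p, W p ∈ unitSpinors) ∧
      ∀ p, spinorSquare (W p) = N p := by
  obtain ⟨w₀, hw₀, h0⟩ := h 0
  obtain ⟨W, ⟨-, hW⟩, -⟩ := isCoveringMap_spinorSquare.existsUnique_continuousMap_lifts
    (⟨fun p => ⟨N p, h p⟩, hc.subtype_mk _⟩ : C(ℝ × ℝ, spinorSquare '' unitSpinors)) 0 ⟨w₀, hw₀⟩
    (Subtype.ext h0)
  exact ⟨fun p => W p, continuous_subtype_val.comp W.continuous, fun p => (W p).2, fun p =>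
    congrArg Subtype.val (congrFun hW p)⟩

theorem spinorInner_sq_of_eq {w w' : ℂ × ℂ} (hw : w ∈ unitSpinors)
    (h : spinorSquare w = spinorSquare w') : spinorInner w w' ^ 2 = 1 := by
  have h1 := spinorSquare_dot_conj w w'
  rw [← h, spinorSquare_dot_conj, spinorInner_self hw] at h1
  linear_combination -h1 / 2

theorem eq_of_sq_eq_one {T : ℝ} (hT : 0 ≤ T) {f : ℝ → ℂ} (hf : ContinuousOn f (Icc 0 T))
    (h : ∀ t ∈ Icc 0 T, f t ^ 2 = 1) : f T = f 0 :=
  isPreconnected_Icc.constant_of_mapsTo (T := {1, -1}) (Set.toFinite _).isDiscrete hf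
    (fun t ht => sq_eq_sq_iff_eq_or_eq_neg.1 ((h t ht).trans (one_pow 2).symm)) (right_mem_Icc.2 hT)
    (left_mem_Icc.2 hT)

theorem continuous_spinorInner {X : Type*} [TopologicalSpace X] {w w' : X → ℂ × ℂ}
    (h : Continuous w) (h' : Continuous w') : Continuous fun x => spinorInner (w x) (w' x) := by
  unfold spinorInner
  exact (h.fst.mul (Complex.continuous_conj.comp h'.fst)).add
    (h.snd.mul (Complex.continuous_conj.comp h'.snd))

/-- Along a contractible loop of orthonormal frames, the product of which with the initial frame never
vanishes, the total angle of this product is a multiple of `4π`: the loop lifts to a closed loop in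
the three-sphere, where the angles are halved. -/
theorem exists_angle_eq_four_pi_mul {T : ℝ} (hT : 0 < T) {N : ℝ → ℝ → Fin 3 → ℂ}
    (hc : ContinuousOn (fun p : ℝ × ℝ => N p.1 p.2) (Icc 0 1 ×ˢ univ))
    (hN : ∀ s ∈ Icc (0 : ℝ) 1, ∀ t, N s t ∈ spinorSquare '' unitSpinors)
    (hper : ∀ s ∈ Icc (0 : ℝ) 1, N s T = N s 0) (hconst : ∀ t, N 0 t = N 0 0) {ℓ : ℝ → ℂ}
    (hℓ : ContinuousOn ℓ (Icc 0 T))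
    (he : ∀ t ∈ Icc 0 T,
      Complex.exp (ℓ t) = N 1 0 ⬝ᵥ fun i => starRingEnd ℂ (N 1 t i)) :
    ∃ k : ℤ, (ℓ T).im - (ℓ 0).im = 4 * Real.pi * k := by
  let P : ℝ × ℝ → ℝ × ℝ := fun p => (projIcc 0 1 zero_le_one p.1, p.2)
  have hP : Continuous P := by
    have : Continuous fun p : ℝ × ℝ => ((projIcc (0 : ℝ) 1 zero_le_one p.1 : ℝ)) :=
      continuous_subtype_val.comp (continuous_projIcc.comp continuous_fst)
    exact this.prodMk continuous_snd
  have hPm : ∀ p, P p ∈ Icc (0 : ℝ) 1 ×ˢ univ := fun p => ⟨(projIcc 0 1 zero_le_one p.1).2, trivial⟩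
  obtain ⟨W, hW, hWu, hWN⟩ := exists_spinor_lift (N := fun p => N (P p).1 (P p).2)
    (hc.comp_continuous hP hPm) fun p => hN _ (hPm p).1 _
  have hWN' : ∀ s ∈ Icc (0 : ℝ) 1, ∀ t, spinorSquare (W (s, t)) = N s t := fun s hs t => by
    rw [hWN]
    simp only [P]
    rw [projIcc_of_mem zero_le_one hs]
  have h0mem : (0 : ℝ) ∈ Icc (0 : ℝ) 1 := by simp
  have h1mem : (1 : ℝ) ∈ Icc (0 : ℝ) 1 := by simp
  -- The lift of each loop closes up to a sign, which is constant in the homotopy and is `1` for the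
  -- constant loop.
  have e0 : spinorInner (W (0, T)) (W (0, 0)) = 1 := by
    have := eq_of_sq_eq_one hT.le (f := fun t => spinorInner (W (0, t)) (W (0, 0)))
      (continuous_spinorInner (hW.comp (by fun_prop)) continuous_const).continuousOn fun t _ =>
        spinorInner_sq_of_eq (hWu _) (by rw [hWN' 0 h0mem, hWN' 0 h0mem, hconst])
    rw [this, spinorInner_self (hWu _)]
  have e1 : spinorInner (W (1, 0)) (W (1, T)) = 1 := by
    have h1 := eq_of_sq_eq_one zero_le_one (f := fun s => spinorInner (W (s, T)) (W (s, 0)))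
      (continuous_spinorInner (hW.comp (by fun_prop)) (hW.comp (by fun_prop))).continuousOn
      fun s hs => spinorInner_sq_of_eq (hWu _) (by rw [hWN' s hs, hWN' s hs, hper s hs])
    simp only [e0] at h1
    have h2 : spinorInner (W (1, 0)) (W (1, T)) = starRingEnd ℂ (spinorInner (W (1, T)) (W (1, 0))) := by
      simp only [spinorInner, map_add, map_mul, Complex.conj_conj]
      ring
    rw [h2, h1, map_one]
  have hsq : ∀ t ∈ Icc 0 T, Complex.exp (ℓ t) = 2 * spinorInner (W (1, 0)) (W (1, t)) ^ 2 :=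
    fun t ht => by
      rw [he t ht, ← spinorSquare_dot_conj, hWN' 1 h1mem, hWN' 1 h1mem]
  obtain ⟨L, hL, hLe⟩ := exists_log_Icc hT.le (f := fun t => spinorInner (W (1, 0)) (W (1, t)))
    (continuous_spinorInner continuous_const (hW.comp (by fun_prop))).continuousOn
    fun t ht h => by
      have := hsq t ht
      rw [h] at this
      simp at this
  have h1 := congrArg Complex.im (eq_of_exp_eq_one hT.le
    (f := fun t => ℓ t - 2 * L t - Complex.log 2)
    ((hℓ.sub (continuousOn_const.mul hL)).sub continuousOn_const) fun t ht => by
      rw [Complex.exp_sub, Complex.exp_sub, hsq t ht, two_mul (L t), Complex.exp_add, hLe t ht,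
        Complex.exp_log two_ne_zero]
      have : spinorInner (W (1, 0)) (W (1, t)) ≠ 0 := by rw [← hLe t ht]; exact Complex.exp_ne_zero _
      field_simp)
  obtain ⟨k, hk⟩ := Complex.exp_eq_one_iff.1 (show Complex.exp (L T - L 0) = 1 by
    rw [Complex.exp_sub, hLe T (right_mem_Icc.2 hT.le), hLe 0 (left_mem_Icc.2 hT.le)]
    rw [e1, spinorInner_self (hWu _), div_one])
  refine ⟨k, ?_⟩
  have h2 := congrArg Complex.im hk
  simp at h1 h2
  linarith

end SpinLift

/-- The isotropic vector `b + i x × b`. -/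
def frameVector (x b : R3) : Fin 3 → ℂ := fun i => ⟨b i, (x ⨯₃ b) i⟩

/-- An orthonormal pair `x, b` comes from a unit spinor. -/
theorem frameVector_mem {x b : R3} (hx : x ⬝ᵥ x = 1) (hxb : x ⬝ᵥ b = 0) (hb : b ⬝ᵥ b = 1) :
    frameVector x b ∈ spinorSquare '' unitSpinors := by
  have hx' := hx
  rw [dot_eq] at hx hxb hb
  have key : (b 1 * x 2 - b 2 * x 1) ^ 2 + (b 2 * x 0 - b 0 * x 2) ^ 2
      + (b 0 * x 1 - b 1 * x 0) ^ 2 = 1 := by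
    linear_combination (b 0 * b 0 + b 1 * b 1 + b 2 * b 2) * hx + hb
      - (x 0 * b 0 + x 1 * b 1 + x 2 * b 2) * hxb
  obtain ⟨w, hw⟩ := exists_spinorSquare_eq (N := frameVector x b) (by
    apply Complex.ext
    · simp [frameVector, dotProduct, Fin.sum_univ_three, cross_zero, cross_one, cross_two]
      linear_combination hb - key
    · simp [frameVector, dotProduct, Fin.sum_univ_three, cross_zero, cross_one, cross_two]
      ring)
  refine ⟨w, ?_, hw⟩
  have h1 := congrArg Complex.re (spinorSquare_dot_conj w w)
  rw [hw, spinorInner_self_eq, ← Complex.ofReal_pow] at h1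
  have h3 : (frameVector x b ⬝ᵥ fun i => starRingEnd ℂ (frameVector x b i)).re = 2 := by
    simp [frameVector, dotProduct, Fin.sum_univ_three, cross_zero, cross_one, cross_two]
    linear_combination hb + key
  rw [h3] at h1
  simp only [Complex.mul_re, Complex.re_ofNat, Complex.ofReal_re, Complex.im_ofNat,
    Complex.ofReal_im, mul_zero, sub_zero] at h1
  have h4 : (0 : ℝ) ≤ ‖w.1‖ ^ 2 + ‖w.2‖ ^ 2 := by positivity
  exact (pow_eq_one_iff_of_nonneg h4 two_ne_zero).1 (by linarith)

/-! ### Total angles along contractible loops of tangent vectors -/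

theorem div_mem_slitPlane {z w : ℂ} (h : z * starRingEnd ℂ w ∈ Complex.slitPlane) :
    z / w ∈ Complex.slitPlane := by
  have hw : w ≠ 0 := by
    rintro rfl
    simp at h
  have h1 : z / w = ((Complex.normSq w)⁻¹ : ℝ) * (z * starRingEnd ℂ w) := by
    have h2 : (Complex.normSq w : ℂ) ≠ 0 := by exact_mod_cast Complex.normSq_pos.2 hw |>.ne'
    push_cast
    field_simp
    rw [mul_assoc, Complex.mul_conj]
  have h3 : 0 < (Complex.normSq w)⁻¹ := inv_pos.2 (Complex.normSq_pos.2 hw)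
  rw [h1, Complex.mem_slitPlane_iff, Complex.re_ofReal_mul, Complex.im_ofReal_mul]
  rcases h with h | h
  · exact Or.inl (mul_pos h3 h)
  · exact Or.inr (mul_ne_zero h3.ne' h)

theorem frameVector_dot_conj (x b y v : R3) :
    (frameVector x b ⬝ᵥ fun i => starRingEnd ℂ (frameVector y v i)) =
      ⟨b ⬝ᵥ v + (x ⨯₃ b) ⬝ᵥ (y ⨯₃ v), (x ⨯₃ b) ⬝ᵥ v - b ⬝ᵥ (y ⨯₃ v)⟩ := by
  apply Complex.ext <;>
    simp [frameVector, dotProduct, Fin.sum_univ_three, cross_zero, cross_one, cross_two] <;> ring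

namespace SphereMetric

/-- A comparison of the parallel transport from `x` to `y` along the great circle with the
projection to the tangent plane. -/
theorem re_frameVector_dot_conj_pos {x y b v : R3} (hy : y ⬝ᵥ y = 1)
    (hb : b ⬝ᵥ b = 1) (hxb : x ⬝ᵥ b = 0) (hyv : y ⬝ᵥ v = 0) (hv : v ≠ 0) (hxy : 0 < y ⬝ᵥ x) :
    0 < ((frameVector x b ⬝ᵥ fun i => starRingEnd ℂ (frameVector y v i))
      * starRingEnd ℂ ⟨extend b y ⬝ᵥ v, y ⬝ᵥ (extend b y ⨯₃ v)⟩).re := by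
  have e1 : extend b y ⬝ᵥ v = b ⬝ᵥ v := by
    rw [extend, sub_dotProduct, smul_dotProduct, hyv]; simp
  have e2 : y ⬝ᵥ (extend b y ⨯₃ v) = y ⬝ᵥ (b ⨯₃ v) := by
    simp [extend, triple_eq]
  have hv0 := dot_self_pos hv
  have hcs : (y ⬝ᵥ b) ^ 2 ≤ 1 := by
    have h : 0 ≤ extend b y ⬝ᵥ extend b y := by
      by_cases h0 : extend b y = 0
      · simp [h0]
      · exact (dot_self_pos h0).le
    have : extend b y ⬝ᵥ extend b y = 1 - (y ⬝ᵥ b) ^ 2 := by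
      simp only [extend, sub_dotProduct, dotProduct_sub, smul_dotProduct, dotProduct_smul, hb, hy,
        dotProduct_comm b y, smul_eq_mul]
      ring
    linarith
  rw [frameVector_dot_conj, e1, e2]
  simp only [Complex.mul_re, Complex.conj_re, Complex.conj_im]
  have key : (b ⬝ᵥ v + (x ⨯₃ b) ⬝ᵥ (y ⨯₃ v)) * (b ⬝ᵥ v)
      - ((x ⨯₃ b) ⬝ᵥ v - b ⬝ᵥ (y ⨯₃ v)) * -(y ⬝ᵥ (b ⨯₃ v))
      = (v ⬝ᵥ v) * (1 + y ⬝ᵥ x - (y ⬝ᵥ b) ^ 2) := by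
    have g1 : (x ⨯₃ b) ⬝ᵥ (y ⨯₃ v) = (y ⬝ᵥ x) * (b ⬝ᵥ v) - (x ⬝ᵥ v) * (y ⬝ᵥ b) := by
      simp only [dot_eq, cross_zero, cross_one, cross_two]; ring
    have g2 : b ⬝ᵥ (y ⨯₃ v) = - (y ⬝ᵥ (b ⨯₃ v)) := by
      simp only [dot_eq, cross_zero, cross_one, cross_two]; ring
    have g3 : (y ⬝ᵥ (b ⨯₃ v)) ^ 2 = (y ⬝ᵥ y) * ((b ⬝ᵥ b) * (v ⬝ᵥ v) - (b ⬝ᵥ v) ^ 2)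
        - (y ⬝ᵥ b) * ((y ⬝ᵥ b) * (v ⬝ᵥ v) - (b ⬝ᵥ v) * (y ⬝ᵥ v))
        + (y ⬝ᵥ v) * ((y ⬝ᵥ b) * (b ⬝ᵥ v) - (b ⬝ᵥ b) * (y ⬝ᵥ v)) := by
      simp only [dot_eq, cross_zero, cross_one, cross_two]; ring
    have g4 : ((x ⨯₃ b) ⬝ᵥ v) * (y ⬝ᵥ (b ⨯₃ v))
        = (y ⬝ᵥ x) * ((b ⬝ᵥ b) * (v ⬝ᵥ v) - (b ⬝ᵥ v) ^ 2)
        - (x ⬝ᵥ b) * ((y ⬝ᵥ b) * (v ⬝ᵥ v) - (b ⬝ᵥ v) * (y ⬝ᵥ v))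
        + (x ⬝ᵥ v) * ((y ⬝ᵥ b) * (b ⬝ᵥ v) - (b ⬝ᵥ b) * (y ⬝ᵥ v)) := by
      simp only [dot_eq, cross_zero, cross_one, cross_two]; ring
    rw [hb, hy, hyv] at g3
    rw [hb, hxb, hyv] at g4
    rw [g1, g2]
    linear_combination g3 + g4
  rw [key]
  exact mul_pos hv0 (by linarith)

variable (g : SphereMetric)

/-- The coordinate of a tangent vector in the orthogonal frame `B, ȷB`, up to a positive factor. -/
def relCoord (x B v : R3) : ℂ := ⟨g.form x B v, g.form x (g.rot x B) v⟩

/-- The angles for the metric `g` and for the Euclidean metric never differ by `π`. -/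
theorem relCoord_mul_conj_mem_slitPlane {x B v : R3} (hx : x ⬝ᵥ x = 1) (hB : x ⬝ᵥ B = 0)
    (hv : x ⬝ᵥ v = 0) (hB0 : B ≠ 0) (hv0 : v ≠ 0) :
    g.relCoord x B v * starRingEnd ℂ ⟨B ⬝ᵥ v, x ⬝ᵥ (B ⨯₃ v)⟩ ∈ Complex.slitPlane := by
  have hρ := g.areaDensity_pos hx
  have hBB := g.pos x B hx hB hB0
  have hBE := dot_self_pos hB0
  rw [Complex.mem_slitPlane_iff]
  simp only [relCoord, g.form_rot hx hB hv, Complex.mul_re, Complex.mul_im, Complex.conj_re,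
    Complex.conj_im]
  set D := x ⬝ᵥ (B ⨯₃ v) with hD
  by_cases h0 : D = 0
  · left
    have h1 := g.frame_expand hx hB hv
    rw [g.form_rot hx hB hv, ← hD, h0, mul_zero, zero_smul, add_zero] at h1
    have h2 : g.form x B v ≠ 0 := fun h => by
      rw [h, zero_smul] at h1
      exact (smul_ne_zero hBB.ne' hv0) h1
    have h3 : g.form x B B * (B ⬝ᵥ v) = g.form x B v * (B ⬝ᵥ B) := by
      have := congrArg (fun y => B ⬝ᵥ y) h1
      simpa [dotProduct_smul] using this
    have h4 : 0 < g.form x B B * (g.form x B v * (B ⬝ᵥ v)) := by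
      have : g.form x B B * (g.form x B v * (B ⬝ᵥ v)) = g.form x B v ^ 2 * (B ⬝ᵥ B) := by
        linear_combination g.form x B v * h3
      rw [this]
      positivity
    rw [h0]
    simpa using pos_of_mul_pos_right h4 hBB.le
  · by_cases h1 : g.form x B v = g.areaDensity x * (B ⬝ᵥ v)
    · left
      rw [h1]
      have : 0 < D ^ 2 := by positivity
      nlinarith [sq_nonneg (B ⬝ᵥ v), mul_pos hρ this, mul_nonneg hρ.le (sq_nonneg (B ⬝ᵥ v))]
    · right
      intro h2
      apply h1
      apply mul_left_cancel₀ h0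
      linear_combination -h2

end SphereMetric

/-- The Euclidean unit vector in the direction of `v`. -/
def unitDir (v : R3) : R3 := (√(v ⬝ᵥ v))⁻¹ • v

theorem unitDir_dot_self {v : R3} (hv : v ≠ 0) : unitDir v ⬝ᵥ unitDir v = 1 := by
  have h := dot_self_pos hv
  simp only [unitDir, dotProduct_smul, smul_dotProduct, smul_eq_mul]
  rw [← mul_assoc, ← mul_inv, Real.mul_self_sqrt h.le, inv_mul_cancel₀ h.ne']

theorem dot_unitDir {x v : R3} (h : x ⬝ᵥ v = 0) : x ⬝ᵥ unitDir v = 0 := by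
  simp [unitDir, dotProduct_smul, h]

theorem smul_unitDir {v : R3} (hv : v ≠ 0) : √(v ⬝ᵥ v) • unitDir v = v := by
  rw [unitDir, smul_smul, mul_inv_cancel₀ (Real.sqrt_pos.2 (dot_self_pos hv)).ne', one_smul]

theorem unitDir_ne_zero {v : R3} (hv : v ≠ 0) : unitDir v ≠ 0 := fun h => by
  have := unitDir_dot_self hv
  rw [h] at this
  simp at this

theorem contDiffAt_unitDir {v : R3} (hv : v ≠ 0) : ContDiffAt ℝ ∞ unitDir v := by
  have h1 : ContDiffAt ℝ ∞ (fun v : R3 => v ⬝ᵥ v) v := contDiffAt_dot contDiffAt_id contDiffAt_id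
  exact ((h1.sqrt (dot_self_pos hv).ne').inv (Real.sqrt_pos.2 (dot_self_pos hv)).ne').smul
    contDiffAt_id

theorem contDiffAt_frameVector_unitDir {z : R3 × R3} (hv : z.2 ≠ 0) :
    ContDiffAt ℝ ∞ (fun z : R3 × R3 => frameVector z.1 (unitDir z.2)) z := by
  have c1 : ContDiffAt ℝ ∞ (fun z : R3 × R3 => unitDir z.2) z :=
    (contDiffAt_unitDir hv).comp z contDiffAt_snd
  have c2 : ContDiffAt ℝ ∞ (fun z : R3 × R3 => z.1 ⨯₃ unitDir z.2) z :=
    contDiffAt_cross contDiffAt_fst c1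
  have e : (fun z : R3 × R3 => frameVector z.1 (unitDir z.2)) = fun z j =>
      (unitDir z.2 j : ℂ) + ((z.1 ⨯₃ unitDir z.2) j : ℂ) * Complex.I := by
    funext z j
    apply Complex.ext <;> simp [frameVector]
  rw [e]
  exact contDiffAt_pi.2 fun j => (Complex.ofRealCLM.contDiff.contDiffAt.comp z
    (contDiffAt_pi.1 c1 j)).add ((Complex.ofRealCLM.contDiff.contDiffAt.comp z
    (contDiffAt_pi.1 c2 j)).mul contDiffAt_const)

namespace SphereMetric

variable (g : SphereMetric)

open Set in
/-- The total angle of the velocities along a contractible loop, relative to the projections of the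
initial velocity, is a multiple of `4π`. -/
theorem exists_angle_eq_of_contractible {m : ℝ} (hm : 0 < m) {γ : ℝ → R3 × R3} {T : ℝ}
    (hT : 0 < T) {i : ℝ → ℝ → R3 × R3} (hi : IsCappingCylinder (g.energyLevel m) γ T i)
    (hnear : ∀ t ∈ Icc 0 T, 0 < (γ t).1 ⬝ᵥ (γ 0).1) {ℓ : ℝ → ℂ} (hℓ : ContinuousOn ℓ (Icc 0 T))
    (hB : ∀ t ∈ Icc 0 T, extend (unitDir (γ 0).2) (γ t).1 ≠ 0)
    (he : ∀ t ∈ Icc 0 T, Complex.exp (ℓ t)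
      = g.relCoord (γ t).1 (extend (unitDir (γ 0).2) (γ t).1) (γ t).2) :
    ∃ k : ℤ, (ℓ T).im - (ℓ 0).im = 4 * Real.pi * k := by
  obtain ⟨hic, hiS, hi0, hi1⟩ := hi
  have h1mem : (1 : ℝ) ∈ Icc (0 : ℝ) 1 := by simp
  have hne : ∀ z ∈ g.energyLevel m, z.2 ≠ 0 := fun z hz => g.ne_zero_of_mem hm hz
  let F : R3 × R3 → Fin 3 → ℂ := fun z => frameVector z.1 (unitDir z.2)
  have hFc : ContinuousOn F (g.energyLevel m) := fun z hz =>
    (contDiffAt_frameVector_unitDir (hne z hz)).continuousAt.continuousWithinAt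
  have hFm : ∀ z ∈ g.energyLevel m, F z ∈ spinorSquare '' unitSpinors := fun z hz => by
    obtain ⟨hx, hv, -⟩ := g.mem_energyLevel.1 hz
    exact frameVector_mem hx (dot_unitDir hv) (unitDir_dot_self (hne z hz))
  have hγS : ∀ t, γ t ∈ g.energyLevel m := fun t => by rw [← hi1]; exact (hiS 1 h1mem t).1
  have hγT : γ T = γ 0 := by
    have := (hiS 1 h1mem 0).2
    rwa [zero_add, hi1, hi1] at this
  have hγc : Continuous γ := by
    have : γ = fun t => i 1 t := funext fun t => (hi1 t).symm
    rw [this]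
    exact hic.comp_continuous (f := fun t : ℝ => ((1 : ℝ), t)) (by fun_prop) fun t =>
      ⟨h1mem, trivial⟩
  let b := unitDir (γ 0).2
  -- The total angle is computed in three ways: `H` is the hermitian product of the Euclidean
  -- frames, `Z` is the Euclidean angle relative to the projection of `b`, and `relCoord` is the
  -- angle of `g`. The quotient of any two consecutive ones avoids the negative real axis.
  let H : ℝ → ℂ := fun t => F (γ 0) ⬝ᵥ fun j => starRingEnd ℂ (F (γ t) j)
  let Z : ℝ → ℂ := fun t => ⟨extend b (γ t).1 ⬝ᵥ unitDir (γ t).2,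
    (γ t).1 ⬝ᵥ (extend b (γ t).1 ⨯₃ unitDir (γ t).2)⟩
  have hHZ : ∀ t ∈ Icc 0 T, H t * starRingEnd ℂ (Z t) ∈ Complex.slitPlane := fun t ht => by
    obtain ⟨hx, hv, -⟩ := g.mem_energyLevel.1 (hγS t)
    have hv0 := (g.mem_energyLevel.1 (hγS 0)).2.1
    exact Or.inl (re_frameVector_dot_conj_pos hx (unitDir_dot_self (hne _ (hγS 0)))
      (dot_unitDir hv0) (dot_unitDir hv) (unitDir_ne_zero (hne _ (hγS t))) (hnear t ht))
  have hH0 : ∀ t ∈ Icc 0 T, H t ≠ 0 := fun t ht h => by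
    have := hHZ t ht
    rw [h, zero_mul] at this
    simp at this
  have hZ0 : ∀ t ∈ Icc 0 T, Z t ≠ 0 := fun t ht h => by
    have := hHZ t ht
    rw [h, map_zero, mul_zero] at this
    simp at this
  have hFγ : Continuous fun t => F (γ t) := hFc.comp_continuous hγc hγS
  have hHc : ContinuousOn H (Icc 0 T) := by
    have : Continuous H := by
      exact continuous_finsetSum _ fun j _ => continuous_const.mul
        (Complex.continuous_conj.comp ((continuous_apply j).comp hFγ))
    exact this.continuousOn
  have hu : Continuous fun t => unitDir (γ t).2 := continuous_iff_continuousAt.2 fun t =>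
    (contDiffAt_unitDir (hne _ (hγS t))).continuousAt.comp
      (f := fun t => (γ t).2) (hγc.snd.continuousAt)
  have hEc : Continuous fun t => extend b (γ t).1 :=
    (contDiff_extend b).continuous.comp hγc.fst
  have hZc : ContinuousOn Z (Icc 0 T) := by
    have e : Z = fun t => ((extend b (γ t).1 ⬝ᵥ unitDir (γ t).2 : ℝ) : ℂ)
        + (((γ t).1 ⬝ᵥ (extend b (γ t).1 ⨯₃ unitDir (γ t).2) : ℝ) : ℂ) * Complex.I := by
      funext t
      apply Complex.ext <;> simp [Z]
    have hx := hγc.fst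
    rw [e]
    simp only [dot_eq]
    exact (by fun_prop : Continuous _).continuousOn
  obtain ⟨L, hL, hLe⟩ := exists_log_Icc hT.le hHc hH0
  obtain ⟨L', hL', hLe'⟩ := exists_log_Icc hT.le hZc hZ0
  obtain ⟨k, hk⟩ := exists_angle_eq_four_pi_mul hT (N := fun s t => F (i s t))
    (hFc.comp (f := fun p : ℝ × ℝ => i p.1 p.2) hic fun p hp => (hiS p.1 hp.1 p.2).1)
    (fun s hs t => hFm _ (hiS s hs t).1)
    (fun s hs => by
      have := (hiS s hs 0).2
      rw [zero_add] at this
      simp only [this])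
    (fun t => by rw [hi0 t]) hL
    (fun t ht => by simp only [hi1]; exact hLe t ht)
  have h1 := angle_sub_angle_of_mem_slitPlane hT.le hL hL' fun t ht => by
    rw [hLe t ht, hLe' t ht]
    exact div_mem_slitPlane (hHZ t ht)
  have h2 := angle_sub_angle_of_mem_slitPlane hT.le hℓ hL' fun t ht => by
    obtain ⟨hx, hv, -⟩ := g.mem_energyLevel.1 (hγS t)
    have hv0 := hne _ (hγS t)
    rw [he t ht, hLe' t ht]
    apply div_mem_slitPlane
    have h3 := g.relCoord_mul_conj_mem_slitPlane hx (extend_tangent b hx) (dot_unitDir hv) (hB t ht)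
      (unitDir_ne_zero hv0)
    have h4 : g.relCoord (γ t).1 (extend b (γ t).1) (γ t).2
        = (√((γ t).2 ⬝ᵥ (γ t).2) : ℝ)
          * g.relCoord (γ t).1 (extend b (γ t).1) (unitDir (γ t).2) := by
      conv_lhs => rw [← smul_unitDir hv0]
      apply Complex.ext <;> simp [relCoord]
    rw [h4, mul_assoc, Complex.mem_slitPlane_iff, Complex.re_ofReal_mul, Complex.im_ofReal_mul]
    have h5 := Real.sqrt_pos.2 (dot_self_pos hv0)
    rcases h3 with h3 | h3
    · exact Or.inl (mul_pos h5 h3)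
    · exact Or.inr (mul_ne_zero h5.ne' h3)
  have hTm := right_mem_Icc.2 hT.le
  have h0m := left_mem_Icc.2 hT.le
  rw [hLe T hTm, hLe' T hTm, hLe 0 h0m, hLe' 0 h0m] at h1
  rw [he T hTm, hLe' T hTm, he 0 h0m, hLe' 0 h0m] at h2
  have e1 : H T = H 0 := by simp only [H, hγT]
  have e2 : Z T = Z 0 := by simp only [Z, hγT]
  rw [e1, e2, sub_self] at h1
  rw [e2, hγT, sub_self] at h2
  exact ⟨k, by linarith⟩

end SphereMetric

/-! ### The periods of contractible orbits -/

namespace SphereMetric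

variable (g : SphereMetric)

/-- `relCoord` multiplies lengths. -/
theorem normSq_relCoord {x B v : R3} (hx : x ⬝ᵥ x = 1) (hB : x ⬝ᵥ B = 0) (hv : x ⬝ᵥ v = 0) :
    ‖g.relCoord x B v‖ ^ 2 = g.form x B B * g.form x v v := by
  rw [← Complex.normSq_eq_norm_sq, Complex.normSq_apply, relCoord]
  have h := congrArg (g.form x v) (g.frame_expand hx hB hv)
  simp only [map_add, map_smul, smul_eq_mul] at h
  rw [h, g.symm x v B, g.symm x v (g.rot x B)]

/-- Projections of a fixed vector to the tangent planes are almost parallel on short paths. -/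
theorem exists_covDeriv_extend_le : ∃ C : ℝ, 0 < C ∧ ∀ x b u : R3, x ⬝ᵥ x = 1 → b ⬝ᵥ b = 1 →
    |x ⬝ᵥ b| ≤ 3 / 4 →
    let A := g.covDeriv x (extend b x) u (fderiv ℝ (extend b) x u)
    g.form x A A ≤ (C * ‖u‖) ^ 2 * g.form x (extend b x) (extend b x) := by
  obtain ⟨δ, hδ, hδf⟩ := g.exists_form_ge
  obtain ⟨C, hC, hCc⟩ := g.exists_norm_covDeriv_le 2
  obtain ⟨G, hG⟩ := isCompact_sphere.exists_bound_of_continuousOn g.smooth.continuous.continuousOn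
  have hG0 : 0 ≤ G := (norm_nonneg _).trans (hG ![1, 0, 0] (by simp))
  refine ⟨√(175 * G * C ^ 2 / δ) + 1, by positivity, fun x b u hx hb hxb => ?_⟩
  intro A
  have nx := norm_le_one_of_unit hx
  have nb := norm_le_one_of_unit hb
  have nB : ‖extend b x‖ ≤ 2 := by
    rw [extend]
    refine (norm_sub_le _ _).trans ?_
    rw [norm_smul, Real.norm_eq_abs]
    nlinarith [norm_nonneg x, abs_nonneg (x ⬝ᵥ b)]
  have nB' : ‖fderiv ℝ (extend b) x u‖ ≤ 4 * ‖u‖ := by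
    rw [fderiv_extend]
    refine (norm_sub_le _ _).trans ?_
    rw [norm_neg, norm_smul, norm_smul, Real.norm_eq_abs, Real.norm_eq_abs]
    have h1 : |u ⬝ᵥ b| * ‖x‖ ≤ 3 * ‖u‖ := by
      calc |u ⬝ᵥ b| * ‖x‖ ≤ 3 * (‖u‖ * 1) * 1 := by
            have := abs_dot_le u b
            gcongr
            exact this.trans (by gcongr)
        _ = 3 * ‖u‖ := by ring
    have h2 : |x ⬝ᵥ b| * ‖u‖ ≤ 1 * ‖u‖ := by gcongr; linarith
    linarith
  have nA : ‖A‖ ≤ 5 * C * ‖u‖ := by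
    calc ‖A‖ ≤ C * (‖u‖ + ‖fderiv ℝ (extend b) x u‖) := hCc _ _ _ _ hx nB
      _ ≤ C * (‖u‖ + 4 * ‖u‖) := by gcongr
      _ = _ := by ring
  have e1 : g.form x A A ≤ G * (5 * C * ‖u‖) ^ 2 := by
    calc g.form x A A ≤ ‖g.form x A A‖ := Real.le_norm_self _
      _ ≤ ‖g.form x‖ * ‖A‖ * ‖A‖ := (g.form x).le_opNorm₂ A A
      _ ≤ G * ‖A‖ * ‖A‖ := by gcongr; exact hG x hx
      _ = G * ‖A‖ ^ 2 := by ring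
      _ ≤ _ := by gcongr
  have e2 : (7 / 48 : ℝ) ≤ ‖extend b x‖ ^ 2 := by
    have h1 : extend b x ⬝ᵥ extend b x = 1 - |x ⬝ᵥ b| ^ 2 := by
      rw [sq_abs]
      simp only [extend, sub_dotProduct, dotProduct_sub, smul_dotProduct, dotProduct_smul, hb, hx,
        dotProduct_comm b x, smul_eq_mul]
      ring
    have h2 := (le_abs_self _).trans (abs_dot_le (extend b x) (extend b x))
    rw [h1] at h2
    nlinarith [abs_nonneg (x ⬝ᵥ b)]
  have e3 := hδf x (extend b x) hx (extend_tangent b hx)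
  have e4 : δ / 7 ≤ g.form x (extend b x) (extend b x) := by nlinarith
  have e5 : 175 * G * C ^ 2 / δ ≤ (√(175 * G * C ^ 2 / δ) + 1) ^ 2 := by
    have h0 : 0 ≤ 175 * G * C ^ 2 / δ := by positivity
    nlinarith [Real.sq_sqrt h0, Real.sqrt_nonneg (175 * G * C ^ 2 / δ)]
  calc g.form x A A ≤ G * (5 * C * ‖u‖) ^ 2 := e1
    _ = 175 * G * C ^ 2 / δ * ‖u‖ ^ 2 * (δ / 7) := by field_simp; ring
    _ ≤ (√(175 * G * C ^ 2 / δ) + 1) ^ 2 * ‖u‖ ^ 2 * g.form x (extend b x) (extend b x) := by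
        gcongr
    _ = _ := by ring

variable (σ : SphereSymplecticForm) (β : R3 → R3 →L[ℝ] ℝ)

/-- Along a Reeb orbit the velocity rotates with speed `f / h` relative to a parallel frame. -/
theorem hasDerivAt_relCoord {m : ℝ} {γ : ℝ → R3 × R3}
    (hγ : ∀ t, γ t ∈ g.energyLevel m ∧ HasDerivAt γ (g.reebField σ β (γ t)) t) (b : R3) {t : ℝ}
    (hB : extend b (γ t).1 ≠ 0) :
    HasDerivAt (fun s => g.relCoord (γ s).1 (extend b (γ s).1) (γ s).2)
      (g.relCoord (γ t).1 (g.covDeriv (γ t).1 (extend b (γ t).1) (g.reebField σ β (γ t)).1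
          (fderiv ℝ (extend b) (γ t).1 (g.reebField σ β (γ t)).1)) (γ t).2
        + (g.strength σ (γ t).1 / g.reebScale σ β (γ t) : ℝ) * Complex.I
          * g.relCoord (γ t).1 (extend b (γ t).1) (γ t).2) t := by
  obtain ⟨hz, hd⟩ := hγ t
  obtain ⟨hx, hv, -⟩ := g.mem_energyLevel.1 hz
  have hs := fun s => g.mem_energyLevel.1 (hγ s).1
  have hp := g.areaSq_pos hx
  have d1 : HasDerivAt (fun s => (γ s).1) (g.reebField σ β (γ t)).1 t := hd.fst
  have d2 : HasDerivAt (fun s => (γ s).2) (g.reebField σ β (γ t)).2 t := hd.snd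
  have hBt := extend_tangent b hx
  have dB : HasDerivAt (fun s => extend b (γ s).1)
      (fderiv ℝ (extend b) (γ t).1 (g.reebField σ β (γ t)).1) t :=
    hasDerivAt_comp_curve ((contDiff_extend b).differentiable (by simp) _).hasFDerivAt d1
  obtain ⟨J, hJ, hJ2⟩ := g.exists_hasDerivAt_rot d1 dB (Filter.Eventually.of_forall fun s => (hs s).1)
    (Filter.Eventually.of_forall fun s => extend_tangent b (hs s).1) hB
  have hcov : g.covDeriv (γ t).1 (γ t).2 (g.reebField σ β (γ t)).1 (g.reebField σ β (γ t)).2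
      = (g.strength σ (γ t).1 / g.reebScale σ β (γ t)) • g.rot (γ t).1 (γ t).2 :=
    g.covDeriv_bundleLift hx (by rw [dotProduct_smul, g.rot_tangent, smul_zero])
  have h1 := g.hasDerivAt_form_covDeriv d1 dB d2 hp hBt hv
  have h2 := g.hasDerivAt_form_covDeriv d1 hJ d2 hp (g.rot_tangent _ _) hv
  rw [hcov, map_smul, smul_eq_mul] at h1 h2
  rw [hJ2] at h2
  have r1 : g.form (γ t).1 (extend b (γ t).1) (g.rot (γ t).1 (γ t).2)
      = - g.form (γ t).1 (g.rot (γ t).1 (extend b (γ t).1)) (γ t).2 := by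
    rw [g.symm, g.form_rot_swap hx hv hBt]
  rw [r1] at h1
  rw [g.form_rot_rot hx hBt hv] at h2
  have e : (fun s => g.relCoord (γ s).1 (extend b (γ s).1) (γ s).2) = fun s =>
      (g.form (γ s).1 (extend b (γ s).1) (γ s).2 : ℂ)
        + (g.form (γ s).1 (g.rot (γ s).1 (extend b (γ s).1)) (γ s).2 : ℂ) * Complex.I := by
    funext s
    apply Complex.ext <;> simp [relCoord]
  rw [e]
  refine (h1.ofReal_comp.fun_add (h2.ofReal_comp.mul_const Complex.I)).congr_deriv ?_
  apply Complex.ext <;> simp [relCoord]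

/-- Contractible Reeb orbits make about two turns, as their lifts to the three-sphere are closed.
This is where contractibility matters: a curve that turns once along a fibre of `Σ_m` takes only
half of this time, and it is not contractible. -/
theorem exists_period_ge {C : ℝ} (hC : 0 < C) : ∃ K m₂ : ℝ, 0 < K ∧ 0 < m₂ ∧
    ∀ m : ℝ, 0 < m → m < m₂ →
    (∀ z ∈ g.energyLevel m, |g.strength σ z.1 / g.reebScale σ β z - σ.mean⁻¹| ≤ C * m ∧
      ‖(g.reebField σ β z).1‖ ≤ C * m) →
    ∀ (γ : ℝ → R3 × R3) (T : ℝ) (i : ℝ → ℝ → R3 × R3), 0 < T →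
      (∀ t, γ t ∈ g.energyLevel m ∧ HasDerivAt γ (g.reebField σ β (γ t)) t) →
      IsCappingCylinder (g.energyLevel m) γ T i → 4 * Real.pi ≤ (|σ.mean|⁻¹ + K * m) * T := by
  obtain ⟨C₁, hC₁, hA⟩ := g.exists_covDeriv_extend_le
  have hc : 0 < |σ.mean| := abs_pos.2 σ.mean_ne_zero
  have hpi := Real.pi_pos
  refine ⟨C₁ * C + C, min (1 / (16 * Real.pi * |σ.mean| * C)) (1 / ((C₁ * C + C) * |σ.mean|)),
    by positivity, by positivity, fun m hm hm2 hest γ T i hT hγ hi => ?_⟩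
  have hm3 : C * m * (4 * Real.pi * |σ.mean|) ≤ 1 / 4 := by
    have := (hm2.trans_le (min_le_left _ _)).le
    rw [le_div_iff₀ (by positivity)] at this
    linarith
  have hm4 : (C₁ * C + C) * m < |σ.mean|⁻¹ := by
    have := hm2.trans_le (min_le_right _ _)
    rw [lt_div_iff₀ (by positivity)] at this
    rw [lt_inv_comm₀ (by positivity) hc, ← one_div, lt_div_iff₀ (by positivity)]
    linarith
  have hKm : 0 ≤ (C₁ * C + C) * m * T := by positivity
  -- There is nothing to prove for long periods. For the others the projection of the orbit to the
  -- sphere has a length of size `O(m)`, so that the frame over it is almost parallel.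
  by_cases hT4 : 4 * Real.pi * |σ.mean| < T
  · have : 4 * Real.pi ≤ |σ.mean|⁻¹ * T := by
      rw [inv_mul_eq_div, le_div_iff₀ hc]
      exact hT4.le
    linarith
  rw [not_lt] at hT4
  have hs := fun s => g.mem_energyLevel.1 (hγ s).1
  have hclose : ∀ t ∈ Set.Icc 0 T, ‖(γ t).1 - (γ 0).1‖ ≤ 1 / 4 := fun t ht => by
    have hd : ∀ s, HasDerivAt (fun t => (γ t).1) (g.reebField σ β (γ s)).1 s := fun s =>
      (hγ s).2.fst
    have h1 := norm_image_sub_le_of_norm_deriv_le_segment' (f := fun t => (γ t).1) (C := C * m)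
      (fun s _ => (hd s).hasDerivWithinAt)
      (fun s _ => (hest _ (hγ s).1).2) t ht
    calc _ ≤ C * m * (t - 0) := h1
      _ ≤ C * m * (4 * Real.pi * |σ.mean|) := by gcongr; linarith [ht.2]
      _ ≤ _ := hm3
  have hv0 := g.ne_zero_of_mem hm (hγ 0).1
  set b := unitDir (γ 0).2 with hbdef
  have hb : b ⬝ᵥ b = 1 := unitDir_dot_self hv0
  have hdot : ∀ t ∈ Set.Icc 0 T, ∀ u : R3, u ⬝ᵥ u = 1 →
      |(γ t).1 ⬝ᵥ u - (γ 0).1 ⬝ᵥ u| ≤ 3 / 4 := fun t ht u hu => by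
    rw [← sub_dotProduct]
    calc _ ≤ 3 * (‖(γ t).1 - (γ 0).1‖ * ‖u‖) := abs_dot_le _ _
      _ ≤ 3 * (1 / 4 * 1) := by gcongr; exacts [hclose t ht, norm_le_one_of_unit hu]
      _ = _ := by norm_num
  have hxb : ∀ t ∈ Set.Icc 0 T, |(γ t).1 ⬝ᵥ b| ≤ 3 / 4 := fun t ht => by
    have := hdot t ht b hb
    rwa [hbdef, dot_unitDir (hs 0).2.1, sub_zero] at this
  have hnear : ∀ t ∈ Set.Icc 0 T, 0 < (γ t).1 ⬝ᵥ (γ 0).1 := fun t ht => by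
    have := (abs_le.1 (hdot t ht _ (hs 0).1)).1
    rw [(hs 0).1] at this
    linarith
  have hB : ∀ t ∈ Set.Icc 0 T, extend b (γ t).1 ≠ 0 := fun t ht h => by
    have h1 : b = ((γ t).1 ⬝ᵥ b) • (γ t).1 := sub_eq_zero.1 h
    have h2 : b ⬝ᵥ b = |(γ t).1 ⬝ᵥ b| ^ 2 := by
      conv_lhs => rw [h1]
      rw [smul_dotProduct, dotProduct_smul, (hs t).1, sq_abs]
      simp [sq]
    rw [hb] at h2
    nlinarith [hxb t ht, abs_nonneg ((γ t).1 ⬝ᵥ b)]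
  let Z : ℝ → ℂ := fun t => g.relCoord (γ t).1 (extend b (γ t).1) (γ t).2
  have hZd := fun t ht => g.hasDerivAt_relCoord σ β hγ b (hB t ht)
  have hZ0 : ∀ t ∈ Set.Icc 0 T, Z t ≠ 0 := fun t ht => by
    have h1 := g.normSq_relCoord (hs t).1 (extend_tangent b (hs t).1) (hs t).2.1
    have h2 := mul_pos (g.pos _ _ (hs t).1 (extend_tangent b (hs t).1) (hB t ht))
      (g.form_pos_of_mem hm (hγ t).1)
    rw [← h1] at h2
    intro h
    simp only [Z] at h
    rw [h] at h2
    simp at h2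
  have hZc : ContinuousOn Z (Set.Icc 0 T) := fun t ht => (hZd t ht).continuousAt.continuousWithinAt
  obtain ⟨ℓ, hℓ, hℓe⟩ := exists_log_Icc hT.le hZc hZ0
  obtain ⟨k, hk⟩ := g.exists_angle_eq_of_contractible hm hT hi hnear hℓ hB hℓe
  have hang := abs_angle_sub_le (ν := σ.mean⁻¹) (η := (C₁ * C + C) * m) hT.le hℓ hℓe hZd
    fun t ht => by
      obtain ⟨e1, e2⟩ := hest _ (hγ t).1
      have n1 : ‖g.relCoord (γ t).1 (g.covDeriv (γ t).1 (extend b (γ t).1) (g.reebField σ β (γ t)).1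
          (fderiv ℝ (extend b) (γ t).1 (g.reebField σ β (γ t)).1)) (γ t).2‖
          ≤ C₁ * (C * m) * ‖Z t‖ := by
        refine (sq_le_sq₀ (norm_nonneg _) (by positivity)).1 ?_
        rw [mul_pow, g.normSq_relCoord (hs t).1 (g.covDeriv_tangent _ _ _ _) (hs t).2.1,
          g.normSq_relCoord (hs t).1 (extend_tangent b (hs t).1) (hs t).2.1, ← mul_assoc]
        have hp := (g.form_pos_of_mem hm (hγ t).1).le
        have hq := (g.pos _ _ (hs t).1 (extend_tangent b (hs t).1) (hB t ht)).le
        gcongr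
        refine (hA _ b _ (hs t).1 hb (hxb t ht)).trans ?_
        gcongr
      have n2 : ‖((g.strength σ (γ t).1 / g.reebScale σ β (γ t) - σ.mean⁻¹ : ℝ) : ℂ) * Complex.I
          * Z t‖ ≤ C * m * ‖Z t‖ := by
        rw [norm_mul, norm_mul, Complex.norm_I, Complex.norm_real, Real.norm_eq_abs, mul_one]
        gcongr
      have e3 : ∀ a F c z : ℂ, a + F * Complex.I * z - c * Complex.I * z
          = a + (F - c) * Complex.I * z := fun a F c z => by ring
      rw [e3, ← Complex.ofReal_sub]
      calc _ ≤ C₁ * (C * m) * ‖Z t‖ + C * m * ‖Z t‖ := (norm_add_le _ _).trans (add_le_add n1 n2)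
        _ = _ := by ring
  rw [hk] at hang
  have hcT : |σ.mean⁻¹ * T| = |σ.mean|⁻¹ * T := by rw [abs_mul, abs_inv, abs_of_pos hT]
  -- The velocity turns, so that the total angle is not zero; hence it is at least `4π`.
  have hk0 : k ≠ 0 := by
    rintro rfl
    rw [Int.cast_zero, mul_zero, zero_sub, abs_neg, hcT] at hang
    exact absurd (le_of_mul_le_mul_right hang hT) (not_le.2 hm4)
  have hk1 : (1 : ℝ) ≤ |(k : ℝ)| := by exact_mod_cast Int.one_le_abs hk0
  have h1 : |4 * Real.pi * (k : ℝ)| ≤ |4 * Real.pi * k - σ.mean⁻¹ * T| + |σ.mean⁻¹ * T| := by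
    have := abs_add_le (4 * Real.pi * k - σ.mean⁻¹ * T) (σ.mean⁻¹ * T)
    rwa [sub_add_cancel] at this
  rw [abs_mul, abs_of_pos (by positivity : (0 : ℝ) < 4 * Real.pi), hcT] at h1
  nlinarith

end SphereMetric

/-! ### Dynamical convexity -/

namespace SphereMetric

variable (g : SphereMetric) (σ : SphereSymplecticForm) (β : R3 → R3 →L[ℝ] ℝ)

/-- The structure equation `d(τ/2E) = -π^*σ_g` and `dβ = σ - c σ_g` give `d(c τ/2E - π^*β) = -π^*σ`.
-/
theorem isPrimitiveOn_contactPrimitive (hβ : g.IsCurvaturePrimitive σ β) {m : ℝ} (hm : 0 < m) :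
    IsPrimitiveOn (g.energyLevel m) g.levelTangent (g.contactPrimitive σ β) (g.twistedForm σ) := by
  intro z hz ξ hξ ζ hζ
  obtain ⟨hx, hv, -⟩ := g.mem_energyLevel.1 hz
  have h := fun ξ hξ => ((g.mem_levelTangent (g.areaSq_pos hx) hv (ξ := ξ)).1 hξ).1
  exact g.dOne_contactPrimitive σ β hβ hx hv (g.ne_zero_of_mem hm hz) (h ξ hξ) (h ζ hζ)

theorem isContactForm_contactPrimitive (hβ : g.IsCurvaturePrimitive σ β) {m : ℝ} (hm : 0 < m)
    (hh : ∀ z ∈ g.energyLevel m, g.reebScale σ β z ≠ 0) :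
    IsContactForm (g.energyLevel m) g.levelTangent (g.contactPrimitive σ β) := by
  refine ⟨⟨{z | 0 < g.areaSq z.1} ∩ {z | g.form z.1 z.2 z.2 ≠ 0}, ?_, fun z hz => ?_,
    fun z hz => ?_⟩, fun z hz ξ hξ hli => g.contactVolume_ne_zero σ β hm hz hβ (hh z hz) hξ hli⟩
  · exact (isOpen_lt continuous_const (g.contDiff_areaSq.continuous.comp continuous_fst)).inter
      (isOpen_ne_fun (g.continuous_form continuous_fst continuous_snd continuous_snd)
        continuous_const)
  · exact ⟨g.areaSq_pos (g.mem_energyLevel.1 hz).1, (g.form_pos_of_mem hm hz).ne'⟩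
  · exact (g.contDiffAt_contactPrimitive σ β hβ.1 hz.1 hz.2).contDiffWithinAt

/-- Contractible orbits have periods of at least about `4π |c|`, and the linearised flow rotates with
velocity of about `1 / |c|`; so it makes about two turns, and more than `5/4` turns in every
admissible frame. -/
theorem exists_isDynamicallyConvex (hβ : g.IsCurvaturePrimitive σ β) :
    ∃ m₀ : ℝ, 0 < m₀ ∧ ∀ m : ℝ, 0 < m → m < m₀ →
      (∀ z ∈ g.energyLevel m, g.reebScale σ β z ≠ 0) ∧
      IsDynamicallyConvex (g.energyLevel m) g.levelTangent (g.contactPrimitive σ β) := by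
  obtain ⟨C, m₁, hC, hm₁, -, hest⟩ := g.exists_estimates σ β hβ.1
  obtain ⟨K, m₂, hK, hm₂, hper⟩ := g.exists_period_ge σ β hC
  have hc : 0 < |σ.mean|⁻¹ := inv_pos.2 (abs_pos.2 σ.mean_ne_zero)
  have hpi := Real.pi_pos
  refine ⟨min (min m₁ m₂) (|σ.mean|⁻¹ / (8 * (5 * C + K))), by positivity, fun m hm hm0 => ?_⟩
  have hmm₁ := hm0.trans_le ((min_le_left _ _).trans (min_le_left _ _))
  have hmm₂ := hm0.trans_le ((min_le_left _ _).trans (min_le_right _ _))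
  have hm3 : (5 * C + K) * m ≤ |σ.mean|⁻¹ / 8 := by
    have := (hm0.trans_le (min_le_right _ _)).le
    rw [le_div_iff₀ (by positivity)] at this
    linarith
  have hest' := hest m hm hmm₁
  have hh : ∀ z ∈ g.energyLevel m, 0 < g.reebScale σ β z := fun z hz => (hest' z hz).1
  have hh' := fun z hz => (hh z hz).ne'
  obtain ⟨φ, M, hφ⟩ := g.exists_isSmoothReebFlow σ β hβ hm hh'
  refine ⟨hh', fun γ T hγ hγc => ?_⟩
  have hrot := fun {i e f Ψ} => rotationInterval_of_orbit (i := i) (e := e) (f := f) (Ψ := Ψ) hφ hm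
    hβ hh (fun z hz => ⟨(hest' z hz).2.1, (hest' z hz).2.2.2⟩) hγ
  constructor
  · obtain ⟨i, hi⟩ := hγc
    obtain ⟨e, f, Ψ, hef, hΨ⟩ := exists_isLinearisedFlow hφ hm hβ hh hγ hi
    obtain ⟨⟨A, B, -, hAB⟩, -⟩ := hrot hi hef hΨ
    obtain ⟨n, hn⟩ := exists_isIntervalIndex A B
    exact ⟨n, i, e, f, Ψ, hi, hef, hΨ, by rw [IsLowerMaslovIndex, hAB]; exact hn⟩
  · rintro n ⟨i, e, f, Ψ, hi, hef, hΨ, hn⟩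
    obtain ⟨⟨A, B, hle, hAB⟩, hr⟩ := hrot hi hef hΨ
    have hT := hper m hm hmm₂ (fun z hz => ⟨(hest' z hz).2.1, (hest' z hz).2.2.1⟩) γ T i hγ.1
      ((isReebTrajectory_iff hm hβ hh').1 hγ.2.1) hi
    refine three_le_of_isIntervalIndex (hAB ▸ Set.nonempty_Icc.2 hle) (a := 5 / 4) (by norm_num)
      (fun r hr' => ?_) hn
    -- `7/8` of the two turns that correspond to `T`, less the half turn by which angles depend on the
    -- frame, are `5/4` turns.
    have h1 : 7 / 8 * (|σ.mean|⁻¹ + K * m) ≤ |σ.mean|⁻¹ - 5 * C * m := by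
      have : 0 < K * m := by positivity
      linarith
    have h2 := mul_le_mul_of_nonneg_right h1 hγ.1.le
    have h3 := hr r hr'
    have h4 : 2 * Real.pi * (5 / 4) ≤ 2 * Real.pi * r := by linarith
    exact le_of_mul_le_mul_left h4 (by positivity)

end SphereMetric

/-! ### The energy levels as lens spaces -/

section Frames

/-- The point `x` of the sphere and the tangent vector `b` at `x` that a non-zero spinor describes:
its square is `b + i (x × b)`, up to a positive factor if `b` is normalised. -/
def spinorFrame (w : ℂ × ℂ) : R3 × R3 :=
  let b : R3 := fun i => (spinorSquare w i).re
  ((b ⬝ᵥ b)⁻¹ • (b ⨯₃ fun i => (spinorSquare w i).im), b)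

theorem spinorSquare_re_im (w : ℂ × ℂ) :
    let b : R3 := fun i => (spinorSquare w i).re
    let y : R3 := fun i => (spinorSquare w i).im
    b ⬝ᵥ b = (‖w.1‖ ^ 2 + ‖w.2‖ ^ 2) ^ 2 ∧ b ⬝ᵥ y = 0 := by
  intro b y
  have h1 := spinorSquare_dot_self w
  have h2 := spinorSquare_dot_conj w w
  rw [spinorInner_self_eq, ← Complex.ofReal_pow] at h2
  have r1 := congrArg Complex.re h1
  have r2 := congrArg Complex.im h1
  have r3 := congrArg Complex.re h2
  simp only [dotProduct, Fin.sum_univ_three, Complex.add_re, Complex.add_im, Complex.mul_re,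
    Complex.mul_im, Complex.conj_re, Complex.conj_im, Complex.zero_re, Complex.zero_im,
    Complex.re_ofNat, Complex.im_ofNat, Complex.ofReal_re, Complex.ofReal_im] at r1 r2 r3
  simp only [dot_eq, b, y]
  constructor
  · linear_combination (r1 + r3) / 2
  · linear_combination r2 / 2

theorem norm_sq_add_norm_sq_pos {w : ℂ × ℂ} (hw : w ≠ 0) : 0 < ‖w.1‖ ^ 2 + ‖w.2‖ ^ 2 := by
  by_contra h
  have h1 : ‖w.1‖ ^ 2 = 0 := by nlinarith [sq_nonneg ‖w.1‖, sq_nonneg ‖w.2‖]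
  have h2 : ‖w.2‖ ^ 2 = 0 := by nlinarith [sq_nonneg ‖w.1‖, sq_nonneg ‖w.2‖]
  exact hw (Prod.ext (by simpa using h1) (by simpa using h2))

theorem cross_cross_self (b y : R3) : (b ⨯₃ y) ⨯₃ b = (b ⬝ᵥ b) • y - (b ⬝ᵥ y) • b := by
  ext i
  fin_cases i <;> simp [cross_apply, dot_eq] <;> ring

/-- The last clause says that `spinorSquare` recovers the frame from the spinor. -/
theorem spinorFrame_spec {w : ℂ × ℂ} (hw : w ≠ 0) :
    let z := spinorFrame w
    z.1 ⬝ᵥ z.1 = 1 ∧ z.1 ⬝ᵥ z.2 = 0 ∧ z.2 ≠ 0 ∧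
      ((‖w.1‖ ^ 2 + ‖w.2‖ ^ 2 : ℝ) : ℂ) • frameVector z.1 (unitDir z.2) = spinorSquare w := by
  obtain ⟨h1, h2⟩ := spinorSquare_re_im w
  have hρ := norm_sq_add_norm_sq_pos hw
  set ρ := ‖w.1‖ ^ 2 + ‖w.2‖ ^ 2
  intro z
  set b : R3 := fun i => (spinorSquare w i).re with hb
  set y : R3 := fun i => (spinorSquare w i).im with hy
  have hz1 : z.1 = (b ⬝ᵥ b)⁻¹ • (b ⨯₃ y) := rfl
  have hz2 : z.2 = b := rfl
  have h3 : y ⬝ᵥ y = ρ ^ 2 := by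
    have r1 := congrArg Complex.re (spinorSquare_dot_self w)
    simp only [dotProduct, Fin.sum_univ_three, Complex.add_re, Complex.mul_re,
      Complex.zero_re] at r1
    rw [← h1]
    simp only [dot_eq, hb, hy]
    linear_combination -r1
  have hρ2 : ρ ^ 2 ≠ 0 := by positivity
  refine ⟨?_, ?_, fun h => hρ2 ?_, ?_⟩
  · have : (b ⨯₃ y) ⬝ᵥ (b ⨯₃ y) = (b ⬝ᵥ b) * (y ⬝ᵥ y) - (b ⬝ᵥ y) ^ 2 := by
      simp only [dot_eq, cross_zero, cross_one, cross_two]; ring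
    rw [hz1, smul_dotProduct, dotProduct_smul, this, h1, h2, h3, smul_eq_mul, smul_eq_mul]
    field_simp
    ring
  · rw [hz1, hz2, smul_dotProduct, dotProduct_comm (b ⨯₃ y) b, dot_self_cross, smul_zero]
  · rw [← h1, ← hz2, h, dotProduct_zero]
  · have e1 : unitDir z.2 = ρ⁻¹ • b := by
      rw [unitDir, hz2, h1, Real.sqrt_sq hρ.le]
    have e2 : z.1 ⨯₃ unitDir z.2 = ρ⁻¹ • y := by
      rw [e1, hz1, map_smul, LinearMap.map_smul₂, cross_cross_self, h2, zero_smul, sub_zero,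
        smul_smul (b ⬝ᵥ b)⁻¹, inv_mul_cancel₀ (by rw [h1]; exact hρ2), one_smul]
    funext i
    rw [Pi.smul_apply, frameVector, e2, e1]
    apply Complex.ext
    · simp [hb, hρ.ne']
    · simp [hy, hρ.ne']

theorem contDiffAt_spinorFrame {w : ℂ × ℂ} (hw : w ≠ 0) : ContDiffAt ℝ ∞ spinorFrame w := by
  have c1 : ContDiffAt ℝ ∞ (fun w => (fun i => (spinorSquare w i).re : R3)) w :=
    contDiffAt_pi.2 fun i => Complex.reCLM.contDiff.contDiffAt.comp w
      (contDiffAt_pi.1 contDiff_spinorSquare.contDiffAt i)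
  have c2 : ContDiffAt ℝ ∞ (fun w => (fun i => (spinorSquare w i).im : R3)) w :=
    contDiffAt_pi.2 fun i => Complex.imCLM.contDiff.contDiffAt.comp w
      (contDiffAt_pi.1 contDiff_spinorSquare.contDiffAt i)
  have h : (spinorFrame w).2 ⬝ᵥ (spinorFrame w).2 ≠ 0 :=
    (dot_self_pos (spinorFrame_spec hw).2.2.1).ne'
  exact (((contDiffAt_dot c1 c1).inv h).smul (contDiffAt_cross c1 c2)).prodMk c1

/-- `spinorSquare` is an immersion away from the origin. -/
theorem eq_zero_of_hasDerivAt_spinorSquare {w h : ℂ × ℂ} (hw : w ≠ 0)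
    (hd : HasDerivAt (fun s : ℝ => spinorSquare (w + s • h)) 0 0) : h = 0 := by
  have d1 : HasDerivAt (fun s : ℝ => w.1 + (s : ℂ) * h.1) h.1 0 := by
    simpa using (Complex.ofRealCLM.hasDerivAt.mul_const h.1).const_add w.1
  have d2 : HasDerivAt (fun s : ℝ => w.2 + (s : ℂ) * h.2) h.2 0 := by
    simpa using (Complex.ofRealCLM.hasDerivAt.mul_const h.2).const_add w.2
  have p1 := d1.fun_mul d1
  have p2 := d2.fun_mul d2
  have p3 := d1.fun_mul d2
  have e0 := (hasDerivAt_pi.1 hd 0).unique ((p1.fun_sub p2).congr_of_eventuallyEq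
    (Filter.Eventually.of_forall fun s => by simp [spinorSquare]; ring))
  have e1 := (hasDerivAt_pi.1 hd 1).unique (((p1.fun_add p2).const_mul
    Complex.I).congr_of_eventuallyEq
    (Filter.Eventually.of_forall fun s => by simp [spinorSquare]; ring))
  have e2 := (hasDerivAt_pi.1 hd 2).unique ((p3.const_mul (-2)).congr_of_eventuallyEq
    (Filter.Eventually.of_forall fun s => by simp [spinorSquare]; ring))
  simp only [Pi.zero_apply, Complex.ofReal_zero, zero_mul, add_zero] at e0 e1 e2
  have e1' := (mul_eq_zero.1 e1.symm).resolve_left Complex.I_ne_zero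
  have f1 : w.1 * h.1 = 0 := by linear_combination (e1' - e0) / 4
  have f2 : w.2 * h.2 = 0 := by linear_combination (e1' + e0) / 4
  have f3 : h.1 * w.2 + w.1 * h.2 = 0 := by linear_combination e2 / 2
  by_cases h1 : w.1 = 0
  · have h2 : w.2 ≠ 0 := fun h2 => hw (Prod.ext h1 h2)
    refine Prod.ext ?_ ((mul_eq_zero.1 f2).resolve_left h2)
    rw [h1, zero_mul, add_zero] at f3
    exact (mul_eq_zero.1 f3).resolve_right h2
  · have h3 := (mul_eq_zero.1 f1).resolve_left h1
    refine Prod.ext h3 ?_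
    rw [h3, zero_mul, zero_add] at f3
    exact (mul_eq_zero.1 f3).resolve_left h1

end Frames

theorem unitDir_smul {a : ℝ} (ha : 0 < a) (v : R3) : unitDir (a • v) = unitDir v := by
  have h : √((a • v) ⬝ᵥ (a • v)) = a * √(v ⬝ᵥ v) := by
    rw [smul_dotProduct, dotProduct_smul, smul_eq_mul, smul_eq_mul, ← mul_assoc,
      Real.sqrt_mul (by positivity), Real.sqrt_mul_self ha.le]
  rw [unitDir, unitDir, h, smul_smul, mul_inv, mul_comm a⁻¹, mul_assoc, inv_mul_cancel₀ ha.ne',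
    mul_one]

theorem exp_pi_mul_int_eq (k : ℤ) :
    (Complex.exp (2 * Real.pi * Complex.I * k / 2) = 1 ∨
      Complex.exp (2 * Real.pi * Complex.I * k / 2) = -1) := by
  have h : Complex.exp (2 * Real.pi * Complex.I * k / 2) ^ 2 = 1 := by
    rw [← Complex.exp_nat_mul, Complex.exp_eq_one_iff]
    exact ⟨k, by push_cast; ring⟩
  simpa using sq_eq_sq_iff_eq_or_eq_neg.1 (h.trans (one_pow 2).symm)

namespace SphereMetric

variable (g : SphereMetric)

/-- The parametrisation of `Σ_m` by spinors: the vector of `spinorFrame` rescaled to `g`-length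
`m`. -/
def levelParam (m : ℝ) (w : ℂ × ℂ) : R3 × R3 :=
  ((spinorFrame w).1, (m / √(g.form (spinorFrame w).1 (spinorFrame w).2 (spinorFrame w).2)) •
    (spinorFrame w).2)

variable {m : ℝ} (hm : 0 < m)
include hm

theorem levelParam_coeff_pos {w : ℂ × ℂ} (hw : w ≠ 0) :
    0 < m / √(g.form (spinorFrame w).1 (spinorFrame w).2 (spinorFrame w).2) := by
  obtain ⟨h1, h2, h3, -⟩ := spinorFrame_spec hw
  exact div_pos hm (Real.sqrt_pos.2 (g.pos _ _ h1 h2 h3))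

omit hm in
theorem contDiffAt_levelParam {w : ℂ × ℂ} (hw : w ≠ 0) : ContDiffAt ℝ ∞ (g.levelParam m) w := by
  obtain ⟨h1, h2, h3, -⟩ := spinorFrame_spec hw
  have hp := g.pos _ _ h1 h2 h3
  have c := contDiffAt_spinorFrame hw
  exact c.fst.prodMk ((contDiffAt_const.div ((g.contDiffAt_form c.fst c.snd c.snd).sqrt hp.ne')
    (Real.sqrt_pos.2 hp).ne').smul c.snd)

omit hm in
theorem levelParam_mem {w : ℂ × ℂ} (hw : w ≠ 0) : g.levelParam m w ∈ g.energyLevel m := by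
  obtain ⟨h1, h2, h3, -⟩ := spinorFrame_spec hw
  have hp := g.pos _ _ h1 h2 h3
  refine g.mem_energyLevel.2 ⟨h1, ?_, ?_⟩
  · rw [levelParam, dotProduct_smul, h2, smul_zero]
  · simp only [levelParam, map_smul, smul_apply, smul_eq_mul]
    rw [← mul_assoc, div_mul_div_comm, Real.mul_self_sqrt hp.le, div_mul_cancel₀ _ hp.ne', sq]

theorem frameVector_levelParam {w : ℂ × ℂ} (hw : w ≠ 0) :
    ((‖w.1‖ ^ 2 + ‖w.2‖ ^ 2 : ℝ) : ℂ)
      • frameVector (g.levelParam m w).1 (unitDir (g.levelParam m w).2) = spinorSquare w := by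
  rw [levelParam, unitDir_smul (g.levelParam_coeff_pos hm hw)]
  exact (spinorFrame_spec hw).2.2.2

omit hm in
theorem ne_zero_of_mem_unitSpinors {w : ℂ × ℂ} (hw : w ∈ unitSpinors) : w ≠ 0 := by
  rintro rfl
  simp [unitSpinors] at hw

/-- The fibres of the parametrisation are the pairs of antipodal spinors, as the frame determines
the spinor up to its sign. -/
theorem levelParam_eq_iff {w w' : ℂ × ℂ} (hw : w ∈ unitSpinors) (hw' : w' ∈ unitSpinors) :
    g.levelParam m w = g.levelParam m w' ↔ w = w' ∨ w = -w' := by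
  rw [← spinorSquare_eq_iff]
  constructor
  · intro h
    have h1 := g.frameVector_levelParam hm (ne_zero_of_mem_unitSpinors hw)
    have h2 := g.frameVector_levelParam hm (ne_zero_of_mem_unitSpinors hw')
    rw [show ‖w.1‖ ^ 2 + ‖w.2‖ ^ 2 = 1 from hw] at h1
    rw [show ‖w'.1‖ ^ 2 + ‖w'.2‖ ^ 2 = 1 from hw'] at h2
    rw [← h1, ← h2, h]
  · intro h
    simp only [levelParam, spinorFrame, h]

theorem exists_levelParam_eq {z : R3 × R3} (hz : z ∈ g.energyLevel m) :
    ∃ w ∈ unitSpinors, g.levelParam m w = z := by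
  obtain ⟨hx, hv, hE⟩ := g.mem_energyLevel.1 hz
  have hv0 := g.ne_zero_of_mem hm hz
  have hu := unitDir_dot_self hv0
  obtain ⟨w, hw, h⟩ := frameVector_mem hx (dot_unitDir hv) hu
  refine ⟨w, hw, ?_⟩
  have hF : spinorFrame w = (z.1, unitDir z.2) := by
    rw [spinorFrame, h]
    have e1 : (fun i => (frameVector z.1 (unitDir z.2) i).re : R3) = unitDir z.2 := rfl
    have e2 : (fun i => (frameVector z.1 (unitDir z.2) i).im : R3) = z.1 ⨯₃ unitDir z.2 := rfl
    simp only [e1, e2, hu, inv_one, one_smul]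
    refine Prod.ext ?_ rfl
    have h2 : unitDir z.2 ⨯₃ (z.1 ⨯₃ unitDir z.2)
        = (unitDir z.2 ⬝ᵥ unitDir z.2) • z.1 - (z.1 ⬝ᵥ unitDir z.2) • unitDir z.2 := by
      ext i
      fin_cases i <;> simp [cross_apply, dot_eq] <;> ring
    simp only [h2, hu, dot_unitDir hv, one_smul, zero_smul, sub_zero]
  have hp := g.pos _ _ hx (dot_unitDir hv) (unitDir_ne_zero hv0)
  have hs : m = √(z.2 ⬝ᵥ z.2) * √(g.form z.1 (unitDir z.2) (unitDir z.2)) := by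
    have h1 : g.form z.1 z.2 z.2
        = (z.2 ⬝ᵥ z.2) * g.form z.1 (unitDir z.2) (unitDir z.2) := by
      conv_lhs => rw [← smul_unitDir hv0]
      simp only [map_smul, smul_apply, smul_eq_mul]
      rw [← mul_assoc, Real.mul_self_sqrt (dot_self_pos hv0).le]
    rw [← Real.sqrt_mul (dot_self_pos hv0).le, ← h1, hE, Real.sqrt_sq hm.le]
  rw [levelParam, hF]
  refine Prod.ext rfl ?_
  simp only
  rw [(div_eq_iff (Real.sqrt_pos.2 hp).ne').2 hs, smul_unitDir hv0]

/-- The direction of the velocity identifies `Σ_m` with the set of orthonormal frames, of which the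
three-sphere is the double cover. -/
theorem isDiffeomorphicToLensSpace_energyLevel :
    IsDiffeomorphicToLensSpace 2 1 (g.energyLevel m) := by
  -- The parametrisation is singular at the origin, so it is cut off there to be smooth on all of
  -- `ℂ²`.
  obtain ⟨χ, hχ, -, hχ1⟩ := exists_cutoff isCompact_unitSpinors
    (U := {w : ℂ × ℂ | w ≠ 0}) isOpen_ne (fun w hw => ne_zero_of_mem_unitSpinors hw)
    (fun w hw => g.contDiffAt_levelParam hw)
  have heq : ∀ w ∈ unitSpinors, χ w • g.levelParam m w = g.levelParam m w := fun w hw => by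
    rw [(hχ1 w hw).self_of_nhds, one_smul]
  refine ⟨fun w => χ w • g.levelParam m w, hχ, ?_, fun w w' hw hw' => ?_, fun w h hw hh hd => ?_⟩
  · ext z
    constructor
    · rintro ⟨w, hw, rfl⟩
      simp only [heq w hw]
      exact g.levelParam_mem (ne_zero_of_mem_unitSpinors hw)
    · intro hz
      obtain ⟨w, hw, h⟩ := g.exists_levelParam_eq hm hz
      exact ⟨w, hw, (heq w hw).trans h⟩
  · simp only [heq w hw, heq w' hw', g.levelParam_eq_iff hm hw hw', Nat.cast_ofNat, Nat.cast_one,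
      mul_one]
    constructor
    · rintro (rfl | rfl)
      · exact ⟨0, by simp⟩
      · refine ⟨1, ?_⟩
        have : Complex.exp (2 * Real.pi * Complex.I * (1 : ℤ) / 2) = -1 := by
          rw [← Complex.exp_pi_mul_I]
          congr 1
          push_cast
          ring
        rw [this]
        ext <;> simp
    · rintro ⟨k, rfl⟩
      rcases exp_pi_mul_int_eq k with h | h
      · left; rw [h]; simp
      · right; rw [h]; ext <;> simp
  -- If the differential vanishes on `h`, then so does that of `spinorSquare`, which is a function
  -- of the image and of `|w|²`, and `h` is tangent to the sphere.
  · have hw0 := ne_zero_of_mem_unitSpinors hw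
    apply eq_zero_of_hasDerivAt_spinorSquare hw0
    have hl : HasDerivAt (fun s : ℝ => w + s • h) h 0 := by
      simpa using ((hasDerivAt_id (0 : ℝ)).smul_const h).const_add w
    have hl0 : w + (0 : ℝ) • h = w := by simp
    have hP : HasDerivAt (fun s : ℝ => χ (w + s • h) • g.levelParam m (w + s • h)) 0 0 := by
      have h1 : HasFDerivAt (fun w => χ w • g.levelParam m w)
          (fderiv ℝ (fun w => χ w • g.levelParam m w) w) (w + (0 : ℝ) • h) := by
        rw [hl0]; exact (hχ.differentiable (by simp) w).hasFDerivAt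
      have h2 := hasDerivAt_comp_curve (c := fun s : ℝ => w + s • h) h1 hl
      rwa [hd] at h2
    have hz := g.levelParam_mem (m := m) hw0
    have hQ : HasDerivAt (fun s : ℝ => frameVector (χ (w + s • h) • g.levelParam m (w + s • h)).1
        (unitDir (χ (w + s • h) • g.levelParam m (w + s • h)).2)) 0 0 := by
      have h1 := ((contDiffAt_frameVector_unitDir (g.ne_zero_of_mem hm hz)).differentiableAt
        (by simp)).hasFDerivAt
      rw [show g.levelParam m w = χ (w + (0 : ℝ) • h) • g.levelParam m (w + (0 : ℝ) • h) by
        rw [hl0, heq w hw]] at h1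
      have h2 := hasDerivAt_comp_curve h1 hP
      rwa [map_zero] at h2
    have hρ : HasDerivAt (fun s : ℝ => ‖(w + s • h).1‖ ^ 2 + ‖(w + s • h).2‖ ^ 2) 0 0 := by
      have h1 : HasDerivAt (fun s : ℝ => (w + s • h).1) h.1 0 := hl.fst
      have h2 : HasDerivAt (fun s : ℝ => (w + s • h).2) h.2 0 := hl.snd
      refine (h1.norm_sq.fun_add h2.norm_sq).congr_deriv ?_
      rw [hl0]
      linear_combination 2 * hh
    have hN := (hρ.ofReal_comp.fun_smul hQ)
    rw [smul_zero, Complex.ofReal_zero, zero_smul, add_zero] at hN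
    refine hN.congr_of_eventuallyEq ?_
    have hcl : Filter.Tendsto (fun s : ℝ => w + s • h) (𝓝 0) (𝓝 w) := by
      have := hl.continuousAt.tendsto
      rwa [hl0] at this
    filter_upwards [hcl.eventually (hχ1 w hw), hcl.eventually (isOpen_ne.mem_nhds hw0)]
      with s h1 h2
    rw [h1, one_smul, g.frameVector_levelParam hm h2]

end SphereMetric

end MagneticSphere

end

theorem theorem1p5 (g : MagneticSphere.SphereMetric) (σ : MagneticSphere.SphereSymplecticForm) :
    (∀ m : ℝ, 0 < m → MagneticSphere.IsDiffeomorphicToLensSpace 2 1 (g.energyLevel m)) ∧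
    (∃ β, g.IsCurvaturePrimitive σ β) ∧
    ∀ β, g.IsCurvaturePrimitive σ β →
      ∃ m₀ : ℝ, 0 < m₀ ∧ ∀ m : ℝ, 0 < m → m < m₀ →
        MagneticSphere.IsPrimitiveOn (g.energyLevel m) g.levelTangent
          (g.contactPrimitive σ β) (g.twistedForm σ) ∧
        MagneticSphere.IsContactForm (g.energyLevel m) g.levelTangent
          (g.contactPrimitive σ β) ∧
        MagneticSphere.IsDynamicallyConvex (g.energyLevel m) g.levelTangent
          (g.contactPrimitive σ β) := by
  refine ⟨fun m hm => g.isDiffeomorphicToLensSpace_energyLevel hm,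
    g.exists_isCurvaturePrimitive σ, fun β hβ => ?_⟩
  obtain ⟨m₀, hm₀, h⟩ := g.exists_isDynamicallyConvex σ β hβ
  refine ⟨m₀, hm₀, fun m hm hlt => ?_⟩
  obtain ⟨h1, h2⟩ := h m hm hlt
  exact ⟨g.isPrimitiveOn_contactPrimitive σ β hβ hm,
    g.isContactForm_contactPrimitive σ β hβ hm h1, h2⟩
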